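/- Let $D=-i\,d/dx$; for a bounded measurable function $b$ on $\mathbb R$ let $b(D)=F^{-1}b(M)F$, where $F$ is the Fourier transform with kernel $e^{-ix\xi}$ and $b(M)$ denotes multiplication by $b$. Let $\mathfrak A$ be the C$^*$-algebra of bounded operators on $L^2(\mathbb R)$ generated by all $a(M)$ with $a\in C[-\infty,+\infty]$, all multiplications by continuous $2\pi$-periodic functions, and all $b(D)$ with $b\in C[-\infty,+\infty]$. Let $X$ be the set of $(x,e^{i\theta})\in[-\infty,+\infty]\times\mathbb S^1$ with $|x|=\infty$ or $x=\theta\in\mathbb R$. Let $\sigma:\mathfrak A\to C(X\times\{-\infty,+\infty\})$ be the surjective $*$-homomorphism (principal symbol) such that, at the points $((x,e^{i\theta}),\pm\infty)$, $\sigma_{a(M)}=a(x)$ for $a\in C[-\infty,+\infty]$, $\sigma_{a(M)}=a(\theta)$ for $a$ continuous and $2\pi$-periodic, and $\sigma_{b(D)}=b(\pm\infty)$; let $\mathfrak E=\ker\sigma$. For $\varphi\in\mathbb R$ let $Y_\varphi$ be the operator on $\ell^2(\mathbb Z)$ obtained from multiplication by $z^{-\varphi}$ on $L^2(\mathbb S^1)$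 through the discrete Fourier transform, so that $Y_j((u_k)_k)=(u_{j+k})_k$ for $j\in\mathbb Z$. Let $\mathfrak B$ and $\mathfrak K_{\mathbb Z}$ denote the bounded and the compact operators on $\ell^2(\mathbb Z)$, $\mathfrak K_{\mathbb R}$ the ideal of compact operators in $\mathfrak A$, and let $\gamma:\mathfrak A\to C(\mathbb S^1\times\{-1,+1\},\mathfrak B)$ be the $*$-homomorphism (boundary principal symbol) such that, at $(e^{2\pi i\varphi},\pm1)$, $\gamma_{a(M)}=a(\pm\infty)I$ for $a\in C[-\infty,+\infty]$, $\gamma_{e^{ikM}}=Y_{-k}$ for $k\in\mathbb Z$, and $\gamma_{b(D)}=Y_\varphi M^b_\varphi Y_{-\varphi}$, where $M^b_\varphi((a_j)_j)=(b(j-\varphi)a_j)_j$. These homomorphisms exist, $\mathfrak K_{\mathbb R}\subset\mathfrak E$, $\gamma$ induces an isomorphism $\mathfrak E/\mathfrak K_{\mathbb R}\cong C(\mathbb S^1\times\{-1,+1\},\mathfrak K_{\mathbb Z})$, and $A\mapsto(\gamma_A(1,-1),\gamma_A(1,+1))$ induces an isomorphism $K_0(\mathfrak E/\mathfrak K_{\mathbb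 R})\cong K_0(\mathfrak K_{\mathbb Z})\oplus K_0(\mathfrak K_{\mathbb Z})$. Let $\delta_1:K_1(\mathfrak A/\mathfrak E)\to K_0(\mathfrak E/\mathfrak K_{\mathbb R})\cong K_0(\mathfrak K_{\mathbb Z})\oplus K_0(\mathfrak K_{\mathbb Z})$ be the index map of $0\to\mathfrak E/\mathfrak K_{\mathbb R}\to\mathfrak A/\mathfrak K_{\mathbb R}\to\mathfrak A/\mathfrak E\to0$, with the usual convention: $\delta_1([u]_1)=[w\,\mathrm{diag}(1,0)\,w^{-1}]_0-[\mathrm{diag}(1,0)]_0$ whenever $w$ is an invertible lift of $\mathrm{diag}(u,u^{-1})$. Let $c:\mathbb R\to[0,1]$ be smooth and non-increasing with $c(x)=1$ for $x\le-1/5$ and $c(x)=0$ for $x\ge1/5$, and let $b=1-c$. Let $l(x)=e^{ix}$ for $x\ge0$, $l(x)=1$ for $x<0$, and $\tilde l(x)=1$ for $x\ge0$, $\tilde l(x)=e^{ix}$ for $x<0$. Let $$A_1=l(M)b(D)+c(D),\quad A_2=\tilde l(M)b(D)+c(D),\quad A_3=b(D)+l(M)c(D),\quad A_4=b(D)+\tilde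 l(M)c(D).$$ Then $A_1,\dots,A_4\in\mathfrak A$ are invertible modulo $\mathfrak E$ and, for every rank-one orthogonal projection $E$ on $\ell^2(\mathbb Z)$, $$\delta_1([[A_1]_{\mathfrak E}]_1)=(0,-[E]_0),\quad \delta_1([[A_2]_{\mathfrak E}]_1)=(-[E]_0,0),\quad \delta_1([[A_3]_{\mathfrak E}]_1)=(0,[E]_0),\quad \delta_1([[A_4]_{\mathfrak E}]_1)=([E]_0,0).$$ -/

import Mathlib

open MeasureTheory
open scoped ENNReal ContDiff

set_option linter.unusedSectionVars false

namespace SemiPeriodic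

/-! ## `K₀` of a ring by idempotent matrices -/

section KZero

variable {R S : Type*} [Ring R] [Ring S]

/-- Algebraic Murray–von Neumann equivalence of (possibly differently sized) square matrices. -/
def MvN {ι κ : Type} [Fintype ι] [Fintype κ] (e : Matrix ι ι R) (f : Matrix κ κ R) : Prop :=
  ∃ (x : Matrix ι κ R) (y : Matrix κ ι R), x * y = e ∧ y * x = f

theorem MvN.refl {ι : Type} [Fintype ι] {e : Matrix ι ι R} (he : IsIdempotentElem e) :
    MvN e e := ⟨e, e, he, he⟩

theorem MvN.symm {ι κ : Type} [Fintype ι] [Fintype κ] {e : Matrix ι ι R} {f : Matrix κ κ R}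
    (h : MvN e f) : MvN f e := by
  obtain ⟨x, y, h1, h2⟩ := h
  exact ⟨y, x, h2, h1⟩

theorem MvN.trans {ι κ μ : Type} [Fintype ι] [Fintype κ] [Fintype μ]
    {e : Matrix ι ι R} {f : Matrix κ κ R} {g : Matrix μ μ R}
    (he : IsIdempotentElem e) (hg : IsIdempotentElem g)
    (h : MvN e f) (h' : MvN f g) : MvN e g := by
  obtain ⟨x, y, rfl, rfl⟩ := h
  obtain ⟨z, w, h3, rfl⟩ := h'
  refine ⟨x * z, w * y, ?_, ?_⟩
  · calc x * z * (w * y) = x * (z * w) * y := by simp only [Matrix.mul_assoc]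
      _ = (x * y) * (x * y) := by rw [h3]; simp only [Matrix.mul_assoc]
      _ = x * y := he
  · calc w * y * (x * z) = w * (y * x) * z := by simp only [Matrix.mul_assoc]
      _ = (w * z) * (w * z) := by rw [← h3]; simp only [Matrix.mul_assoc]
      _ = w * z := hg

theorem MvN.reindex {ι κ : Type} [Fintype ι] [Fintype κ] (σ : ι ≃ κ) {e : Matrix ι ι R}
    (he : IsIdempotentElem e) : MvN e (Matrix.reindex σ σ e) := by
  have he' : e * e = e := he
  refine ⟨e.submatrix id σ.symm, e.submatrix σ.symm id, ?_, ?_⟩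
  · rw [Matrix.submatrix_mul_equiv, he', Matrix.submatrix_id_id]
  · rw [← Matrix.submatrix_mul _ _ _ _ _ Function.bijective_id, he']
    rfl

theorem idem_blocks {ι κ : Type} [Fintype ι] [Fintype κ] {e : Matrix ι ι R} {f : Matrix κ κ R}
    (he : IsIdempotentElem e) (hf : IsIdempotentElem f) :
    IsIdempotentElem (Matrix.fromBlocks e 0 0 f) := by
  have he' : e * e = e := he
  have hf' : f * f = f := hf
  simp [IsIdempotentElem, Matrix.fromBlocks_multiply, he', hf']

theorem idem_reindex {ι κ : Type} [Fintype ι] [Fintype κ] (σ : ι ≃ κ) {e : Matrix ι ι R}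
    (he : IsIdempotentElem e) : IsIdempotentElem (Matrix.reindex σ σ e) := by
  have he' : e * e = e := he
  simp [IsIdempotentElem, he']

theorem idem_map {ι : Type} [Fintype ι] (φ : R →+* S) {e : Matrix ι ι R}
    (he : IsIdempotentElem e) : IsIdempotentElem (e.map φ) := by
  have he' : e * e = e := he
  rw [IsIdempotentElem, ← Matrix.map_mul, he']

theorem MvN.blocks {ι κ ι' κ' : Type} [Fintype ι] [Fintype κ] [Fintype ι'] [Fintype κ']
    {e : Matrix ι ι R} {f : Matrix κ κ R} {e' : Matrix ι' ι' R} {f' : Matrix κ' κ' R}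
    (h : MvN e e') (h' : MvN f f') :
    MvN (Matrix.fromBlocks e 0 0 f) (Matrix.fromBlocks e' 0 0 f') := by
  obtain ⟨x, y, rfl, rfl⟩ := h
  obtain ⟨z, w, rfl, rfl⟩ := h'
  exact ⟨Matrix.fromBlocks x 0 0 z, Matrix.fromBlocks y 0 0 w,
    by simp [Matrix.fromBlocks_multiply], by simp [Matrix.fromBlocks_multiply]⟩

theorem MvN.map {ι κ : Type} [Fintype ι] [Fintype κ] (φ : R →+* S)
    {e : Matrix ι ι R} {f : Matrix κ κ R} (h : MvN e f) : MvN (e.map φ) (f.map φ) := by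
  obtain ⟨x, y, rfl, rfl⟩ := h
  exact ⟨x.map φ, y.map φ, by rw [Matrix.map_mul], by rw [Matrix.map_mul]⟩

variable (R) in
/-- Idempotents in `⋃ₙ Mₙ(R)`. -/
def Idem : Type _ := Σ n : ℕ, {e : Matrix (Fin n) (Fin n) R // IsIdempotentElem e}

variable (R) in
instance idemSetoid : Setoid (Idem R) where
  r e f := MvN e.2.1 f.2.1
  iseqv := ⟨fun e => MvN.refl e.2.2, MvN.symm, fun {e _ g} h h' => MvN.trans e.2.2 g.2.2 h h'⟩

variable (R) in
/-- The monoid `V(R)` of classes of idempotents in `⋃ₙ Mₙ(R)`; addition is the block sum. -/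
def V : Type _ := Quotient (idemSetoid R)

/-- The class in `V(R)` of an idempotent matrix over any finite index type. -/
noncomputable def V.of {ι : Type} [Fintype ι] (e : Matrix ι ι R) (he : IsIdempotentElem e) : V R :=
  Quotient.mk (idemSetoid R) ⟨Fintype.card ι,
    Matrix.reindex (Fintype.equivFin ι) (Fintype.equivFin ι) e, idem_reindex _ he⟩

theorem V.of_eq {ι κ : Type} [Fintype ι] [Fintype κ] {e : Matrix ι ι R} {f : Matrix κ κ R}
    (he : IsIdempotentElem e) (hf : IsIdempotentElem f) (h : MvN e f) : V.of e he = V.of f hf :=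
  Quotient.sound (s := idemSetoid R) (MvN.trans (idem_reindex _ he) (idem_reindex _ hf)
    (MvN.reindex _ he).symm (MvN.trans he (idem_reindex _ hf) h (MvN.reindex _ hf)))

theorem V.mk_eq (e : Idem R) : Quotient.mk (idemSetoid R) e = V.of e.2.1 e.2.2 :=
  Quotient.sound (s := idemSetoid R) (MvN.reindex _ e.2.2)

theorem V.ind {p : V R → Prop}
    (h : ∀ (n : ℕ) (e : Matrix (Fin n) (Fin n) R) (he : IsIdempotentElem e), p (V.of e he))
    (x : V R) : p x := by
  induction x using Quotient.ind with
  | _ e => rw [V.mk_eq]; exact h _ _ _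

/-- Block sum of classes of idempotents. -/
noncomputable def V.add : V R → V R → V R :=
  Quotient.lift₂ (s₁ := idemSetoid R) (s₂ := idemSetoid R)
    (fun e f => V.of (Matrix.fromBlocks e.2.1 0 0 f.2.1) (idem_blocks e.2.2 f.2.2))
    (fun _ _ _ _ h h' => V.of_eq _ _ (MvN.blocks h h'))

theorem V.add_of {ι κ : Type} [Fintype ι] [Fintype κ] {e : Matrix ι ι R} {f : Matrix κ κ R}
    (he : IsIdempotentElem e) (hf : IsIdempotentElem f) :
    V.add (V.of e he) (V.of f hf) = V.of (Matrix.fromBlocks e 0 0 f) (idem_blocks he hf) :=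
  V.of_eq (idem_blocks (idem_reindex _ he) (idem_reindex _ hf)) _
    (MvN.blocks (MvN.reindex _ he).symm (MvN.reindex _ hf).symm)

theorem V.add_comm' (x y : V R) : V.add x y = V.add y x := by
  induction x using V.ind with
  | _ m e he =>
    induction y using V.ind with
    | _ n f hf =>
      rw [V.add_of, V.add_of]
      refine V.of_eq _ _ ⟨Matrix.fromBlocks 0 e f 0, Matrix.fromBlocks 0 f e 0, ?_, ?_⟩ <;>
        simp [Matrix.fromBlocks_multiply, he.eq, hf.eq]

theorem V.add_assoc' (x y z : V R) : V.add (V.add x y) z = V.add x (V.add y z) := by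
  induction x using V.ind with
  | _ m e he =>
    induction y using V.ind with
    | _ n f hf =>
      induction z using V.ind with
      | _ k g hg =>
        simp only [V.add_of]
        refine V.of_eq _ _ ?_
        have h := MvN.reindex (Equiv.sumAssoc (Fin m) (Fin n) (Fin k))
          (idem_blocks (idem_blocks he hf) hg)
        have h2 : Matrix.reindex (Equiv.sumAssoc (Fin m) (Fin n) (Fin k))
            (Equiv.sumAssoc (Fin m) (Fin n) (Fin k))
            (Matrix.fromBlocks (Matrix.fromBlocks e 0 0 f) 0 0 g)
            = Matrix.fromBlocks e 0 0 (Matrix.fromBlocks f 0 0 g) := by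
          ext i j
          rcases i with i | i | i <;> rcases j with j | j | j <;> rfl
        rwa [h2] at h

theorem idem_zero {ι : Type} [Fintype ι] : IsIdempotentElem (0 : Matrix ι ι R) := by
  simp [IsIdempotentElem]

theorem V.zero_add' (x : V R) :
    V.add (V.of (0 : Matrix (Fin 0) (Fin 0) R) idem_zero) x = x := by
  induction x using V.ind with
  | _ m e he =>
    rw [V.add_of]
    refine V.of_eq _ _ ⟨Matrix.fromRows 0 e, Matrix.fromCols 0 e, ?_, ?_⟩
    · ext i j
      rcases i with i | i
      · exact i.elim0
      · rcases j with j | j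
        · exact j.elim0
        · simpa [Matrix.mul_apply] using congrFun (congrFun he.eq i) j
    · rw [Matrix.fromCols_mul_fromRows, he.eq]
      simp

noncomputable instance : Add (V R) := ⟨V.add⟩

noncomputable instance : Zero (V R) := ⟨V.of (0 : Matrix (Fin 0) (Fin 0) R) idem_zero⟩

noncomputable instance : AddCommMonoid (V R) where
  add_assoc := V.add_assoc'
  add_comm := V.add_comm'
  zero_add := V.zero_add'
  add_zero x := (V.add_comm' _ _).trans (V.zero_add' x)
  nsmul := nsmulRec

/-- The homomorphism `V(R) → V(S)` induced by a ring homomorphism. -/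
noncomputable def V.map (φ : R →+* S) : V R →+ V S where
  toFun := Quotient.lift (s := idemSetoid R)
    (fun e => V.of (e.2.1.map φ) (idem_map φ e.2.2)) (fun _ _ h => V.of_eq _ _ (MvN.map φ h))
  map_zero' := V.of_eq (idem_map φ (idem_reindex _ idem_zero)) idem_zero
    ⟨0, 0, by ext i; exact (i.cast (Fintype.card_fin 0)).elim0, by ext i; exact i.elim0⟩
  map_add' x y := by
    induction x using Quotient.ind with
    | _ e =>
      induction y using Quotient.ind with
      | _ f =>
        change V.of _ _ = V.add (V.of _ _) (V.of _ _)
        rw [V.add_of]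
        refine V.of_eq _ _ ?_
        have h := MvN.map φ (MvN.reindex (Fintype.equivFin (Fin e.1 ⊕ Fin f.1))
          (idem_blocks e.2.2 f.2.2)).symm
        have h2 : (Matrix.fromBlocks e.2.1 0 0 f.2.1).map φ
            = Matrix.fromBlocks (e.2.1.map φ) 0 0 (f.2.1.map φ) := by
          simp [Matrix.fromBlocks_map]
        rwa [h2] at h

theorem V.map_of (φ : R →+* S) {ι : Type} [Fintype ι] (e : Matrix ι ι R)
    (he : IsIdempotentElem e) : V.map φ (V.of e he) = V.of (e.map φ) (idem_map φ he) :=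
  V.of_eq (idem_map φ (idem_reindex _ he)) _ (MvN.map φ (MvN.reindex _ he).symm)

theorem V.map_map {T : Type*} [Ring T] (φ : R →+* S) (ψ : S →+* T) (x : V R) :
    V.map ψ (V.map φ x) = V.map (ψ.comp φ) x := by
  induction x using V.ind with
  | _ m e he => simp only [V.map_of]; rfl

variable (R) in
/-- `K₀` of a unital ring: the Grothendieck group of `V(R)`. -/
abbrev K0 : Type _ := Algebra.GrothendieckAddGroup (V R)

/-- The class `[e]₀` of an idempotent matrix. -/
noncomputable def K0.mk {ι : Type} [Fintype ι] (e : Matrix ι ι R) (he : IsIdempotentElem e) :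
    K0 R := Algebra.GrothendieckAddGroup.of (V.of e he)

/-- Functoriality of `K₀`. -/
noncomputable def K0.map (φ : R →+* S) : K0 R →+ K0 S :=
  Algebra.GrothendieckAddGroup.lift (Algebra.GrothendieckAddGroup.of.comp (V.map φ))

theorem K0.map_of (φ : R →+* S) (x : V R) :
    K0.map φ (Algebra.GrothendieckAddGroup.of x) = Algebra.GrothendieckAddGroup.of (V.map φ x) :=
  DFunLike.congr_fun (Algebra.GrothendieckAddGroup.lift.symm_apply_apply
    (Algebra.GrothendieckAddGroup.of.comp (V.map φ))) x

theorem K0.map_comp {T : Type*} [Ring T] (φ : R →+* S) (ψ : S →+* T) :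
    (K0.map ψ).comp (K0.map φ) = K0.map (ψ.comp φ) := by
  refine Algebra.GrothendieckAddGroup.lift.symm.injective ?_
  ext x
  change K0.map ψ (K0.map φ (Algebra.GrothendieckAddGroup.of x))
    = K0.map (ψ.comp φ) (Algebra.GrothendieckAddGroup.of x)
  simp only [K0.map_of, V.map_map]

end KZero

/-! ## `K₀` of a non-unital algebra -/

section KZeroNonUnital

variable (J : Type*) [NonUnitalRing J] [Module ℂ J] [IsScalarTower ℂ J J] [SMulCommClass ℂ J J]
variable (J' : Type*) [NonUnitalRing J'] [Module ℂ J'] [IsScalarTower ℂ J' J']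
  [SMulCommClass ℂ J' J']

/-- `K₀(J) = ker (K₀(J⁺) → K₀(ℂ))` with `J⁺ = ℂ ⊕ J` the unitization. -/
noncomputable def K0nu : AddSubgroup (K0 (Unitization ℂ J)) :=
  (K0.map (Unitization.fstHom ℂ J).toRingHom).ker

variable {J J'}

theorem idem_inr {e : J} (he : IsIdempotentElem e) :
    IsIdempotentElem (Matrix.of fun _ _ => (e : Unitization ℂ J) :
      Matrix (Fin 1) (Fin 1) (Unitization ℂ J)) :=
  Matrix.ext fun i j => by simp [Matrix.mul_apply, ← Unitization.inr_mul, he.eq]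

/-- The class `[e]₀ ∈ K₀(J)` of an idempotent `e` of `J`. -/
noncomputable def K0nu.mk (e : J) (he : IsIdempotentElem e) : K0nu J :=
  ⟨K0.mk _ (idem_inr he), by
    refine ((K0.map_of _ _).trans (congrArg _ ?_)).trans (map_zero Algebra.GrothendieckAddGroup.of)
    refine (V.map_of _ _ _).trans ?_
    exact V.of_eq _ idem_zero ⟨(0 : Matrix (Fin 1) (Fin 0) ℂ), (0 : Matrix (Fin 0) (Fin 1) ℂ),
      by ext; simp, by ext i; exact i.elim0⟩⟩

/-- The unital extension `J⁺ → J'⁺` of a homomorphism `J → J'`. -/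
def unitizationMap (φ : J →ₙₐ[ℂ] J') : Unitization ℂ J →ₐ[ℂ] Unitization ℂ J' :=
  Unitization.lift ((Unitization.inrNonUnitalAlgHom ℂ J').comp φ)

/-- Functoriality of `K₀` for non-unital algebras. -/
noncomputable def K0nu.map (φ : J →ₙₐ[ℂ] J') : K0nu J →+ K0nu J' :=
  ((K0.map (unitizationMap φ).toRingHom).comp (K0nu J).subtype).codRestrict (K0nu J') (by
    rintro ⟨x, hx⟩
    have h : ((Unitization.fstHom ℂ J').toRingHom.comp (unitizationMap φ).toRingHom)
        = (Unitization.fstHom ℂ J).toRingHom := by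
      ext y
      simp [unitizationMap, Unitization.lift, Unitization.algebraMap_eq_inl]
    have h2 := DFunLike.congr_fun
      (K0.map_comp (unitizationMap φ).toRingHom (Unitization.fstHom ℂ J').toRingHom) x
    rw [h] at h2
    exact h2.trans hx)

end KZeroNonUnital

/-! ## `K₁` of a unital topological algebra -/

section KOne

variable (Q : Type*) [Ring Q] [TopologicalSpace Q] [IsTopologicalRing Q]

/-- The topological group `GLₙ(Q)`. -/
abbrev GLn (n : ℕ) : Type _ := (Matrix (Fin n) (Fin n) Q)ˣ

variable {Q}

/-- The matrix `diag(M, 1)`: `M` padded by an identity block in the lower right corner. -/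
def padMat {Q : Type*} [Ring Q] {m n : ℕ} (h : m ≤ n) (M : Matrix (Fin m) (Fin m) Q) : Matrix (Fin n) (Fin n) Q :=
  Matrix.reindex (finSumFinEquiv.trans (finCongr (Nat.add_sub_cancel' h)))
    (finSumFinEquiv.trans (finCongr (Nat.add_sub_cancel' h)))
    (Matrix.fromBlocks M 0 0 (1 : Matrix (Fin (n - m)) (Fin (n - m)) Q))

theorem padMat_apply {Q : Type*} [Ring Q] {m n : ℕ} (h : m ≤ n) (M : Matrix (Fin m) (Fin m) Q) (i j : Fin n) :
    padMat h M i j = if hij : (i : ℕ) < m ∧ (j : ℕ) < m then M ⟨i, hij.1⟩ ⟨j, hij.2⟩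
      else if i = j then 1 else 0 := by
  set σ := finSumFinEquiv.trans (finCongr (Nat.add_sub_cancel' h)) with hσ
  obtain ⟨i, rfl⟩ := σ.surjective i
  obtain ⟨j, rfl⟩ := σ.surjective j
  have key : padMat h M (σ i) (σ j)
      = Matrix.fromBlocks M 0 0 (1 : Matrix (Fin (n - m)) (Fin (n - m)) Q) i j := by
    simp [padMat, hσ]
  rw [key]
  rcases i with i | i <;> rcases j with j | j
  · simp [hσ]
  · have := i.2
    have h1 : ¬ (σ (Sum.inl i) = σ (Sum.inr j)) := by simp
    rw [if_neg h1]
    simp [hσ]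
  · have h1 : ¬ (σ (Sum.inr i) = σ (Sum.inl j)) := by simp
    rw [if_neg h1]
    simp [hσ]
  · simp [hσ, Matrix.one_apply]

/-- The embedding `GLₘ(Q) → GLₙ(Q)`, `u ↦ diag(u, 1)`. -/
def pad {Q : Type*} [Ring Q] {m n : ℕ} (h : m ≤ n) : GLn Q m →* GLn Q n :=
  Units.map
    { toFun := padMat h
      map_one' := by
        ext i j
        simp only [padMat_apply, Matrix.one_apply, Fin.ext_iff]
        split_ifs <;> rfl
      map_mul' := fun M N => by
        simp only [padMat, Matrix.reindex_apply, Matrix.submatrix_mul_equiv,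
          Matrix.fromBlocks_multiply]
        simp }

theorem continuous_pad {Q : Type*} [Ring Q] [TopologicalSpace Q] {m n : ℕ} (h : m ≤ n) : Continuous (pad (Q := Q) h) := by
  refine Continuous.units_map _ ?_
  refine continuous_pi fun i => continuous_pi fun j => ?_
  change Continuous fun M => padMat h M i j
  simp only [padMat_apply]
  split_ifs
  · exact (continuous_apply _).comp (continuous_apply _)
  · exact continuous_const
  · exact continuous_const

instance normal_component (n : ℕ) :
    (Subgroup.connectedComponentOfOne (GLn Q n)).Normal where
  conj_mem u hu g := by
    have hc : Continuous fun x : GLn Q n => g * x * g⁻¹ := by fun_prop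
    have := hc.image_connectedComponent_subset 1 ⟨u, hu, rfl⟩
    rw [mul_one, mul_inv_cancel] at this
    exact this

variable (Q) in
/-- `GLₙ(Q)` modulo the connected component of the identity. -/
abbrev GLComp (n : ℕ) : Type _ := GLn Q n ⧸ Subgroup.connectedComponentOfOne (GLn Q n)

/-- The map on component groups induced by `u ↦ diag(u, 1)`. -/
def padComp {m n : ℕ} (h : m ≤ n) : GLComp Q m →* GLComp Q n :=
  QuotientGroup.map _ _ (pad h) (by
    intro u hu
    have := (continuous_pad (Q := Q) h).image_connectedComponent_subset 1 ⟨u, hu, rfl⟩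
    rw [map_one] at this
    exact this)

instance : DirectedSystem (GLComp Q) (fun _ _ h => padComp (Q := Q) h) where
  map_self := by
    intro i x
    induction x using QuotientGroup.induction_on with
    | H u =>
      refine congrArg _ (Units.ext ?_)
      ext r s
      change padMat le_rfl (u : Matrix (Fin i) (Fin i) Q) r s = _
      simp [padMat_apply]
  map_map := by
    intro k j i hij hjk x
    induction x using QuotientGroup.induction_on with
    | H u =>
      refine congrArg _ (Units.ext ?_)
      ext r s
      change padMat hjk (padMat hij (u : Matrix (Fin i) (Fin i) Q)) r s
        = padMat (hij.trans hjk) (u : Matrix (Fin i) (Fin i) Q) r s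
      simp only [padMat_apply, Fin.mk.injEq]
      split_ifs <;> first | rfl | omega

variable (Q) in
/-- `K₁(Q) = lim GLₙ(Q)/GLₙ(Q)₀`, written multiplicatively. -/
def K1 : Type _ := DirectLimit (GLComp Q) (fun _ _ h => padComp (Q := Q) h)

noncomputable instance : Group (K1 Q) :=
  inferInstanceAs (Group (DirectLimit (GLComp Q) (fun _ _ h => padComp (Q := Q) h)))

/-- The class `[u]₁` of an invertible matrix. -/
def K1.mk {n : ℕ} (u : GLn Q n) : K1 Q :=
  (⟦⟨n, (u : GLComp Q n)⟩⟧ : DirectLimit (GLComp Q) (fun _ _ h => padComp (Q := Q) h))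

/-- The class `[u]₁` of an invertible element of `Q`, seen as a `1 × 1` matrix. -/
def K1.ofUnit (u : Qˣ) : K1 Q :=
  K1.mk (n := 1) (Units.map (Matrix.scalar (Fin 1)).toMonoidHom u)

end KOne

/-! ## The index map -/

section Index

variable {A Q : Type*} [Ring A] [Algebra ℂ A] [Ring Q] [TopologicalSpace Q] [IsTopologicalRing Q]

theorem idem_corner (R : Type*) [Ring R] (n : ℕ) :
    IsIdempotentElem (Matrix.fromBlocks 1 0 0 0 : Matrix (Fin n ⊕ Fin n) (Fin n ⊕ Fin n) R) := by
  simp [IsIdempotentElem, Matrix.fromBlocks_multiply]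

/-- `δ` is the index map `K₁(Q) → K₀(J)` of the exact sequence `0 → J → A → Q → 0`, where
`π : A → Q` is surjective with kernel `J`: if `w ∈ GL₂ₙ(A)` lifts `diag(u, u⁻¹)`, then
`δ [u]₁ = [w diag(1,0) w⁻¹]₀ - [diag(1,0)]₀`. Here `p` is the matrix `w diag(1,0) w⁻¹`, regarded
as a matrix over the unitization of `J` with scalar part `diag(1,0)`. As every class in `K₁(Q)` is
some `[u]₁` and such `w` and `p` always exist, this determines `δ`. -/
def IsIndexMap (π : A →+* Q) (J : NonUnitalSubalgebra ℂ A)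
    (δ : Additive (K1 Q) →+ K0nu J) : Prop :=
  ∀ (n : ℕ) (u : GLn Q n) (w : (Matrix (Fin n ⊕ Fin n) (Fin n ⊕ Fin n) A)ˣ)
    (p : Matrix (Fin n ⊕ Fin n) (Fin n ⊕ Fin n) (Unitization ℂ J)) (hp : IsIdempotentElem p),
    (w : Matrix (Fin n ⊕ Fin n) (Fin n ⊕ Fin n) A).map π =
      Matrix.fromBlocks (u : Matrix (Fin n) (Fin n) Q) 0 0
        ((u⁻¹ : GLn Q n) : Matrix (Fin n) (Fin n) Q) →
    p.map (NonUnitalSubalgebra.unitization J) =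
      (w : Matrix (Fin n ⊕ Fin n) (Fin n ⊕ Fin n) A) * Matrix.fromBlocks 1 0 0 0 *
        ((w⁻¹ : (Matrix (Fin n ⊕ Fin n) (Fin n ⊕ Fin n) A)ˣ) :
          Matrix (Fin n ⊕ Fin n) (Fin n ⊕ Fin n) A) →
    p.map (Unitization.fstHom ℂ J) = Matrix.fromBlocks 1 0 0 0 →
    (δ (Additive.ofMul (K1.mk u)) : K0 (Unitization ℂ J)) =
      K0.mk p hp - K0.mk (Matrix.fromBlocks 1 0 0 0) (idem_corner _ n)

end Index

/-! ## The quotient topology on a quotient by a two-sided ideal -/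

section Quotient

variable {R : Type*} [Ring R] [TopologicalSpace R] (I : Ideal R) [I.IsTwoSided]

instance quotientTopology : TopologicalSpace (R ⧸ I) :=
  TopologicalSpace.coinduced (Ideal.Quotient.mk I) inferInstance

instance quotientTopologicalRing [IsTopologicalRing R] : IsTopologicalRing (R ⧸ I) := by
  have hq : IsOpenQuotientMap (Ideal.Quotient.mk I) := by
    refine ⟨Ideal.Quotient.mk_surjective, continuous_coinduced_rng, fun U hU => ?_⟩
    rw [isOpen_coinduced]
    have : (Ideal.Quotient.mk I) ⁻¹' ((Ideal.Quotient.mk I) '' U)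
        = ⋃ x ∈ I, (fun y => x + y) ⁻¹' U := by
      ext y
      simp only [Set.mem_preimage, Set.mem_image, Set.mem_iUnion, exists_prop]
      constructor
      · rintro ⟨z, hz, h⟩
        exact ⟨z - y, Ideal.Quotient.eq.mp h, by simpa using hz⟩
      · rintro ⟨x, hx, h⟩
        exact ⟨x + y, h, by simp [Ideal.Quotient.eq_zero_iff_mem.mpr hx]⟩
    rw [this]
    exact isOpen_biUnion fun x _ => hU.preimage (by fun_prop)
  have hq2 := (hq.prodMap hq).isQuotientMap
  have hc : Continuous (Ideal.Quotient.mk I) := hq.continuous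
  exact
    { continuous_add := hq2.continuous_iff.2 (hc.comp continuous_add)
      continuous_mul := hq2.continuous_iff.2 (hc.comp continuous_mul)
      continuous_neg := hq.isQuotientMap.continuous_iff.2 (hc.comp continuous_neg) }

end Quotient

/-! ## The operators -/

/-- Multiplication by `g` on `L²(μ)` (for `g ∈ L^∞(μ)`; all uses below are of this kind). -/
noncomputable def mulOp {α : Type*} [MeasurableSpace α] (μ : Measure α) (g : α → ℂ) :
    Lp ℂ 2 μ →L[ℂ] Lp ℂ 2 μ := by
  classical
  exact if h : MemLp g ∞ μ then (ContinuousLinearMap.mul ℂ ℂ).holderL μ ∞ 2 2 (h.toLp g) else 0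

/-- `L²(ℝ)`. -/
abbrev L2R : Type := Lp ℂ 2 (volume : Measure ℝ)

/-- The multiplication operator `a(M)` on `L²(ℝ)`. -/
noncomputable def opM (a : ℝ → ℂ) : L2R →L[ℂ] L2R := mulOp volume a

/-- The Fourier multiplier `b(D) = F⁻¹ b(M) F`, `D = -i d/dx`. Mathlib's Fourier transform has the
kernel `e^{-2πixξ}`, so the symbol is rescaled by `2π` to match the kernel `e^{-ixξ}`. -/
noncomputable def opD (b : ℝ → ℂ) : L2R →L[ℂ] L2R :=
  ((Lp.fourierTransformₗᵢ ℝ ℂ).symm.toContinuousLinearEquiv : L2R →L[ℂ] L2R) ∘L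
    mulOp volume (fun ξ => b (2 * Real.pi * ξ)) ∘L
    ((Lp.fourierTransformₗᵢ ℝ ℂ).toContinuousLinearEquiv : L2R →L[ℂ] L2R)

/-- The generators of the algebra; `C(EReal, ℂ)` is `C[-∞,+∞]`. -/
def generators : Set (L2R →L[ℂ] L2R) :=
  {T | ∃ a : C(EReal, ℂ), T = opM fun x => a x} ∪
  {T | ∃ a : ℝ → ℂ, Continuous a ∧ Function.Periodic a (2 * Real.pi) ∧ T = opM a} ∪
  {T | ∃ b : C(EReal, ℂ), T = opD fun ξ => b ξ}

/-- The C*-algebra `𝔄` of bounded operators on `L²(ℝ)`. -/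
noncomputable def 𝔄 : StarSubalgebra ℂ (L2R →L[ℂ] L2R) :=
  (StarAlgebra.adjoin ℂ generators).topologicalClosure

/-- The ideal `𝔎_ℝ` of compact operators in `𝔄`. -/
def compactIdeal : Ideal 𝔄 where
  carrier := {A | IsCompactOperator (A : L2R →L[ℂ] L2R)}
  add_mem' ha hb := IsCompactOperator.add ha hb
  zero_mem' := isCompactOperator_zero
  smul_mem' A _ hB := IsCompactOperator.clm_comp hB (A : L2R →L[ℂ] L2R)

instance : compactIdeal.IsTwoSided where
  mul_mem_of_left {_} B hA := IsCompactOperator.comp_clm hA (B : L2R →L[ℂ] L2R)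

/-! ## The principal symbol -/

/-- The space `X ⊂ [-∞,+∞] × S¹`. -/
def X : Set (EReal × Circle) :=
  {p | p.1 = ⊥ ∨ p.1 = ⊤ ∨ ∃ x : ℝ, p.1 = x ∧ p.2 = Circle.exp x}

/-- The point `+∞` (for `true`) or `-∞` (for `false`) of `[-∞,+∞]`. Throughout, `Bool` stands for
`{-∞,+∞}` or `{-1,+1}`. -/
noncomputable def endpt : Bool → EReal
  | true => ⊤
  | false => ⊥

/-- `σ` is the principal symbol: the surjective *-homomorphism `𝔄 → C(X × {-∞,+∞})` with the
standard values on the generators (which determine it). -/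
def IsPrincipalSymbol (σ : 𝔄 →⋆ₐ[ℂ] C(X × Bool, ℂ)) : Prop :=
  Function.Surjective σ ∧
  (∀ (a : C(EReal, ℂ)) (A : 𝔄), (A : L2R →L[ℂ] L2R) = (opM fun x => a x) →
    ∀ (m : X) (s : Bool), σ A (m, s) = a m.1.1) ∧
  (∀ a : ℝ → ℂ, Continuous a → Function.Periodic a (2 * Real.pi) →
    ∀ A : 𝔄, (A : L2R →L[ℂ] L2R) = opM a →
    ∀ (m : X) (s : Bool) (θ : ℝ), m.1.2 = Circle.exp θ → σ A (m, s) = a θ) ∧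
  (∀ (b : C(EReal, ℂ)) (A : 𝔄), (A : L2R →L[ℂ] L2R) = (opD fun ξ => b ξ) →
    ∀ (m : X) (s : Bool), σ A (m, s) = b (endpt s))

/-! ## The boundary principal symbol -/

/-- `ℓ²(ℤ)`. -/
abbrev l2Z : Type := lp (fun _ : ℤ => ℂ) 2

/-- The algebra `𝔅` of bounded operators on `ℓ²(ℤ)`. -/
abbrev 𝔅 : Type := l2Z →L[ℂ] l2Z

/-- The diagonal operator `(u_j) ↦ (d_j u_j)` for a bounded sequence `d` (zero if `d` is
unbounded). -/
noncomputable def diagOp (d : ℤ → ℂ) : 𝔅 := by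
  classical
  exact if h : ∃ C : ℝ, ∀ j, ‖d j‖ ≤ C then
    lp.mapCLM (𝕜 := ℂ) (E := fun _ : ℤ => ℂ) (F := fun _ : ℤ => ℂ) 2
      (fun j => ContinuousLinearMap.mul ℂ ℂ (d j)) (K := h.choose)
      ((norm_nonneg _).trans (h.choose_spec 0))
      (fun j => (ContinuousLinearMap.opNorm_mul_apply ℂ ℂ (d j)).le.trans (h.choose_spec j))
  else 0

/-- `Y_φ`: multiplication by `z^{-φ}` on `L²(S¹)`, conjugated with the discrete Fourier transform
`L²(S¹) → ℓ²(ℤ)`. The circle is `ℝ/ℤ` with `z = e^{2πix}`, and `z^{-φ} = e^{-2πiφx}` for the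
representative `x ∈ (-1/2, 1/2]`. -/
noncomputable def Y (φ : ℝ) : 𝔅 :=
  ((fourierBasis (T := 1)).repr.toContinuousLinearEquiv :
      Lp ℂ 2 (AddCircle.haarAddCircle (T := 1)) →L[ℂ] l2Z) ∘L
    mulOp AddCircle.haarAddCircle (fun x : UnitAddCircle =>
      Complex.exp (-(2 * Real.pi * φ * (AddCircle.equivIoc (1 : ℝ) (-1 / 2) x : ℝ)) * Complex.I)) ∘L
    ((fourierBasis (T := 1)).repr.symm.toContinuousLinearEquiv :
      l2Z →L[ℂ] Lp ℂ 2 (AddCircle.haarAddCircle (T := 1)))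

/-- `γ` is the boundary principal symbol: the *-homomorphism `𝔄 → C(S*S¹, 𝔅)`, with
`S*S¹ = S¹ × {-1,+1}`, that has the standard values on the generators (which determine it). -/
def IsBoundarySymbol (γ : 𝔄 →⋆ₐ[ℂ] C(Circle × Bool, 𝔅)) : Prop :=
  (∀ (a : C(EReal, ℂ)) (A : 𝔄), (A : L2R →L[ℂ] L2R) = (opM fun x => a x) →
    ∀ (z : Circle) (s : Bool), γ A (z, s) = a (endpt s) • (1 : 𝔅)) ∧
  (∀ (k : ℤ) (A : 𝔄), (A : L2R →L[ℂ] L2R) = (opM fun x => Complex.exp (k * x * Complex.I)) →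
    ∀ (z : Circle) (s : Bool), γ A (z, s) = Y (-k)) ∧
  (∀ (b : C(EReal, ℂ)) (A : 𝔄), (A : L2R →L[ℂ] L2R) = (opD fun ξ => b ξ) →
    ∀ (φ : ℝ) (s : Bool), γ A (Circle.exp (2 * Real.pi * φ), s) =
      Y φ * diagOp (fun j => b ((j - φ : ℝ) : EReal)) * Y (-φ))

/-- The compact operators `𝔎_ℤ` on `ℓ²(ℤ)`. -/
def compactsZ : NonUnitalSubalgebra ℂ 𝔅 where
  carrier := {T | IsCompactOperator T}
  add_mem' ha hb := IsCompactOperator.add ha hb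
  zero_mem' := isCompactOperator_zero
  mul_mem' {_ B} hA _ := IsCompactOperator.comp_clm hA B
  smul_mem' c _ hA := IsCompactOperator.smul hA c

/-- The ideal `𝔈/𝔎_ℝ` of `𝔄/𝔎_ℝ`, with `𝔈 = ker σ`. -/
noncomputable def EK (σ : 𝔄 →⋆ₐ[ℂ] C(X × Bool, ℂ)) : NonUnitalSubalgebra ℂ (𝔄 ⧸ compactIdeal) where
  carrier := Ideal.Quotient.mk compactIdeal '' {A | σ A = 0}
  add_mem' := by
    rintro _ _ ⟨A, hA, rfl⟩ ⟨B, hB, rfl⟩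
    exact ⟨A + B, by simp_all, map_add _ _ _⟩
  zero_mem' := ⟨0, by simp, map_zero _⟩
  mul_mem' := by
    rintro _ _ ⟨A, hA, rfl⟩ ⟨B, hB, rfl⟩
    exact ⟨A * B, by simp_all, map_mul _ _ _⟩
  smul_mem' := by
    rintro c _ ⟨A, hA, rfl⟩
    refine ⟨c • A, ?_, rfl⟩
    have hA' : σ A = 0 := hA
    change σ (c • A) = 0
    rw [map_smul, hA']
    exact smul_zero (A := C(X × Bool, ℂ)) c

/-- Evaluation `C(S*S¹, 𝔎_ℤ) → 𝔎_ℤ` at the point `(1, ±1)`. -/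
noncomputable def evalOne (s : Bool) : C(Circle × Bool, compactsZ) →ₙₐ[ℂ] compactsZ where
  toFun f := f (1, s)
  map_smul' _ _ := rfl
  map_zero' := rfl
  map_add' _ _ := rfl
  map_mul' _ _ := rfl

/-- The quotient algebra `𝔄/𝔈`, with `𝔈 = ker σ`. -/
abbrev AE (σ : 𝔄 →⋆ₐ[ℂ] C(X × Bool, ℂ)) : Type := 𝔄 ⧸ RingHom.ker σ

/-- The homomorphism `K₀(𝔈/𝔎_ℝ) → K₀(𝔎_ℤ) ⊕ K₀(𝔎_ℤ)` induced by a homomorphism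
`Φ : 𝔈/𝔎_ℝ → C(S*S¹, 𝔎_ℤ)` followed by the evaluations at `(1, -1)` and `(1, +1)`. -/
noncomputable def nuMap {σ : 𝔄 →⋆ₐ[ℂ] C(X × Bool, ℂ)}
    (Φ : EK σ →ₙₐ[ℂ] C(Circle × Bool, compactsZ)) :
    K0nu (EK σ) →+ K0nu compactsZ × K0nu compactsZ :=
  (K0nu.map ((evalOne false).comp Φ)).prod (K0nu.map ((evalOne true).comp Φ))

/-! ## The operators `A₁, …, A₄` -/

/-- The cut-off functions `c`; the companion function is `b = 1 - c`. -/
def IsCutoff (c : ℝ → ℝ) : Prop :=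
  ContDiff ℝ ∞ c ∧ Antitone c ∧ (∀ x, c x ∈ Set.Icc (0 : ℝ) 1) ∧
    (∀ x ≤ -1 / 5, c x = 1) ∧ ∀ x ≥ 1 / 5, c x = 0

/-- `l(x) = e^{ix}` for `x ≥ 0` and `1` for `x < 0`. -/
noncomputable def l (x : ℝ) : ℂ := if 0 ≤ x then Complex.exp (x * Complex.I) else 1

/-- `l̃(x) = 1` for `x ≥ 0` and `e^{ix}` for `x < 0`. -/
noncomputable def lTilde (x : ℝ) : ℂ := if 0 ≤ x then 1 else Complex.exp (x * Complex.I)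

end SemiPeriodic

open SemiPeriodic

namespace SemiPeriodic

/-! ## Multiplication operators and Fourier multipliers -/

section MulOp

variable {α : Type*} [MeasurableSpace α] {μ : Measure α}

theorem mulOp_coeFn {g : α → ℂ} (h : MemLp g ∞ μ) (f : Lp ℂ 2 μ) :
    mulOp μ g f =ᵐ[μ] fun x => g x * f x := by
  rw [mulOp, dif_pos h]
  refine (ContinuousLinearMap.coeFn_holder (ContinuousLinearMap.mul ℂ ℂ) (h.toLp g) f).trans ?_
  filter_upwards [h.coeFn_toLp] with x hx
  simp [hx]

theorem mulOp_toLp {g : α → ℂ} (h : MemLp g ∞ μ) {f : α → ℂ} (hf : MemLp f 2 μ)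
    (hgf : MemLp (fun x => g x * f x) 2 μ) : mulOp μ g (hf.toLp f) = hgf.toLp _ := by
  refine Lp.ext ?_
  filter_upwards [mulOp_coeFn h (hf.toLp f), hf.coeFn_toLp, hgf.coeFn_toLp] with x h1 h2 h3
  rw [h1, h2, h3]

theorem mulOp_mul {g g' : α → ℂ} (h : MemLp g ∞ μ) (h' : MemLp g' ∞ μ)
    (h'' : MemLp (fun x => g x * g' x) ∞ μ) :
    mulOp μ (fun x => g x * g' x) = mulOp μ g * mulOp μ g' := by
  ext1 f
  refine Lp.ext ?_
  filter_upwards [mulOp_coeFn h'' f, mulOp_coeFn h (mulOp μ g' f), mulOp_coeFn h' f]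
    with x h1 h2 h3
  rw [h1, mul_apply_eq_comp, h2, h3, mul_assoc]

theorem mulOp_add {g g' : α → ℂ} (h : MemLp g ∞ μ) (h' : MemLp g' ∞ μ) :
    mulOp μ (fun x => g x + g' x) = mulOp μ g + mulOp μ g' := by
  ext1 f
  refine Lp.ext ?_
  filter_upwards [mulOp_coeFn (h.add h') f, mulOp_coeFn h f, mulOp_coeFn h' f,
    Lp.coeFn_add (mulOp μ g f) (mulOp μ g' f)] with x h1 h2 h3 h4
  rw [add_apply, h4, Pi.add_apply, h2, h3, ← add_mul]
  exact h1

theorem mulOp_smul {g : α → ℂ} (c : ℂ) (h : MemLp g ∞ μ) :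
    mulOp μ (fun x => c * g x) = c • mulOp μ g := by
  ext1 f
  refine Lp.ext ?_
  filter_upwards [mulOp_coeFn (h.const_mul c) f, mulOp_coeFn h f,
    Lp.coeFn_smul c (mulOp μ g f)] with x h1 h2 h4
  rw [smul_apply, h4, Pi.smul_apply, h2, h1, smul_eq_mul, mul_assoc]

theorem mulOp_const (c : ℂ) (hc : MemLp (fun _ : α => c) ∞ μ) :
    mulOp μ (fun _ => c) = c • 1 := by
  ext1 f
  refine Lp.ext ?_
  filter_upwards [mulOp_coeFn hc f, Lp.coeFn_smul c f] with x h1 h2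
  rw [h1, smul_apply, one_apply_eq_self, h2]
  rfl

theorem norm_mulOp_le {g : α → ℂ} (h : MemLp g ∞ μ) {C : ℝ} (hC : 0 ≤ C)
    (hg : ∀ᵐ x ∂μ, ‖g x‖ ≤ C) : ‖mulOp μ g‖ ≤ C := by
  refine ContinuousLinearMap.opNorm_le_bound _ hC fun f => ?_
  refine Lp.norm_le_mul_norm_of_ae_le_mul ?_
  filter_upwards [mulOp_coeFn h f, hg] with x h1 h2
  rw [h1, norm_mul]
  gcongr

theorem adjoint_mulOp {g : α → ℂ} (h : MemLp g ∞ μ) (h' : MemLp (fun x => star (g x)) ∞ μ) :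
    star (mulOp μ g) = mulOp μ (fun x => star (g x)) := by
  refine Eq.symm ((ContinuousLinearMap.eq_adjoint_iff _ _).2 fun f f' => ?_)
  rw [L2.inner_def, L2.inner_def]
  refine integral_congr_ae ?_
  filter_upwards [mulOp_coeFn h' f, mulOp_coeFn h f'] with x h1 h2
  rw [h1, h2]
  simp only [RCLike.inner_apply, map_mul, RCLike.star_def, starRingEnd_self_apply]
  ring

end MulOp

/-- Bounded measurable functions on the line. -/
def BddMeas (g : ℝ → ℂ) : Prop := Measurable g ∧ ∃ C, ∀ x, ‖g x‖ ≤ C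

namespace BddMeas

variable {g g' : ℝ → ℂ}

theorem memLp (h : BddMeas g) {μ : Measure ℝ} : MemLp g ∞ μ :=
  memLp_top_of_bound h.1.aestronglyMeasurable h.2.choose (.of_forall h.2.choose_spec)

theorem add (h : BddMeas g) (h' : BddMeas g') : BddMeas fun x => g x + g' x :=
  ⟨h.1.add h'.1, h.2.choose + h'.2.choose, fun x =>
    (norm_add_le _ _).trans (add_le_add (h.2.choose_spec x) (h'.2.choose_spec x))⟩

theorem const (c : ℂ) : BddMeas fun _ => c := ⟨measurable_const, ‖c‖, fun _ => le_rfl⟩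

theorem mul (h : BddMeas g) (h' : BddMeas g') : BddMeas fun x => g x * g' x :=
  ⟨h.1.mul h'.1, h.2.choose * h'.2.choose, fun x => by
    rw [norm_mul]
    exact mul_le_mul (h.2.choose_spec x) (h'.2.choose_spec x) (norm_nonneg _)
      ((norm_nonneg _).trans (h.2.choose_spec x))⟩

theorem smul (c : ℂ) (h : BddMeas g) : BddMeas fun x => c * g x := (const c).mul h

theorem neg (h : BddMeas g) : BddMeas fun x => - g x := by simpa using h.smul (-1)

theorem sub (h : BddMeas g) (h' : BddMeas g') : BddMeas fun x => g x - g' x := by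
  simpa [sub_eq_add_neg] using h.add h'.neg

theorem star (h : BddMeas g) : BddMeas fun x => star (g x) :=
  ⟨(continuous_star.measurable).comp h.1, h.2.choose, fun x => by
    rw [norm_star]; exact h.2.choose_spec x⟩

theorem comp (h : BddMeas g) {u : ℝ → ℝ} (hu : Measurable u) : BddMeas fun x => g (u x) :=
  ⟨h.1.comp hu, h.2.choose, fun _ => h.2.choose_spec _⟩

theorem exp (k : ℝ) : BddMeas fun x => Complex.exp (k * x * Complex.I) :=
  ⟨by fun_prop, 1, fun x => by
    change ‖Complex.exp (k * x * Complex.I)‖ ≤ 1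
    rw [← Complex.ofReal_mul, Complex.norm_exp_ofReal_mul_I]⟩

theorem ereal (a : C(EReal, ℂ)) : BddMeas fun x : ℝ => a x :=
  ⟨(a.continuous.comp continuous_coe_real_ereal).measurable, ‖a‖, fun _ => a.norm_coe_le_norm _⟩

theorem indicator {s : Set ℝ} (hs : MeasurableSet s) : BddMeas (s.indicator 1) :=
  ⟨measurable_one.indicator hs, 1, fun x => by
    by_cases h : x ∈ s <;> simp [h]⟩

end BddMeas

section OpMD

variable {a b a' b' : ℝ → ℂ}

theorem opM_coeFn (h : BddMeas a) (f : L2R) : opM a f =ᵐ[volume] fun x => a x * f x :=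
  mulOp_coeFn h.memLp f

theorem opM_mul (h : BddMeas a) (h' : BddMeas a') :
    opM (fun x => a x * a' x) = opM a * opM a' := mulOp_mul h.memLp h'.memLp (h.mul h').memLp

theorem opM_add (h : BddMeas a) (h' : BddMeas a') :
    opM (fun x => a x + a' x) = opM a + opM a' := mulOp_add h.memLp h'.memLp

theorem opM_smul (c : ℂ) (h : BddMeas a) : opM (fun x => c * a x) = c • opM a :=
  mulOp_smul c h.memLp

theorem opM_const (c : ℂ) : opM (fun _ => c) = c • 1 := mulOp_const c (BddMeas.const c).memLp

theorem opM_one : opM (fun _ => 1) = 1 := by rw [opM_const, one_smul]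

theorem opM_sub (h : BddMeas a) (h' : BddMeas a') :
    opM (fun x => a x - a' x) = opM a - opM a' := by
  rw [eq_sub_iff_add_eq, ← opM_add (h.sub h') h']
  simp

theorem opM_star (h : BddMeas a) : opM (fun x => star (a x)) = star (opM a) :=
  (adjoint_mulOp h.memLp h.star.memLp).symm

theorem norm_opM_le (h : BddMeas a) {C : ℝ} (hC : 0 ≤ C) (ha : ∀ x, ‖a x‖ ≤ C) : ‖opM a‖ ≤ C :=
  norm_mulOp_le h.memLp hC (.of_forall ha)

/-- The Fourier transform on `L²(ℝ)` as a unitary equivalence. -/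
noncomputable abbrev FT : L2R ≃ₗᵢ[ℂ] L2R := Lp.fourierTransformₗᵢ ℝ ℂ

theorem opD_apply (b : ℝ → ℂ) (f : L2R) :
    opD b f = FT.symm (opM (fun ξ => b (2 * Real.pi * ξ)) (FT f)) := rfl

theorem FT_opD (b : ℝ → ℂ) (f : L2R) :
    FT (opD b f) = opM (fun ξ => b (2 * Real.pi * ξ)) (FT f) := by
  rw [opD_apply, LinearIsometryEquiv.apply_symm_apply]

theorem BddMeas.scale (h : BddMeas b) : BddMeas fun ξ => b (2 * Real.pi * ξ) :=
  h.comp (by fun_prop)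

theorem opD_mul (h : BddMeas b) (h' : BddMeas b') :
    opD (fun x => b x * b' x) = opD b * opD b' := by
  ext1 f
  rw [opD_apply, opM_mul h.scale h'.scale, mul_apply_eq_comp,
    mul_apply_eq_comp, opD_apply, FT_opD]

theorem opD_add (h : BddMeas b) (h' : BddMeas b') :
    opD (fun x => b x + b' x) = opD b + opD b' := by
  ext1 f
  rw [opD_apply, opM_add h.scale h'.scale]
  simp [opD_apply]

theorem opD_smul (c : ℂ) (h : BddMeas b) : opD (fun x => c * b x) = c • opD b := by
  ext1 f
  rw [opD_apply, opM_smul c h.scale]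
  simp [opD_apply]

theorem opD_const (c : ℂ) : opD (fun _ => c) = c • 1 := by
  ext1 f
  rw [opD_apply, opM_const]
  simp

theorem opD_one : opD (fun _ => 1) = 1 := by rw [opD_const, one_smul]

theorem opD_star (h : BddMeas b) : opD (fun x => star (b x)) = star (opD b) := by
  refine (ContinuousLinearMap.eq_adjoint_iff _ _).2 fun f f' => ?_
  rw [← FT.inner_map_map, ← FT.inner_map_map f, FT_opD, FT_opD, opM_star h.scale]
  exact ContinuousLinearMap.adjoint_inner_left _ _ _

theorem norm_opD_le (h : BddMeas b) {C : ℝ} (hC : 0 ≤ C) (hb : ∀ x, ‖b x‖ ≤ C) : ‖opD b‖ ≤ C := by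
  refine ContinuousLinearMap.opNorm_le_bound _ hC fun f => ?_
  rw [← FT.norm_map, FT_opD, ← FT.norm_map f]
  exact ContinuousLinearMap.le_of_opNorm_le _ (norm_opM_le h.scale hC fun _ => hb _) _

theorem opM_comm (h : BddMeas a) (h' : BddMeas a') : Commute (opM a) (opM a') := by
  rw [Commute, SemiconjBy, ← opM_mul h h', ← opM_mul h' h]
  simp only [mul_comm]

end OpMD

/-! ## The Fourier transform of functions in `L¹ ∩ L²` -/

section Fourier

open FourierTransform SchwartzMap

set_option maxHeartbeats 2000000 in
theorem fourier_toLp_ae {g : ℝ → ℂ} (h1 : Integrable g) (h2 : MemLp g 2) :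
    FT (h2.toLp g) =ᵐ[volume] 𝓕 g := by
  have hcont : Continuous (𝓕 g) := VectorFourier.fourierIntegral_continuous
    Real.continuous_fourierChar (by fun_prop) h1
  refine ae_eq_of_integral_contDiff_smul_eq
    ((Lp.memLp _).locallyIntegrable (by norm_num)) hcont.locallyIntegrable ?_
  intro u hu hsupp
  have huc : HasCompactSupport (fun x => (u x : ℂ)) := hsupp.comp_left (g := Complex.ofReal) Complex.ofReal_zero
  have hus : ContDiff ℝ ∞ (fun x => (u x : ℂ)) := Complex.ofRealCLM.contDiff.comp hu
  set φ : 𝓢(ℝ, ℂ) := huc.toSchwartzMap hus with hφ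
  have key := congrArg (fun T : TemperedDistribution ℝ ℂ => T φ)
    (Lp.fourier_toTemperedDistribution_eq (h2.toLp g))
  simp only [TemperedDistribution.fourier_apply, Lp.toTemperedDistribution_apply] at key
  have h3 := VectorFourier.integral_fourierIntegral_smul_eq_flip (μ := volume) (ν := volume)
    (L := innerₗ ℝ) Real.continuous_fourierChar (by fun_prop) (φ.integrable (μ := volume)) h1
  have e1 : ∀ x, (u x : ℂ) = φ x := fun x => rfl
  calc ∫ x, u x • FT (h2.toLp g) x = ∫ x, φ x • FT (h2.toLp g) x := by
        refine integral_congr_ae (.of_forall fun x => ?_)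
        simp only [← e1]; rfl
    _ = ∫ x, (𝓕 φ) x • (h2.toLp g) x := key.symm
    _ = ∫ x, (𝓕 φ) x • g x := by
        refine integral_congr_ae ?_
        filter_upwards [h2.coeFn_toLp] with x hx
        rw [hx]
    _ = ∫ x, φ x • 𝓕 g x := by
        rw [flip_innerₗ] at h3
        exact h3
    _ = _ := by
        refine integral_congr_ae (.of_forall fun x => ?_)
        simp only [← e1]; rfl

end Fourier

end SemiPeriodic

namespace SemiPeriodic

section Covariance

open FourierTransform SchwartzMap Filter Topology

theorem L2R.norm_sq_eq (f : L2R) : ‖f‖ ^ 2 = ∫ x, ‖f x‖ ^ 2 := by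
  have h := L2.inner_def (𝕜 := ℂ) f f
  rw [inner_self_eq_norm_sq_to_K] at h
  simp only [inner_self_eq_norm_sq_to_K] at h
  have h2 : ((‖f‖ ^ 2 : ℝ) : ℂ) = ((∫ x, ‖f x‖ ^ 2 : ℝ) : ℂ) := by
    rw [← integral_complex_ofReal]
    simpa using h
  exact_mod_cast h2

/-- Translation on `L²(ℝ)`. -/
noncomputable def translate (s : ℝ) : L2R →ₗᵢ[ℂ] L2R :=
  Lp.compMeasurePreservingₗᵢ ℂ (fun x => x - s) (measurePreserving_sub_right volume s)

theorem translate_coeFn (s : ℝ) (f : L2R) : translate s f =ᵐ[volume] fun x => f (x - s) :=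
  Lp.coeFn_compMeasurePreserving f (measurePreserving_sub_right volume s)

theorem opM_translate {a : ℝ → ℂ} (h : BddMeas a) (s : ℝ) (f : L2R) :
    opM a (translate s f) = translate s (opM (fun x => a (x + s)) f) := by
  refine Lp.ext ?_
  have h3 := (measurePreserving_sub_right (volume : Measure ℝ) s).quasiMeasurePreserving.ae
    (opM_coeFn (h.comp (u := fun x => x + s) (by fun_prop)) f)
  filter_upwards [opM_coeFn h (translate s f), translate_coeFn s f,
    translate_coeFn s (opM (fun x => a (x + s)) f), h3] with x h1 h2 h4 h5
  rw [h1, h2, h4, h5]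
  simp

theorem dense_schwartz {p : L2R → Prop} (hp : IsClosed {f | p f})
    (h : ∀ g : 𝓢(ℝ, ℂ), p (g.toLp 2)) (f : L2R) : p f :=
  (SchwartzMap.denseRange_toLpCLM (E := ℝ) (F := ℂ) (p := 2) (μ := volume)
    ENNReal.ofNat_ne_top).induction_on (p := p) f hp h

theorem fourier_exp_mul (k : ℝ) (g : ℝ → ℂ) (ξ : ℝ) :
    𝓕 (fun x : ℝ => Complex.exp (k * x * Complex.I) * g x) ξ = 𝓕 g (ξ - k / (2 * Real.pi)) := by
  rw [Real.fourier_real_eq_integral_exp_smul, Real.fourier_real_eq_integral_exp_smul]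
  refine integral_congr_ae (.of_forall fun x => ?_)
  simp only [smul_eq_mul]
  rw [← mul_assoc, ← Complex.exp_add]
  congr 2
  push_cast
  have : (Real.pi : ℂ) ≠ 0 := by exact_mod_cast Real.pi_ne_zero
  field_simp
  ring

theorem FT_exp (k : ℝ) (f : L2R) :
    FT (opM (fun x => Complex.exp (k * x * Complex.I)) f) = translate (k / (2 * Real.pi)) (FT f) := by
  refine dense_schwartz (p := fun f => FT (opM (fun x => Complex.exp (k * x * Complex.I)) f)
    = translate (k / (2 * Real.pi)) (FT f)) ?_ ?_ f
  · exact isClosed_eq (FT.continuous.comp (opM _).continuous)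
      ((translate _).continuous.comp FT.continuous)
  · intro g
    have h2 : MemLp (fun x : ℝ => Complex.exp (k * x * Complex.I) * g x) 2 :=
      MemLp.of_le (g.memLp 2 volume) (by fun_prop) (.of_forall fun x => by
        rw [norm_mul, ← Complex.ofReal_mul, Complex.norm_exp_ofReal_mul_I, one_mul])
    have h1 : Integrable (fun x : ℝ => Complex.exp (k * x * Complex.I) * g x) :=
      (g.integrable (μ := volume)).mono (by fun_prop) (.of_forall fun x => by
        rw [norm_mul, ← Complex.ofReal_mul, Complex.norm_exp_ofReal_mul_I, one_mul])
    have e1 : opM (fun x => Complex.exp (k * x * Complex.I)) (g.toLp 2) = h2.toLp _ :=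
      mulOp_toLp (BddMeas.exp k).memLp (g.memLp 2 volume) h2
    rw [e1]
    refine Lp.ext ?_
    have h3 := (measurePreserving_sub_right (volume : Measure ℝ)
      (k / (2 * Real.pi))).quasiMeasurePreserving.ae
      (fourier_toLp_ae (g.integrable (μ := volume)) (g.memLp 2 volume))
    filter_upwards [fourier_toLp_ae h1 h2, translate_coeFn (k / (2 * Real.pi)) (FT (g.toLp 2)), h3]
      with x h4 h5 h6
    rw [h4, h5, fourier_exp_mul]
    exact h6.symm

theorem opD_mul_exp {b : ℝ → ℂ} (h : BddMeas b) (k : ℝ) :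
    opD b * opM (fun x => Complex.exp (k * x * Complex.I)) =
      opM (fun x => Complex.exp (k * x * Complex.I)) * opD (fun ξ => b (ξ + k)) := by
  ext1 f
  refine FT.injective ?_
  rw [mul_apply_eq_comp, mul_apply_eq_comp, FT_opD, FT_exp, FT_exp, opM_translate h.scale, FT_opD]
  have : (2 * Real.pi) * (k / (2 * Real.pi)) = k := by field_simp
  simp only [mul_add, this]

/-- The function `√t g(t (x - y)) e^{iηx}`. -/
noncomputable def wave (g : ℝ → ℂ) (t y η : ℝ) (x : ℝ) : ℂ :=
  (√t : ℂ) * (Complex.exp (η * x * Complex.I) * g (t * (x - y)))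

theorem norm_wave {g : ℝ → ℂ} {t y η : ℝ} (x : ℝ) :
    ‖wave g t y η x‖ = √t * ‖g (t * (x - y))‖ := by
  rw [wave, norm_mul, norm_mul, ← Complex.ofReal_mul, Complex.norm_exp_ofReal_mul_I, one_mul,
    Complex.norm_real, Real.norm_eq_abs, abs_of_nonneg (Real.sqrt_nonneg _)]

theorem integral_affine (F : ℝ → ℝ) {t : ℝ} (ht : 0 < t) (y : ℝ) :
    ∫ x, t * F (t * (x - y)) = ∫ u, F u := by
  rw [integral_sub_right_eq_self (fun x => t * F (t * x)) y, integral_const_mul,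
    Measure.integral_comp_mul_left, abs_of_pos (inv_pos.2 ht), smul_eq_mul]
  field_simp

variable {g : ℝ → ℂ}

theorem integrable_wave (h1 : Integrable g) {t : ℝ} (ht : 0 < t) (y η : ℝ) :
    Integrable (wave g t y η) := by
  have h : Integrable fun x => g (t * (x - y)) := (h1.comp_mul_left' ht.ne').comp_sub_right y
  refine (h.bdd_mul (c := 1) (f := fun x : ℝ => Complex.exp (η * x * Complex.I)) (by fun_prop)
    (.of_forall fun x => ?_)).const_mul _
  rw [← Complex.ofReal_mul, Complex.norm_exp_ofReal_mul_I]

theorem memLp_wave (h2 : MemLp g 2) {t : ℝ} (ht : 0 < t) (y η : ℝ) :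
    MemLp (wave g t y η) 2 := by
  have hq : Measure.QuasiMeasurePreserving (fun x : ℝ => t * (x - y)) volume volume :=
    (Measure.quasiMeasurePreserving_smul volume ht.ne').comp
      (measurePreserving_sub_right volume y).quasiMeasurePreserving
  have hm : AEStronglyMeasurable (fun x => g (t * (x - y))) volume :=
    h2.1.comp_quasiMeasurePreserving hq
  have hm' : AEStronglyMeasurable (wave g t y η) volume := by
    unfold wave
    exact (AEStronglyMeasurable.mul (by fun_prop) hm).const_mul _
  rw [memLp_two_iff_integrable_sq_norm hm']
  have h3 := ((memLp_two_iff_integrable_sq_norm h2.1).1 h2)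
  have h4 : Integrable fun x => ‖g (t * (x - y))‖ ^ 2 := (h3.comp_mul_left' ht.ne').comp_sub_right y
  refine (h4.const_mul t).congr (.of_forall fun x => ?_)
  simp only [norm_wave, mul_pow, Real.sq_sqrt ht.le]

/-- `√t g(t (x - y)) e^{iηx}` as an element of `L²(ℝ)`. -/
noncomputable def waveLp (h2 : MemLp g 2) {t : ℝ} (ht : 0 < t) (y η : ℝ) : L2R :=
  (memLp_wave h2 ht y η).toLp _

theorem waveLp_coeFn (h2 : MemLp g 2) {t : ℝ} (ht : 0 < t) (y η : ℝ) :
    waveLp h2 ht y η =ᵐ[volume] wave g t y η := MemLp.coeFn_toLp _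

theorem norm_sq_opM_sub_wave {a : ℝ → ℂ} (ha : BddMeas a) (c : ℂ) (h2 : MemLp g 2) {t : ℝ}
    (ht : 0 < t) (y η : ℝ) :
    ‖opM a (waveLp h2 ht y η) - c • waveLp h2 ht y η‖ ^ 2 =
      ∫ u, ‖a (y + u / t) - c‖ ^ 2 * ‖g u‖ ^ 2 := by
  rw [L2R.norm_sq_eq, ← integral_affine (fun u => ‖a (y + u / t) - c‖ ^ 2 * ‖g u‖ ^ 2) ht y]
  refine integral_congr_ae ?_
  filter_upwards [Lp.coeFn_sub (opM a (waveLp h2 ht y η)) (c • waveLp h2 ht y η),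
    Lp.coeFn_smul c (waveLp h2 ht y η), opM_coeFn ha (waveLp h2 ht y η),
    waveLp_coeFn h2 ht y η] with x e1 e2 e3 e4
  have e5 : y + t * (x - y) / t = x := by field_simp; ring
  rw [e1, Pi.sub_apply, e2, e3, Pi.smul_apply, e4, smul_eq_mul, ← sub_mul, norm_mul, norm_wave, e5,
    mul_pow, mul_pow, Real.sq_sqrt ht.le]
  ring

theorem norm_waveLp (h2 : MemLp g 2) {t : ℝ} (ht : 0 < t) (y η : ℝ) :
    ‖waveLp h2 ht y η‖ ^ 2 = ∫ u, ‖g u‖ ^ 2 := by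
  have h := norm_sq_opM_sub_wave (BddMeas.const 1) 0 h2 ht y η
  rw [opM_one] at h
  simpa using h

theorem norm_fourier_wave {t : ℝ} (ht : 0 < t) (y η ξ : ℝ) :
    ‖𝓕 (wave g t y η) ξ‖ ^ 2 = t⁻¹ * ‖𝓕 g (t⁻¹ * (ξ - η / (2 * Real.pi)))‖ ^ 2 := by
  have e1 : 𝓕 (wave g t y η) ξ =
      √t * 𝓕 (fun x : ℝ => g (t * (x - y))) (ξ - η / (2 * Real.pi)) := by
    rw [← fourier_exp_mul, Real.fourier_real_eq_integral_exp_smul,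
      Real.fourier_real_eq_integral_exp_smul, ← integral_const_mul]
    refine integral_congr_ae (.of_forall fun x => ?_)
    simp only [wave, smul_eq_mul]
    ring
  have e2 : ∀ ζ : ℝ, 𝓕 (fun x : ℝ => g (t * (x - y))) ζ =
      Complex.exp (-(2 * Real.pi * y * ζ : ℝ) * Complex.I) * ((t⁻¹ : ℝ) * 𝓕 g (t⁻¹ * ζ)) := by
    intro ζ
    rw [Real.fourier_real_eq_integral_exp_smul, Real.fourier_real_eq_integral_exp_smul]
    obtain ⟨G, hG⟩ : ∃ G : ℝ → ℂ, G = fun u : ℝ =>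
        Complex.exp (-(2 * Real.pi * y * ζ : ℝ) * Complex.I) *
          (Complex.exp (↑(-2 * Real.pi * u * (t⁻¹ * ζ)) * Complex.I) • g u) := ⟨_, rfl⟩
    have h3 : ∀ v : ℝ, Complex.exp (↑(-2 * Real.pi * v * ζ) * Complex.I) • g (t * (v - y)) =
        (fun x : ℝ => G (t * x)) (v - y) := by
      intro v
      simp only [smul_eq_mul, hG]
      rw [← mul_assoc, ← Complex.exp_add]
      congr 2
      have : (t : ℂ) ≠ 0 := by exact_mod_cast ht.ne'
      push_cast
      field_simp
      ring
    simp_rw [h3]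
    rw [integral_sub_right_eq_self (fun x : ℝ => G (t * x)) y,
      Measure.integral_comp_mul_left, abs_of_pos (inv_pos.2 ht), hG, integral_const_mul,
      Complex.real_smul]
    ring
  rw [e1, e2]
  simp only [norm_mul, Complex.norm_real, Real.norm_eq_abs]
  rw [← Complex.ofReal_neg, Complex.norm_exp_ofReal_mul_I, abs_of_nonneg (Real.sqrt_nonneg _),
    abs_of_pos (inv_pos.2 ht), one_mul, mul_pow, mul_pow, Real.sq_sqrt ht.le]
  field_simp

theorem norm_sq_opD_sub_wave {b : ℝ → ℂ} (hb : BddMeas b) (c : ℂ) (h1 : Integrable g)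
    (h2 : MemLp g 2) {t : ℝ} (ht : 0 < t) (y η : ℝ) :
    ‖opD b (waveLp h2 ht y η) - c • waveLp h2 ht y η‖ ^ 2 =
      ∫ ζ, ‖b (2 * Real.pi * t * ζ + η) - c‖ ^ 2 * ‖𝓕 g ζ‖ ^ 2 := by
  rw [← FT.norm_map, map_sub, FT_opD, map_smul, L2R.norm_sq_eq,
    
    ← integral_affine (fun ζ => ‖b (2 * Real.pi * t * ζ + η) - c‖ ^ 2 * ‖𝓕 g ζ‖ ^ 2) (inv_pos.2 ht)
      (η / (2 * Real.pi))]
  refine integral_congr_ae ?_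
  filter_upwards [Lp.coeFn_sub (opM (fun ξ => b (2 * Real.pi * ξ)) (FT (waveLp h2 ht y η)))
      (c • FT (waveLp h2 ht y η)),
    Lp.coeFn_smul c (FT (waveLp h2 ht y η)), opM_coeFn hb.scale (FT (waveLp h2 ht y η)),
    fourier_toLp_ae (integrable_wave h1 ht y η) (memLp_wave h2 ht y η)] with x e1 e2 e3 e4
  have e5 : 2 * Real.pi * t * (t⁻¹ * (x - η / (2 * Real.pi))) + η = 2 * Real.pi * x := by
    field_simp; ring
  rw [e1, Pi.sub_apply, e2, e3, Pi.smul_apply]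
  unfold waveLp
  rw [e4, smul_eq_mul, ← sub_mul, norm_mul, e5, mul_pow, norm_fourier_wave ht]
  ring

theorem tendsto_integral_bdd {h : ℝ → ℂ} (hh : Integrable fun u => ‖h u‖ ^ 2) {F : ℕ → ℝ → ℂ}
    {C : ℝ} {c : ℂ} (hF : ∀ n, AEStronglyMeasurable (F n) volume) (hC : ∀ n x, ‖F n x‖ ≤ C)
    (hlim : ∀ u, Tendsto (fun n => F n u) atTop (𝓝 c)) :
    Tendsto (fun n => ∫ u, ‖F n u - c‖ ^ 2 * ‖h u‖ ^ 2) atTop (𝓝 0) := by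
  have h0 : ∫ u, (0 : ℝ) * ‖h u‖ ^ 2 = 0 := by simp
  rw [← h0]
  refine tendsto_integral_of_dominated_convergence (fun u => (C + ‖c‖) ^ 2 * ‖h u‖ ^ 2) ?_ ?_ ?_ ?_
  · exact fun n => (((hF n).sub aestronglyMeasurable_const).norm.pow 2).mul hh.1
  · exact hh.const_mul _
  · intro n
    refine .of_forall fun u => ?_
    rw [norm_mul, norm_pow, norm_pow, norm_norm, norm_norm]
    gcongr
    exact (norm_sub_le _ _).trans (by gcongr; exact hC n u)
  · refine .of_forall fun u => ?_
    have := ((hlim u).sub_const c).norm.pow 2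
    simp only [sub_self, norm_zero, ne_eq, OfNat.ofNat_ne_zero, not_false_eq_true, zero_pow] at this
    exact this.mul_const _

theorem tendsto_zero_of_sq {u : ℕ → ℝ} (h : Tendsto (fun n => u n ^ 2) atTop (𝓝 0))
    (h0 : ∀ n, 0 ≤ u n) : Tendsto u atTop (𝓝 0) := by
  have := h.sqrt
  simpa only [Real.sqrt_sq (h0 _), Real.sqrt_zero] using this

variable {t y η : ℕ → ℝ}

theorem tendsto_opM_wave {a : ℝ → ℂ} (ha : BddMeas a) {c : ℂ} (h2 : MemLp g 2)
    (ht : ∀ n, 0 < t n) (hlim : ∀ u, Tendsto (fun n => a (y n + u / t n)) atTop (𝓝 c)) :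
    Tendsto (fun n => ‖opM a (waveLp h2 (ht n) (y n) (η n)) - c • waveLp h2 (ht n) (y n) (η n)‖)
      atTop (𝓝 0) := by
  refine tendsto_zero_of_sq ?_ fun n => norm_nonneg _
  simp only [norm_sq_opM_sub_wave ha]
  exact tendsto_integral_bdd ((memLp_two_iff_integrable_sq_norm h2.1).1 h2)
    (fun n => (ha.1.comp (by fun_prop)).aestronglyMeasurable) (fun n x => ha.2.choose_spec _) hlim

theorem tendsto_opD_wave {b : ℝ → ℂ} (hb : BddMeas b) {c : ℂ} (h1 : Integrable g)
    (h2 : MemLp g 2) (ht : ∀ n, 0 < t n)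
    (hlim : ∀ u, Tendsto (fun n => b (2 * Real.pi * t n * u + η n)) atTop (𝓝 c)) :
    Tendsto (fun n => ‖opD b (waveLp h2 (ht n) (y n) (η n)) - c • waveLp h2 (ht n) (y n) (η n)‖)
      atTop (𝓝 0) := by
  refine tendsto_zero_of_sq ?_ fun n => norm_nonneg _
  simp only [norm_sq_opD_sub_wave hb _ h1]
  refine tendsto_integral_bdd ?_
    (fun n => (hb.1.comp (by fun_prop)).aestronglyMeasurable) (fun n x => hb.2.choose_spec _) hlim
  have h3 := Lp.memLp (FT (h2.toLp g))
  refine ((memLp_two_iff_integrable_sq_norm h3.1).1 h3).congr ?_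
  filter_upwards [fourier_toLp_ae h1 h2] with x hx
  rw [hx]

end Covariance

end SemiPeriodic

namespace SemiPeriodic

/-! ## Compactness of `a(M) φ(D)` for `a` and `φ` vanishing at infinity -/

section Compact

open FourierTransform Filter Topology InnerProductSpace

theorem isCompactOperator_star {H : Type*} [NormedAddCommGroup H] [InnerProductSpace ℂ H]
    [CompleteSpace H] {T : H →L[ℂ] H} (hT : IsCompactOperator T) :
    IsCompactOperator (star T : H →L[ℂ] H) := by
  have hTT : IsCompactOperator (T * star T : H →L[ℂ] H) := hT.comp_clm (star T)
  have hK : IsCompact (closure ((T * star T : H →L[ℂ] H) '' Metric.closedBall 0 1)) :=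
    IsCompactOperator.isCompact_closure_image_closedBall
      (f := ((T * star T : H →L[ℂ] H) : H →ₗ[ℂ] H)) hTT 1
  refine (isCompactOperator_iff_isCompact_closure_image_closedBall
    ((star T : H →L[ℂ] H) : H →ₗ[ℂ] H) one_pos).2 ?_
  refine TotallyBounded.isCompact_of_isClosed (TotallyBounded.closure ?_) isClosed_closure
  refine Metric.totallyBounded_iff.2 fun ε hε => ?_
  have h1 := (hK.totallyBounded.subset subset_closure).exists_subset
    (Metric.dist_mem_uniformity (show (0 : ℝ) < ε ^ 2 / 4 by positivity))
  obtain ⟨t, hts, htf, hcov⟩ := h1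
  obtain ⟨s, hs, rfl⟩ := Set.exists_subset_image_iff.1 ⟨t, hts, rfl⟩ |>.imp fun s hs => hs
  choose! v hv using fun y (hy : y ∈ (T * star T : H →L[ℂ] H) '' s) => hy
  refine ⟨(fun y => (star T : H →L[ℂ] H) (v y)) '' ((T * star T : H →L[ℂ] H) '' s),
    htf.image _, ?_⟩
  rintro _ ⟨x, hx, rfl⟩
  have h2 := hcov ⟨x, hx, rfl⟩
  simp only [Set.mem_iUnion, Set.mem_ofPred_eq, exists_prop] at h2
  obtain ⟨y, hy, hxy⟩ := h2
  simp only [Set.mem_iUnion, exists_prop]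
  refine ⟨_, ⟨y, hy, rfl⟩, ?_⟩
  obtain ⟨hvs, hvy⟩ := hv y hy
  have hvB := hs hvs
  rw [← hvy, dist_eq_norm, ← map_sub] at hxy
  rw [Metric.mem_ball, dist_eq_norm]
  change ‖(star T : H →L[ℂ] H) x - (star T : H →L[ℂ] H) (v y)‖ < ε
  rw [← map_sub]
  set z := x - v y with hz
  have hz2 : ‖z‖ ≤ 2 := by
    have h1 : ‖x‖ ≤ 1 := by simpa using hx
    have h2 : ‖v y‖ ≤ 1 := by simpa using hvB
    exact (norm_sub_le _ _).trans (by linarith)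
  have h3 : ‖(star T : H →L[ℂ] H) z‖ ^ 2 ≤ ‖(T * star T : H →L[ℂ] H) z‖ * ‖z‖ := by
    have h4 : ⟪(T * star T : H →L[ℂ] H) z, z⟫_ℂ = ((‖(star T : H →L[ℂ] H) z‖ ^ 2 : ℝ) : ℂ) := by
      rw [mul_apply_eq_comp, ContinuousLinearMap.star_eq_adjoint,
        ← ContinuousLinearMap.adjoint_inner_right, inner_self_eq_norm_sq_to_K]
      simp
    have h5 := norm_inner_le_norm (𝕜 := ℂ) ((T * star T : H →L[ℂ] H) z) z
    rwa [h4, Complex.norm_real, Real.norm_eq_abs, abs_of_nonneg (by positivity)] at h5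
  refine lt_of_pow_lt_pow_left₀ 2 hε.le ?_
  have h6 := norm_nonneg ((T * star T : H →L[ℂ] H) z)
  nlinarith [mul_le_mul_of_nonneg_left hz2 h6]

theorem isCompactOperator_rankOne {H : Type*} [NormedAddCommGroup H] [InnerProductSpace ℂ H]
    (u v : H) : IsCompactOperator (rankOne ℂ u v) := by
  have h : IsCompactOperator (innerSL ℂ v : H →L[ℂ] ℂ) :=
    isCompactOperator_of_locallyCompactSpace_dom _
  exact h.clm_comp (ContinuousLinearMap.toSpanSingleton ℂ u)

theorem isCompactOperator_finset_sum {ι M₁ M₂ : Type*} [AddCommMonoid M₁] [TopologicalSpace M₁]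
    [AddCommMonoid M₂] [TopologicalSpace M₂] [ContinuousAdd M₂] (s : Finset ι) {T : ι → M₁ → M₂}
    (h : ∀ i ∈ s, IsCompactOperator (T i)) : IsCompactOperator (∑ i ∈ s, T i) := by
  classical
  induction s using Finset.induction_on with
  | empty => simpa using isCompactOperator_zero
  | insert a s ha ih =>
    rw [Finset.sum_insert ha]
    exact (h a (by simp)).add (ih fun i hi => h i (by simp [hi]))

/-- The indicator function of `[-R, R]`. -/
noncomputable def cut (R : ℝ) : ℝ → ℂ := (Set.Icc (-R) R).indicator 1

theorem bddMeas_cut (R : ℝ) : BddMeas (cut R) := BddMeas.indicator measurableSet_Icc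

theorem cut_of_mem {R x : ℝ} (h : |x| ≤ R) : cut R x = 1 := by
  rw [cut, Set.indicator_of_mem (show x ∈ Set.Icc (-R) R from abs_le.1 h), Pi.one_apply]

theorem cut_of_notMem {R x : ℝ} (h : ¬ |x| ≤ R) : cut R x = 0 := by
  rw [cut, Set.indicator_of_notMem (show x ∉ Set.Icc (-R) R from fun h' => h (abs_le.2 h'))]

theorem memLp_cut_mul {R : ℝ} {h : ℝ → ℂ} (hh : Continuous h) (p : ℝ≥0∞) :
    MemLp (fun x => cut R x * h x) p := by
  obtain ⟨C, hC⟩ := (isCompact_Icc (a := -R) (b := R)).exists_bound_of_continuousOn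
    hh.continuousOn
  have h1 : MemLp ((Set.Icc (-R) R).indicator fun _ => (max C 0 : ℝ)) p volume :=
    memLp_indicator_const p measurableSet_Icc _ (Or.inr (by simp))
  refine h1.of_le (((bddMeas_cut R).1.aestronglyMeasurable).mul hh.aestronglyMeasurable)
    (.of_forall fun x => ?_)
  by_cases hx : x ∈ Set.Icc (-R) R
  · rw [Set.indicator_of_mem hx, cut, Set.indicator_of_mem hx, Pi.one_apply, one_mul]
    exact (hC x hx).trans ((le_max_left _ _).trans (le_abs_self _))
  · rw [cut, Set.indicator_of_notMem hx]
    simp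

theorem norm_cut_le (R x : ℝ) : ‖cut R x‖ ≤ 1 := by
  by_cases h : |x| ≤ R
  · simp [cut_of_mem h]
  · simp [cut_of_notMem h]

theorem star_cut (R x : ℝ) : star (cut R x) = cut R x := by
  by_cases h : |x| ≤ R
  · simp [cut_of_mem h]
  · simp [cut_of_notMem h]

/-- The monomial `x ^ n` on `[-R, R]`, extended by zero. -/
noncomputable def cutPow (R : ℝ) (n : ℕ) : L2R :=
  (memLp_cut_mul (R := R) (h := fun x => (x : ℂ) ^ n) (by fun_prop) 2).toLp _

theorem cutPow_coeFn (R : ℝ) (n : ℕ) : cutPow R n =ᵐ[volume] fun x => cut R x * (x : ℂ) ^ n :=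
  MemLp.coeFn_toLp _

theorem inner_cutPow (R : ℝ) (n : ℕ) (f : L2R) :
    ⟪cutPow R n, f⟫_ℂ = ∫ x : ℝ, (x : ℂ) ^ n * (cut R x * f x) := by
  rw [L2.inner_def]
  refine integral_congr_ae ?_
  filter_upwards [cutPow_coeFn R n] with x hx
  rw [hx, RCLike.inner_apply, map_mul, ← RCLike.star_def, star_cut]
  simp
  ring

theorem integral_cut_norm_le (R : ℝ) (f : L2R) :
    ∫ x, ‖cut R x * f x‖ ≤ ‖cutPow R 0‖ * ‖f‖ := by
  have hF : MemLp (fun x => (‖f x‖ : ℂ)) 2 volume := (Lp.memLp f).norm.ofReal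
  have hn : ‖hF.toLp _‖ = ‖f‖ := by
    have : ‖hF.toLp _‖ ^ 2 = ‖f‖ ^ 2 := by
      rw [L2R.norm_sq_eq, L2R.norm_sq_eq]
      refine integral_congr_ae ?_
      filter_upwards [hF.coeFn_toLp] with x hx
      rw [hx]
      simp
    exact (sq_eq_sq₀ (norm_nonneg _) (norm_nonneg _)).1 this
  have h1 := norm_inner_le_norm (𝕜 := ℂ) (cutPow R 0) (hF.toLp _)
  have h2 : ⟪cutPow R 0, hF.toLp _⟫_ℂ = ((∫ x, ‖cut R x * f x‖ : ℝ) : ℂ) := by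
    rw [inner_cutPow, ← integral_complex_ofReal]
    refine integral_congr_ae ?_
    filter_upwards [hF.coeFn_toLp] with x hx
    rw [hx, pow_zero, one_mul]
    by_cases h : |x| ≤ R
    · simp [cut_of_mem h]
    · simp [cut_of_notMem h]
  rw [h2, hn, Complex.norm_real] at h1
  exact (le_abs_self _).trans h1

/-- Finite rank approximations of the Fourier transform between intervals. -/
noncomputable def cutFourierApprox (R : ℝ) (N : ℕ) : L2R →L[ℂ] L2R :=
  ∑ n ∈ Finset.range N, ((-2 * Real.pi * Complex.I) ^ n / (n.factorial : ℂ)) •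
    rankOne ℂ (cutPow R n) (cutPow R n)

theorem cutFourierApprox_coeFn (R : ℝ) (N : ℕ) (f : L2R) :
    cutFourierApprox R N f =ᵐ[volume] fun ξ => cut R ξ * ∑ n ∈ Finset.range N,
      ((-2 * Real.pi * Complex.I) ^ n / (n.factorial : ℂ)) * ⟪cutPow R n, f⟫_ℂ * (ξ : ℂ) ^ n := by
  induction N with
  | zero =>
    simp only [cutFourierApprox, Finset.range_zero, Finset.sum_empty, mul_zero]
    exact Lp.coeFn_zero _ _ _
  | succ N ih =>
    have e : cutFourierApprox R (N + 1) f = cutFourierApprox R N f +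
        (((-2 * Real.pi * Complex.I) ^ N / (N.factorial : ℂ)) * ⟪cutPow R N, f⟫_ℂ) •
          cutPow R N := by
      simp [cutFourierApprox, Finset.sum_range_succ, rankOne_apply, mul_smul]
    rw [e]
    filter_upwards [ih, Lp.coeFn_add (cutFourierApprox R N f)
      ((((-2 * Real.pi * Complex.I) ^ N / (N.factorial : ℂ)) * ⟪cutPow R N, f⟫_ℂ) • cutPow R N),
      Lp.coeFn_smul (((-2 * Real.pi * Complex.I) ^ N / (N.factorial : ℂ)) * ⟪cutPow R N, f⟫_ℂ)
        (cutPow R N), cutPow_coeFn R N] with x h1 h2 h3 h4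
    rw [h2, Pi.add_apply, h1, h3, Pi.smul_apply, h4, Finset.sum_range_succ, smul_eq_mul]
    ring

theorem norm_integral_sub_le {f g : ℝ → ℂ} {H : ℝ → ℝ} (hf : Integrable f) (hg : Integrable g)
    (hH : Integrable H) (h : ∀ x, ‖f x - g x‖ ≤ H x) :
    ‖(∫ x, f x) - ∫ x, g x‖ ≤ ∫ x, H x := by
  rw [← integral_sub hf hg]
  exact norm_integral_le_of_norm_le hH (.of_forall h)

theorem norm_fourier_sub_sum_le {R : ℝ} {N : ℕ}
    (hN : 2 * Real.pi * R ^ 2 / N.succ ≤ 1 / 2) {w : ℝ → ℂ} (hw : Integrable w)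
    (hw0 : ∀ x, ¬ |x| ≤ R → w x = 0) {ξ : ℝ} (hξ : |ξ| ≤ R) :
    ‖𝓕 w ξ - ∑ n ∈ Finset.range N, ((-2 * Real.pi * Complex.I) ^ n / (n.factorial : ℂ)) *
        (∫ x : ℝ, (x : ℂ) ^ n * w x) * (ξ : ℂ) ^ n‖ ≤
      (2 * Real.pi * R ^ 2) ^ N / N.factorial * 2 * ∫ x, ‖w x‖ := by
  have hR : 0 ≤ R := (abs_nonneg _).trans hξ
  have mp : ∀ n : ℕ, Integrable fun x : ℝ => (x : ℂ) ^ n * w x := by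
    intro n
    refine (hw.norm.const_mul (R ^ n)).mono' (by fun_prop) (.of_forall fun x => ?_)
    by_cases hx : |x| ≤ R
    · rw [norm_mul, norm_pow, Complex.norm_real, Real.norm_eq_abs]
      gcongr
    · simp [hw0 x hx]
  have e3 : ∀ (n : ℕ) (x : ℝ), (-2 * Real.pi * Complex.I) ^ n / (n.factorial : ℂ) *
      ((x : ℂ) ^ n * w x) * (ξ : ℂ) ^ n =
      (↑(-2 * Real.pi * x * ξ) * Complex.I) ^ n / (n.factorial : ℂ) * w x := by
    intro n x
    push_cast
    rw [show ((-2 * Real.pi * x * ξ : ℂ) * Complex.I) =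
      (-2 * Real.pi * Complex.I) * x * ξ by ring, mul_pow, mul_pow]
    ring
  have e4 : ∀ n : ℕ, Integrable fun x : ℝ =>
      (↑(-2 * Real.pi * x * ξ) * Complex.I) ^ n / (n.factorial : ℂ) * w x := fun n => by
    simp only [← e3]
    exact ((mp n).const_mul _).mul_const _
  have e2 : ∑ n ∈ Finset.range N, ((-2 * Real.pi * Complex.I) ^ n / (n.factorial : ℂ)) *
      (∫ x : ℝ, (x : ℂ) ^ n * w x) * (ξ : ℂ) ^ n =
      ∫ x : ℝ, ∑ n ∈ Finset.range N,
        ((↑(-2 * Real.pi * x * ξ) * Complex.I) ^ n / (n.factorial : ℂ)) * w x := by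
    rw [integral_finsetSum _ fun n _ => e4 n]
    refine Finset.sum_congr rfl fun n _ => ?_
    rw [← integral_const_mul, ← integral_mul_const]
    simp only [e3]
  have e5 : Integrable fun x : ℝ => Complex.exp (↑(-2 * Real.pi * x * ξ) * Complex.I) • w x := by
    simp only [smul_eq_mul]
    have hm : AEStronglyMeasurable
        (fun x : ℝ => Complex.exp (↑(-2 * Real.pi * x * ξ) * Complex.I)) volume := by fun_prop
    exact hw.bdd_mul hm (.of_forall fun x => (Complex.norm_exp_ofReal_mul_I _).le)
  rw [e2, Real.fourier_real_eq_integral_exp_smul, ← integral_const_mul]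
  refine norm_integral_sub_le e5 (integrable_finsetSum _ fun n _ => e4 n)
    (hw.norm.const_mul _) fun x => ?_
  simp only [smul_eq_mul]
  rw [← Finset.sum_mul, ← sub_mul, norm_mul]
  by_cases hx : |x| ≤ R
  swap
  · simp [hw0 x hx]
  refine mul_le_mul_of_nonneg_right ?_ (norm_nonneg _)
  have h6 : ‖((-2 * Real.pi * x * ξ : ℝ) : ℂ) * Complex.I‖ ≤ 2 * Real.pi * R ^ 2 := by
    rw [norm_mul, Complex.norm_I, mul_one, Complex.norm_real, Real.norm_eq_abs, abs_mul,
      abs_mul, abs_mul, abs_neg, abs_two, abs_of_pos Real.pi_pos, mul_assoc, pow_two]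
    gcongr
  refine (Complex.exp_bound' ((div_le_div_of_nonneg_right h6 (by positivity)).trans hN)).trans ?_
  gcongr

theorem norm_cutFourier_sub_le {R : ℝ} {N : ℕ}
    (hN : 2 * Real.pi * R ^ 2 / N.succ ≤ 1 / 2) (f : L2R) :
    ‖opM (cut R) (FT (opM (cut R) f)) - cutFourierApprox R N f‖ ≤
      (2 * Real.pi * R ^ 2) ^ N / N.factorial * 2 * ‖cutPow R 0‖ * ‖cutPow R 0‖ * ‖f‖ := by
  obtain ⟨M, hM⟩ : ∃ M : ℝ, M = (2 * Real.pi * R ^ 2) ^ N / N.factorial * 2 := ⟨_, rfl⟩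
  have hM0 : 0 ≤ M := by rw [hM]; positivity
  have m2 : MemLp (fun x => cut R x * f x) 2 volume :=
    (Lp.memLp f).of_le (((bddMeas_cut R).1.aestronglyMeasurable).mul (Lp.memLp f).1)
      (.of_forall fun x => by
        rw [norm_mul]
        exact mul_le_of_le_one_left (norm_nonneg _) (norm_cut_le R x))
  have m1 : Integrable (fun x => cut R x * f x) := by
    have h1 : MemLp (cut R) 2 volume := by
      simpa using memLp_cut_mul (R := R) (h := fun _ => 1) continuous_const 2
    exact h1.integrable_mul (Lp.memLp f)
  have e1 : opM (cut R) f = m2.toLp _ := by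
    refine Lp.ext ?_
    filter_upwards [opM_coeFn (bddMeas_cut R) f, m2.coeFn_toLp] with x h1 h2
    rw [h1, h2]
  have hbound : ‖opM (cut R) (FT (opM (cut R) f)) - cutFourierApprox R N f‖ ≤
      (M * ∫ x, ‖cut R x * f x‖) * ‖cutPow R 0‖ := by
    refine Lp.norm_le_mul_norm_of_ae_le_mul ?_
    filter_upwards [Lp.coeFn_sub (opM (cut R) (FT (opM (cut R) f))) (cutFourierApprox R N f),
      opM_coeFn (bddMeas_cut R) (FT (opM (cut R) f)), cutFourierApprox_coeFn R N f,
      cutPow_coeFn R 0, fourier_toLp_ae m1 m2] with ξ h1 h2 h3 h4 h5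
    rw [h1, Pi.sub_apply, h2, h3, h4, e1, h5, ← mul_sub]
    by_cases hξ : |ξ| ≤ R
    swap
    · simp [cut_of_notMem hξ]
    rw [cut_of_mem hξ, one_mul, one_mul, pow_zero, norm_one, mul_one, hM]
    simp only [inner_cutPow]
    exact norm_fourier_sub_sum_le hN m1 (fun x hx => by rw [cut_of_notMem hx, zero_mul]) hξ
  refine hbound.trans ?_
  have h7 := integral_cut_norm_le R f
  rw [← hM]
  calc (M * ∫ x, ‖cut R x * f x‖) * ‖cutPow R 0‖
      ≤ (M * (‖cutPow R 0‖ * ‖f‖)) * ‖cutPow R 0‖ := by gcongr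
    _ = _ := by ring

theorem isCompactOperator_cutFourier (R : ℝ) :
    IsCompactOperator (opM (cut R) * (FT.toContinuousLinearEquiv : L2R →L[ℂ] L2R) *
      opM (cut R) : L2R →L[ℂ] L2R) := by
  refine isCompactOperator_of_tendsto (l := atTop) (F := cutFourierApprox R) ?_ ?_
  · rw [tendsto_iff_norm_sub_tendsto_zero]
    have h1 : Tendsto (fun N : ℕ => (2 * Real.pi * R ^ 2) ^ N / (N.factorial : ℝ) * 2 *
        ‖cutPow R 0‖ * ‖cutPow R 0‖) atTop (𝓝 0) := by
      have := (((FloorSemiring.tendsto_pow_div_factorial_atTop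
        (2 * Real.pi * R ^ 2)).mul_const 2).mul_const ‖cutPow R 0‖).mul_const ‖cutPow R 0‖
      simpa using this
    refine squeeze_zero' (.of_forall fun _ => norm_nonneg _) ?_ h1
    have h2 : Tendsto (fun N : ℕ => 2 * Real.pi * R ^ 2 / (N.succ : ℝ)) atTop (𝓝 0) :=
      (tendsto_const_div_atTop_nhds_zero_nat _).comp (tendsto_add_atTop_nat 1)
    filter_upwards [h2.eventually_le_const (show (0 : ℝ) < 1 / 2 by norm_num)] with N hN
    rw [← norm_neg, neg_sub]
    exact ContinuousLinearMap.opNorm_le_bound _ (by positivity)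
      fun f => norm_cutFourier_sub_le hN f
  · refine .of_forall fun N => ?_
    rw [cutFourierApprox, FunLike.coe_sum]
    exact isCompactOperator_finset_sum _ fun n _ =>
      IsCompactOperator.smul (S := ℂ) (isCompactOperator_rankOne _ _) _

end Compact

end SemiPeriodic

namespace SemiPeriodic

section ERealExt

open Filter Topology

theorem exists_ereal_extension (f : ℝ → ℂ) (hf : Continuous f) {l₁ l₂ : ℂ}
    (h₁ : Tendsto f atBot (𝓝 l₁)) (h₂ : Tendsto f atTop (𝓝 l₂)) :
    ∃ F : C(EReal, ℂ), (∀ x : ℝ, F x = f x) ∧ F ⊥ = l₁ ∧ F ⊤ = l₂ := by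
  let F : EReal → ℂ := fun x => EReal.rec (motive := fun _ => ℂ) l₁ f l₂ x
  have hF : Continuous F := by
    rw [continuous_iff_continuousAt]
    intro x
    induction x using EReal.rec with
    | bot =>
      change Tendsto F (𝓝 ⊥) (𝓝 l₁)
      intro s hs
      obtain ⟨M, hM⟩ := (h₁.eventually hs).exists_forall_of_atBot
      refine EReal.mem_nhds_bot_iff.2 ⟨M, fun y hy => ?_⟩
      induction y using EReal.rec with
      | bot =>
        have h : l₁ ∈ s := mem_of_mem_nhds hs
        exact h
      | coe y => exact hM y (EReal.coe_lt_coe_iff.1 hy).le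
      | top => exact absurd hy (by simp)
    | coe x =>
      rw [ContinuousAt, EReal.nhds_coe, tendsto_map'_iff]
      exact hf.continuousAt
    | top =>
      change Tendsto F (𝓝 ⊤) (𝓝 l₂)
      intro s hs
      obtain ⟨M, hM⟩ := (h₂.eventually hs).exists_forall_of_atTop
      refine EReal.mem_nhds_top_iff.2 ⟨M, fun y hy => ?_⟩
      induction y using EReal.rec with
      | top =>
        have h : l₂ ∈ s := mem_of_mem_nhds hs
        exact h
      | coe y => exact hM y (EReal.coe_lt_coe_iff.1 hy).le
      | bot => exact absurd hy (by simp)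
  exact ⟨⟨F, hF⟩, fun _ => rfl, rfl, rfl⟩

theorem tendsto_ereal_atTop (a : C(EReal, ℂ)) : Tendsto (fun x : ℝ => a x) atTop (𝓝 (a ⊤)) :=
  (a.continuous.tendsto ⊤).comp (EReal.tendsto_coe_nhds_top_iff.2 tendsto_id)

theorem tendsto_ereal_atBot (a : C(EReal, ℂ)) : Tendsto (fun x : ℝ => a x) atBot (𝓝 (a ⊥)) :=
  (a.continuous.tendsto ⊥).comp (EReal.tendsto_coe_nhds_bot_iff.2 tendsto_id)

theorem continuous_ereal (a : C(EReal, ℂ)) : Continuous fun x : ℝ => a x :=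
  a.continuous.comp continuous_coe_real_ereal

theorem exists_shift (a : C(EReal, ℂ)) (k : ℝ) :
    ∃ F : C(EReal, ℂ), (∀ x : ℝ, F x = a ((x + k : ℝ) : EReal)) ∧ F ⊥ = a ⊥ ∧ F ⊤ = a ⊤ :=
  exists_ereal_extension (fun x => a ((x + k : ℝ) : EReal))
    ((continuous_ereal a).comp (by fun_prop))
    ((tendsto_ereal_atBot a).comp (tendsto_atBot_add_const_right _ _ tendsto_id))
    ((tendsto_ereal_atTop a).comp (tendsto_atTop_add_const_right _ _ tendsto_id))

/-- Functions on `[-∞,+∞]` that vanish at `±∞`. -/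
def VanishInf (a : C(EReal, ℂ)) : Prop := a ⊥ = 0 ∧ a ⊤ = 0

theorem VanishInf.tendsto_cut {a : C(EReal, ℂ)} (h : VanishInf a) :
    Tendsto (fun n : ℕ => opM fun x => a x * cut n x) atTop (𝓝 (opM fun x => a x)) := by
  rw [tendsto_iff_norm_sub_tendsto_zero, Metric.tendsto_atTop]
  intro ε hε
  have h1 := (Metric.tendsto_atTop.1 (h.2 ▸ tendsto_ereal_atTop a)) (ε / 2) (by positivity)
  have h2 := (Metric.tendsto_nhds.1 (h.1 ▸ tendsto_ereal_atBot a)) (ε / 2) (by positivity)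
  obtain ⟨N, hN⟩ := h1
  obtain ⟨N', hN'⟩ := h2.exists_forall_of_atBot
  obtain ⟨K, hK⟩ := exists_nat_ge (max N (-N'))
  refine ⟨K, fun n hn => ?_⟩
  rw [Real.dist_eq, sub_zero, abs_of_nonneg (norm_nonneg _),
    ← opM_sub ((BddMeas.ereal a).mul (bddMeas_cut n)) (BddMeas.ereal a)]
  refine (norm_opM_le (((BddMeas.ereal a).mul (bddMeas_cut n)).sub (BddMeas.ereal a))
    (show 0 ≤ ε / 2 by positivity) fun x => ?_).trans_lt (by linarith)
  by_cases hx : |x| ≤ n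
  · rw [cut_of_mem hx, mul_one, sub_self, norm_zero]
    positivity
  · rw [cut_of_notMem hx, mul_zero, zero_sub, norm_neg]
    have hKn : (K : ℝ) ≤ n := by exact_mod_cast hn
    rcases lt_abs.1 (not_le.1 hx) with h3 | h3
    · have := hN x (by have := le_max_left N (-N'); linarith)
      rw [dist_zero_right] at this
      exact this.le
    · have := hN' x (by have := le_max_right N (-N'); linarith)
      rw [dist_zero_right] at this
      exact this.le

theorem isCompactOperator_opD_opM {a φ : C(EReal, ℂ)} (ha : VanishInf a) (hφ : VanishInf φ) :
    IsCompactOperator (opD (fun ξ => φ ξ) * opM (fun x => a x) : L2R →L[ℂ] L2R) := by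
  obtain ⟨ψ, hψ, hψ1, hψ2⟩ := exists_ereal_extension (fun ξ => φ ((2 * Real.pi * ξ : ℝ) : EReal))
    ((continuous_ereal φ).comp (by fun_prop))
    ((tendsto_ereal_atBot φ).comp (tendsto_id.const_mul_atBot (by positivity)))
    ((tendsto_ereal_atTop φ).comp (tendsto_id.const_mul_atTop (by positivity)))
  have hψ0 : VanishInf ψ := ⟨hψ1.trans hφ.1, hψ2.trans hφ.2⟩
  have e1 : (opD (fun ξ => φ ξ) * opM (fun x => a x) : L2R →L[ℂ] L2R) =
      (FT.symm.toContinuousLinearEquiv : L2R →L[ℂ] L2R) *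
        (opM (fun ξ => ψ ξ) * (FT.toContinuousLinearEquiv : L2R →L[ℂ] L2R) *
          opM (fun x => a x)) := by
    simp only [hψ]
    rfl
  rw [e1]
  refine IsCompactOperator.clm_comp (f := (opM (fun ξ => ψ ξ) *
    (FT.toContinuousLinearEquiv : L2R →L[ℂ] L2R) * opM (fun x => a x) : L2R →L[ℂ] L2R)) ?_ _
  refine isCompactOperator_of_tendsto (l := atTop) ((hψ0.tendsto_cut.mul_const _).mul ha.tendsto_cut)
    (.of_forall fun n => ?_)
  have e2 : ((opM fun x => ψ x * cut n x) * (FT.toContinuousLinearEquiv : L2R →L[ℂ] L2R) *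
      (opM fun x => a x * cut n x) : L2R →L[ℂ] L2R) =
      (opM fun x => ψ x) * (opM (cut n) * (FT.toContinuousLinearEquiv : L2R →L[ℂ] L2R) *
        opM (cut n)) * opM fun x => a x := by
    rw [opM_mul (BddMeas.ereal ψ) (bddMeas_cut n), opM_mul (BddMeas.ereal a) (bddMeas_cut n),
      (opM_comm (BddMeas.ereal a) (bddMeas_cut n)).eq]
    simp only [mul_assoc]
  rw [e2]
  exact ((isCompactOperator_cutFourier n).clm_comp (opM fun x => ψ x)).comp_clm (opM fun x => a x)

theorem VanishInf.star {a : C(EReal, ℂ)} (ha : VanishInf a) : VanishInf (star a) :=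
  ⟨by simp [ha.1], by simp [ha.2]⟩

theorem isCompactOperator_opM_opD {a φ : C(EReal, ℂ)} (ha : VanishInf a) (hφ : VanishInf φ) :
    IsCompactOperator (opM (fun x => a x) * opD (fun ξ => φ ξ) : L2R →L[ℂ] L2R) := by
  have h := isCompactOperator_star (isCompactOperator_opD_opM ha.star hφ.star)
  rw [star_mul] at h
  have e1 : (fun x : ℝ => (Star.star a) (x : EReal)) = fun x : ℝ => Star.star (a x) := rfl
  have e2 : (fun x : ℝ => (Star.star φ) (x : EReal)) = fun x : ℝ => Star.star (φ x) := rfl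
  rwa [e1, e2, opM_star (BddMeas.ereal a), opD_star (BddMeas.ereal φ), star_star, star_star] at h

end ERealExt

section Resolvent

open FourierTransform Filter Topology SchwartzMap

/-- The symbol `(ξ + iκ)⁻¹` of a resolvent of `D`. -/
noncomputable def res (κ : ℝ) (ξ : ℝ) : ℂ := ((ξ : ℂ) + κ * Complex.I)⁻¹

theorem res_ne {κ : ℝ} (hκ : 0 < κ) (ξ : ℝ) : (ξ : ℂ) + κ * Complex.I ≠ 0 := fun h => by
  have := congrArg Complex.im h
  simp at this
  exact hκ.ne' this

theorem norm_res_le {κ : ℝ} (hκ : 0 < κ) (ξ : ℝ) : ‖res κ ξ‖ ≤ κ⁻¹ := by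
  rw [res, norm_inv]
  gcongr
  have := Complex.abs_im_le_norm ((ξ : ℂ) + κ * Complex.I)
  simp at this
  exact (le_abs_self _).trans this

theorem continuous_res {κ : ℝ} (hκ : 0 < κ) : Continuous (res κ) := by
  unfold res
  exact Continuous.inv₀ (by fun_prop) (res_ne hκ)

theorem bddMeas_res {κ : ℝ} (hκ : 0 < κ) : BddMeas (res κ) :=
  ⟨(continuous_res hκ).measurable, _, norm_res_le hκ⟩

theorem tendsto_res (κ : ℝ) {l : Filter ℝ} (hl : Tendsto (fun x : ℝ => |x|) l atTop) :
    Tendsto (res κ) l (𝓝 0) := by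
  have h1 : Tendsto (fun ξ : ℝ => ‖(ξ : ℂ) + κ * Complex.I‖) l atTop := by
    refine tendsto_atTop_mono (fun ξ => ?_) hl
    have := Complex.abs_re_le_norm ((ξ : ℂ) + κ * Complex.I)
    simpa using this
  rw [tendsto_zero_iff_norm_tendsto_zero]
  simp only [res, norm_inv]
  exact h1.inv_tendsto_atTop

theorem exists_res_ext {κ : ℝ} (hκ : 0 < κ) :
    ∃ F : C(EReal, ℂ), (∀ x : ℝ, F x = res κ x) ∧ VanishInf F := by
  obtain ⟨F, h1, h2, h3⟩ := exists_ereal_extension (res κ) (continuous_res hκ)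
    (tendsto_res κ tendsto_abs_atBot_atTop) (tendsto_res κ tendsto_abs_atTop_atTop)
  exact ⟨F, h1, h2, h3⟩

theorem opD_res_apply {κ : ℝ} (hκ : 0 < κ) {h : ℝ → ℂ} (hd : Differentiable ℝ h)
    (h1 : Integrable h) (h2 : MemLp h 2 volume) (h1' : Integrable (deriv h))
    (h2' : MemLp (deriv h) 2 volume) :
    opD (res κ) ((-Complex.I) • h2'.toLp _ + (κ * Complex.I) • h2.toLp _) = h2.toLp _ := by
  refine FT.injective ?_
  rw [FT_opD, map_add, map_smul, map_smul]
  obtain ⟨u, hu⟩ : ∃ u : L2R, u = FT (h2.toLp h) := ⟨_, rfl⟩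
  obtain ⟨u', hu'⟩ : ∃ u : L2R, u = FT (h2'.toLp (deriv h)) := ⟨_, rfl⟩
  have hu1 := fourier_toLp_ae h1 h2
  have hu2 := fourier_toLp_ae h1' h2'
  rw [← hu] at hu1 ⊢
  rw [← hu'] at hu2 ⊢
  refine Lp.ext ?_
  filter_upwards [opM_coeFn (bddMeas_res hκ).scale ((-Complex.I) • u' + (κ * Complex.I) • u),
    Lp.coeFn_add ((-Complex.I) • u') ((κ * Complex.I) • u),
    Lp.coeFn_smul (-Complex.I) u', Lp.coeFn_smul (κ * Complex.I) u,
    hu1, hu2] with ξ e1 e2 e3 e4 e5 e6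
  rw [e1, e2, Pi.add_apply, e3, e4, Pi.smul_apply, Pi.smul_apply, e5, e6,
    Real.fourier_deriv h1 hd h1']
  have := res_ne hκ (2 * Real.pi * ξ)
  simp only [smul_eq_mul, res]
  rw [inv_mul_eq_iff_eq_mul₀ this]
  push_cast
  linear_combination (-2 * Real.pi * ξ * 𝓕 h ξ) * Complex.I_sq

theorem hasTemperateGrowth_res {κ : ℝ} (hκ : 0 < κ) :
    Function.HasTemperateGrowth fun ξ : ℝ => res κ (2 * Real.pi * ξ) := by
  have h1 := Function.hasTemperateGrowth_one_add_norm_sq_rpow ℝ (-1)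
  have h2 : Function.HasTemperateGrowth fun ξ : ℝ => κ⁻¹ * (2 * Real.pi) * ξ := by fun_prop
  have h3 := Function.HasTemperateGrowth.comp Function.Complex.hasTemperateGrowth_ofReal (h1.comp h2)
  have h4 : Function.HasTemperateGrowth fun ξ : ℝ =>
      ((2 * Real.pi : ℂ) * Complex.ofReal ξ - κ * Complex.I) * (κ⁻¹ : ℂ) ^ 2 := by
    have := Function.Complex.hasTemperateGrowth_ofReal
    fun_prop
  suffices hs : (fun ξ : ℝ => res κ (2 * Real.pi * ξ)) = (fun ξ : ℝ =>
      ((2 * Real.pi : ℂ) * Complex.ofReal ξ - κ * Complex.I) * (κ⁻¹ : ℂ) ^ 2) *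
      (Complex.ofReal ∘ ((fun x : ℝ => (1 + ‖x‖ ^ 2) ^ (-1 : ℝ)) ∘
        fun ξ : ℝ => κ⁻¹ * (2 * Real.pi) * ξ)) by
    rw [hs]
    exact h4.mul h3
  ext ξ
  have hne := res_ne hκ (2 * Real.pi * ξ)
  have hk : (κ : ℂ) ≠ 0 := by exact_mod_cast hκ.ne'
  have h5 : (1 + (κ⁻¹ * (2 * Real.pi) * ξ) ^ 2 : ℂ) ≠ 0 := by
    have : (1 + (κ⁻¹ * (2 * Real.pi) * ξ) ^ 2 : ℝ) ≠ 0 := by positivity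
    exact_mod_cast this
  simp only [Pi.mul_apply, Function.comp_apply, res, Real.rpow_neg_one, Real.norm_eq_abs, sq_abs]
  push_cast at hne ⊢
  rw [inv_eq_iff_eq_inv, mul_inv, inv_inv, mul_inv]
  have h6 : ((2 * Real.pi : ℂ) * ξ - κ * Complex.I) ≠ 0 := by
    intro h
    have := congrArg Complex.im h
    simp at this
    exact hκ.ne' this
  field_simp
  linear_combination (-(κ : ℂ) ^ 2) * Complex.I_sq

theorem opD_res_injective {κ : ℝ} (hκ : 0 < κ) : Function.Injective (opD (res κ)) := by
  intro u v huv
  refine FT.injective (Lp.ext ?_)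
  have h := congrArg FT huv
  rw [FT_opD, FT_opD] at h
  have h' := Lp.ext_iff.1 h
  filter_upwards [h', opM_coeFn (bddMeas_res hκ).scale (FT u),
    opM_coeFn (bddMeas_res hκ).scale (FT v)] with x h1 h2 h3
  rw [h2, h3] at h1
  exact mul_left_cancel₀ (inv_ne_zero (res_ne hκ _)) h1

theorem exists_res_schwartz {κ : ℝ} (hκ : 0 < κ) (f : 𝓢(ℝ, ℂ)) :
    ∃ g : 𝓢(ℝ, ℂ), opD (res κ) (f.toLp 2) = g.toLp 2 := by
  set g : 𝓢(ℝ, ℂ) := 𝓕⁻ (smulLeftCLM ℂ (fun ξ : ℝ => res κ (2 * Real.pi * ξ)) (𝓕 f)) with hg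
  refine ⟨g, FT.injective ?_⟩
  have e1 : FT (g.toLp 2) = (𝓕 g).toLp 2 := SchwartzMap.toLp_fourier_eq g
  have e2 : FT (f.toLp 2) = (𝓕 f).toLp 2 := SchwartzMap.toLp_fourier_eq f
  have e3 : 𝓕 g = smulLeftCLM ℂ (fun ξ : ℝ => res κ (2 * Real.pi * ξ)) (𝓕 f) := by
    rw [hg, FourierTransform.fourier_fourierInv_eq]
  rw [FT_opD, e1, e2, e3]
  refine Lp.ext ?_
  filter_upwards [opM_coeFn (bddMeas_res hκ).scale ((𝓕 f).toLp 2), (𝓕 f).coeFn_toLp 2,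
    (smulLeftCLM ℂ (fun ξ : ℝ => res κ (2 * Real.pi * ξ)) (𝓕 f)).coeFn_toLp 2] with x h1 h2 h3
  rw [h1, h2, h3, smulLeftCLM_apply_apply (hasTemperateGrowth_res hκ), smul_eq_mul]

theorem BddMeas.memLp_mul {a : ℝ → ℂ} (ha : BddMeas a) {f : ℝ → ℂ} {p : ℝ≥0∞} (hf : MemLp f p) :
    MemLp (fun x => a x * f x) p :=
  hf.mul' (r := p) (p := ∞) (q := p) ha.memLp

theorem BddMeas.integrable_mul {a : ℝ → ℂ} (ha : BddMeas a) {f : ℝ → ℂ} (hf : Integrable f) :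
    Integrable (fun x => a x * f x) :=
  hf.bdd_mul ha.1.aestronglyMeasurable (.of_forall ha.2.choose_spec)

theorem opD_res_mul_opM {κ : ℝ} (hκ : 0 < κ) {α α' : ℝ → ℂ} (hα : BddMeas α) (hα' : BddMeas α')
    (hd : ∀ x, HasDerivAt α (α' x) x) :
    opD (res κ) * opM α = opM α * opD (res κ) +
      Complex.I • (opD (res κ) * opM α' * opD (res κ)) := by
  ext1 f
  refine dense_schwartz (p := fun f => (opD (res κ) * opM α) f = (opM α * opD (res κ) +
      Complex.I • (opD (res κ) * opM α' * opD (res κ))) f)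
    (isClosed_eq (ContinuousLinearMap.continuous _) (ContinuousLinearMap.continuous _)) ?_ f
  intro f
  obtain ⟨g, hg⟩ := exists_res_schwartz hκ f
  have hdg : (derivCLM ℂ ℂ g : ℝ → ℂ) = deriv g := by ext; simp
  have i1 : Integrable (deriv g) := by rw [← hdg]; exact (derivCLM ℂ ℂ g).integrable
  have i2 : MemLp (deriv g) 2 := by rw [← hdg]; exact (derivCLM ℂ ℂ g).memLp 2 volume
  have g1 : Integrable g := g.integrable
  have g2 : MemLp g 2 := g.memLp 2 volume
  have e1 := opD_res_apply hκ g.differentiable g1 g2 i1 i2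
  have e2 : f.toLp 2 = (-Complex.I) • i2.toLp _ + (κ * Complex.I) • g2.toLp _ :=
    opD_res_injective hκ (hg.trans e1.symm)
  have hder : ∀ x, HasDerivAt (fun x => α x * g x) (α' x * g x + α x * deriv g x) x := fun x =>
    (hd x).mul (g.differentiable x).hasDerivAt
  have hder' : deriv (fun x => α x * g x) = fun x => α' x * g x + α x * deriv g x :=
    funext fun x => (hder x).deriv
  have j1 : Integrable (deriv fun x => α x * g x) := by
    rw [hder']; exact (hα'.integrable_mul g1).add (hα.integrable_mul i1)
  have j2 : MemLp (deriv fun x => α x * g x) 2 := by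
    rw [hder']; exact (hα'.memLp_mul g2).add (hα.memLp_mul i2)
  have e3 := opD_res_apply hκ (fun x => (hder x).differentiableAt) (hα.integrable_mul g1)
    (hα.memLp_mul g2) j1 j2
  have e4 : j2.toLp _ = opM α' (g2.toLp _) + opM α (i2.toLp _) := by
    rw [opM, opM, mulOp_toLp hα'.memLp g2 (hα'.memLp_mul g2),
      mulOp_toLp hα.memLp i2 (hα.memLp_mul i2), ← MemLp.toLp_add]
    congr 1
  have e5 : (hα.memLp_mul g2).toLp _ = opM α (g2.toLp _) := by
    rw [opM, mulOp_toLp hα.memLp g2 (hα.memLp_mul g2)]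
  rw [e4, e5] at e3
  have e6 : g.toLp 2 = g2.toLp g := rfl
  simp only [mul_apply_eq_comp, add_apply, smul_apply, hg, e6]
  rw [e2, ← e3]
  simp only [map_add, map_smul, smul_add]
  module

end Resolvent

end SemiPeriodic

namespace SemiPeriodic

section Commutator

open Filter Topology

/-- The function `x / √(1 + x²)`. -/
noncomputable def bend (x : ℝ) : ℝ := x / √(1 + x ^ 2)

theorem one_add_sq_pos (x : ℝ) : 0 < 1 + x ^ 2 := by positivity

theorem hasDerivAt_bend (x : ℝ) : HasDerivAt bend ((1 + x ^ 2)⁻¹ * (√(1 + x ^ 2))⁻¹) x := by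
  have h1 : HasDerivAt (fun x : ℝ => √(1 + x ^ 2)) (2 * x / (2 * √(1 + x ^ 2))) x := by
    have := ((hasDerivAt_pow 2 x).const_add 1).sqrt (one_add_sq_pos x).ne'
    simpa using this
  have hs : √(1 + x ^ 2) ≠ 0 := (Real.sqrt_pos.2 (one_add_sq_pos x)).ne'
  have h2 := (hasDerivAt_id x).div h1 hs
  have h3 := Real.sq_sqrt (one_add_sq_pos x).le
  have h4 := (one_add_sq_pos x).ne'
  have e : (1 * √(1 + x ^ 2) - id x * (2 * x / (2 * √(1 + x ^ 2)))) / √(1 + x ^ 2) ^ 2 =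
      (1 + x ^ 2)⁻¹ * (√(1 + x ^ 2))⁻¹ := by
    rw [id, h3]
    field_simp
    rw [h3]
    ring
  rw [← e]
  exact h2

theorem abs_bend_lt (x : ℝ) : |bend x| < 1 := by
  rw [bend, abs_div, abs_of_pos (Real.sqrt_pos.2 (one_add_sq_pos x)),
    div_lt_one (Real.sqrt_pos.2 (one_add_sq_pos x))]
  refine Real.lt_sqrt_of_sq_lt ?_
  rw [sq_abs]
  linarith

theorem strictMono_bend : StrictMono bend :=
  strictMono_of_hasDerivAt_pos hasDerivAt_bend fun x => by
    have := one_add_sq_pos x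
    positivity

theorem continuous_bend : Continuous bend :=
  continuous_iff_continuousAt.2 fun x => (hasDerivAt_bend x).continuousAt

theorem bend_neg (x : ℝ) : bend (-x) = - bend x := by simp [bend, neg_div]

theorem tendsto_bend_atTop : Tendsto bend atTop (𝓝 1) := by
  have h1 : Tendsto (fun x : ℝ => (√(1 + (x⁻¹) ^ 2))⁻¹) atTop (𝓝 1) := by
    have : Tendsto (fun x : ℝ => (√(1 + (x⁻¹) ^ 2))⁻¹) atTop (𝓝 (√(1 + 0 ^ 2))⁻¹) :=
      Tendsto.inv₀ ((tendsto_inv_atTop_zero.pow 2).const_add 1).sqrt (by simp)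
    simpa using this
  refine h1.congr' ?_
  filter_upwards [eventually_gt_atTop 0] with x hx
  rw [bend, div_eq_mul_inv, show 1 + x ^ 2 = x ^ 2 * (1 + x⁻¹ ^ 2) by field_simp; ring,
    Real.sqrt_mul (by positivity), Real.sqrt_sq hx.le]
  field_simp

theorem tendsto_bend_atBot : Tendsto bend atBot (𝓝 (-1)) := by
  have h := (tendsto_bend_atTop.comp tendsto_neg_atBot_atTop).neg
  refine h.congr fun x => ?_
  simp [bend_neg]

theorem exists_bend_ext : ∃ F : C(EReal, ℂ), (∀ x : ℝ, F x = bend x) ∧ F ⊥ = -1 ∧ F ⊤ = 1 := by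
  have h1 := (Complex.continuous_ofReal.tendsto _).comp tendsto_bend_atBot
  have h2 := (Complex.continuous_ofReal.tendsto _).comp tendsto_bend_atTop
  obtain ⟨F, e1, e2, e3⟩ := exists_ereal_extension (fun x => (bend x : ℂ))
    (Complex.continuous_ofReal.comp continuous_bend) h1 h2
  exact ⟨F, e1, by simpa using e2, by simpa using e3⟩

/-- The derivative of `bend`. -/
noncomputable def bend' (x : ℝ) : ℝ := (1 + x ^ 2)⁻¹ * (√(1 + x ^ 2))⁻¹

theorem bend'_nonneg (x : ℝ) : 0 ≤ bend' x := by unfold bend'; positivity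

theorem bend'_le (x : ℝ) : bend' x ≤ (1 + x ^ 2)⁻¹ := by
  refine mul_le_of_le_one_right (by positivity) (inv_le_one_of_one_le₀ ?_)
  exact Real.one_le_sqrt.2 (by nlinarith [sq_nonneg x])

theorem bend'_le_one (x : ℝ) : bend' x ≤ 1 :=
  (bend'_le x).trans (inv_le_one_of_one_le₀ (by nlinarith [sq_nonneg x]))

theorem continuous_bend' : Continuous bend' := by
  unfold bend'
  refine Continuous.mul (Continuous.inv₀ (by fun_prop) fun x => (one_add_sq_pos x).ne')
    (Continuous.inv₀ (by fun_prop) fun x => (Real.sqrt_pos.2 (one_add_sq_pos x)).ne')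

theorem exists_bend'_ext : ∃ F : C(EReal, ℂ), (∀ x : ℝ, F x = bend' x) ∧ VanishInf F := by
  have h0 : ∀ l : Filter ℝ, Tendsto (fun x : ℝ => |x|) l atTop →
      Tendsto (fun x => (bend' x : ℂ)) l (𝓝 0) := by
    intro l hl
    have h1 : Tendsto (fun x : ℝ => (1 + |x| ^ 2)⁻¹) l (𝓝 0) :=
      ((tendsto_atTop_add_const_left _ 1 (tendsto_pow_atTop two_ne_zero)).comp
        hl).inv_tendsto_atTop
    have h2 : Tendsto bend' l (𝓝 0) :=
      squeeze_zero bend'_nonneg (fun x => by rw [sq_abs]; exact bend'_le x) h1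
    have h := (Complex.continuous_ofReal.tendsto 0).comp h2
    rw [Complex.ofReal_zero] at h
    exact h
  obtain ⟨F, e1, e2, e3⟩ := exists_ereal_extension (fun x => (bend' x : ℂ))
    (Complex.continuous_ofReal.comp continuous_bend') (h0 _ tendsto_abs_atBot_atTop)
    (h0 _ tendsto_abs_atTop_atTop)
  exact ⟨F, e1, e2, e3⟩

theorem bddMeas_bend : BddMeas fun x => (bend x : ℂ) :=
  ⟨(Complex.continuous_ofReal.comp continuous_bend).measurable, 1, fun x => by
    rw [Complex.norm_real]; exact (abs_bend_lt x).le⟩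

theorem bddMeas_bend' : BddMeas fun x => (bend' x : ℂ) :=
  ⟨(Complex.continuous_ofReal.comp continuous_bend').measurable, 1, fun x => by
    rw [Complex.norm_real, Real.norm_eq_abs, abs_of_nonneg (bend'_nonneg x)]; exact bend'_le_one x⟩

/-- The commutator of multiplication by `bend` with a bounded operator. -/
noncomputable def comm (T : L2R →L[ℂ] L2R) : L2R →L[ℂ] L2R :=
  opM (fun x => bend x) * T - T * opM (fun x => bend x)

theorem opM_bend_star : star (opM fun x => (bend x : ℂ)) = opM fun x => (bend x : ℂ) := by
  rw [← opM_star bddMeas_bend]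
  simp

theorem comm_star (T : L2R →L[ℂ] L2R) : comm (star T) = - star (comm T) := by
  simp only [comm, star_sub, star_mul, opM_bend_star]
  abel

theorem comm_res {κ : ℝ} (hκ : 0 < κ) : comm (opD (res κ)) =
    -Complex.I • (opD (res κ) * opM (fun x => bend' x) * opD (res κ)) := by
  rw [comm, opD_res_mul_opM hκ bddMeas_bend bddMeas_bend' fun x => (hasDerivAt_bend x).ofReal_comp]
  module

theorem norm_comm_res_le {κ : ℝ} (hκ : 0 < κ) : ‖comm (opD (res κ))‖ ≤ (κ ^ 2)⁻¹ := by
  rw [comm_res hκ, norm_smul, norm_neg, Complex.norm_I, one_mul]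
  have h1 := norm_opD_le (bddMeas_res hκ) (inv_pos.2 hκ).le (norm_res_le hκ)
  have h2 : ‖opM fun x => (bend' x : ℂ)‖ ≤ 1 := norm_opM_le bddMeas_bend' zero_le_one fun x => by
    rw [Complex.norm_real, Real.norm_eq_abs, abs_of_nonneg (bend'_nonneg x)]; exact bend'_le_one x
  calc _ ≤ ‖opD (res κ)‖ * ‖opM fun x => (bend' x : ℂ)‖ * ‖opD (res κ)‖ :=
        (norm_mul_le _ _).trans (by gcongr; exact norm_mul_le _ _)
    _ ≤ κ⁻¹ * 1 * κ⁻¹ := by gcongr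
    _ = _ := by rw [mul_one, sq, mul_inv]

theorem isCompactOperator_comm_res {κ : ℝ} (hκ : 0 < κ) : IsCompactOperator (comm (opD (res κ))) := by
  obtain ⟨F, hF, hF0⟩ := exists_bend'_ext
  obtain ⟨G, hG, hG0⟩ := exists_res_ext hκ
  have h := isCompactOperator_opM_opD hF0 hG0
  simp only [hF, hG] at h
  rw [comm_res hκ, mul_assoc]
  exact IsCompactOperator.smul (S := ℂ) (f := (opD (res κ) * (opM (fun x => bend' x) *
    opD (res κ)) : L2R →L[ℂ] L2R)) (h.clm_comp (opD (res κ))) _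

theorem arctan_sub_le {a b : ℝ} (ha : 0 ≤ a) (hab : a ≤ b) :
    (b - a) / (1 + b ^ 2) ≤ Real.arctan b - Real.arctan a ∧
      Real.arctan b - Real.arctan a ≤ (b - a) / (1 + a ^ 2) := by
  rcases hab.eq_or_lt with rfl | hlt
  · simp
  obtain ⟨c, hc, hc'⟩ := exists_hasDerivAt_eq_slope Real.arctan (fun x => 1 / (1 + x ^ 2)) hlt
    Real.continuous_arctan.continuousOn (fun x _ => Real.hasDerivAt_arctan x)
  have h0 : 0 < b - a := sub_pos.2 hlt
  have h1 : Real.arctan b - Real.arctan a = (b - a) * (1 / (1 + c ^ 2)) := by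
    rw [hc']; field_simp
  have hc0 : 0 ≤ c := ha.trans hc.1.le
  rw [h1]
  have h3 := hc.1
  have h4 := hc.2
  constructor
  · rw [div_eq_mul_one_div]; gcongr
  · rw [div_eq_mul_one_div (b - a)]
    refine mul_le_mul_of_nonneg_left (one_div_le_one_div_of_le (by positivity) ?_) h0.le
    nlinarith

/-- The `n`-th term of the partial fraction expansion of `coth`. -/
noncomputable def pf (n : ℕ) (ξ : ℝ) : ℝ := ξ / (ξ ^ 2 + (n + 1) ^ 2)

/-- Partial sums of the partial fraction expansion of `coth`. -/
noncomputable def pfSum (N : ℕ) (ξ : ℝ) : ℝ := ∑ n ∈ Finset.range N, pf n ξ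

/-- The sum `∑ ξ / (ξ² + n²)` over `n ≥ 1`. -/
noncomputable def pfLim (ξ : ℝ) : ℝ := ∑' n, pf n ξ

theorem abs_pf_le (n : ℕ) (ξ : ℝ) : |pf n ξ| ≤ |ξ| * (1 / ((n : ℝ) + 1) ^ 2) := by
  rw [pf, abs_div, abs_of_nonneg (by positivity : 0 ≤ ξ ^ 2 + ((n : ℝ) + 1) ^ 2),
    div_eq_mul_one_div]
  gcongr
  nlinarith [sq_nonneg ξ]

theorem summable_inv_sq : Summable fun n : ℕ => 1 / ((n : ℝ) + 1) ^ 2 := by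
  have := (summable_nat_add_iff 1).2 (Real.summable_one_div_nat_pow.2 one_lt_two)
  simpa using this

theorem summable_pf (ξ : ℝ) : Summable fun n => pf n ξ :=
  Summable.of_norm_bounded (summable_inv_sq.mul_left |ξ|) fun n => abs_pf_le n ξ

theorem pf_neg (n : ℕ) (ξ : ℝ) : pf n (-ξ) = - pf n ξ := by simp [pf, neg_div]

theorem pfSum_neg (N : ℕ) (ξ : ℝ) : pfSum N (-ξ) = - pfSum N ξ := by simp [pfSum, pf_neg]

theorem pfLim_neg (ξ : ℝ) : pfLim (-ξ) = - pfLim ξ := by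
  simp only [pfLim, pf_neg, tsum_neg]

theorem tendsto_pfSum (ξ : ℝ) : Tendsto (fun N => pfSum N ξ) atTop (𝓝 (pfLim ξ)) :=
  (summable_pf ξ).hasSum.tendsto_sum_nat

theorem pfSum_le {ξ : ℝ} (hξ : 0 < ξ) (N : ℕ) : pfSum N ξ ≤ Real.arctan (N / ξ) := by
  induction N with
  | zero => simp [pfSum]
  | succ N ih =>
    have h := (arctan_sub_le (a := N / ξ) (b := (N + 1 : ℕ) / ξ) (by positivity)
      (by gcongr; simp)).1
    have e : ((N + 1 : ℕ) / ξ - N / ξ) / (1 + ((N + 1 : ℕ) / ξ) ^ 2) = pf N ξ := by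
      rw [pf]; push_cast; field_simp; ring
    rw [e] at h
    rw [pfSum, Finset.sum_range_succ, ← pfSum]
    linarith

theorem le_pfSum {ξ : ℝ} (hξ : 0 < ξ) (N : ℕ) :
    Real.arctan ((N + 1 : ℕ) / ξ) - Real.arctan (1 / ξ) ≤ pfSum N ξ := by
  induction N with
  | zero => simp [pfSum]
  | succ N ih =>
    have h := (arctan_sub_le (a := (N + 1 : ℕ) / ξ) (b := (N + 1 + 1 : ℕ) / ξ) (by positivity)
      (by gcongr; simp)).2
    have e : ((N + 1 + 1 : ℕ) / ξ - (N + 1 : ℕ) / ξ) / (1 + ((N + 1 : ℕ) / ξ) ^ 2) = pf N ξ := by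
      rw [pf]; push_cast; field_simp; ring
    rw [e] at h
    rw [pfSum, Finset.sum_range_succ, ← pfSum]
    linarith

theorem pfSum_nonneg {ξ : ℝ} (hξ : 0 ≤ ξ) (N : ℕ) : 0 ≤ pfSum N ξ :=
  Finset.sum_nonneg fun n _ => by unfold pf; positivity

theorem abs_pfSum_le (N : ℕ) (ξ : ℝ) : |pfSum N ξ| ≤ Real.pi / 2 := by
  have h : ∀ ξ : ℝ, 0 ≤ ξ → |pfSum N ξ| ≤ Real.pi / 2 := by
    intro ξ hξ
    rw [abs_of_nonneg (pfSum_nonneg hξ N)]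
    rcases hξ.eq_or_lt with rfl | hξ
    · simp [pfSum, pf]; positivity
    · exact (pfSum_le hξ N).trans (Real.arctan_lt_pi_div_two _).le
  rcases le_total 0 ξ with h' | h'
  · exact h ξ h'
  · rw [← abs_neg, ← pfSum_neg]
    exact h _ (by linarith)

theorem abs_pfLim_le (ξ : ℝ) : |pfLim ξ| ≤ Real.pi / 2 :=
  le_of_tendsto (tendsto_pfSum ξ).abs (.of_forall fun N => abs_pfSum_le N ξ)

theorem tendsto_pfLim_atTop : Tendsto pfLim atTop (𝓝 (Real.pi / 2)) := by
  have h1 : Tendsto (fun ξ : ℝ => Real.pi / 2 - Real.arctan (1 / ξ)) atTop (𝓝 (Real.pi / 2)) := by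
    have : Tendsto (fun ξ : ℝ => Real.arctan (1 / ξ)) atTop (𝓝 0) := by
      have := (Real.continuous_arctan.tendsto 0).comp tendsto_inv_atTop_zero
      simpa [Function.comp_def] using this
    simpa using this.const_sub (Real.pi / 2)
  refine tendsto_of_tendsto_of_tendsto_of_le_of_le' h1 tendsto_const_nhds ?_
    (.of_forall fun ξ => (le_abs_self _).trans (abs_pfLim_le ξ))
  filter_upwards [eventually_gt_atTop 0] with ξ hξ
  refine le_of_tendsto_of_tendsto' (Tendsto.sub_const ?_ _) (tendsto_pfSum ξ) (le_pfSum hξ)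
  have h2 : Tendsto (fun N : ℕ => ((N + 1 : ℕ) : ℝ) / ξ) atTop atTop :=
    (tendsto_natCast_atTop_atTop.comp (tendsto_add_atTop_nat 1)).atTop_div_const hξ
  exact (Real.tendsto_arctan_atTop.mono_right nhdsWithin_le_nhds).comp h2

theorem tendsto_pfLim_atBot : Tendsto pfLim atBot (𝓝 (-(Real.pi / 2))) := by
  have h := (tendsto_pfLim_atTop.comp tendsto_neg_atBot_atTop).neg
  refine h.congr fun x => ?_
  simp [pfLim_neg]

theorem continuous_pfLim : Continuous pfLim := by
  rw [continuous_iff_continuousAt]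
  intro x
  have h : ContinuousOn pfLim (Metric.ball 0 (|x| + 1)) := by
    refine continuousOn_tsum (u := fun n : ℕ => (|x| + 1) * (1 / ((n : ℝ) + 1) ^ 2)) (fun n => ?_)
      (summable_inv_sq.mul_left _) fun n y hy => ?_
    · unfold pf
      exact (Continuous.div (by fun_prop) (by fun_prop) fun y => by positivity).continuousOn
    · refine (abs_pf_le n y).trans ?_
      gcongr
      simpa using (mem_ball_zero_iff.1 hy).le
  exact h.continuousAt (Metric.isOpen_ball.mem_nhds (by simp))

theorem pf_eq_res (n : ℕ) (ξ : ℝ) :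
    (pf n ξ : ℂ) = 2⁻¹ * (res (n + 1) ξ + star (res (n + 1) ξ)) := by
  have h := res_ne (κ := (n : ℝ) + 1) (by positivity) ξ
  rw [show star (res (n + 1) ξ) = (starRingEnd ℂ) (res (n + 1) ξ) from rfl, Complex.add_conj, res,
    Complex.inv_re, pf]
  simp [Complex.normSq_apply]
  ring

theorem bddMeas_pf (n : ℕ) : BddMeas fun ξ => (pf n ξ : ℂ) := by
  have h := bddMeas_res (κ := (n : ℝ) + 1) (by positivity)
  simp only [pf_eq_res]
  exact (h.add h.star).smul _

theorem opD_pf (n : ℕ) : opD (fun ξ => (pf n ξ : ℂ)) =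
    (2⁻¹ : ℂ) • (opD (res (n + 1)) + star (opD (res (n + 1)))) := by
  have h := bddMeas_res (κ := (n : ℝ) + 1) (by positivity)
  simp only [pf_eq_res]
  rw [opD_smul _ (h.add h.star), opD_add h h.star, opD_star h]

theorem comm_smul (c : ℂ) (T : L2R →L[ℂ] L2R) : comm (c • T) = c • comm T := by
  simp [comm, smul_sub]

theorem comm_add (T S : L2R →L[ℂ] L2R) : comm (T + S) = comm T + comm S := by
  simp only [comm, mul_add, add_mul]; abel

theorem comm_opD_pf (n : ℕ) : comm (opD fun ξ => (pf n ξ : ℂ)) =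
    (2⁻¹ : ℂ) • (comm (opD (res (n + 1))) - star (comm (opD (res (n + 1))))) := by
  rw [opD_pf, comm_smul, comm_add, comm_star, sub_eq_add_neg]

theorem norm_comm_opD_pf_le (n : ℕ) :
    ‖comm (opD fun ξ => (pf n ξ : ℂ))‖ ≤ 1 / ((n : ℝ) + 1) ^ 2 := by
  rw [comm_opD_pf, norm_smul]
  have h := norm_comm_res_le (κ := (n : ℝ) + 1) (by positivity)
  have h2 := norm_sub_le (comm (opD (res (n + 1)))) (star (comm (opD (res (n + 1)))))
  rw [show ‖star (comm (opD (res (n + 1))))‖ = ‖comm (opD (res (n + 1)))‖ from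
    LinearIsometryEquiv.norm_map ContinuousLinearMap.adjoint _] at h2
  have h3 : ‖(2⁻¹ : ℂ)‖ = 2⁻¹ := by simp
  rw [h3, one_div]
  linarith

theorem isCompactOperator_comm_opD_pf (n : ℕ) :
    IsCompactOperator (comm (opD fun ξ => (pf n ξ : ℂ))) := by
  have h := isCompactOperator_comm_res (κ := (n : ℝ) + 1) (by positivity)
  rw [comm_opD_pf]
  exact IsCompactOperator.smul (S := ℂ) (h.sub (isCompactOperator_star h)) _

theorem bddMeas_pfLim : BddMeas fun ξ => (pfLim ξ : ℂ) :=
  ⟨(Complex.continuous_ofReal.comp continuous_pfLim).measurable, _, fun x => by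
    rw [Complex.norm_real]; exact abs_pfLim_le x⟩

theorem tendsto_opM_apply {F : ℕ → ℝ → ℂ} {G : ℝ → ℂ} {C : ℝ} (hF : ∀ n, BddMeas (F n))
    (hG : BddMeas G) (hC : ∀ n x, ‖F n x‖ ≤ C) (hlim : ∀ x, Tendsto (fun n => F n x) atTop (𝓝 (G x)))
    (f : L2R) : Tendsto (fun n => opM (F n) f) atTop (𝓝 (opM G f)) := by
  rw [tendsto_iff_norm_sub_tendsto_zero]
  refine tendsto_zero_of_sq ?_ fun n => norm_nonneg _
  have e : ∀ n, ‖opM (F n) f - opM G f‖ ^ 2 = ∫ x, ‖(F n x - G x) - 0‖ ^ 2 * ‖f x‖ ^ 2 := by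
    intro n
    rw [L2R.norm_sq_eq]
    refine integral_congr_ae ?_
    filter_upwards [Lp.coeFn_sub (opM (F n) f) (opM G f), opM_coeFn (hF n) f, opM_coeFn hG f]
      with x h1 h2 h3
    rw [h1, Pi.sub_apply, h2, h3, ← sub_mul, norm_mul, mul_pow, sub_zero]
  simp only [e]
  refine tendsto_integral_bdd ((memLp_two_iff_integrable_sq_norm (Lp.memLp f).1).1 (Lp.memLp f))
    (C := C + C) (fun n => ((hF n).sub hG).1.aestronglyMeasurable) (fun n x => ?_) fun x => ?_
  · refine (norm_sub_le _ _).trans (add_le_add (hC n x) ?_)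
    exact le_of_tendsto (hlim x).norm (.of_forall fun n => hC n x)
  · simpa using (hlim x).sub_const (G x)

theorem tendsto_opD_apply {F : ℕ → ℝ → ℂ} {G : ℝ → ℂ} {C : ℝ} (hF : ∀ n, BddMeas (F n))
    (hG : BddMeas G) (hC : ∀ n x, ‖F n x‖ ≤ C) (hlim : ∀ x, Tendsto (fun n => F n x) atTop (𝓝 (G x)))
    (f : L2R) : Tendsto (fun n => opD (F n) f) atTop (𝓝 (opD G f)) := by
  simp only [opD_apply]
  exact (FT.symm.continuous.tendsto _).comp (tendsto_opM_apply (fun n => (hF n).scale) hG.scale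
    (fun n x => hC n _) (fun x => hlim _) (FT f))

theorem isCompactOperator_comm_pfLim : IsCompactOperator (comm (opD fun ξ => (pfLim ξ : ℂ))) := by
  have hs : Summable fun n => comm (opD fun ξ => (pf n ξ : ℂ)) :=
    Summable.of_norm_bounded summable_inv_sq norm_comm_opD_pf_le
  obtain ⟨K, hK⟩ := hs
  have hcomp : IsCompactOperator K := by
    refine isCompactOperator_of_tendsto hK.tendsto_sum_nat (.of_forall fun N => ?_)
    rw [FunLike.coe_sum]
    exact isCompactOperator_finset_sum _ fun n _ => isCompactOperator_comm_opD_pf n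
  have hsum : ∀ N, ∑ n ∈ Finset.range N, comm (opD fun ξ => (pf n ξ : ℂ)) =
      comm (opD fun ξ => (pfSum N ξ : ℂ)) ∧ BddMeas fun ξ => (pfSum N ξ : ℂ) := by
    intro N
    induction N with
    | zero =>
      have : opD (fun _ => 0) = 0 := by simpa using opD_const 0
      refine ⟨by simp [pfSum, comm, this], by simpa [pfSum] using BddMeas.const 0⟩
    | succ N ih =>
      have e : (fun ξ => (pfSum (N + 1) ξ : ℂ)) = fun ξ => (pfSum N ξ : ℂ) + (pf N ξ : ℂ) := by
        ext ξ
        rw [pfSum, Finset.sum_range_succ, ← pfSum]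
        push_cast
        rfl
      rw [e, Finset.sum_range_succ, ih.1, opD_add ih.2 (bddMeas_pf N), comm_add]
      exact ⟨rfl, ih.2.add (bddMeas_pf N)⟩
  have hKe : K = comm (opD fun ξ => (pfLim ξ : ℂ)) := by
    ext1 f
    have h1 : Tendsto (fun N => comm (opD fun ξ => (pfSum N ξ : ℂ)) f) atTop (𝓝 (K f)) := by
      have := hK.tendsto_sum_nat
      simp only [(hsum _).1] at this
      exact ((ContinuousLinearMap.apply ℂ L2R f).continuous.tendsto K).comp this
    have h2 := fun f => tendsto_opD_apply (fun N => (hsum N).2) bddMeas_pfLim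
      (C := Real.pi / 2) (fun N x => by rw [Complex.norm_real]; exact abs_pfSum_le N x)
      (fun x => (Complex.continuous_ofReal.tendsto _).comp (tendsto_pfSum x)) f
    refine tendsto_nhds_unique h1 ?_
    exact (((opM fun x => (bend x : ℂ)).continuous.tendsto _).comp (h2 f)).sub (h2 _)
  rwa [← hKe]

theorem EReal_starSubalgebra_eq_top (S : StarSubalgebra ℂ C(EReal, ℂ)) (hS : IsClosed (S : Set C(EReal, ℂ)))
    (h : ∀ x y : EReal, x ≠ y → ∃ f ∈ S, f x ≠ f y) (f : C(EReal, ℂ)) : f ∈ S := by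
  have h1 := ContinuousMap.starSubalgebra_topologicalClosure_eq_top_of_separatesPoints S (by
    intro x y hxy
    obtain ⟨f, hf, hne⟩ := h x y hxy
    exact ⟨f, ⟨f, hf, rfl⟩, hne⟩)
  have h2 : f ∈ S.topologicalClosure := by rw [h1]; trivial
  rw [← SetLike.mem_coe, StarSubalgebra.topologicalClosure_coe, hS.closure_eq] at h2
  exact h2

theorem opM_ereal_norm_le (a : C(EReal, ℂ)) : ‖opM fun x => a x‖ ≤ ‖a‖ :=
  norm_opM_le (.ereal a) (norm_nonneg _) fun _ => a.norm_coe_le_norm _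

theorem opD_ereal_norm_le (a : C(EReal, ℂ)) : ‖opD fun x => a x‖ ≤ ‖a‖ :=
  norm_opD_le (.ereal a) (norm_nonneg _) fun _ => a.norm_coe_le_norm _

/-- The homomorphism `a ↦ a(M)` on `C[-∞,+∞]`. -/
noncomputable def erealM : C(EReal, ℂ) →⋆ₐ[ℂ] (L2R →L[ℂ] L2R) where
  toFun a := opM fun x => a x
  map_one' := opM_one
  map_mul' a b := opM_mul (.ereal a) (.ereal b)
  map_zero' := by simpa using opM_const 0
  map_add' a b := opM_add (.ereal a) (.ereal b)
  commutes' c := by simpa [Algebra.algebraMap_eq_smul_one] using opM_const c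
  map_star' a := opM_star (.ereal a)

/-- The homomorphism `b ↦ b(D)` on `C[-∞,+∞]`. -/
noncomputable def erealD : C(EReal, ℂ) →⋆ₐ[ℂ] (L2R →L[ℂ] L2R) where
  toFun a := opD fun x => a x
  map_one' := opD_one
  map_mul' a b := opD_mul (.ereal a) (.ereal b)
  map_zero' := by simpa using opD_const 0
  map_add' a b := opD_add (.ereal a) (.ereal b)
  commutes' c := by simpa [Algebra.algebraMap_eq_smul_one] using opD_const c
  map_star' a := opD_star (.ereal a)

theorem erealM_apply (a : C(EReal, ℂ)) : erealM a = opM fun x => a x := rfl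

theorem erealD_apply (a : C(EReal, ℂ)) : erealD a = opD fun x => a x := rfl

theorem continuous_erealM : Continuous erealM :=
  AddMonoidHomClass.continuous_of_bound erealM 1 fun a => by
    rw [one_mul]; exact opM_ereal_norm_le a

theorem continuous_erealD : Continuous erealD :=
  AddMonoidHomClass.continuous_of_bound erealD 1 fun a => by
    rw [one_mul]; exact opD_ereal_norm_le a

/-- The elements whose image under `ψ` commutes with `T` and `T⋆` modulo compact operators. -/
noncomputable def essCommutant (ψ : C(EReal, ℂ) →⋆ₐ[ℂ] (L2R →L[ℂ] L2R)) (T : L2R →L[ℂ] L2R)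
    (hT : star T = T) : StarSubalgebra ℂ C(EReal, ℂ) where
  carrier := {b | IsCompactOperator (T * ψ b - ψ b * T : L2R →L[ℂ] L2R)}
  mul_mem' {a b} ha hb := by
    have e : T * ψ (a * b) - ψ (a * b) * T = (T * ψ a - ψ a * T) * ψ b + ψ a * (T * ψ b - ψ b * T) := by
      rw [map_mul]; noncomm_ring
    change IsCompactOperator _
    rw [e]
    exact (IsCompactOperator.comp_clm ha (ψ b)).add (IsCompactOperator.clm_comp hb (ψ a))
  add_mem' {a b} ha hb := by
    have e : T * ψ (a + b) - ψ (a + b) * T = (T * ψ a - ψ a * T) + (T * ψ b - ψ b * T) := by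
      rw [map_add]; noncomm_ring
    change IsCompactOperator _
    rw [e]
    exact IsCompactOperator.add ha hb
  algebraMap_mem' c := by
    change IsCompactOperator _
    have e : T * ψ (algebraMap ℂ _ c) - ψ (algebraMap ℂ _ c) * T = 0 := by
      rw [AlgHomClass.commutes, Algebra.commutes, sub_self]
    rw [e]
    exact isCompactOperator_zero
  star_mem' {a} ha := by
    have e : T * ψ (star a) - ψ (star a) * T = - star (T * ψ a - ψ a * T) := by
      rw [map_star, star_sub, star_mul, star_mul, hT]; abel
    change IsCompactOperator _
    rw [e]
    exact (isCompactOperator_star ha).neg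

theorem mem_essCommutant {ψ : C(EReal, ℂ) →⋆ₐ[ℂ] (L2R →L[ℂ] L2R)} {T : L2R →L[ℂ] L2R}
    {hT : star T = T} {b : C(EReal, ℂ)} : b ∈ essCommutant ψ T hT ↔
      IsCompactOperator (T * ψ b - ψ b * T : L2R →L[ℂ] L2R) := Iff.rfl

theorem isClosed_essCommutant {ψ : C(EReal, ℂ) →⋆ₐ[ℂ] (L2R →L[ℂ] L2R)} (hψ : Continuous ψ)
    {T : L2R →L[ℂ] L2R} (hT : star T = T) : IsClosed (essCommutant ψ T hT : Set C(EReal, ℂ)) := by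
  have hc : Continuous fun b => T * ψ b - ψ b * T := by fun_prop
  exact isClosed_setOfPred_isCompactOperator.preimage hc

theorem exists_pfLim_ext : ∃ F : C(EReal, ℂ), (∀ x : ℝ, F x = pfLim x) ∧
    F ⊥ = ((-(Real.pi / 2) : ℝ) : ℂ) ∧ F ⊤ = ((Real.pi / 2 : ℝ) : ℂ) := by
  have l1 : Tendsto (fun x => (pfLim x : ℂ)) atBot (𝓝 ((-(Real.pi / 2) : ℝ) : ℂ)) :=
    (Complex.continuous_ofReal.tendsto (-(Real.pi / 2))).comp tendsto_pfLim_atBot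
  have l2 : Tendsto (fun x => (pfLim x : ℂ)) atTop (𝓝 ((Real.pi / 2 : ℝ) : ℂ)) :=
    (Complex.continuous_ofReal.tendsto (Real.pi / 2)).comp tendsto_pfLim_atTop
  exact exists_ereal_extension (fun x => (pfLim x : ℂ))
    (Complex.continuous_ofReal.comp continuous_pfLim) l1 l2

theorem isCompactOperator_comm_erealD (b : C(EReal, ℂ)) : IsCompactOperator (comm (erealD b)) := by
  rw [comm, ← mem_essCommutant (hT := opM_bend_star)]
  refine EReal_starSubalgebra_eq_top _ (isClosed_essCommutant continuous_erealD _)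
    (fun x y hxy => ?_) b
  obtain ⟨G, hG, hG0⟩ := exists_res_ext one_pos
  obtain ⟨F, hF, hF1, hF2⟩ := exists_pfLim_ext
  have mG : G ∈ essCommutant erealD _ opM_bend_star := by
    have := isCompactOperator_comm_res one_pos
    have e : erealD G = opD (res 1) := by
      rw [erealD_apply]; simp only [hG]
    rw [mem_essCommutant, e]
    exact this
  have mF : F ∈ essCommutant erealD _ opM_bend_star := by
    have := isCompactOperator_comm_pfLim
    have e : erealD F = opD (fun ξ => (pfLim ξ : ℂ)) := by
      rw [erealD_apply]; simp only [hF]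
    rw [mem_essCommutant, e]
    exact this
  have key : ∀ x : ℝ, G x ≠ 0 := fun x => by
    rw [hG]; exact inv_ne_zero (res_ne one_pos x)
  have hpi : ((Real.pi / 2 : ℝ) : ℂ) ≠ ((-(Real.pi / 2) : ℝ) : ℂ) := by
    rw [Ne, Complex.ofReal_inj]
    intro h
    linarith [Real.pi_pos]
  induction x using EReal.rec with
  | bot =>
    induction y using EReal.rec with
    | bot => exact absurd rfl hxy
    | coe y => exact ⟨G, mG, by rw [hG0.1]; exact (key y).symm⟩
    | top => exact ⟨F, mF, by rw [hF1, hF2]; exact hpi.symm⟩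
  | coe x =>
    induction y using EReal.rec with
    | bot => exact ⟨G, mG, by rw [hG0.1]; exact key x⟩
    | coe y =>
      refine ⟨G, mG, fun h => hxy ?_⟩
      rw [hG, hG, res, res, inv_inj, add_left_inj, Complex.ofReal_inj] at h
      rw [h]
    | top => exact ⟨G, mG, by rw [hG0.2]; exact key x⟩
  | top =>
    induction y using EReal.rec with
    | bot => exact ⟨F, mF, by rw [hF1, hF2]; exact hpi⟩
    | coe y => exact ⟨G, mG, by rw [hG0.2]; exact (key y).symm⟩
    | top => exact absurd rfl hxy

/-- The commutators `[b(D), a(M)]` with `a, b ∈ C[-∞,+∞]` are compact. -/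
theorem isCompactOperator_commutator (a b : C(EReal, ℂ)) :
    IsCompactOperator (erealD b * erealM a - erealM a * erealD b : L2R →L[ℂ] L2R) := by
  have hstar : ∀ b : C(EReal, ℂ), star b = b → ∀ a, IsCompactOperator
      (erealD b * erealM a - erealM a * erealD b : L2R →L[ℂ] L2R) := by
    intro b hb a
    have hb' : star (erealD b) = erealD b := by rw [← map_star, hb]
    rw [← mem_essCommutant (hT := hb')]
    refine EReal_starSubalgebra_eq_top _ (isClosed_essCommutant continuous_erealM _)
      (fun x y hxy => ?_) a
    obtain ⟨F, hF, hF1, hF2⟩ := exists_bend_ext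
    refine ⟨F, ?_, fun h => hxy ?_⟩
    · have e : erealM F = opM (fun x => bend x) := by
        rw [erealM_apply]; simp only [hF]
      have h := (isCompactOperator_comm_erealD b).neg
      rw [mem_essCommutant, e, ← neg_sub]
      exact h
    · have hre : ∀ x : ℝ, F x ≠ 1 ∧ F x ≠ -1 := fun x => by
        have h := abs_lt.1 (abs_bend_lt x)
        rw [hF]
        refine ⟨fun h' => ?_, fun h' => ?_⟩
        · have := Complex.ofReal_injective (h'.trans Complex.ofReal_one.symm); linarith [h.2]
        · have : ((bend x : ℝ) : ℂ) = ((-1 : ℝ) : ℂ) := by rw [h']; simp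
          have := Complex.ofReal_injective this; linarith [h.1]
      have h11 : (1 : ℂ) ≠ -1 := by norm_num
      induction x using EReal.rec with
      | bot =>
        induction y using EReal.rec with
        | bot => rfl
        | coe y => exact absurd (h.symm.trans hF1) (hre y).2
        | top => rw [hF1, hF2] at h; exact absurd h.symm h11
      | coe x =>
        induction y using EReal.rec with
        | bot => exact absurd (h.trans hF1) (hre x).2
        | coe y =>
          rw [hF, hF, Complex.ofReal_inj] at h
          rw [strictMono_bend.injective h]
        | top => exact absurd (h.trans hF2) (hre x).1
      | top =>
        induction y using EReal.rec with
        | bot => rw [hF1, hF2] at h; exact absurd h h11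
        | coe y => exact absurd (h.symm.trans hF2) (hre y).1
        | top => rfl
  have h1 := hstar (b + star b) (by rw [star_add, star_star, add_comm]) a
  have h2 := hstar (Complex.I • (b - star b)) (by
    rw [star_smul, star_sub, star_star, Complex.star_def, Complex.conj_I]; module) a
  have e : erealD b * erealM a - erealM a * erealD b = (2⁻¹ : ℂ) •
      ((erealD (b + star b) * erealM a - erealM a * erealD (b + star b)) - Complex.I •
        (erealD (Complex.I • (b - star b)) * erealM a -
          erealM a * erealD (Complex.I • (b - star b)))) := by
    simp only [map_smul, map_add, map_sub, smul_mul_assoc, mul_smul_comm, ← smul_sub, smul_smul,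
      Complex.I_mul_I, add_mul, mul_add, sub_mul, mul_sub]
    module
  rw [e]
  exact IsCompactOperator.smul (S := ℂ) (h1.sub (IsCompactOperator.smul (S := ℂ) h2 _)) _

end Commutator

end SemiPeriodic

namespace SemiPeriodic

/-! ## Asymptotic intertwining -/

section Asymptotic

open Filter Topology InnerProductSpace

variable {H : Type*} [NormedAddCommGroup H] [InnerProductSpace ℂ H] [CompleteSpace H]

/-- The isometries `V n` intertwine `A` and `S` asymptotically. -/
def Intertwines (V : ℕ → H →ₗᵢ[ℂ] L2R) (A : L2R →L[ℂ] L2R) (S : H →L[ℂ] H) : Prop :=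
  ∀ u, Tendsto (fun n => ‖A (V n u) - V n (S u)‖) atTop (𝓝 0)

namespace Intertwines

variable {V : ℕ → H →ₗᵢ[ℂ] L2R} {A B : L2R →L[ℂ] L2R} {S T : H →L[ℂ] H}

theorem add (h : Intertwines V A S) (h' : Intertwines V B T) :
    Intertwines V (A + B) (S + T) := fun u => by
  refine squeeze_zero (fun n => norm_nonneg _) (fun n => ?_) (by simpa using (h u).add (h' u))
  refine le_trans (le_of_eq ?_) (norm_add_le _ _)
  simp only [add_apply, map_add]
  congr 1
  abel

theorem mul (h : Intertwines V A S) (h' : Intertwines V B T) :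
    Intertwines V (A * B) (S * T) := fun u => by
  refine squeeze_zero (fun n => norm_nonneg _) (fun n => ?_)
    (by simpa using ((h' u).const_mul ‖A‖).add (h (T u)))
  calc ‖(A * B) (V n u) - V n ((S * T) u)‖
      = ‖A (B (V n u) - V n (T u)) + (A (V n (T u)) - V n (S (T u)))‖ := by
        simp only [mul_apply_eq_comp, map_sub]; congr 1; abel
    _ ≤ _ := (norm_add_le _ _).trans (by gcongr; exact A.le_opNorm _)

theorem smul_one (c : ℂ) : Intertwines V (c • 1) (c • 1) := fun u => by simp

theorem norm_le (h : Intertwines V A S) : ‖S‖ ≤ ‖A‖ := by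
  refine S.opNorm_le_bound (norm_nonneg _) fun u => ?_
  have h1 := (h u).add_const (‖A‖ * ‖u‖)
  rw [zero_add] at h1
  refine ge_of_tendsto' h1 fun n => ?_
  calc ‖S u‖ = ‖V n (S u)‖ := ((V n).norm_map _).symm
    _ = ‖A (V n u) - (A (V n u) - V n (S u))‖ := by congr 1; abel
    _ ≤ ‖A (V n u)‖ + ‖A (V n u) - V n (S u)‖ := norm_sub_le _ _
    _ ≤ ‖A (V n u) - V n (S u)‖ + ‖A‖ * ‖u‖ := by
      have := A.le_opNorm (V n u)
      rw [(V n).norm_map] at this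
      linarith

theorem of_approx (h : ∀ ε > 0, ∃ A' S', Intertwines V A' S' ∧ ‖A - A'‖ ≤ ε ∧ ‖S - S'‖ ≤ ε) :
    Intertwines V A S := fun u => by
  rw [Metric.tendsto_atTop]
  intro ε hε
  obtain ⟨A', S', h', hA, hS⟩ := h (ε / (4 * (‖u‖ + 1))) (by positivity)
  obtain ⟨N, hN⟩ := Metric.tendsto_atTop.1 (h' u) (ε / 2) (by positivity)
  refine ⟨N, fun n hn => ?_⟩
  have h1 := hN n hn
  rw [Real.dist_eq, sub_zero, abs_of_nonneg (norm_nonneg _)] at h1 ⊢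
  have e : A (V n u) - V n (S u) = (A - A') (V n u) + (A' (V n u) - V n (S' u)) -
      V n ((S - S') u) := by
    simp only [sub_apply, map_sub]; abel
  have h2 : ‖(A - A') (V n u)‖ ≤ ε / (4 * (‖u‖ + 1)) * ‖u‖ := by
    refine ((A - A').le_opNorm _).trans ?_
    rw [(V n).norm_map]
    gcongr
  have h3 : ‖V n ((S - S') u)‖ ≤ ε / (4 * (‖u‖ + 1)) * ‖u‖ := by
    rw [(V n).norm_map]
    refine ((S - S').le_opNorm _).trans ?_
    gcongr
  have h4 : ε / (4 * (‖u‖ + 1)) * ‖u‖ ≤ ε / 4 := by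
    rw [div_mul_eq_mul_div, div_le_div_iff₀ (by positivity) (by positivity)]
    nlinarith [norm_nonneg u]
  rw [e]
  have h5 := norm_sub_le ((A - A') (V n u) + (A' (V n u) - V n (S' u))) (V n ((S - S') u))
  have h6 := norm_add_le ((A - A') (V n u)) (A' (V n u) - V n (S' u))
  linarith

theorem conj {H' : Type*} [NormedAddCommGroup H'] [InnerProductSpace ℂ H'] {S' : H' →L[ℂ] H'}
    (h : Intertwines V A S) (U : H' →ₗᵢ[ℂ] H) (hU : ∀ u, U (S' u) = S (U u)) :
    Intertwines (fun n => (V n).comp U) A S' := fun u => by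
  refine (h (U u)).congr fun n => ?_
  simp [hU]

theorem of_dense {s : Set H} (hcl : (Submodule.span ℂ s).topologicalClosure = ⊤)
    (h : ∀ u ∈ s, Tendsto (fun n => ‖A (V n u) - V n (S u)‖) atTop (𝓝 0)) : Intertwines V A S := by
  have h1 : ∀ u ∈ Submodule.span ℂ s, Tendsto (fun n => ‖A (V n u) - V n (S u)‖) atTop (𝓝 0) := by
    intro u hu
    induction hu using Submodule.span_induction with
    | mem u hu => exact h u hu
    | zero => simp
    | add u v _ _ hu hv =>
      refine squeeze_zero (fun n => norm_nonneg _) (fun n => ?_) (by simpa using hu.add hv)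
      refine le_trans (le_of_eq ?_) (norm_add_le _ _)
      simp only [map_add]
      congr 1
      abel
    | smul c u _ hu =>
      refine squeeze_zero (fun n => norm_nonneg _) (fun n => ?_) (by simpa using hu.const_mul ‖c‖)
      rw [← norm_smul, smul_sub]
      simp only [map_smul]
      exact le_rfl
  intro u
  have hu : u ∈ closure ((Submodule.span ℂ s : Submodule ℂ H) : Set H) := by
    rw [← Submodule.topologicalClosure_coe, hcl]; trivial
  rw [Metric.tendsto_atTop]
  intro ε hε
  obtain ⟨v, hv, hd⟩ := Metric.mem_closure_iff.1 hu (ε / (2 * (‖A‖ + ‖S‖ + 1))) (by positivity)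
  obtain ⟨N, hN⟩ := Metric.tendsto_atTop.1 (h1 v hv) (ε / 2) (by positivity)
  refine ⟨N, fun n hn => ?_⟩
  have h2 := hN n hn
  rw [Real.dist_eq, sub_zero, abs_of_nonneg (norm_nonneg _)] at h2 ⊢
  have e : A (V n u) - V n (S u) = A (V n (u - v)) + (A (V n v) - V n (S v)) - V n (S (u - v)) := by
    simp only [map_sub]; abel
  rw [dist_eq_norm] at hd
  have h3 : ‖A (V n (u - v))‖ ≤ ‖A‖ * ‖u - v‖ := by
    have := A.le_opNorm (V n (u - v)); rwa [(V n).norm_map] at this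
  have h4 : ‖V n (S (u - v))‖ ≤ ‖S‖ * ‖u - v‖ := by
    rw [(V n).norm_map]; exact S.le_opNorm _
  rw [e]
  have h5 := norm_sub_le (A (V n (u - v)) + (A (V n v) - V n (S v))) (V n (S (u - v)))
  have h6 := norm_add_le (A (V n (u - v))) (A (V n v) - V n (S v))
  have h7 : (‖A‖ + ‖S‖) * ‖u - v‖ ≤ ε / 2 := by
    have h8 : (‖A‖ + ‖S‖ + 1) * ‖u - v‖ ≤ ε / 2 := by
      have := mul_le_mul_of_nonneg_left hd.le (by positivity : 0 ≤ ‖A‖ + ‖S‖ + 1)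
      refine this.trans (le_of_eq ?_)
      field_simp
    nlinarith [norm_nonneg (u - v)]
  linarith

theorem tendsto_zero_of_compact {K : L2R →L[ℂ] L2R} (hK : IsCompactOperator K) {w : ℕ → L2R} {C : ℝ}
    (hw : ∀ n, ‖w n‖ ≤ C) {s : ℕ → Set ℝ} (hs : ∀ n, MeasurableSet (s n))
    (hsw : ∀ n, opM ((s n).indicator 1) (w n) = w n) (hlim : ∀ x, ∀ᶠ n in atTop, x ∉ s n) :
    Tendsto (fun n => K (w n)) atTop (𝓝 0) := by
  have hweak : ∀ z : L2R, Tendsto (fun n => ⟪z, w n⟫_ℂ) atTop (𝓝 0) := by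
    intro z
    have hz : Tendsto (fun n => opM ((s n).indicator 1) z) atTop (𝓝 0) := by
      have h := tendsto_opM_apply (F := fun n => (s n).indicator 1) (G := fun _ => 0) (C := 1)
        (fun n => BddMeas.indicator (hs n)) (BddMeas.const 0)
        (fun n x => by
          by_cases hx : x ∈ s n <;> simp [hx])
        (fun x => tendsto_const_nhds.congr' (by
          filter_upwards [hlim x] with n hn
          simp [hn])) z
      rw [opM_const] at h
      simpa using h
    have h2 := hz.norm.mul_const C
    rw [norm_zero, zero_mul] at h2
    refine squeeze_zero_norm (fun n => ?_) h2
    have e : star (opM ((s n).indicator 1)) = opM ((s n).indicator 1) := by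
      rw [← opM_star (BddMeas.indicator (hs n))]
      congr 1
      ext x
      by_cases hx : x ∈ s n <;> simp [hx]
    rw [← hsw n, ← ContinuousLinearMap.adjoint_inner_left, ← ContinuousLinearMap.star_eq_adjoint, e]
    refine (norm_inner_le_norm _ _).trans ?_
    gcongr
    exact hw n
  obtain ⟨D, hD, hsub⟩ := IsCompactOperator.image_closedBall_subset_compact
    (f := (K : L2R →ₗ[ℂ] L2R)) hK C
  refine tendsto_of_subseq_tendsto fun ns hns => ?_
  have hmem : ∀ k, K (w (ns k)) ∈ D := fun k => hsub ⟨w (ns k), by simpa using hw _, rfl⟩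
  obtain ⟨y, -, φ, hφ, hy⟩ := hD.tendsto_subseq hmem
  refine ⟨φ, ?_⟩
  have hy0 : y = 0 := by
    refine ext_inner_left ℂ fun z => ?_
    rw [inner_zero_right]
    have h1 : Tendsto (fun k => ⟪z, K (w (ns (φ k)))⟫_ℂ) atTop (𝓝 ⟪z, y⟫_ℂ) :=
      (tendsto_const_nhds.inner hy)
    have h2 : Tendsto (fun k => ⟪z, K (w (ns (φ k)))⟫_ℂ) atTop (𝓝 0) := by
      simp only [← ContinuousLinearMap.adjoint_inner_left K]
      exact (hweak _).comp (hns.comp hφ.tendsto_atTop)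
    exact tendsto_nhds_unique h1 h2
  rw [← hy0]
  exact hy

end Intertwines

/-- Pairs of operators intertwined, together with their adjoints, by `V`. -/
noncomputable def intertwined (V : ℕ → H →ₗᵢ[ℂ] L2R) :
    StarSubalgebra ℂ ((L2R →L[ℂ] L2R) × (H →L[ℂ] H)) where
  carrier := {p | Intertwines V p.1 p.2 ∧ Intertwines V (star p.1) (star p.2)}
  mul_mem' {p q} hp hq := ⟨hp.1.mul hq.1, by
    rw [Prod.fst_mul, Prod.snd_mul, star_mul, star_mul]; exact hq.2.mul hp.2⟩
  add_mem' {p q} hp hq := ⟨hp.1.add hq.1, by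
    rw [Prod.fst_add, Prod.snd_add, star_add, star_add]; exact hp.2.add hq.2⟩
  algebraMap_mem' c := by
    simp only [Algebra.algebraMap_eq_smul_one, Set.mem_ofPred_eq, Prod.smul_fst, Prod.smul_snd,
      Prod.fst_one, Prod.snd_one, star_smul, star_one]
    exact ⟨.smul_one c, .smul_one _⟩
  star_mem' {p} hp := ⟨hp.2, by rw [Prod.fst_star, Prod.snd_star, star_star, star_star]; exact hp.1⟩

theorem mem_intertwined {V : ℕ → H →ₗᵢ[ℂ] L2R} {p : (L2R →L[ℂ] L2R) × (H →L[ℂ] H)} :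
    p ∈ intertwined V ↔ Intertwines V p.1 p.2 ∧ Intertwines V (star p.1) (star p.2) := Iff.rfl

theorem isClosed_intertwined (V : ℕ → H →ₗᵢ[ℂ] L2R) :
    IsClosed (intertwined V : Set ((L2R →L[ℂ] L2R) × (H →L[ℂ] H))) := by
  refine isClosed_of_closure_subset fun p hp => ?_
  rw [SetLike.mem_coe, mem_intertwined]
  have hstar : ∀ A B : L2R →L[ℂ] L2R, ‖star A - star B‖ = ‖A - B‖ := fun A B => by
    rw [← star_sub]; exact LinearIsometryEquiv.norm_map ContinuousLinearMap.adjoint _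
  have hstar' : ∀ A B : H →L[ℂ] H, ‖star A - star B‖ = ‖A - B‖ := fun A B => by
    rw [← star_sub]; exact LinearIsometryEquiv.norm_map ContinuousLinearMap.adjoint _
  constructor
  · refine .of_approx fun ε hε => ?_
    obtain ⟨q, hq, hd⟩ := Metric.mem_closure_iff.1 hp ε hε
    rw [Prod.dist_eq, dist_eq_norm, dist_eq_norm, max_lt_iff] at hd
    exact ⟨q.1, q.2, hq.1, hd.1.le, hd.2.le⟩
  · refine .of_approx fun ε hε => ?_
    obtain ⟨q, hq, hd⟩ := Metric.mem_closure_iff.1 hp ε hε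
    rw [Prod.dist_eq, dist_eq_norm, dist_eq_norm, max_lt_iff] at hd
    exact ⟨star q.1, star q.2, hq.2, by rw [hstar]; exact hd.1.le, by rw [hstar']; exact hd.2.le⟩

/-- A closed star subalgebra containing the basic generators contains `𝔄`. -/
theorem fst_isClosed {C : Type*} [NormedRing C] [StarRing C] [NormedAlgebra ℂ C] [StarModule ℂ C]
    [CompleteSpace C] (R : StarSubalgebra ℂ ((L2R →L[ℂ] L2R) × C))
    (hR : IsClosed (R : Set ((L2R →L[ℂ] L2R) × C))) (hn : ∀ p ∈ R, ‖p.2‖ ≤ ‖p.1‖) :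
    IsClosed (R.map (StarAlgHom.fst ℂ (L2R →L[ℂ] L2R) C) : Set (L2R →L[ℂ] L2R)) := by
  have : CompleteSpace R := hR.completeSpace_coe
  have h : AntilipschitzWith 1 (fun p : R => (p : (L2R →L[ℂ] L2R) × C).1) := by
    refine AntilipschitzWith.of_le_mul_dist fun p q => ?_
    have := hn _ (p - q).2
    rw [NNReal.coe_one, one_mul, Subtype.dist_eq, Prod.dist_eq]
    refine max_le le_rfl ?_
    rw [dist_eq_norm, dist_eq_norm]
    exact this
  have h2 := h.isClosed_range (uniformContinuous_fst.comp uniformContinuous_subtype_val)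
  have e : (R.map (StarAlgHom.fst ℂ (L2R →L[ℂ] L2R) C) : Set (L2R →L[ℂ] L2R)) =
      Set.range fun p : R => (p : (L2R →L[ℂ] L2R) × C).1 := by
    refine Set.ext fun T => ⟨?_, ?_⟩
    · rintro ⟨p, hp, rfl⟩
      exact ⟨⟨p, hp⟩, rfl⟩
    · rintro ⟨⟨p, hp⟩, rfl⟩
      exact ⟨p, hp, rfl⟩
  rw [e]
  exact h2

end Asymptotic

section PeriodicFunctions

open Filter Topology

/-- Continuous `2π`-periodic functions are functions on the circle. -/
theorem exists_circle_map {E : Type*} [TopologicalSpace E] {f : ℝ → E} (hf : Continuous f)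
    (hp : Function.Periodic f (2 * Real.pi)) :
    ∃ F : C(Circle, E), ∀ θ : ℝ, F (Circle.exp θ) = f θ := by
  have hc : Continuous (hp.lift : AddCircle (2 * Real.pi) → E) := continuous_coinduced_dom.2 hf
  refine ⟨⟨fun z => hp.lift (AddCircle.homeomorphCircle'.symm z),
    hc.comp AddCircle.homeomorphCircle'.symm.continuous⟩, fun θ => ?_⟩
  have : AddCircle.homeomorphCircle'.symm (Circle.exp θ) = (θ : AddCircle (2 * Real.pi)) := by
    rw [Homeomorph.symm_apply_eq, AddCircle.homeomorphCircle'_apply_mk]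
  rw [ContinuousMap.coe_mk, this]
  rfl

theorem BddMeas.circle (F : C(Circle, ℂ)) : BddMeas fun x => F (Circle.exp x) :=
  ⟨(F.continuous.comp Circle.exp.continuous).measurable, ‖F‖, fun _ => F.norm_coe_le_norm _⟩

/-- The homomorphism `F ↦ F(e^{ix})` into multiplication operators. -/
noncomputable def circleM : C(Circle, ℂ) →⋆ₐ[ℂ] (L2R →L[ℂ] L2R) where
  toFun a := opM fun x => a (Circle.exp x)
  map_one' := opM_one
  map_mul' a b := opM_mul (.circle a) (.circle b)
  map_zero' := by simpa using opM_const 0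
  map_add' a b := opM_add (.circle a) (.circle b)
  commutes' c := by simpa [Algebra.algebraMap_eq_smul_one] using opM_const c
  map_star' a := opM_star (.circle a)

theorem circleM_apply (a : C(Circle, ℂ)) : circleM a = opM fun x => a (Circle.exp x) := rfl

theorem continuous_circleM : Continuous circleM :=
  AddMonoidHomClass.continuous_of_bound circleM 1 fun a => by
    rw [one_mul]
    exact norm_opM_le (.circle a) (norm_nonneg _) fun x => a.norm_coe_le_norm _

/-- The operator of multiplication by `e^{ikx}`. -/
noncomputable def expM (k : ℤ) : L2R →L[ℂ] L2R := opM fun x => Complex.exp (k * x * Complex.I)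

theorem periodic_exp (k : ℤ) :
    Function.Periodic (fun x : ℝ => Complex.exp (k * x * Complex.I)) (2 * Real.pi) := fun x => by
  have : (k : ℂ) * ((x + 2 * Real.pi : ℝ) : ℂ) * Complex.I =
      k * x * Complex.I + k * (2 * Real.pi * Complex.I) := by push_cast; ring
  simp only [this, Complex.exp_add, Complex.exp_int_mul_two_pi_mul_I, mul_one]

theorem bddMeas_expM (k : ℤ) : BddMeas fun x => Complex.exp (k * x * Complex.I) := by
  simpa using BddMeas.exp (k : ℝ)

theorem expM_add (k m : ℤ) : expM (k + m) = expM k * expM m := by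
  rw [expM, expM, expM, ← opM_mul (bddMeas_expM k) (bddMeas_expM m)]
  congr 1
  ext x
  rw [← Complex.exp_add]
  push_cast
  ring_nf

theorem expM_zero : expM 0 = 1 := by
  rw [expM, ← opM_one]; simp

theorem star_expM (k : ℤ) : star (expM k) = expM (-k) := by
  rw [expM, expM, ← opM_star (bddMeas_expM k)]
  congr 1
  ext x
  rw [Complex.star_def, ← Complex.exp_conj]
  simp

/-- A closed set of operators that is a subspace and contains the `e^{ikM}` contains all
multiplications by continuous periodic functions. -/
theorem circleM_mem (S : Submodule ℂ (L2R →L[ℂ] L2R)) (hS : IsClosed (S : Set (L2R →L[ℂ] L2R)))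
    (h : ∀ k, expM k ∈ S) (F : C(Circle, ℂ)) : circleM F ∈ S := by
  have hpi : Fact (0 < 2 * Real.pi) := ⟨Real.two_pi_pos⟩
  let e : C(AddCircle (2 * Real.pi), Circle) := ⟨_, AddCircle.homeomorphCircle'.continuous⟩
  let e' : C(Circle, AddCircle (2 * Real.pi)) := ⟨_, AddCircle.homeomorphCircle'.symm.continuous⟩
  let L : C(AddCircle (2 * Real.pi), ℂ) →ₐ[ℂ] (L2R →L[ℂ] L2R) :=
    (circleM : C(Circle, ℂ) →ₐ[ℂ] (L2R →L[ℂ] L2R)).comp (ContinuousMap.compRightAlgHom ℂ ℂ e')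
  have hL : Continuous L :=
    continuous_circleM.comp (ContinuousMap.compRightAlgHom_continuous ℂ ℂ e')
  have hF : L (F.comp e) = circleM F := by
    change circleM ((F.comp e).comp e') = circleM F
    congr 1
    ext z
    exact congrArg F (AddCircle.homeomorphCircle'.apply_symm_apply z)
  have key : (⊤ : Submodule ℂ C(AddCircle (2 * Real.pi), ℂ)) ≤ S.comap L.toLinearMap := by
    rw [← span_fourier_closure_eq_top]
    refine Submodule.topologicalClosure_minimal _ (Submodule.span_le.2 ?_) (hS.preimage hL)
    rintro _ ⟨k, rfl⟩
    have : L (fourier k) = expM k := by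
      change circleM ((fourier k).comp e') = expM k
      rw [circleM_apply, expM]
      congr 1
      ext x
      have h1 : e' (Circle.exp x) = (x : AddCircle (2 * Real.pi)) := by
        change AddCircle.homeomorphCircle'.symm _ = _
        rw [Homeomorph.symm_apply_eq, AddCircle.homeomorphCircle'_apply_mk]
      rw [ContinuousMap.comp_apply, h1, fourier_coe_apply]
      congr 1
      have := Real.pi_ne_zero
      push_cast
      field_simp
    change L (fourier k) ∈ S
    rw [this]
    exact h k
  rw [← hF]
  exact key (x := F.comp e) trivial

theorem exists_circleM {a : ℝ → ℂ} (ha : Continuous a) (hp : Function.Periodic a (2 * Real.pi)) :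
    ∃ F : C(Circle, ℂ), (∀ θ : ℝ, F (Circle.exp θ) = a θ) ∧ circleM F = opM a := by
  obtain ⟨F, hF⟩ := exists_circle_map ha hp
  exact ⟨F, hF, by rw [circleM_apply]; simp only [hF]⟩

/-- A closed star subalgebra containing all `a(M)`, `e^{ikM}` and `b(D)` contains `𝔄`. -/
theorem 𝔄_le {S : StarSubalgebra ℂ (L2R →L[ℂ] L2R)} (hS : IsClosed (S : Set (L2R →L[ℂ] L2R)))
    (h1 : ∀ a, erealM a ∈ S) (h2 : ∀ k, expM k ∈ S) (h3 : ∀ b, erealD b ∈ S) : 𝔄 ≤ S := by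
  refine StarSubalgebra.topologicalClosure_minimal (StarAlgebra.adjoin_le_iff.2 ?_) hS
  rintro _ ((⟨a, rfl⟩ | ⟨a, ha, hp, rfl⟩) | ⟨b, rfl⟩)
  · exact h1 a
  · obtain ⟨F, -, hF⟩ := exists_circleM ha hp
    rw [← hF]
    exact circleM_mem (Subalgebra.toSubmodule S.toSubalgebra) hS h2 F
  · exact h3 b

theorem mem_map_fst {C : Type*} [NormedRing C] [StarRing C] [NormedAlgebra ℂ C] [StarModule ℂ C]
    {R : StarSubalgebra ℂ ((L2R →L[ℂ] L2R) × C)} {T : L2R →L[ℂ] L2R} :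
    T ∈ R.map (StarAlgHom.fst ℂ (L2R →L[ℂ] L2R) C) ↔ ∃ c, (T, c) ∈ R := by
  rw [StarSubalgebra.mem_map]
  constructor
  · rintro ⟨⟨T', c⟩, hp, rfl⟩
    exact ⟨c, hp⟩
  · rintro ⟨c, hc⟩
    exact ⟨_, hc, rfl⟩

/-- A closed star subalgebra of pairs `(A, f)` with `‖f‖ ≤ ‖A‖` whose first components contain `S`
is the graph of a homomorphism on `S`. -/
theorem exists_hom_of_graph {B C : Type*} [NormedRing B] [StarRing B] [NormedAlgebra ℂ B]
    [StarModule ℂ B] [NormedRing C] [StarRing C] [NormedAlgebra ℂ C]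
    [StarModule ℂ C] (S : StarSubalgebra ℂ B)
    (R : StarSubalgebra ℂ (B × C))
    (hn : ∀ p ∈ R, ‖p.2‖ ≤ ‖p.1‖) (hex : ∀ A : S, ∃ c, ((A : B), c) ∈ R) :
    ∃ ψ : S →⋆ₐ[ℂ] C, (∀ A : S, ((A : B), ψ A) ∈ R) ∧
      ∀ (A : S) (c : C), ((A : B), c) ∈ R → ψ A = c := by
  choose ψ hψ using hex
  have huniq : ∀ (A : S) (c : C), ((A : B), c) ∈ R → ψ A = c := by
    intro A c hc
    have h1 : ((A : B), ψ A) - ((A : B), c) ∈ R := sub_mem (hψ A) hc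
    have h2 : ‖ψ A - c‖ ≤ ‖(A : B) - A‖ := hn _ h1
    rw [sub_self, norm_zero] at h2
    exact sub_eq_zero.1 (norm_le_zero_iff.1 h2)
  have m1 : ((1 : B), (1 : C)) ∈ R := one_mem R
  have m0 : ((0 : B), (0 : C)) ∈ R := zero_mem R
  have mm : ∀ A A' : S, ((A : B) * A', ψ A * ψ A') ∈ R := fun A A' =>
    mul_mem (hψ A) (hψ A')
  have ma : ∀ A A' : S, ((A : B) + A', ψ A + ψ A') ∈ R := fun A A' =>
    add_mem (hψ A) (hψ A')
  have ms : ∀ A : S, (star (A : B), star (ψ A)) ∈ R := fun A => star_mem (hψ A)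
  have mc : ∀ c : ℂ, (algebraMap ℂ B c, algebraMap ℂ C c) ∈ R := fun c =>
    algebraMap_mem R c
  exact ⟨{ toFun := ψ
           map_one' := huniq 1 1 m1
           map_mul' := fun A A' => huniq (A * A') _ (mm A A')
           map_zero' := huniq 0 0 m0
           map_add' := fun A A' => huniq (A + A') _ (ma A A')
           commutes' := fun c => huniq (algebraMap ℂ S c) _ (mc c)
           map_star' := fun A => huniq (star A) _ (ms A) }, hψ, huniq⟩

theorem exists_hom {C : Type*} [NormedRing C] [StarRing C] [NormedAlgebra ℂ C]
    [StarModule ℂ C] [CompleteSpace C] (R : StarSubalgebra ℂ ((L2R →L[ℂ] L2R) × C))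
    (hR : IsClosed (R : Set ((L2R →L[ℂ] L2R) × C))) (hn : ∀ p ∈ R, ‖p.2‖ ≤ ‖p.1‖)
    (h1 : ∀ a, ∃ c, (erealM a, c) ∈ R) (h2 : ∀ k, ∃ c, (expM k, c) ∈ R)
    (h3 : ∀ b, ∃ c, (erealD b, c) ∈ R) :
    ∃ ψ : 𝔄 →⋆ₐ[ℂ] C, (∀ A : 𝔄, ((A : L2R →L[ℂ] L2R), ψ A) ∈ R) ∧
      ∀ (A : 𝔄) (c : C), ((A : L2R →L[ℂ] L2R), c) ∈ R → ψ A = c :=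
  exists_hom_of_graph 𝔄 R hn fun A => mem_map_fst.1 (𝔄_le (fst_isClosed R hR hn)
    (fun a => mem_map_fst.2 (h1 a)) (fun a => mem_map_fst.2 (h2 a))
    (fun a => mem_map_fst.2 (h3 a)) A.2)

theorem generators_le : generators ⊆ (𝔄 : Set (L2R →L[ℂ] L2R)) :=
  (StarAlgebra.subset_adjoin ℂ generators).trans (StarSubalgebra.le_topologicalClosure _)

theorem erealM_mem (a : C(EReal, ℂ)) : erealM a ∈ 𝔄 := generators_le (.inl (.inl ⟨a, rfl⟩))

theorem erealD_mem (a : C(EReal, ℂ)) : erealD a ∈ 𝔄 := generators_le (.inr ⟨a, rfl⟩)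

theorem expM_mem (k : ℤ) : expM k ∈ 𝔄 :=
  generators_le (.inl (.inr ⟨_, by fun_prop, periodic_exp k, rfl⟩))

theorem isClosed_𝔄 : IsClosed (𝔄 : Set (L2R →L[ℂ] L2R)) :=
  StarSubalgebra.isClosed_topologicalClosure _

theorem circleM_mem_𝔄 (F : C(Circle, ℂ)) : circleM F ∈ 𝔄 :=
  circleM_mem (Subalgebra.toSubmodule 𝔄.toSubalgebra) isClosed_𝔄 expM_mem F

end PeriodicFunctions

end SemiPeriodic

namespace SemiPeriodic

/-! ## The principal symbol -/

section PrincipalSymbol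

open Filter Topology

theorem isClosed_X : IsClosed X := by
  rw [← isOpen_compl_iff, isOpen_iff_mem_nhds]
  rintro ⟨x, z⟩ hp
  simp only [X, Set.mem_compl_iff, Set.mem_ofPred_eq, not_or, not_exists, not_and] at hp
  obtain ⟨h1, h2, h3⟩ := hp
  lift x to ℝ using ⟨h2, h1⟩
  have hz : z ≠ Circle.exp x := h3 x rfl
  have c1 : ContinuousAt (fun p : EReal × Circle => Circle.exp p.1.toReal) ((x : EReal), z) :=
    Circle.exp.continuous.continuousAt.comp
      ((EReal.tendsto_toReal (EReal.coe_ne_top x) (EReal.coe_ne_bot x)).comp continuousAt_fst)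
  have c2 : ContinuousAt (fun p : EReal × Circle => p.2) ((x : EReal), z) := continuousAt_snd
  have e1 : ∀ᶠ p : EReal × Circle in 𝓝 ((x : EReal), z), p.2 ≠ Circle.exp p.1.toReal :=
    (Filter.Tendsto.prodMk_nhds c2 c1).eventually
      ((isOpen_ne_fun continuous_fst continuous_snd).mem_nhds (by simpa using hz))
  have e2 : ∀ᶠ p : EReal × Circle in 𝓝 ((x : EReal), z), p.1 ≠ ⊥ :=
    continuousAt_fst.eventually_ne h1
  have e3 : ∀ᶠ p : EReal × Circle in 𝓝 ((x : EReal), z), p.1 ≠ ⊤ :=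
    continuousAt_fst.eventually_ne h2
  filter_upwards [e1, e2, e3] with p p1 p2 p3
  simp only [X, Set.mem_compl_iff, Set.mem_ofPred_eq, not_or, not_exists, not_and]
  refine ⟨p2, p3, fun y hy hy' => p1 ?_⟩
  rw [hy', hy, EReal.toReal_coe]

instance : CompactSpace X := isCompact_iff_compactSpace.1 isClosed_X.isCompact

/-- The indicator function of `(0, 1]`. -/
noncomputable def bump : ℝ → ℂ := (Set.Ioc (0 : ℝ) 1).indicator 1

theorem memLp_bump (p : ℝ≥0∞) : MemLp bump p :=
  memLp_indicator_const p measurableSet_Ioc 1 (.inr (by simp))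

theorem integral_bump : ∫ u, ‖bump u‖ ^ 2 = 1 := by
  have : (fun u => ‖bump u‖ ^ 2) = (Set.Ioc (0 : ℝ) 1).indicator 1 := by
    ext u
    by_cases h : u ∈ Set.Ioc (0 : ℝ) 1 <;> simp [bump, h]
  rw [this, integral_indicator_one measurableSet_Ioc]
  simp

theorem natCast_succ_pos (n : ℕ) : (0 : ℝ) < (n : ℝ) + 1 := by positivity

/-- Unit vectors concentrated at `y` in position and at `η` in momentum. -/
noncomputable def packet (y η : ℕ → ℝ) (n : ℕ) : L2R :=
  waveLp (memLp_bump 2) (natCast_succ_pos n) (y n) (η n)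

theorem norm_packet (y η : ℕ → ℝ) (n : ℕ) : ‖packet y η n‖ = 1 := by
  have h := norm_waveLp (memLp_bump 2) (natCast_succ_pos n) (y n) (η n)
  rw [integral_bump] at h
  exact (pow_eq_one_iff_of_nonneg (norm_nonneg _) two_ne_zero).1 h

theorem opM_packet (y η : ℕ → ℝ) (n : ℕ) :
    opM ((Set.Ioc (y n) (y n + 1 / ((n : ℝ) + 1))).indicator 1) (packet y η n) = packet y η n := by
  refine Lp.ext ?_
  filter_upwards [opM_coeFn (BddMeas.indicator (s := Set.Ioc (y n) (y n + 1 / ((n : ℝ) + 1)))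
    measurableSet_Ioc) (packet y η n), waveLp_coeFn (memLp_bump 2) (natCast_succ_pos n) (y n) (η n)]
    with x h1 h2
  rw [h1]
  by_cases hx : x ∈ Set.Ioc (y n) (y n + 1 / ((n : ℝ) + 1))
  · rw [Set.indicator_of_mem hx, Pi.one_apply, one_mul]
  · have : bump (((n : ℝ) + 1) * (x - y n)) = 0 := by
      refine Set.indicator_of_notMem (fun h => hx ?_) _
      have hn := natCast_succ_pos n
      refine ⟨by linarith [(mul_pos_iff_of_pos_left hn).1 h.1], ?_⟩
      have : x - y n ≤ 1 / ((n : ℝ) + 1) := by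
        rw [le_div_iff₀ hn]; linarith [h.2, mul_comm (x - y n) ((n : ℝ) + 1)]
      linarith
    rw [packet, h2, wave, this]
    simp

/-- The isometries `ℂ → L²(ℝ)` determined by unit vectors. -/
noncomputable def packetV (y η : ℕ → ℝ) (n : ℕ) : ℂ →ₗᵢ[ℂ] L2R :=
  LinearIsometry.toSpanSingleton ℂ L2R (norm_packet y η n)

theorem packetV_apply (y η : ℕ → ℝ) (n : ℕ) (c : ℂ) : packetV y η n c = c • packet y η n := rfl

theorem intertwines_packetV {y η : ℕ → ℝ} {A : L2R →L[ℂ] L2R} {k : ℂ}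
    (h : Tendsto (fun n => ‖A (packet y η n) - k • packet y η n‖) atTop (𝓝 0)) :
    Intertwines (packetV y η) A (k • 1) := fun c => by
  have h1 := h.const_mul ‖c‖
  rw [mul_zero] at h1
  refine h1.congr fun n => ?_
  rw [← norm_smul, packetV_apply, packetV_apply, map_smul, smul_sub, smul_comm c k, smul_apply,
    one_apply_eq_self, smul_eq_mul, mul_smul]

theorem BddMeas.pair (H : C(EReal × Circle, ℂ)) : BddMeas fun x : ℝ => H (x, Circle.exp x) :=
  ⟨(H.continuous.comp (continuous_coe_real_ereal.prodMk Circle.exp.continuous)).measurable, ‖H‖,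
    fun _ => H.norm_coe_le_norm _⟩

/-- The homomorphism `H ↦ H(x, e^{ix})` into multiplication operators. -/
noncomputable def pairM : C(EReal × Circle, ℂ) →⋆ₐ[ℂ] (L2R →L[ℂ] L2R) where
  toFun H := opM fun x => H (x, Circle.exp x)
  map_one' := opM_one
  map_mul' a b := opM_mul (.pair a) (.pair b)
  map_zero' := by simpa using opM_const 0
  map_add' a b := opM_add (.pair a) (.pair b)
  commutes' c := by simpa [Algebra.algebraMap_eq_smul_one] using opM_const c
  map_star' a := opM_star (.pair a)

theorem continuous_pairM : Continuous pairM :=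
  AddMonoidHomClass.continuous_of_bound pairM 1 fun a => by
    rw [one_mul]
    exact norm_opM_le (.pair a) (norm_nonneg _) fun x => a.norm_coe_le_norm _

/-- A function of the first variable. -/
noncomputable def onFst (a : C(EReal, ℂ)) : C(EReal × Circle, ℂ) := ⟨fun p => a p.1, by fun_prop⟩

/-- A function of the second variable. -/
noncomputable def onSnd (a : C(Circle, ℂ)) : C(EReal × Circle, ℂ) := ⟨fun p => a p.2, by fun_prop⟩

theorem pairM_onFst (a : C(EReal, ℂ)) : pairM (onFst a) = erealM a := rfl

theorem pairM_onSnd (a : C(Circle, ℂ)) : pairM (onSnd a) = circleM a := rfl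

theorem exists_separates_ereal {x y : EReal} (h : x ≠ y) : ∃ a : C(EReal, ℂ), a x ≠ a y := by
  obtain ⟨f, hf0, hf1, -⟩ := exists_continuous_zero_one_of_isClosed (isClosed_singleton (x := x))
    (isClosed_singleton (x := y)) (Set.disjoint_singleton.2 h)
  refine ⟨⟨fun x => (f x : ℂ), by fun_prop⟩, ?_⟩
  have h0 : f x = 0 := hf0 rfl
  have h1 : f y = 1 := hf1 rfl
  simp [h0, h1]

theorem pairM_mem (H : C(EReal × Circle, ℂ)) : pairM H ∈ 𝔄 := by
  have h1 := ContinuousMap.starSubalgebra_topologicalClosure_eq_top_of_separatesPoints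
    (𝔄.comap pairM) (by
      rintro ⟨x, z⟩ ⟨y, w⟩ hne
      by_cases hxy : x = y
      · refine ⟨_, ⟨onSnd ⟨fun z => (z : ℂ), by fun_prop⟩, ?_, rfl⟩, fun h => hne ?_⟩
        · exact circleM_mem_𝔄 ⟨fun z => (z : ℂ), by fun_prop⟩
        have h' : (z : ℂ) = w := h
        rw [hxy, Circle.ext h']
      · obtain ⟨a, ha⟩ := exists_separates_ereal hxy
        refine ⟨_, ⟨onFst a, ?_, rfl⟩, ha⟩
        exact erealM_mem a)
  have h2 : H ∈ (𝔄.comap pairM).topologicalClosure := by rw [h1]; trivial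
  have h3 : IsClosed (𝔄.comap pairM : Set C(EReal × Circle, ℂ)) :=
    isClosed_𝔄.preimage continuous_pairM
  rw [← SetLike.mem_coe, StarSubalgebra.topologicalClosure_coe, h3.closure_eq] at h2
  exact h2

/-- Symbol data at a point of `X × {±∞}`. -/
def IsPointSymbol (m : EReal × Circle) (s : Bool) (V : ℕ → ℂ →ₗᵢ[ℂ] L2R) : Prop :=
  (∀ H, Intertwines V (pairM H) (H m • 1)) ∧
  (∀ b, Intertwines V (erealD b) (b (endpt s) • 1)) ∧
  ∀ K : L2R →L[ℂ] L2R, IsCompactOperator K → Intertwines V K 0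

theorem isPointSymbol_packetV {m : EReal × Circle} {s : Bool} {y : ℕ → ℝ}
    (h1 : ∀ u : ℝ, Tendsto (fun n : ℕ => ((y n + u / ((n : ℝ) + 1) : ℝ) : EReal)) atTop (𝓝 m.1))
    (h2 : ∀ u : ℝ, Tendsto (fun n : ℕ => Circle.exp (y n + u / ((n : ℝ) + 1))) atTop (𝓝 m.2))
    (h3 : ∀ x, ∀ᶠ n : ℕ in atTop, x ∉ Set.Ioc (y n) (y n + 1 / ((n : ℝ) + 1))) :
    ∃ V, IsPointSymbol m s V := by
  have hη : ∃ η : ℕ → ℝ, ∀ u : ℝ,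
      Tendsto (fun n : ℕ => ((2 * Real.pi * ((n : ℝ) + 1) * u + η n : ℝ) : EReal)) atTop
        (𝓝 (endpt s)) := by
    have hn : Tendsto (fun n : ℕ => (n : ℝ) + 1) atTop atTop :=
      tendsto_atTop_add_const_right _ _ tendsto_natCast_atTop_atTop
    cases s with
    | true =>
      refine ⟨fun n => ((n : ℝ) + 1) ^ 2, fun u => ?_⟩
      refine EReal.tendsto_coe_nhds_top_iff.2 ?_
      have := hn.atTop_mul_atTop₀ (tendsto_atTop_add_const_left _ (2 * Real.pi * u) hn)
      exact this.congr fun n => by ring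
    | false =>
      refine ⟨fun n => -((n : ℝ) + 1) ^ 2, fun u => ?_⟩
      refine EReal.tendsto_coe_nhds_bot_iff.2 ?_
      have := tendsto_neg_atTop_atBot.comp
        (hn.atTop_mul_atTop₀ (tendsto_atTop_add_const_left _ (-(2 * Real.pi * u)) hn))
      exact this.congr fun n => by simp only [Function.comp]; ring
  obtain ⟨η, hη⟩ := hη
  refine ⟨packetV y η, fun H => ?_, fun b => ?_, fun K hK => ?_⟩
  · exact intertwines_packetV (tendsto_opM_wave (.pair H) (memLp_bump 2) natCast_succ_pos
      fun u => (H.continuous.tendsto _).comp ((h1 u).prodMk_nhds (h2 u)))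
  · exact intertwines_packetV (tendsto_opD_wave (.ereal b) (memLp_one_iff_integrable.1
      (memLp_bump 1)) (memLp_bump 2) natCast_succ_pos fun u => (b.continuous.tendsto _).comp (hη u))
  · rw [← zero_smul ℂ (1 : ℂ →L[ℂ] ℂ)]
    refine intertwines_packetV ?_
    have := (Intertwines.tendsto_zero_of_compact hK (fun n => (norm_packet y η n).le)
      (fun n => measurableSet_Ioc) (opM_packet y η) h3).norm
    simpa using this

theorem exists_isPointSymbol (m : X) (s : Bool) : ∃ V, IsPointSymbol m.1 s V := by
  obtain ⟨⟨x, z⟩, hm⟩ := m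
  obtain ⟨θ, rfl⟩ : ∃ θ : ℝ, Circle.exp θ = z := ⟨Complex.arg z, Circle.exp_arg z⟩
  have hn : Tendsto (fun n : ℕ => (n : ℝ) + 1) atTop atTop :=
    tendsto_atTop_add_const_right _ _ tendsto_natCast_atTop_atTop
  have hu : ∀ u : ℝ, Tendsto (fun n : ℕ => u / ((n : ℝ) + 1)) atTop (𝓝 0) := fun u =>
    tendsto_const_nhds.div_atTop hn
  have hfin : ∀ x : ℝ, ∀ u : ℝ, Tendsto (fun n : ℕ => x + u / ((n : ℝ) + 1)) atTop (𝓝 x) :=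
    fun x u => by simpa using (hu u).const_add x
  have hexp : ∀ (k : ℕ → ℤ) (u : ℝ), Tendsto (fun n : ℕ => Circle.exp
      ((θ + k n * (2 * Real.pi)) + u / ((n : ℝ) + 1))) atTop (𝓝 (Circle.exp θ)) := by
    intro k u
    refine ((Circle.exp.continuous.tendsto _).comp (hfin θ u)).congr fun n => ?_
    have h := Circle.periodic_exp.int_mul (k n) (θ + u / ((n : ℝ) + 1))
    rw [Function.comp, ← h]
    congr 1
    ring
  have htop : Tendsto (fun n : ℕ => θ + ((n : ℤ) : ℝ) * (2 * Real.pi)) atTop atTop := by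
    refine tendsto_atTop_add_const_left _ _ ?_
    exact tendsto_natCast_atTop_atTop.atTop_mul_const Real.two_pi_pos
  have hbot : Tendsto (fun n : ℕ => θ + ((-n : ℤ) : ℝ) * (2 * Real.pi)) atTop atBot := by
    refine tendsto_atBot_add_const_left _ _ ?_
    have := tendsto_neg_atTop_atBot.comp
      ((tendsto_natCast_atTop_atTop (R := ℝ)).atTop_mul_const Real.two_pi_pos)
    refine this.congr fun n => ?_
    simp
  rcases hm with h | h | ⟨y, h, h'⟩
  · simp only at h
    subst h
    refine isPointSymbol_packetV (y := fun n => θ + ((-n : ℤ) : ℝ) * (2 * Real.pi)) (fun u => ?_)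
      (hexp fun n => -n) fun x => ?_
    · exact EReal.tendsto_coe_nhds_bot_iff.2 (hbot.atBot_add (hu u))
    · filter_upwards [(hbot.atBot_add (hu 1)).eventually (eventually_lt_atBot x)] with n hn hx
      exact absurd hx.2 (not_le.2 hn)
  · simp only at h
    subst h
    refine isPointSymbol_packetV (y := fun n => θ + ((n : ℤ) : ℝ) * (2 * Real.pi)) (fun u => ?_)
      (hexp fun n => n) fun x => ?_
    · exact EReal.tendsto_coe_nhds_top_iff.2 (htop.atTop_add (hu u))
    · filter_upwards [htop.eventually (eventually_ge_atTop x)] with n hn hx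
      exact absurd hx.1 (not_lt.2 hn)
  · simp only at h h'
    subst h
    change ∃ V, IsPointSymbol ((y : EReal), Circle.exp θ) s V
    rw [h']
    refine isPointSymbol_packetV (y := fun _ => y) (fun u => ?_) (fun u => ?_) fun x => ?_
    · exact (continuous_coe_real_ereal.tendsto y).comp (hfin y u)
    · exact (Circle.exp.continuous.tendsto y).comp (hfin y u)
    · rcases le_or_gt x y with hx | hx
      · exact .of_forall fun n h => absurd h.1 (not_lt.2 hx)
      · filter_upwards [(hfin y 1).eventually (gt_mem_nhds hx)] with n hn h
        exact absurd h.2 (not_le.2 hn)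

/-- Evaluation of the second component at a point. -/
noncomputable def evalPair (v : X × Bool) :
    (L2R →L[ℂ] L2R) × C(X × Bool, ℂ) →⋆ₐ[ℂ] (L2R →L[ℂ] L2R) × (ℂ →L[ℂ] ℂ) where
  toFun p := (p.1, p.2 v • 1)
  map_one' := Prod.ext rfl (one_smul ℂ _)
  map_mul' p q := Prod.ext rfl (by
    change (p.2 v * q.2 v) • (1 : ℂ →L[ℂ] ℂ) = p.2 v • (1 : ℂ →L[ℂ] ℂ) * q.2 v • (1 : ℂ →L[ℂ] ℂ)
    rw [smul_mul_smul_comm, one_mul])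
  map_zero' := Prod.ext rfl (by
    change (0 : ℂ) • (1 : ℂ →L[ℂ] ℂ) = 0
    exact zero_smul ℂ (1 : ℂ →L[ℂ] ℂ))
  map_add' p q := Prod.ext rfl (add_smul (p.2 v) (q.2 v) (1 : ℂ →L[ℂ] ℂ))
  commutes' c := by
    simp [Algebra.algebraMap_eq_smul_one, Prod.ext_iff]
  map_star' p := by simp [star_smul, Prod.ext_iff]

/-- The graph of the principal symbol. -/
noncomputable def symbolGraph (V : X × Bool → ℕ → ℂ →ₗᵢ[ℂ] L2R) :
    StarSubalgebra ℂ ((L2R →L[ℂ] L2R) × C(X × Bool, ℂ)) :=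
  ⨅ v, (intertwined (V v)).comap (evalPair v)

theorem mem_symbolGraph {V : X × Bool → ℕ → ℂ →ₗᵢ[ℂ] L2R}
    {p : (L2R →L[ℂ] L2R) × C(X × Bool, ℂ)} :
    p ∈ symbolGraph V ↔ ∀ v, Intertwines (V v) p.1 (p.2 v • 1) ∧
      Intertwines (V v) (star p.1) (star (p.2 v) • 1) := by
  rw [symbolGraph, StarSubalgebra.mem_iInf]
  refine forall_congr' fun v => ?_
  rw [StarSubalgebra.mem_comap, mem_intertwined]
  have e : star (p.2 v • (1 : ℂ →L[ℂ] ℂ)) = star (p.2 v) • 1 := by rw [star_smul, star_one]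
  rw [← e]
  rfl

theorem norm_le_of_mem_symbolGraph {V : X × Bool → ℕ → ℂ →ₗᵢ[ℂ] L2R} :
    ∀ p ∈ symbolGraph V, ‖p.2‖ ≤ ‖p.1‖ := by
  intro p hp
  refine (ContinuousMap.norm_le _ (norm_nonneg _)).2 fun v => ?_
  have h := ((mem_symbolGraph.1 hp) v).1.norm_le
  simpa [norm_smul] using h

theorem isClosed_symbolGraph (V : X × Bool → ℕ → ℂ →ₗᵢ[ℂ] L2R) :
    IsClosed (symbolGraph V : Set ((L2R →L[ℂ] L2R) × C(X × Bool, ℂ))) := by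
  rw [symbolGraph, StarSubalgebra.coe_iInf]
  refine isClosed_iInter fun v => (isClosed_intertwined (V v)).preimage ?_
  have h : Continuous fun p : (L2R →L[ℂ] L2R) × C(X × Bool, ℂ) => p.2 v :=
    by
    have h0 : Continuous fun f : C(X × Bool, ℂ) => f v := continuous_eval_const v
    exact h0.comp continuous_snd
  exact continuous_fst.prodMk (h.smul continuous_const)

/-- The symbol of multiplication by `H(x, e^{ix})`. -/
noncomputable def symM (H : C(EReal × Circle, ℂ)) : C(X × Bool, ℂ) :=
  ⟨fun v => H v.1.1, by fun_prop⟩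

/-- The symbol of `b(D)`. -/
noncomputable def symD (b : C(EReal, ℂ)) : C(X × Bool, ℂ) := ⟨fun v => b (endpt v.2),
  (continuous_of_discreteTopology (f := fun s => b (endpt s))).comp continuous_snd⟩

section

variable {V : X × Bool → ℕ → ℂ →ₗᵢ[ℂ] L2R}

theorem pairM_mem_symbolGraph (hV : ∀ v, IsPointSymbol v.1.1 v.2 (V v))
    (a : C(EReal × Circle, ℂ)) : (pairM a, symM a) ∈ symbolGraph V :=
  mem_symbolGraph.2 fun v => ⟨(hV v).1 a, by
    have := (hV v).1 (star a); rw [map_star] at this; exact this⟩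

theorem erealD_mem_symbolGraph (hV : ∀ v, IsPointSymbol v.1.1 v.2 (V v))
    (a : C(EReal, ℂ)) : (erealD a, symD a) ∈ symbolGraph V :=
  mem_symbolGraph.2 fun v => ⟨(hV v).2.1 a, by
    have := (hV v).2.1 (star a); rw [map_star] at this; exact this⟩

theorem compact_mem_symbolGraph (hV : ∀ v, IsPointSymbol v.1.1 v.2 (V v))
    {K : L2R →L[ℂ] L2R} (hK : IsCompactOperator K) :
    (K, (0 : C(X × Bool, ℂ))) ∈ symbolGraph V :=
  mem_symbolGraph.2 fun v => by
    simp only [ContinuousMap.zero_apply, zero_smul, star_zero]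
    exact ⟨(hV v).2.2 _ hK, (hV v).2.2 _ (isCompactOperator_star hK)⟩

end

theorem exists_expM_circle (k : ℤ) : ∃ F : C(Circle, ℂ), (∀ θ : ℝ, F (Circle.exp θ) =
    Complex.exp (k * θ * Complex.I)) ∧ circleM F = expM k :=
  exists_circleM (by fun_prop) (periodic_exp k)

theorem exists_symbol : ∃ σ : 𝔄 →⋆ₐ[ℂ] C(X × Bool, ℂ),
    (∀ (H : C(EReal × Circle, ℂ)) (A : 𝔄), (A : L2R →L[ℂ] L2R) = pairM H → σ A = symM H) ∧
    (∀ (b : C(EReal, ℂ)) (A : 𝔄), (A : L2R →L[ℂ] L2R) = erealD b → σ A = symD b) ∧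
    (∀ A : 𝔄, IsCompactOperator (A : L2R →L[ℂ] L2R) → σ A = 0) ∧
    ∀ A : 𝔄, ‖σ A‖ ≤ ‖(A : L2R →L[ℂ] L2R)‖ := by
  choose V hV using fun v : X × Bool => exists_isPointSymbol v.1 v.2
  have m2 : ∀ k, ∃ c, (expM k, c) ∈ symbolGraph V := fun k => by
    obtain ⟨F, -, hF⟩ := exists_expM_circle k
    exact ⟨symM (onSnd F), hF ▸ pairM_mem_symbolGraph hV (onSnd F)⟩
  obtain ⟨σ, h1, h2⟩ := exists_hom (symbolGraph V) (isClosed_symbolGraph V)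
    norm_le_of_mem_symbolGraph (fun a => ⟨_, pairM_mem_symbolGraph hV (onFst a)⟩) m2
    (fun b => ⟨_, erealD_mem_symbolGraph hV b⟩)
  refine ⟨σ, fun a A hA => h2 A _ ?_, fun a A hA => h2 A _ ?_,
    fun A hA => h2 A 0 ?_, fun A =>
    norm_le_of_mem_symbolGraph ((A : L2R →L[ℂ] L2R), σ A) (h1 A)⟩
  · rw [hA]; exact pairM_mem_symbolGraph hV a
  · rw [hA]; exact erealD_mem_symbolGraph hV a
  · exact compact_mem_symbolGraph hV hA

theorem exists_cutoffs : ∃ b c : C(EReal, ℂ), b + c = 1 ∧ b ⊤ = 1 ∧ b ⊥ = 0 ∧ c ⊤ = 0 ∧ c ⊥ = 1 ∧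
    (∀ x, ‖b x‖ ≤ 1) ∧ ∀ x, ‖c x‖ ≤ 1 := by
  obtain ⟨f, hf0, hf1, hf⟩ := exists_continuous_zero_one_of_isClosed
    (isClosed_singleton (x := (⊥ : EReal))) (isClosed_singleton (x := (⊤ : EReal)))
    (Set.disjoint_singleton.2 bot_ne_top)
  have h0 : f ⊥ = 0 := hf0 rfl
  have h1 : f ⊤ = 1 := hf1 rfl
  refine ⟨⟨fun x => (f x : ℂ), by fun_prop⟩, ⟨fun x => ((1 - f x : ℝ) : ℂ), by fun_prop⟩, ?_,
    by simp [h1], by simp [h0], by simp [h1], by simp [h0], fun x => ?_, fun x => ?_⟩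
  · ext x; simp
  · have := hf x
    simp only [ContinuousMap.coe_mk, Complex.norm_real, Real.norm_eq_abs]
    rw [abs_of_nonneg this.1]; exact this.2
  · have := hf x
    simp only [ContinuousMap.coe_mk, Complex.norm_real, Real.norm_eq_abs]
    rw [abs_of_nonneg (by linarith [this.2])]; linarith [this.1]

theorem exists_pair_extension (f : C(X × Bool, ℂ)) (s : Bool) :
    ∃ H : C(EReal × Circle, ℂ), ∀ m : X, H m.1 = f (m, s) := by
  obtain ⟨H, hH⟩ := ContinuousMap.exists_restrict_eq isClosed_X
    (⟨fun m : X => f (m, s), by fun_prop⟩ : C(X, ℂ))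
  exact ⟨H, fun m => DFunLike.congr_fun hH m⟩

theorem exists_isPrincipalSymbol : ∃ σ : 𝔄 →⋆ₐ[ℂ] C(X × Bool, ℂ), IsPrincipalSymbol σ ∧
    (∀ (H : C(EReal × Circle, ℂ)) (A : 𝔄), (A : L2R →L[ℂ] L2R) = pairM H → σ A = symM H) ∧
    (∀ (b : C(EReal, ℂ)) (A : 𝔄), (A : L2R →L[ℂ] L2R) = erealD b → σ A = symD b) ∧
    (∀ A : 𝔄, IsCompactOperator (A : L2R →L[ℂ] L2R) → σ A = 0) ∧
    ∀ A : 𝔄, ‖σ A‖ ≤ ‖(A : L2R →L[ℂ] L2R)‖ := by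
  obtain ⟨σ, h1, h2, h3, h4⟩ := exists_symbol
  refine ⟨σ, ⟨fun f => ?_, fun a A hA m s => ?_, fun a ha hp A hA m s θ hθ => ?_,
    fun b A hA m s => ?_⟩, h1, h2, h3, h4⟩
  · obtain ⟨b, c, -, b1, b0, c0, c1, -⟩ := exists_cutoffs
    obtain ⟨H, hH⟩ := exists_pair_extension f true
    obtain ⟨G, hG⟩ := exists_pair_extension f false
    refine ⟨⟨pairM H, pairM_mem H⟩ * ⟨erealD b, erealD_mem b⟩ +
      ⟨pairM G, pairM_mem G⟩ * ⟨erealD c, erealD_mem c⟩, ?_⟩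
    rw [map_add, map_mul, map_mul, h1 H ⟨pairM H, pairM_mem H⟩ rfl,
      h1 G ⟨pairM G, pairM_mem G⟩ rfl, h2 b ⟨erealD b, erealD_mem b⟩ rfl,
      h2 c ⟨erealD c, erealD_mem c⟩ rfl]
    ext ⟨m, s⟩
    cases s with
    | true => simp [symM, symD, endpt, hH, b1, c0]
    | false => simp [symM, symD, endpt, hG, b0, c1]
  · rw [h1 (onFst a) A hA]; rfl
  · obtain ⟨F, hF, hF'⟩ := exists_circleM ha hp
    rw [h1 (onSnd F) A (by rw [hA, pairM_onSnd, hF']), ← hF θ, ← hθ]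
    rfl
  · rw [h2 b A hA]; rfl

end PrincipalSymbol

end SemiPeriodic

namespace SemiPeriodic

/-! ## Operators on `ℓ²(ℤ)` -/

section SequenceSpace

open Filter Topology

/-- The standard basis vectors of `ℓ²(ℤ)`. -/
noncomputable def basisVec (j : ℤ) : l2Z := lp.single 2 j (1 : ℂ)

theorem basisVec_apply (j k : ℤ) : basisVec j k = if k = j then 1 else 0 := by
  rw [basisVec, lp.single_apply, Pi.single_apply]

theorem span_basisVec : (Submodule.span ℂ (Set.range basisVec)).topologicalClosure = ⊤ := by
  rw [eq_top_iff]
  rintro u -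
  have h := lp.hasSum_single (by simp) u
  have h' : HasSum (fun j => u j • basisVec j) u := by
    refine h.congr_fun fun j => ?_
    rw [basisVec, ← lp.single_smul, smul_eq_mul, mul_one]
  refine mem_closure_of_tendsto h' (.of_forall fun s => ?_)
  exact Submodule.sum_mem _ fun j _ => Submodule.smul_mem _ _ (Submodule.subset_span ⟨j, rfl⟩)

theorem ext_basisVec {S T : 𝔅} (h : ∀ j, S (basisVec j) = T (basisVec j)) : S = T :=
  ContinuousLinearMap.ext_on (Submodule.dense_iff_topologicalClosure_eq_top.2 span_basisVec)
    (by rintro _ ⟨j, rfl⟩; exact h j)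

theorem diagOp_apply {d : ℤ → ℂ} (h : ∃ C : ℝ, ∀ j, ‖d j‖ ≤ C) (u : l2Z) (j : ℤ) :
    diagOp d u j = d j * u j := by
  rw [diagOp, dif_pos h]
  rfl

theorem diagOp_basisVec {d : ℤ → ℂ} (h : ∃ C : ℝ, ∀ j, ‖d j‖ ≤ C) (j : ℤ) :
    diagOp d (basisVec j) = d j • basisVec j := by
  ext k
  rw [diagOp_apply h, lp.coeFn_smul, Pi.smul_apply, basisVec_apply]
  split_ifs with hk
  · rw [hk]; rfl
  · simp

theorem norm_diagOp_le {d : ℤ → ℂ} {C : ℝ} (hC : ∀ j, ‖d j‖ ≤ C) : ‖diagOp d‖ ≤ C := by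
  have h0 : 0 ≤ C := (norm_nonneg _).trans (hC 0)
  refine ContinuousLinearMap.opNorm_le_bound _ h0 fun u => ?_
  have : ‖diagOp d u‖ ≤ ‖(C : ℂ) • u‖ := by
    refine lp.norm_mono (by simp) fun j => ?_
    rw [diagOp_apply ⟨C, hC⟩, lp.coeFn_smul, Pi.smul_apply, norm_smul, norm_mul, Complex.norm_real,
      Real.norm_eq_abs, abs_of_nonneg h0]
    exact mul_le_mul_of_nonneg_right (hC j) (norm_nonneg _)
  rwa [norm_smul, Complex.norm_real, Real.norm_eq_abs, abs_of_nonneg h0] at this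

/-- The phase `e^{-2πiφx}` on the circle `ℝ/ℤ`. -/
noncomputable def phase (φ : ℝ) (x : UnitAddCircle) : ℂ :=
  Complex.exp (-(2 * Real.pi * φ * (AddCircle.equivIoc (1 : ℝ) (-1 / 2) x : ℝ)) * Complex.I)

theorem norm_phase (φ : ℝ) (x : UnitAddCircle) : ‖phase φ x‖ = 1 := by
  rw [phase]
  exact_mod_cast Complex.norm_exp_ofReal_mul_I
    (-(2 * Real.pi * φ * (AddCircle.equivIoc (1 : ℝ) (-1 / 2) x : ℝ)))

theorem measurable_phase (φ : ℝ) : Measurable (phase φ) := by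
  have h : Measurable fun x : UnitAddCircle => (AddCircle.equivIoc (1 : ℝ) (-1 / 2) x : ℝ) :=
    measurable_subtype_coe.comp (AddCircle.measurableEquivIoc (1 : ℝ) (-1 / 2)).measurable
  unfold phase
  fun_prop

theorem memLp_phase (φ : ℝ) : MemLp (phase φ) ∞ AddCircle.haarAddCircle :=
  memLp_top_of_bound (measurable_phase φ).aestronglyMeasurable 1
    (.of_forall fun x => (norm_phase φ x).le)

/-- The discrete Fourier transform `L²(S¹) → ℓ²(ℤ)`. -/
noncomputable abbrev dft : Lp ℂ 2 (AddCircle.haarAddCircle (T := 1)) ≃ₗᵢ[ℂ] l2Z :=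
  (fourierBasis (T := 1)).repr

theorem Y_apply (φ : ℝ) (u : l2Z) :
    Y φ u = dft (mulOp AddCircle.haarAddCircle (phase φ) (dft.symm u)) := rfl

theorem Y_add (φ ψ : ℝ) : Y (φ + ψ) = Y φ * Y ψ := by
  ext1 u
  rw [mul_apply_eq_comp, Y_apply, Y_apply, Y_apply, LinearIsometryEquiv.symm_apply_apply,
    ← mul_apply_eq_comp, ← mulOp_mul (memLp_phase φ) (memLp_phase ψ)]
  · congr 3
    ext x
    rw [phase, phase, phase, ← Complex.exp_add]
    congr 1
    push_cast
    ring
  · refine memLp_top_of_bound ((measurable_phase φ).mul (measurable_phase ψ)).aestronglyMeasurable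
      1 (.of_forall fun x => ?_)
    rw [norm_mul, norm_phase, norm_phase, one_mul]

theorem Y_zero : Y 0 = 1 := by
  ext1 u
  have : phase 0 = fun _ => 1 := by ext x; simp [phase]
  rw [Y_apply, this, mulOp_const 1 (by rw [← this]; exact memLp_phase 0)]
  simp

theorem Y_mul_neg (φ : ℝ) : Y φ * Y (-φ) = 1 := by rw [← Y_add, add_neg_cancel, Y_zero]

theorem Y_neg_mul (φ : ℝ) : Y (-φ) * Y φ = 1 := by rw [← Y_add, neg_add_cancel, Y_zero]

theorem norm_Y_le (φ : ℝ) : ‖Y φ‖ ≤ 1 := by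
  refine ContinuousLinearMap.opNorm_le_bound _ zero_le_one fun u => ?_
  rw [Y_apply, LinearIsometryEquiv.norm_map]
  refine (ContinuousLinearMap.le_of_opNorm_le _ (norm_mulOp_le (memLp_phase φ) zero_le_one
    (.of_forall fun x => (norm_phase φ x).le)) _).trans ?_
  rw [LinearIsometryEquiv.norm_map]

theorem norm_Y_apply (φ : ℝ) (u : l2Z) : ‖Y φ u‖ = ‖u‖ := by
  refine le_antisymm ((ContinuousLinearMap.le_of_opNorm_le _ (norm_Y_le φ) u).trans_eq
    (one_mul _)) ?_
  have h := ContinuousLinearMap.le_of_opNorm_le _ (norm_Y_le (-φ)) (Y φ u)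
  rwa [← mul_apply_eq_comp, Y_neg_mul, one_apply_eq_self, one_mul] at h

theorem star_Y (φ : ℝ) : star (Y φ) = Y (-φ) := by
  have h : star (Y φ) * Y φ = 1 :=
    (ContinuousLinearMap.norm_map_iff_adjoint_comp_self _).1 (norm_Y_apply φ)
  calc star (Y φ) = star (Y φ) * (Y φ * Y (-φ)) := by rw [Y_mul_neg, mul_one]
    _ = Y (-φ) := by rw [← mul_assoc, h, one_mul]

theorem norm_phase_sub_one_le (φ : ℝ) (x : UnitAddCircle) :
    ‖phase φ x + -1‖ ≤ 2 * Real.pi * |φ| := by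
  have h := (AddCircle.equivIoc (1 : ℝ) (-1 / 2) x).2
  set y : ℝ := (AddCircle.equivIoc (1 : ℝ) (-1 / 2) x : ℝ) with hy
  have h1 := Real.norm_exp_I_mul_ofReal_sub_one_le (x := -(2 * Real.pi * φ * y))
  have e : phase φ x = Complex.exp (Complex.I * ((-(2 * Real.pi * φ * y) : ℝ) : ℂ)) := by
    rw [phase]; congr 1; push_cast; ring
  rw [e, ← sub_eq_add_neg]
  refine h1.trans ?_
  rw [norm_neg, Real.norm_eq_abs, abs_mul, abs_mul, abs_of_pos Real.two_pi_pos]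
  refine mul_le_of_le_one_right (by positivity) (abs_le.2 ⟨?_, ?_⟩) <;> linarith [h.1, h.2]

theorem norm_Y_sub_one_le (φ : ℝ) : ‖Y φ - 1‖ ≤ 2 * Real.pi * |φ| := by
  have h1 : MemLp (fun _ : UnitAddCircle => (-1 : ℂ)) ∞ AddCircle.haarAddCircle :=
    memLp_top_of_bound (by fun_prop) 1 (by simp)
  refine ContinuousLinearMap.opNorm_le_bound _ (by positivity) fun u => ?_
  have e : (Y φ - 1) u = dft (mulOp AddCircle.haarAddCircle (fun x => phase φ x + -1)
      (dft.symm u)) := by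
    rw [mulOp_add (memLp_phase φ) h1, mulOp_const _ h1, sub_apply, add_apply, map_add, ← Y_apply,
      smul_apply, map_smul, one_apply_eq_self, one_apply_eq_self,
      LinearIsometryEquiv.apply_symm_apply]
    module
  rw [e, LinearIsometryEquiv.norm_map]
  refine (ContinuousLinearMap.le_of_opNorm_le _ (norm_mulOp_le ((memLp_phase φ).add h1)
    (by positivity) (.of_forall (norm_phase_sub_one_le φ))) _).trans ?_
  rw [LinearIsometryEquiv.norm_map]

theorem continuous_Y : Continuous Y := by
  refine continuous_iff_continuousAt.2 fun φ => ?_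
  rw [ContinuousAt, tendsto_iff_norm_sub_tendsto_zero]
  have h : Tendsto (fun ψ : ℝ => 2 * Real.pi * |ψ - φ|) (𝓝 φ) (𝓝 0) := by
    have : Continuous fun ψ : ℝ => 2 * Real.pi * |ψ - φ| := by fun_prop
    simpa using this.tendsto φ
  refine squeeze_zero (fun _ => norm_nonneg _) (fun ψ => ?_) h
  have e : Y ψ - Y φ = Y φ * (Y (ψ - φ) - 1) := by
    rw [mul_sub, ← Y_add, mul_one, add_sub_cancel]
  rw [e]
  calc _ ≤ ‖Y φ‖ * ‖Y (ψ - φ) - 1‖ := norm_mul_le _ _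
    _ ≤ 1 * (2 * Real.pi * |ψ - φ|) := by
      gcongr
      · exact norm_Y_le φ
      · exact norm_Y_sub_one_le _
    _ = _ := one_mul _

theorem Y_int (k j : ℤ) : Y k (basisVec j) = basisVec (j - k) := by
  have e : ∀ i, dft.symm (basisVec i) = fourierLp 2 i := fun i => by
    rw [LinearIsometryEquiv.symm_apply_eq, ← coe_fourierBasis, HilbertBasis.repr_self]
    rfl
  rw [Y_apply, ← LinearIsometryEquiv.eq_symm_apply, e, e]
  refine Lp.ext ?_
  filter_upwards [mulOp_coeFn (memLp_phase k) (fourierLp 2 j), coeFn_fourierLp (T := 1) 2 j,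
    coeFn_fourierLp (T := 1) 2 (j - k)] with x h1 h2 h3
  rw [h1, h2, h3]
  have hx : ((AddCircle.equivIoc (1 : ℝ) (-1 / 2) x : ℝ) : UnitAddCircle) = x :=
    (AddCircle.equivIoc (1 : ℝ) (-1 / 2)).symm_apply_apply x
  nth_rw 2 3 [← hx]
  rw [fourier_coe_apply, fourier_coe_apply, phase, ← Complex.exp_add]
  congr 1
  push_cast
  ring

/-- The diagonal operator of a function on `[-∞,+∞]`. -/
noncomputable def diagE : C(EReal, ℂ) →⋆ₐ[ℂ] 𝔅 where
  toFun d := diagOp fun j => d ((j : ℝ) : EReal)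
  map_one' := ext_basisVec fun j => by
    rw [diagOp_basisVec ⟨1, by simp⟩]; simp
  map_mul' a b := ext_basisVec fun j => by
    rw [diagOp_basisVec ⟨‖a * b‖, fun j => (a * b).norm_coe_le_norm _⟩, mul_apply_eq_comp,
      diagOp_basisVec ⟨‖b‖, fun j => b.norm_coe_le_norm _⟩, map_smul,
      diagOp_basisVec ⟨‖a‖, fun j => a.norm_coe_le_norm _⟩, smul_smul, mul_comm]
    rfl
  map_zero' := ext_basisVec fun j => by
    rw [diagOp_basisVec ⟨1, by simp⟩]; simp
  map_add' a b := ext_basisVec fun j => by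
    rw [diagOp_basisVec ⟨‖a + b‖, fun j => (a + b).norm_coe_le_norm _⟩]
    change _ = diagOp _ (basisVec j) + diagOp _ (basisVec j)
    rw [diagOp_basisVec ⟨‖b‖, fun j => b.norm_coe_le_norm _⟩,
      diagOp_basisVec ⟨‖a‖, fun j => a.norm_coe_le_norm _⟩, ← add_smul]
    rfl
  commutes' c := ext_basisVec fun j => by
    rw [diagOp_basisVec ⟨‖c‖, fun j => by simp [Algebra.algebraMap_eq_smul_one]⟩]
    simp [Algebra.algebraMap_eq_smul_one]
  map_star' a := by
    refine ((ContinuousLinearMap.eq_adjoint_iff _ _).2 fun u v => ?_)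
    rw [lp.inner_eq_tsum, lp.inner_eq_tsum]
    refine tsum_congr fun j => ?_
    rw [diagOp_apply ⟨‖star a‖, fun j => (star a).norm_coe_le_norm _⟩,
      diagOp_apply ⟨‖a‖, fun j => a.norm_coe_le_norm _⟩]
    simp
    ring

theorem diagE_apply (d : C(EReal, ℂ)) : diagE d = diagOp fun j => d ((j : ℝ) : EReal) := rfl

theorem diagE_basisVec (d : C(EReal, ℂ)) (j : ℤ) :
    diagE d (basisVec j) = d ((j : ℝ) : EReal) • basisVec j :=
  diagOp_basisVec ⟨‖d‖, fun _ => d.norm_coe_le_norm _⟩ j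

theorem norm_diagE_le (d : C(EReal, ℂ)) : ‖diagE d‖ ≤ ‖d‖ :=
  norm_diagOp_le fun _ => d.norm_coe_le_norm _

theorem continuous_diagE : Continuous diagE :=
  AddMonoidHomClass.continuous_of_bound diagE 1 fun a => by
    rw [one_mul]; exact norm_diagE_le a

/-- The family `φ ↦ b(· - φ)`. -/
noncomputable def shiftE (b : C(EReal, ℂ)) : C(ℝ, C(EReal, ℂ)) :=
  ContinuousMap.curry ⟨fun p : ℝ × EReal => b (p.2 + ((-p.1 : ℝ) : EReal)), by
    refine b.continuous.comp (continuous_iff_continuousAt.2 fun p => ?_)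
    refine ContinuousAt.comp (f := fun p : ℝ × EReal => (p.2, ((-p.1 : ℝ) : EReal)))
      (g := fun q : EReal × EReal => q.1 + q.2)
      (EReal.continuousAt_add (.inr (EReal.coe_ne_bot _)) (.inr (EReal.coe_ne_top _))) ?_
    exact (continuous_snd.prodMk (continuous_coe_real_ereal.comp
      continuous_fst.neg)).continuousAt⟩

theorem shiftE_apply (b : C(EReal, ℂ)) (φ x : ℝ) :
    shiftE b φ (x : EReal) = b ((x - φ : ℝ) : EReal) := by
  change b ((x : EReal) + ((-φ : ℝ) : EReal)) = _
  rw [← EReal.coe_add, sub_eq_add_neg]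

/-- The boundary symbol of `b(D)` as a function on `ℝ`. -/
noncomputable def bsymR (b : C(EReal, ℂ)) (φ : ℝ) : 𝔅 := Y φ * diagE (shiftE b φ) * Y (-φ)

theorem bsymR_eq (b : C(EReal, ℂ)) (φ : ℝ) : bsymR b φ =
    Y φ * diagOp (fun j => b ((j - φ : ℝ) : EReal)) * Y (-φ) := by
  rw [bsymR, diagE_apply]
  simp only [shiftE_apply]

theorem continuous_bsymR (b : C(EReal, ℂ)) : Continuous (bsymR b) :=
  (continuous_Y.mul (continuous_diagE.comp (shiftE b).continuous)).mul
    (continuous_Y.comp continuous_neg)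

theorem bsymR_add_one (b : C(EReal, ℂ)) (φ : ℝ) : bsymR b (φ + 1) = bsymR b φ := by
  have h : Y 1 * diagE (shiftE b (φ + 1)) * Y (-1) = diagE (shiftE b φ) := by
    refine ext_basisVec fun j => ?_
    have h1 := Y_int (-1) j
    have h2 := Y_int 1 (j + 1)
    push_cast at h1 h2
    rw [mul_apply_eq_comp, mul_apply_eq_comp, h1, sub_neg_eq_add, diagE_basisVec, map_smul, h2,
      diagE_basisVec, add_sub_cancel_right, shiftE_apply, shiftE_apply]
    congr 3
    push_cast
    ring
  rw [bsymR, bsymR, ← h, neg_add_rev, Y_add φ 1, Y_add (-1)]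
  simp only [mul_assoc]

theorem exists_bsym (b : C(EReal, ℂ)) :
    ∃ F : C(Circle, 𝔅), ∀ φ : ℝ, F (Circle.exp (2 * Real.pi * φ)) = bsymR b φ := by
  obtain ⟨F, hF⟩ := exists_circle_map (f := fun θ => bsymR b (θ / (2 * Real.pi)))
    ((continuous_bsymR b).comp (by fun_prop)) (fun θ => by
      simp only
      rw [add_div, div_self Real.two_pi_pos.ne', bsymR_add_one])
  refine ⟨F, fun φ => ?_⟩
  rw [hF, mul_div_cancel_left₀ _ Real.two_pi_pos.ne']

theorem exists_exp_two_pi (z : Circle) : ∃ φ : ℝ, Circle.exp (2 * Real.pi * φ) = z :=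
  ⟨Complex.arg z / (2 * Real.pi), by
    rw [mul_div_cancel₀ _ Real.two_pi_pos.ne', Circle.exp_arg]⟩

end SequenceSpace

/-! ## The boundary principal symbol -/

section BoundarySymbol

open Filter Topology InnerProductSpace

/-- The normalized indicator function of `(0, 2π]`. -/
noncomputable def arc : ℝ → ℂ :=
  (Set.Ioc (0 : ℝ) (2 * Real.pi)).indicator fun _ => ((√(2 * Real.pi))⁻¹ : ℝ)

theorem memLp_arc (p : ℝ≥0∞) : MemLp arc p :=
  memLp_indicator_const p measurableSet_Ioc _ (.inr measure_Ioc_lt_top.ne)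

theorem star_arc_mul (u : ℝ) : (starRingEnd ℂ) (arc u) * arc u =
    (Set.Ioc (0 : ℝ) (2 * Real.pi)).indicator (fun _ => ((2 * Real.pi)⁻¹ : ℂ)) u := by
  by_cases h : u ∈ Set.Ioc (0 : ℝ) (2 * Real.pi)
  · rw [arc, Set.indicator_of_mem h, Set.indicator_of_mem h, Complex.conj_ofReal,
      ← Complex.ofReal_mul, ← mul_inv, Real.mul_self_sqrt Real.two_pi_pos.le]
    push_cast
    rfl
  · rw [arc, Set.indicator_of_notMem h, Set.indicator_of_notMem h, mul_zero]

theorem integral_arc : ∫ u, ‖arc u‖ ^ 2 = 1 := by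
  have : (fun u => ‖arc u‖ ^ 2) = (Set.Ioc (0 : ℝ) (2 * Real.pi)).indicator
      fun _ => (2 * Real.pi)⁻¹ := by
    ext u
    by_cases h : u ∈ Set.Ioc (0 : ℝ) (2 * Real.pi)
    · rw [arc, Set.indicator_of_mem h, Set.indicator_of_mem h, Complex.norm_real, norm_inv,
        Real.norm_eq_abs, abs_of_nonneg (Real.sqrt_nonneg _), inv_pow, Real.sq_sqrt
        Real.two_pi_pos.le]
    · rw [arc, Set.indicator_of_notMem h, Set.indicator_of_notMem h]; simp
  rw [this, integral_indicator measurableSet_Ioc, setIntegral_const]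
  simp [Real.pi_pos.le]
  field_simp

theorem inv_succ_pos (n : ℕ) : (0 : ℝ) < 1 / ((n : ℝ) + 1) := by positivity

/-- The left end point of the support of the frame vectors. -/
noncomputable def base (s : Bool) (n : ℕ) : ℝ :=
  (bif s then 2 * Real.pi * (n + 1) ^ 2 else -(2 * Real.pi * (n + 1) ^ 2))

/-- The frame vectors near `±∞`. -/
noncomputable def frame (s : Bool) (φ : ℝ) (n : ℕ) (j : ℤ) : L2R :=
  waveLp (memLp_arc 2) (inv_succ_pos n) (base s n) (j - φ)

theorem norm_frame (s : Bool) (φ : ℝ) (n : ℕ) (j : ℤ) : ‖frame s φ n j‖ = 1 := by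
  have h := norm_waveLp (memLp_arc 2) (inv_succ_pos n) (base s n) (j - φ)
  rw [integral_arc] at h
  exact (pow_eq_one_iff_of_nonneg (norm_nonneg _) two_ne_zero).1 h

theorem exp_base (s : Bool) (n : ℕ) (m : ℤ) :
    Complex.exp (m * base s n * Complex.I) = 1 := by
  cases s with
  | true =>
    rw [← Complex.exp_int_mul_two_pi_mul_I (m * (n + 1) ^ 2)]
    congr 1
    simp only [base, cond_true]
    push_cast
    ring
  | false =>
    rw [← Complex.exp_int_mul_two_pi_mul_I (-(m * (n + 1) ^ 2))]
    congr 1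
    simp only [base, cond_false]
    push_cast
    ring

theorem mem_arc_iff (s : Bool) (n : ℕ) (x : ℝ) :
    1 / ((n : ℝ) + 1) * (x - base s n) ∈ Set.Ioc (0 : ℝ) (2 * Real.pi) ↔
      x ∈ Set.Ioc (base s n) (base s n + 2 * Real.pi * (n + 1)) := by
  have hn := natCast_succ_pos n
  rw [Set.mem_Ioc, Set.mem_Ioc, one_div_mul_eq_div, div_le_iff₀ hn, div_pos_iff_of_pos_right hn,
    sub_pos, sub_le_iff_le_add']

theorem inner_frame (s : Bool) (φ : ℝ) (n : ℕ) {i j : ℤ} (hij : i ≠ j) :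
    ⟪frame s φ n i, frame s φ n j⟫_ℂ = 0 := by
  rw [L2.inner_def]
  have h : ∀ᵐ x, ⟪frame s φ n i x, frame s φ n j x⟫_ℂ =
      (Set.Ioc (base s n) (base s n + 2 * Real.pi * (n + 1))).indicator
      (fun x : ℝ => ((1 / ((n : ℝ) + 1) * (2 * Real.pi)⁻¹ : ℝ) : ℂ) *
        Complex.exp (((j - i : ℤ) * Complex.I) * x)) x := by
    filter_upwards [waveLp_coeFn (memLp_arc 2) (inv_succ_pos n) (base s n) (i - φ),
      waveLp_coeFn (memLp_arc 2) (inv_succ_pos n) (base s n) (j - φ)] with x h1 h2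
    rw [frame, frame, h1, h2, RCLike.inner_apply, wave, wave]
    simp only [map_mul, Complex.conj_ofReal]
    have e1 : (starRingEnd ℂ) (Complex.exp (((i - φ : ℝ) : ℂ) * x * Complex.I)) *
        Complex.exp (((j - φ : ℝ) : ℂ) * x * Complex.I) =
        Complex.exp (((j - i : ℤ) * Complex.I) * x) := by
      rw [← Complex.exp_conj, ← Complex.exp_add]
      congr 1
      simp only [map_mul, Complex.conj_ofReal, Complex.conj_I]
      push_cast
      ring
    have e2 : ((√(1 / ((n : ℝ) + 1)) : ℝ) : ℂ) * ((√(1 / ((n : ℝ) + 1)) : ℝ) : ℂ) =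
        ((1 / ((n : ℝ) + 1) : ℝ) : ℂ) := by
      rw [← Complex.ofReal_mul, Real.mul_self_sqrt (inv_succ_pos n).le]
    have e3 := star_arc_mul (1 / ((n : ℝ) + 1) * (x - base s n))
    calc _ = ((√(1 / ((n : ℝ) + 1)) : ℝ) : ℂ) * ((√(1 / ((n : ℝ) + 1)) : ℝ) : ℂ) *
        ((starRingEnd ℂ) (Complex.exp (((i - φ : ℝ) : ℂ) * x * Complex.I)) *
        Complex.exp (((j - φ : ℝ) : ℂ) * x * Complex.I)) *
        ((starRingEnd ℂ) (arc (1 / ((n : ℝ) + 1) * (x - base s n))) *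
          arc (1 / ((n : ℝ) + 1) * (x - base s n))) := by ring
      _ = _ := by
        rw [e1, e2, e3]
        by_cases hx : x ∈ Set.Ioc (base s n) (base s n + 2 * Real.pi * (n + 1))
        · rw [Set.indicator_of_mem hx, Set.indicator_of_mem ((mem_arc_iff s n x).2 hx)]
          push_cast
          ring
        · rw [Set.indicator_of_notMem hx,
            Set.indicator_of_notMem (fun h => hx ((mem_arc_iff s n x).1 h)), mul_zero]
  rw [integral_congr_ae h, integral_indicator measurableSet_Ioc, integral_const_mul,
    ← intervalIntegral.integral_of_le (by
      have := natCast_succ_pos n; have := Real.pi_pos; nlinarith [mul_pos this (natCast_succ_pos n)]),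
    integral_exp_mul_complex]
  · have e1 := exp_base s n (j - i)
    have e2 : Complex.exp (((j - i : ℤ) * Complex.I) * ((base s n + 2 * Real.pi * (n + 1) : ℝ) : ℂ))
        = 1 := by
      have h3 : ((j - i : ℤ) * Complex.I) * ((base s n + 2 * Real.pi * (n + 1) : ℝ) : ℂ) =
          (j - i : ℤ) * base s n * Complex.I +
            (((j - i) * (n + 1) : ℤ) : ℂ) * (2 * Real.pi * Complex.I) := by
        push_cast; ring
      rw [h3, Complex.exp_add, e1, Complex.exp_int_mul_two_pi_mul_I, one_mul]
    rw [e2, mul_right_comm, e1, sub_self, zero_div, mul_zero]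
  · refine mul_ne_zero ?_ Complex.I_ne_zero
    exact_mod_cast sub_ne_zero.2 hij.symm

theorem orthonormal_frame (s : Bool) (φ : ℝ) (n : ℕ) : Orthonormal ℂ (frame s φ n) :=
  ⟨norm_frame s φ n, fun _ _ h => inner_frame s φ n h⟩

/-- The isometries `ℓ²(ℤ) → L²(ℝ)` determined by the frames. -/
noncomputable def frameV (s : Bool) (φ : ℝ) (n : ℕ) : l2Z →ₗᵢ[ℂ] L2R :=
  (orthonormal_frame s φ n).orthogonalFamily.linearIsometry

theorem frameV_basisVec (s : Bool) (φ : ℝ) (n : ℕ) (j : ℤ) :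
    frameV s φ n (basisVec j) = frame s φ n j := by
  rw [frameV, basisVec, OrthogonalFamily.linearIsometry_apply_single]
  exact one_smul ℂ _

theorem intertwines_frameV {s : Bool} {φ : ℝ} {A : L2R →L[ℂ] L2R} {S : 𝔅}
    (h : ∀ j, Tendsto (fun n => ‖A (frame s φ n j) - frameV s φ n (S (basisVec j))‖) atTop (𝓝 0)) :
    Intertwines (frameV s φ) A S := by
  refine .of_dense span_basisVec ?_
  rintro _ ⟨j, rfl⟩
  simpa only [frameV_basisVec] using h j

theorem tendsto_base (s : Bool) (u : ℝ) :
    Tendsto (fun n : ℕ => ((base s n + u / (1 / ((n : ℝ) + 1)) : ℝ) : EReal)) atTop (𝓝 (endpt s)) := by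
  have hn : Tendsto (fun n : ℕ => (n : ℝ) + 1) atTop atTop :=
    tendsto_atTop_add_const_right _ _ tendsto_natCast_atTop_atTop
  cases s with
  | true =>
    refine EReal.tendsto_coe_nhds_top_iff.2 ?_
    have := hn.atTop_mul_atTop₀ (tendsto_atTop_add_const_left _ u
      (hn.const_mul_atTop Real.two_pi_pos))
    exact this.congr fun n => by simp only [base, cond_true]; field_simp; ring
  | false =>
    refine EReal.tendsto_coe_nhds_bot_iff.2 ?_
    have := tendsto_neg_atTop_atBot.comp (hn.atTop_mul_atTop₀ (tendsto_atTop_add_const_left _ (-u)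
      (hn.const_mul_atTop Real.two_pi_pos)))
    exact this.congr fun n => by simp only [base, cond_false, Function.comp]; field_simp; ring

theorem intertwines_frame_erealM (s : Bool) (φ : ℝ) (a : C(EReal, ℂ)) :
    Intertwines (frameV s φ) (erealM a) (a (endpt s) • 1) := by
  refine intertwines_frameV fun j => ?_
  have := tendsto_opM_wave (.ereal a) (c := a (endpt s)) (y := base s) (η := fun _ => j - φ)
    (memLp_arc 2) inv_succ_pos fun u => (a.continuous.tendsto _).comp (tendsto_base s u)
  refine this.congr fun n => ?_
  rw [smul_apply, one_apply_eq_self, map_smul, frameV_basisVec]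
  rfl

theorem intertwines_frame_erealD (s : Bool) (φ : ℝ) (b : C(EReal, ℂ)) :
    Intertwines (frameV s φ) (erealD b) (diagE (shiftE b φ)) := by
  refine intertwines_frameV fun j => ?_
  have ht : Tendsto (fun n : ℕ => 1 / ((n : ℝ) + 1)) atTop (𝓝 0) :=
    tendsto_one_div_add_atTop_nhds_zero_nat
  have := tendsto_opD_wave (.ereal b) (c := b ((j - φ : ℝ) : EReal)) (y := base s)
    (η := fun _ => j - φ) (memLp_one_iff_integrable.1 (memLp_arc 1))
    (memLp_arc 2) inv_succ_pos fun u => ((continuous_ereal b).tendsto _).comp (by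
      simpa using ((ht.const_mul (2 * Real.pi)).mul_const u).add_const ((j : ℝ) - φ))
  refine this.congr fun n => ?_
  rw [diagE_basisVec, map_smul, frameV_basisVec, shiftE_apply]
  rfl

theorem expM_frame (s : Bool) (φ : ℝ) (n : ℕ) (k j : ℤ) :
    expM k (frame s φ n j) = frame s φ n (j + k) := by
  refine Lp.ext ?_
  filter_upwards [opM_coeFn (bddMeas_expM k) (frame s φ n j),
    waveLp_coeFn (memLp_arc 2) (inv_succ_pos n) (base s n) (j - φ),
    waveLp_coeFn (memLp_arc 2) (inv_succ_pos n) (base s n) ((j + k : ℤ) - φ)] with x h1 h2 h3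
  rw [expM, h1, frame, h2, frame, h3, wave, wave]
  have : Complex.exp ((((j + k : ℤ) - φ : ℝ) : ℂ) * x * Complex.I) =
      Complex.exp (k * x * Complex.I) * Complex.exp (((j - φ : ℝ) : ℂ) * x * Complex.I) := by
    rw [← Complex.exp_add]; congr 1; push_cast; ring
  rw [this]
  ring

theorem intertwines_frame_expM (s : Bool) (φ : ℝ) (k : ℤ) :
    Intertwines (frameV s φ) (expM k) (Y (-k)) := by
  refine intertwines_frameV fun j => ?_
  have h := Y_int (-k) j
  rw [Int.cast_neg] at h
  simp [h, expM_frame, frameV_basisVec]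

theorem intertwines_frame_compact (s : Bool) (φ : ℝ) {K : L2R →L[ℂ] L2R}
    (hK : IsCompactOperator K) : Intertwines (frameV s φ) K 0 := by
  refine intertwines_frameV fun j => ?_
  simp only [zero_apply, map_zero, sub_zero]
  have h := Intertwines.tendsto_zero_of_compact hK (w := fun n => frame s φ n j)
    (fun n => (norm_frame s φ n j).le)
    (s := fun n => Set.Ioc (base s n) (base s n + 2 * Real.pi * (n + 1)))
    (fun n => measurableSet_Ioc) (fun n => ?_) fun x => ?_
  · simpa using h.norm
  · refine Lp.ext ?_
    filter_upwards [opM_coeFn (BddMeas.indicator (s := Set.Ioc (base s n)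
      (base s n + 2 * Real.pi * (n + 1))) measurableSet_Ioc) (frame s φ n j),
      waveLp_coeFn (memLp_arc 2) (inv_succ_pos n) (base s n) (j - φ)] with x h1 h2
    rw [h1]
    by_cases hx : x ∈ Set.Ioc (base s n) (base s n + 2 * Real.pi * (n + 1))
    · rw [Set.indicator_of_mem hx, Pi.one_apply, one_mul]
    · have : arc (1 / ((n : ℝ) + 1) * (x - base s n)) = 0 :=
        Set.indicator_of_notMem (fun h => hx ((mem_arc_iff s n x).1 h)) _
      rw [frame, h2, wave, this]
      simp
  · cases s with
    | true =>
      have h := EReal.tendsto_coe_nhds_top_iff.1 (tendsto_base true 0)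
      filter_upwards [h.eventually (eventually_ge_atTop x)] with n hn hx
      rw [zero_div, add_zero] at hn
      exact absurd hx.1 (not_lt.2 hn)
    | false =>
      have h := EReal.tendsto_coe_nhds_bot_iff.1 (tendsto_base false (2 * Real.pi))
      filter_upwards [h.eventually (eventually_lt_atBot x)] with n hn hx
      rw [div_div_eq_mul_div, div_one] at hn
      exact absurd hx.2 (not_le.2 hn)

/-- `Y_φ` as an isometry. -/
noncomputable def Yiso (φ : ℝ) : l2Z →ₗᵢ[ℂ] l2Z := ⟨(Y φ).toLinearMap, norm_Y_apply φ⟩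

/-- The isometries defining the boundary symbol. -/
noncomputable def bdryV (v : ℝ × Bool) (n : ℕ) : l2Z →ₗᵢ[ℂ] L2R :=
  (frameV v.2 v.1 n).comp (Yiso (-v.1))

theorem Intertwines.bdry {v : ℝ × Bool} {A : L2R →L[ℂ] L2R} {S S' : 𝔅}
    (h : Intertwines (frameV v.2 v.1) A S) (hS : Y (-v.1) * S' = S * Y (-v.1)) :
    Intertwines (bdryV v) A S' :=
  h.conj _ fun u => by
    change (Y (-v.1) * S') u = (S * Y (-v.1)) u
    rw [hS]

section Family

variable {K I H : Type*} [TopologicalSpace K] [CompactSpace K] [NormedAddCommGroup H]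
  [InnerProductSpace ℂ H] [CompleteSpace H]

/-- Evaluation of the second component at a point. -/
noncomputable def evalSnd (v : K) :
    (L2R →L[ℂ] L2R) × C(K, H →L[ℂ] H) →⋆ₐ[ℂ] (L2R →L[ℂ] L2R) × (H →L[ℂ] H) where
  toFun p := (p.1, p.2 v)
  map_one' := rfl
  map_mul' _ _ := rfl
  map_zero' := rfl
  map_add' _ _ := rfl
  commutes' _ := rfl
  map_star' _ := rfl

/-- Pairs `(A, f)` such that `A` is asymptotically intertwined with all values of `f`. -/
noncomputable def familyGraph (p : I → K) (V : I → ℕ → H →ₗᵢ[ℂ] L2R) :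
    StarSubalgebra ℂ ((L2R →L[ℂ] L2R) × C(K, H →L[ℂ] H)) :=
  ⨅ i, (intertwined (V i)).comap (evalSnd (p i))

variable {p : I → K} {V : I → ℕ → H →ₗᵢ[ℂ] L2R}

theorem mem_familyGraph {A : L2R →L[ℂ] L2R} {f : C(K, H →L[ℂ] H)} :
    (A, f) ∈ familyGraph p V ↔ ∀ i,
      Intertwines (V i) A (f (p i)) ∧ Intertwines (V i) (star A) (star (f (p i))) := by
  rw [familyGraph, StarSubalgebra.mem_iInf]
  rfl

theorem norm_le_of_mem_familyGraph (hp : Function.Surjective p)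
    (q : (L2R →L[ℂ] L2R) × C(K, H →L[ℂ] H)) (hq : q ∈ familyGraph p V) : ‖q.2‖ ≤ ‖q.1‖ := by
  refine (ContinuousMap.norm_le _ (norm_nonneg _)).2 fun z => ?_
  obtain ⟨i, rfl⟩ := hp z
  exact (mem_familyGraph.1 hq i).1.norm_le

theorem isClosed_familyGraph :
    IsClosed (familyGraph p V : Set ((L2R →L[ℂ] L2R) × C(K, H →L[ℂ] H))) := by
  rw [familyGraph, StarSubalgebra.coe_iInf]
  refine isClosed_iInter fun i => (isClosed_intertwined (V i)).preimage ?_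
  have h0 : Continuous fun f : C(K, H →L[ℂ] H) => f (p i) := continuous_eval_const _
  exact continuous_fst.prodMk (h0.comp continuous_snd)

theorem exists_hom_family (hp : Function.Surjective p)
    (h1 : ∀ a, ∃ c : C(K, H →L[ℂ] H), (erealM a, c) ∈ familyGraph p V)
    (h2 : ∀ k, ∃ c : C(K, H →L[ℂ] H), (expM k, c) ∈ familyGraph p V)
    (h3 : ∀ b, ∃ c : C(K, H →L[ℂ] H), (erealD b, c) ∈ familyGraph p V) :
    ∃ ψ : 𝔄 →⋆ₐ[ℂ] C(K, H →L[ℂ] H), (∀ (A : 𝔄) (f : C(K, H →L[ℂ] H)),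
      ((A : L2R →L[ℂ] L2R), f) ∈ familyGraph p V → ψ A = f) ∧
      ∀ A : 𝔄, ‖ψ A‖ ≤ ‖(A : L2R →L[ℂ] L2R)‖ := by
  obtain ⟨ψ, e1, e2⟩ := exists_hom (familyGraph p V) isClosed_familyGraph
    (norm_le_of_mem_familyGraph hp) h1 h2 h3
  exact ⟨ψ, e2, fun A => norm_le_of_mem_familyGraph hp ((A : L2R →L[ℂ] L2R), ψ A) (e1 A)⟩

end Family

/-- The point of the cosphere bundle with parameter `φ`. -/
noncomputable def bdryPt (v : ℝ × Bool) : Circle × Bool := (Circle.exp (2 * Real.pi * v.1), v.2)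

theorem bdryPt_surjective : Function.Surjective bdryPt := by
  rintro ⟨z, s⟩
  obtain ⟨φ, rfl⟩ := exists_exp_two_pi z
  exact ⟨(φ, s), rfl⟩

/-- The boundary symbol of `a(M)`. -/
noncomputable def bsymM (a : C(EReal, ℂ)) : C(Circle × Bool, 𝔅) :=
  ⟨fun v => a (endpt v.2) • 1, by
    exact (continuous_of_discreteTopology (f := fun s => a (endpt s) • (1 : 𝔅))).comp
      continuous_snd⟩

/-- The boundary symbol of `b(D)`. -/
noncomputable def bsymD (b : C(EReal, ℂ)) : C(Circle × Bool, 𝔅) :=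
  ⟨fun v => (exists_bsym b).choose v.1, by fun_prop⟩

theorem bsymD_apply (b : C(EReal, ℂ)) (φ : ℝ) (s : Bool) :
    bsymD b (Circle.exp (2 * Real.pi * φ), s) = bsymR b φ := (exists_bsym b).choose_spec φ

theorem erealM_mem_familyGraph (a : C(EReal, ℂ)) : (erealM a, bsymM a) ∈ familyGraph bdryPt bdryV := by
  have h : ∀ (a : C(EReal, ℂ)) (v : ℝ × Bool),
      Intertwines (bdryV v) (erealM a) (a (endpt v.2) • 1) := fun a v =>
    (intertwines_frame_erealM v.2 v.1 a).bdry (by simp)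
  refine mem_familyGraph.2 fun v => ⟨h a v, ?_⟩
  have := h (star a) v
  rw [map_star] at this
  have e : star (a (endpt v.2) • (1 : 𝔅)) = star (a (endpt v.2)) • 1 := by rw [star_smul, star_one]
  change Intertwines (bdryV v) (star (erealM a)) (star (a (endpt v.2) • (1 : 𝔅)))
  rw [e]
  exact this

theorem expM_mem_familyGraph (k : ℤ) :
    (expM k, ContinuousMap.const (Circle × Bool) (Y (-k))) ∈ familyGraph bdryPt bdryV := by
  have h : ∀ (k : ℤ) (v : ℝ × Bool), Intertwines (bdryV v) (expM k) (Y (-k)) := fun k v =>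
    (intertwines_frame_expM v.2 v.1 k).bdry (by rw [← Y_add, ← Y_add, add_comm])
  refine mem_familyGraph.2 fun v => ⟨h k v, ?_⟩
  have := h (-k) v
  rw [← star_expM] at this
  simpa [star_Y] using this

theorem erealD_mem_familyGraph (b : C(EReal, ℂ)) : (erealD b, bsymD b) ∈ familyGraph bdryPt bdryV := by
  have h : ∀ (b : C(EReal, ℂ)) (v : ℝ × Bool), Intertwines (bdryV v) (erealD b) (bsymR b v.1) :=
    fun b v => (intertwines_frame_erealD v.2 v.1 b).bdry (by
      rw [bsymR, mul_assoc, ← mul_assoc, Y_neg_mul, one_mul])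
  have hs : ∀ φ, star (bsymR b φ) = bsymR (star b) φ := fun φ => by
    have e : star (shiftE b φ) = shiftE (star b) φ := rfl
    rw [bsymR, star_mul, star_mul, star_Y, star_Y, neg_neg, ← map_star, e, ← mul_assoc]
    rfl
  refine mem_familyGraph.2 fun v => ?_
  simp only [bdryPt, bsymD_apply, hs, ← map_star]
  exact ⟨h b v, h _ v⟩

theorem compact_mem_familyGraph {K : L2R →L[ℂ] L2R} (hK : IsCompactOperator K) :
    (K, (0 : C(Circle × Bool, 𝔅))) ∈ familyGraph bdryPt bdryV := by
  have h : ∀ {K : L2R →L[ℂ] L2R}, IsCompactOperator K → ∀ v, Intertwines (bdryV v) K 0 :=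
    fun hK v => (intertwines_frame_compact v.2 v.1 hK).bdry (by simp)
  refine mem_familyGraph.2 fun v => ?_
  simp only [ContinuousMap.zero_apply, star_zero]
  exact ⟨h hK v, h (isCompactOperator_star hK) v⟩

theorem exists_isBoundarySymbol : ∃ γ : 𝔄 →⋆ₐ[ℂ] C(Circle × Bool, 𝔅), IsBoundarySymbol γ ∧
    (∀ A : 𝔄, IsCompactOperator (A : L2R →L[ℂ] L2R) → γ A = 0) ∧
    ∀ A : 𝔄, ‖γ A‖ ≤ ‖(A : L2R →L[ℂ] L2R)‖ := by
  obtain ⟨γ, h2, h3⟩ := exists_hom_family bdryPt_surjective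
    (fun a => ⟨_, erealM_mem_familyGraph a⟩) (fun k => ⟨_, expM_mem_familyGraph k⟩)
    (fun b => ⟨_, erealD_mem_familyGraph b⟩)
  refine ⟨γ, ⟨fun a A hA z s => ?_, fun k A hA z s => ?_, fun b A hA φ s => ?_⟩,
    fun A hA => h2 A 0 (compact_mem_familyGraph hA), h3⟩
  · have := h2 A _ (by rw [hA]; exact erealM_mem_familyGraph a)
    rw [this]
    rfl
  · have := h2 A _ (by rw [hA]; exact expM_mem_familyGraph k)
    rw [this]
    rfl
  · have := h2 A _ (by rw [hA]; exact erealD_mem_familyGraph b)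
    rw [this, bsymD_apply, bsymR_eq]

end BoundarySymbol

end SemiPeriodic

namespace SemiPeriodic

/-! ## Compact operators on `ℓ²(ℤ)` -/

section CompactSequence

open Filter Topology InnerProductSpace

theorem inner_basisVec (j : ℤ) (u : l2Z) : ⟪basisVec j, u⟫_ℂ = u j := by
  rw [basisVec, lp.inner_single_left]
  simp

/-- The matrix units of `𝔅`. -/
noncomputable def matUnit (i j : ℤ) : 𝔅 := rankOne ℂ (basisVec i) (basisVec j)

theorem matUnit_apply (i j : ℤ) (u : l2Z) : matUnit i j u = u j • basisVec i := by
  rw [matUnit, rankOne_apply, inner_basisVec]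

theorem isCompactOperator_matUnit (i j : ℤ) : IsCompactOperator (matUnit i j) :=
  isCompactOperator_rankOne _ _

theorem matUnit_basisVec (i j k : ℤ) :
    matUnit i j (basisVec k) = if j = k then basisVec i else 0 := by
  rw [matUnit_apply, basisVec_apply]
  split_ifs <;> simp

/-- The projection onto the span of the basis vectors with index in `[-N, N]`. -/
noncomputable def trunc (N : ℕ) : 𝔅 := ∑ j ∈ Finset.Icc (-(N : ℤ)) N, matUnit j j

theorem trunc_basisVec (N : ℕ) (k : ℤ) :
    trunc N (basisVec k) = if k ∈ Finset.Icc (-(N : ℤ)) N then basisVec k else 0 := by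
  rw [trunc, _root_.sum_apply]
  simp only [matUnit_basisVec, Finset.sum_ite_eq']

theorem trunc_apply (N : ℕ) (u : l2Z) (k : ℤ) :
    trunc N u k = if k ∈ Finset.Icc (-(N : ℤ)) N then u k else 0 := by
  rw [← inner_basisVec, trunc, _root_.sum_apply, inner_sum]
  simp only [matUnit_apply, inner_smul_right, inner_basisVec, basisVec_apply, mul_ite, mul_one,
    mul_zero, Finset.sum_ite_eq]

theorem isCompactOperator_trunc (N : ℕ) : IsCompactOperator (trunc N) := by
  rw [trunc, FunLike.coe_sum]
  exact isCompactOperator_finset_sum _ fun j _ => isCompactOperator_matUnit j j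

theorem star_trunc (N : ℕ) : star (trunc N) = trunc N := by
  refine ((ContinuousLinearMap.eq_adjoint_iff _ _).2 fun u v => ?_).symm
  rw [lp.inner_eq_tsum, lp.inner_eq_tsum]
  refine tsum_congr fun j => ?_
  rw [trunc_apply, trunc_apply]
  split_ifs <;> simp

theorem norm_sub_trunc_apply_le (N : ℕ) (u : l2Z) : ‖u - trunc N u‖ ≤ ‖u‖ := by
  refine lp.norm_mono (by simp) fun j => ?_
  rw [lp.coeFn_sub, Pi.sub_apply, trunc_apply]
  split_ifs <;> simp

theorem tendsto_trunc (u : l2Z) : Tendsto (fun N => trunc N u) atTop (𝓝 u) := by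
  have h : HasSum (fun j => u j • basisVec j) u := by
    refine (lp.hasSum_single (by simp) u).congr_fun fun j => ?_
    rw [basisVec, ← lp.single_smul, smul_eq_mul, mul_one]
  have h2 : Tendsto (fun N : ℕ => Finset.Icc (-(N : ℤ)) N) atTop atTop := by
    refine tendsto_atTop_finset_of_monotone (fun a b hab => Finset.Icc_subset_Icc (by simpa) (by
      simpa)) fun j => ⟨j.natAbs, ?_⟩
    rw [Finset.mem_Icc]
    omega
  refine (h.comp h2).congr fun N => ?_
  rw [Function.comp, trunc, _root_.sum_apply]
  simp only [matUnit_apply]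

theorem tendsto_trunc_mul {K : 𝔅} (hK : IsCompactOperator K) :
    Tendsto (fun N => trunc N * K) atTop (𝓝 K) := by
  obtain ⟨D, hD, hsub⟩ := IsCompactOperator.image_closedBall_subset_compact
    (f := (K : l2Z →ₗ[ℂ] l2Z)) hK 1
  rw [Metric.tendsto_atTop]
  intro ε hε
  obtain ⟨t, -, htf, hcov⟩ := hD.finite_cover_balls (e := ε / 4) (by positivity)
  have hev : ∀ y ∈ t, ∀ᶠ N in atTop, ‖trunc N y - y‖ < ε / 4 := fun y _ => by
    have := Metric.tendsto_atTop.1 (tendsto_trunc y) (ε / 4) (by positivity)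
    simpa [dist_eq_norm] using this
  obtain ⟨N₀, hN₀⟩ := eventually_atTop.1 ((htf.eventually_all).2 hev)
  refine ⟨N₀, fun N hN => ?_⟩
  rw [dist_eq_norm]
  refine lt_of_le_of_lt (ContinuousLinearMap.opNorm_le_of_unit_norm (C := ε / 2) (by positivity)
    fun x hx => ?_) (by linarith)
  have hx' : K x ∈ D := hsub ⟨x, by simp [hx], rfl⟩
  obtain ⟨y, hy, hxy⟩ := Set.mem_iUnion₂.1 (hcov hx')
  rw [Metric.mem_ball, dist_eq_norm] at hxy
  have h1 := hN₀ N hN y hy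
  have h2 := norm_sub_trunc_apply_le N (K x - y)
  have e : (trunc N * K - K) x = (trunc N y - y) - ((K x - y) - trunc N (K x - y)) := by
    rw [sub_apply, mul_apply_eq_comp, map_sub]; abel
  rw [e]
  have := norm_sub_le (trunc N y - y) ((K x - y) - trunc N (K x - y))
  linarith

theorem tendsto_mul_trunc {K : 𝔅} (hK : IsCompactOperator K) :
    Tendsto (fun N => K * trunc N) atTop (𝓝 K) := by
  have h := (continuous_star.tendsto _).comp (tendsto_trunc_mul (isCompactOperator_star hK))
  rw [star_star] at h
  refine h.congr fun N => ?_
  rw [Function.comp, star_mul, star_star, star_trunc]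

theorem norm_trunc_le (N : ℕ) : ‖trunc N‖ ≤ 1 := by
  refine ContinuousLinearMap.opNorm_le_bound _ zero_le_one fun u => ?_
  rw [one_mul]
  refine lp.norm_mono (by simp) fun j => ?_
  rw [trunc_apply]
  split_ifs <;> simp

theorem tendsto_trunc_mul_trunc {K : 𝔅} (hK : IsCompactOperator K) :
    Tendsto (fun N => trunc N * K * trunc N) atTop (𝓝 K) := by
  rw [tendsto_iff_norm_sub_tendsto_zero]
  have h1 := (tendsto_iff_norm_sub_tendsto_zero.1 (tendsto_mul_trunc hK)).add
    (tendsto_iff_norm_sub_tendsto_zero.1 (tendsto_trunc_mul hK))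
  rw [add_zero] at h1
  refine squeeze_zero (fun _ => norm_nonneg _) (fun N => ?_) h1
  have e : trunc N * K * trunc N - K = trunc N * (K * trunc N - K) + (trunc N * K - K) := by
    rw [mul_sub, mul_assoc]; abel
  rw [e]
  refine (norm_add_le _ _).trans (add_le_add ?_ le_rfl)
  refine (norm_mul_le _ _).trans (mul_le_of_le_one_left (norm_nonneg _) (norm_trunc_le N))

theorem trunc_mul_mul_trunc (N : ℕ) (T : 𝔅) : trunc N * T * trunc N =
    ∑ i ∈ Finset.Icc (-(N : ℤ)) N, ∑ j ∈ Finset.Icc (-(N : ℤ)) N,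
      T (basisVec j) i • matUnit i j := by
  refine ext_basisVec fun k => ?_
  rw [mul_apply_eq_comp, trunc_basisVec, _root_.sum_apply]
  simp only [_root_.sum_apply, smul_apply, matUnit_basisVec, smul_ite, smul_zero,
    Finset.sum_ite_eq']
  split_ifs with h
  · rw [mul_apply_eq_comp, trunc, _root_.sum_apply]
    simp only [matUnit_apply]
  · simp

theorem tendsto_cofinite_of_vanishInf {d : C(EReal, ℂ)} (hd : VanishInf d) (φ : ℝ) {ε : ℝ}
    (hε : 0 < ε) : ∃ N : ℕ, ∀ j : ℤ, j ∉ Finset.Icc (-(N : ℤ)) N →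
      ‖d ((j - φ : ℝ) : EReal)‖ ≤ ε := by
  have h1 := tendsto_ereal_atTop d
  have h2 := tendsto_ereal_atBot d
  rw [hd.2] at h1
  rw [hd.1] at h2
  have h3 := (tendsto_zero_iff_norm_tendsto_zero.1 h1).eventually (ge_mem_nhds hε)
  have h4 := (tendsto_zero_iff_norm_tendsto_zero.1 h2).eventually (ge_mem_nhds hε)
  obtain ⟨R, hR⟩ := eventually_atTop.1 h3
  obtain ⟨Q, hQ⟩ := eventually_atBot.1 h4
  obtain ⟨N, hN⟩ := exists_nat_gt (max (R + φ) (-(Q + φ)))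
  refine ⟨N, fun j hj => ?_⟩
  rw [Finset.mem_Icc, not_and_or, not_le, not_le] at hj
  rcases hj with hj | hj
  · have h5 : (j : ℝ) < -(N : ℝ) := by exact_mod_cast hj
    exact hQ _ (by linarith [le_max_right (R + φ) (-(Q + φ))])
  · have h5 : (N : ℝ) < j := by exact_mod_cast hj
    exact hR _ (by linarith [le_max_left (R + φ) (-(Q + φ))])

theorem isCompactOperator_diagE_shiftE {d : C(EReal, ℂ)} (hd : VanishInf d) (φ : ℝ) :
    IsCompactOperator (diagE (shiftE d φ)) := by
  have h : Tendsto (fun N => trunc N * diagE (shiftE d φ)) atTop (𝓝 (diagE (shiftE d φ))) := by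
    rw [Metric.tendsto_atTop]
    intro ε hε
    obtain ⟨N₀, hN₀⟩ := tendsto_cofinite_of_vanishInf hd φ (half_pos hε)
    refine ⟨N₀, fun N hN => ?_⟩
    rw [dist_eq_norm]
    refine lt_of_le_of_lt (ContinuousLinearMap.opNorm_le_bound _ (half_pos hε).le fun u => ?_)
      (half_lt_self hε)
    have : ‖(trunc N * diagE (shiftE d φ) - diagE (shiftE d φ)) u‖ ≤ ‖((ε / 2 : ℝ) : ℂ) • u‖ := by
      refine lp.norm_mono (by simp) fun j => ?_
      rw [sub_apply, mul_apply_eq_comp, lp.coeFn_sub, Pi.sub_apply, trunc_apply, lp.coeFn_smul,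
        Pi.smul_apply, norm_smul, Complex.norm_real, Real.norm_eq_abs, abs_of_pos (half_pos hε)]
      split_ifs with hj
      · rw [sub_self, norm_zero]; positivity
      · rw [zero_sub, norm_neg, diagE_apply, diagOp_apply ⟨‖shiftE d φ‖, fun j =>
          (shiftE d φ).norm_coe_le_norm _⟩, norm_mul, shiftE_apply]
        gcongr
        refine hN₀ j fun h => hj ?_
        rw [Finset.mem_Icc] at h ⊢
        omega
    rwa [norm_smul, Complex.norm_real, Real.norm_eq_abs, abs_of_pos (half_pos hε)] at this
  exact isCompactOperator_of_tendsto h (.of_forall fun N =>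
    (isCompactOperator_trunc N).comp_clm _)

theorem isCompactOperator_bsymR {d : C(EReal, ℂ)} (hd : VanishInf d) (φ : ℝ) :
    IsCompactOperator (bsymR d φ) :=
  ((isCompactOperator_diagE_shiftE hd φ).clm_comp (Y φ)).comp_clm (Y (-φ))

end CompactSequence

end SemiPeriodic

namespace SemiPeriodic

/-! ## The structure of `𝔄` modulo compact operators -/

section Structure

open Filter Topology

/-- The compact operators in `𝔄`, as a subspace. -/
noncomputable def cptA : Submodule ℂ (L2R →L[ℂ] L2R) where
  carrier := {K | IsCompactOperator K ∧ K ∈ 𝔄}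
  add_mem' ha hb := ⟨ha.1.add hb.1, add_mem ha.2 hb.2⟩
  zero_mem' := ⟨isCompactOperator_zero, zero_mem _⟩
  smul_mem' c _ ha := ⟨IsCompactOperator.smul (S := ℂ) ha.1 c, SMulMemClass.smul_mem c ha.2⟩

theorem cptA_mul_left {A K : L2R →L[ℂ] L2R} (hA : A ∈ 𝔄) (hK : K ∈ cptA) : A * K ∈ cptA :=
  ⟨hK.1.clm_comp A, mul_mem hA hK.2⟩

theorem cptA_mul_right {A K : L2R →L[ℂ] L2R} (hA : A ∈ 𝔄) (hK : K ∈ cptA) : K * A ∈ cptA :=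
  ⟨hK.1.comp_clm A, mul_mem hK.2 hA⟩

theorem erealM_expM (a : C(EReal, ℂ)) (k : ℤ) : erealM a * expM k = expM k * erealM a :=
  opM_comm (.ereal a) (bddMeas_expM k)

theorem exists_erealD_expM (b : C(EReal, ℂ)) (k : ℤ) : ∃ b' : C(EReal, ℂ),
    erealD b * expM k = expM k * erealD b' ∧ b' ⊥ = b ⊥ ∧ b' ⊤ = b ⊤ := by
  obtain ⟨F, hF, h1, h2⟩ := exists_shift b k
  refine ⟨F, ?_, h1, h2⟩
  have h := opD_mul_exp (BddMeas.ereal b) k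
  rw [erealD_apply, erealD_apply, expM]
  simp only [hF]
  simpa using h

/-- The span of the operators `a(M) e^{ikM} b(D)` with `b` satisfying `P`. -/
noncomputable def prodSpan (P : C(EReal, ℂ) → Prop) : Submodule ℂ (L2R →L[ℂ] L2R) :=
  Submodule.span ℂ {T | ∃ a k b, P b ∧ T = erealM a * expM k * erealD b}

/-- The span of the operators `e^{ikM} φ(D)` with `φ` vanishing at `±∞`. -/
noncomputable def expSpan : Submodule ℂ (L2R →L[ℂ] L2R) :=
  Submodule.span ℂ {T | ∃ k φ, VanishInf φ ∧ T = expM k * erealD φ}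

theorem expSpan_le : ∀ T ∈ expSpan, T ∈ 𝔄 := by
  intro T hT
  have h : expSpan ≤ Subalgebra.toSubmodule 𝔄.toSubalgebra := Submodule.span_le.2 (by
    rintro _ ⟨k, b, -, rfl⟩
    exact mul_mem (S := StarSubalgebra ℂ (L2R →L[ℂ] L2R)) (expM_mem k) (erealD_mem b))
  exact h hT

/-- The star subalgebra of elements that, together with their adjoints, preserve `L`. -/
noncomputable def leftStab (L : Submodule ℂ (L2R →L[ℂ] L2R)) :
    StarSubalgebra ℂ (L2R →L[ℂ] L2R) where
  carrier := {T | (∀ w ∈ L, T * w ∈ L) ∧ ∀ w ∈ L, star T * w ∈ L}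
  mul_mem' {S T} hS hT := ⟨fun w hw => by rw [mul_assoc]; exact hS.1 _ (hT.1 _ hw), fun w hw => by
    rw [star_mul, mul_assoc]; exact hT.2 _ (hS.2 _ hw)⟩
  add_mem' {S T} hS hT := ⟨fun w hw => by rw [add_mul]; exact L.add_mem (hS.1 _ hw) (hT.1 _ hw),
    fun w hw => by rw [star_add, add_mul]; exact L.add_mem (hS.2 _ hw) (hT.2 _ hw)⟩
  algebraMap_mem' c := ⟨fun w hw => by
    rw [Algebra.algebraMap_eq_smul_one, smul_one_mul]; exact L.smul_mem _ hw, fun w hw => by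
    rw [Algebra.algebraMap_eq_smul_one, star_smul, star_one, smul_one_mul]; exact L.smul_mem _ hw⟩
  star_mem' {S} hS := ⟨hS.2, by rw [star_star]; exact hS.1⟩

theorem mem_leftStab {L : Submodule ℂ (L2R →L[ℂ] L2R)} {T : L2R →L[ℂ] L2R} :
    T ∈ leftStab L ↔ (∀ w ∈ L, T * w ∈ L) ∧ ∀ w ∈ L, star T * w ∈ L := Iff.rfl

theorem isClosed_leftStab {L : Submodule ℂ (L2R →L[ℂ] L2R)}
    (hL : IsClosed (L : Set (L2R →L[ℂ] L2R))) :
    IsClosed (leftStab L : Set (L2R →L[ℂ] L2R)) := by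
  have e : (leftStab L : Set (L2R →L[ℂ] L2R)) =
      (⋂ w ∈ L, {T | T * w ∈ L}) ∩ ⋂ w ∈ L, {T | star T * w ∈ L} := by
    ext T
    simp only [Set.mem_inter_iff, Set.mem_iInter, Set.mem_ofPred_eq, SetLike.mem_coe, mem_leftStab]
  rw [e]
  refine IsClosed.inter (isClosed_biInter fun w _ => ?_) (isClosed_biInter fun w _ => ?_)
  · exact hL.preimage (continuous_mul_const w)
  · have hs : Continuous fun T : L2R →L[ℂ] L2R => star T := continuous_star
    exact hL.preimage (hs.mul continuous_const)

/-- `𝔄` is the closure of the span of the operators `a(M) e^{ikM} b(D)` and the compact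
operators. -/
theorem mem_closure_prodSpan {A : L2R →L[ℂ] L2R} (hA : A ∈ 𝔄) :
    A ∈ (prodSpan (fun _ => True) ⊔ cptA).topologicalClosure := by
  set W := prodSpan (fun _ => True) ⊔ cptA with hW
  set L := W.topologicalClosure with hL
  have hLc : IsClosed (L : Set (L2R →L[ℂ] L2R)) := Submodule.isClosed_topologicalClosure _
  have ext : ∀ T : L2R →L[ℂ] L2R, (∀ w ∈ W, T * w ∈ W) → ∀ w ∈ L, T * w ∈ L := by
    intro T hT w hw
    exact map_mem_closure (continuous_const_mul T) hw hT
  have ext2 : ∀ T ∈ 𝔄, (∀ a k b, T * (erealM a * expM k * erealD b) ∈ W) → ∀ w ∈ L, T * w ∈ L := by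
    intro T hTA hT
    refine ext T fun w hw => ?_
    obtain ⟨w1, hw1, w2, hw2, rfl⟩ := Submodule.mem_sup.1 hw
    rw [mul_add]
    refine W.add_mem ?_ (Submodule.mem_sup_right (cptA_mul_left hTA hw2))
    refine Submodule.span_induction (p := fun w _ => T * w ∈ W) ?_ ?_ ?_ ?_ hw1
    · rintro _ ⟨a, k, b, -, rfl⟩
      exact hT a k b
    · rw [mul_zero]; exact W.zero_mem
    · intro x y _ _ hx hy
      rw [mul_add]; exact W.add_mem hx hy
    · intro c x _ hx
      rw [mul_smul_comm]; exact W.smul_mem _ hx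
  have hgen : ∀ a k b, erealM a * expM k * erealD b ∈ W := fun a k b =>
    Submodule.mem_sup_left (Submodule.subset_span ⟨a, k, b, trivial, rfl⟩)
  have g1 : ∀ a', ∀ w ∈ L, erealM a' * w ∈ L := fun a' => ext2 _ (erealM_mem a') fun a k b => by
    have e : erealM a' * (erealM a * expM k * erealD b) = erealM (a' * a) * expM k * erealD b := by
      rw [map_mul]; simp only [mul_assoc]
    rw [e]
    exact hgen _ _ _
  have g2 : ∀ k', ∀ w ∈ L, expM k' * w ∈ L := fun k' => ext2 _ (expM_mem k') fun a k b => by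
    have e : expM k' * (erealM a * expM k * erealD b) = erealM a * expM (k' + k) * erealD b := by
      rw [expM_add, ← mul_assoc, ← mul_assoc, ← erealM_expM]; simp only [mul_assoc]
    rw [e]
    exact hgen _ _ _
  have g3 : ∀ b', ∀ w ∈ L, erealD b' * w ∈ L := fun b' => ext2 _ (erealD_mem b') fun a k b => by
    obtain ⟨b'', hb, -⟩ := exists_erealD_expM b' k
    have e : erealD b' * (erealM a * expM k * erealD b) = erealM a * expM k * erealD (b'' * b) +
        (erealD b' * erealM a - erealM a * erealD b') * (expM k * erealD b) := by
      have e2 : erealM a * expM k * erealD (b'' * b) = erealM a * erealD b' * (expM k * erealD b) := by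
        rw [map_mul, mul_assoc (erealM a), ← mul_assoc (expM k), ← hb]; simp only [mul_assoc]
      rw [e2, sub_mul]
      simp only [mul_assoc]
      abel
    rw [e]
    refine W.add_mem (hgen _ _ _) (Submodule.mem_sup_right (cptA_mul_right ?_ ⟨?_, ?_⟩))
    · exact mul_mem (expM_mem k) (erealD_mem b)
    · exact isCompactOperator_commutator a b'
    · exact sub_mem (mul_mem (erealD_mem b') (erealM_mem a)) (mul_mem (erealM_mem a) (erealD_mem b'))
  have h𝔄 : 𝔄 ≤ leftStab L := 𝔄_le (isClosed_leftStab hLc)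
    (fun a => ⟨g1 a, by rw [← map_star]; exact g1 _⟩)
    (fun k => ⟨g2 k, by rw [star_expM]; exact g2 _⟩)
    (fun b => ⟨g3 b, by rw [← map_star]; exact g3 _⟩)
  have h1 : (1 : L2R →L[ℂ] L2R) ∈ L := by
    have := hgen 1 0 1
    rw [map_one, map_one, expM_zero, mul_one, mul_one] at this
    exact subset_closure this
  have := (h𝔄 hA).1 1 h1
  rwa [mul_one] at this

theorem erealD_eq_cutoff {b c : C(EReal, ℂ)} (b1 : b ⊤ = 1) (b0 : b ⊥ = 0) (c0 : c ⊤ = 0)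
    (c1 : c ⊥ = 1) (f : C(EReal, ℂ)) :
    ∃ φ, VanishInf φ ∧ f = f ⊤ • b + f ⊥ • c + φ :=
  ⟨f - f ⊤ • b - f ⊥ • c, by simp [VanishInf, b1, b0, c0, c1], by abel⟩

theorem exists_decomposition {b c : C(EReal, ℂ)} (b1 : b ⊤ = 1) (b0 : b ⊥ = 0) (c0 : c ⊤ = 0)
    (c1 : c ⊥ = 1) {T : L2R →L[ℂ] L2R} (hT : T ∈ prodSpan (fun _ => True)) :
    ∃ (H G : C(EReal × Circle, ℂ)) (T₀ : L2R →L[ℂ] L2R), T₀ ∈ prodSpan VanishInf ∧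
      T = pairM H * erealD b + pairM G * erealD c + T₀ := by
  induction hT using Submodule.span_induction with
  | mem T hT =>
    obtain ⟨a, k, f, -, rfl⟩ := hT
    obtain ⟨φ, hφ, hf⟩ := erealD_eq_cutoff b1 b0 c0 c1 f
    obtain ⟨F, -, hF⟩ := exists_expM_circle k
    have e : pairM (onFst a * onSnd F) = erealM a * expM k := by
      rw [map_mul, pairM_onFst, pairM_onSnd, hF]
    refine ⟨f ⊤ • (onFst a * onSnd F), f ⊥ • (onFst a * onSnd F), erealM a * expM k * erealD φ,
      Submodule.subset_span ⟨a, k, φ, hφ, rfl⟩, ?_⟩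
    rw [map_smul, map_smul, e]
    conv_lhs => rw [hf]
    rw [map_add, map_add, map_smul, map_smul, mul_add, mul_add, smul_mul_assoc, smul_mul_assoc,
      mul_smul_comm, mul_smul_comm]
  | zero => exact ⟨0, 0, 0, zero_mem _, by simp⟩
  | add S T _ _ hS hT =>
    obtain ⟨H, G, S₀, hS₀, rfl⟩ := hS
    obtain ⟨H', G', T₀, hT₀, rfl⟩ := hT
    exact ⟨H + H', G + G', S₀ + T₀, add_mem hS₀ hT₀, by rw [map_add, map_add, add_mul, add_mul]; abel⟩
  | smul t T _ hT =>
    obtain ⟨H, G, S₀, hS₀, rfl⟩ := hT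
    exact ⟨t • H, t • G, t • S₀, Submodule.smul_mem _ _ hS₀, by
      rw [map_smul, map_smul, smul_add, smul_add, smul_mul_assoc, smul_mul_assoc]⟩

theorem exists_splitting {b c : C(EReal, ℂ)} (b1 : b ⊤ = 1) (b0 : b ⊥ = 0) (c0 : c ⊤ = 0)
    (c1 : c ⊥ = 1) {T : L2R →L[ℂ] L2R} (hT : T ∈ prodSpan VanishInf) :
    ∃ B ∈ expSpan, ∃ C ∈ expSpan, ∃ K ∈ cptA, T = erealM b * B + erealM c * C + K := by
  induction hT using Submodule.span_induction with
  | mem T hT =>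
    obtain ⟨f, k, φ, hφ, rfl⟩ := hT
    obtain ⟨a, ha, hf⟩ := erealD_eq_cutoff b1 b0 c0 c1 f
    have hm : expM k * erealD φ ∈ expSpan := Submodule.subset_span ⟨k, φ, hφ, rfl⟩
    refine ⟨_, Submodule.smul_mem _ (f ⊤) hm, _, Submodule.smul_mem _ (f ⊥) hm,
      erealM a * expM k * erealD φ, ⟨?_, ?_⟩, ?_⟩
    · rw [erealM_expM, mul_assoc]
      exact (isCompactOperator_opM_opD ha hφ).clm_comp (expM k)
    · exact mul_mem (mul_mem (erealM_mem a) (expM_mem k)) (erealD_mem φ)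
    · conv_lhs => rw [hf]
      rw [map_add, map_add, map_smul, map_smul, mul_smul_comm, mul_smul_comm]
      simp only [add_mul, smul_mul_assoc, mul_assoc]
  | zero => exact ⟨0, zero_mem _, 0, zero_mem _, 0, zero_mem _, by simp⟩
  | add S T _ _ hS hT =>
    obtain ⟨B, hB, C, hC, K, hK, rfl⟩ := hS
    obtain ⟨B', hB', C', hC', K', hK', rfl⟩ := hT
    exact ⟨B + B', add_mem hB hB', C + C', add_mem hC hC', K + K', add_mem hK hK', by
      rw [mul_add, mul_add]; abel⟩
  | smul t T _ hT =>
    obtain ⟨B, hB, C, hC, K, hK, rfl⟩ := hT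
    exact ⟨t • B, Submodule.smul_mem _ _ hB, t • C, Submodule.smul_mem _ _ hC, t • K,
      Submodule.smul_mem _ _ hK, by rw [smul_add, smul_add, mul_smul_comm, mul_smul_comm]⟩

theorem norm_pairM_le_of {H : C(EReal × Circle, ℂ)} {C : ℝ} (hC : 0 ≤ C)
    (h : ∀ m : X, ‖H m.1‖ ≤ C) : ‖pairM H‖ ≤ C :=
  norm_opM_le (.pair H) hC fun x => h ⟨((x : EReal), Circle.exp x), .inr (.inr ⟨x, rfl, rfl⟩)⟩

/-- The kernel of a homomorphism on `𝔄`, as a space of operators. -/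
noncomputable def kerSub (σ : 𝔄 →⋆ₐ[ℂ] C(X × Bool, ℂ)) : Submodule ℂ (L2R →L[ℂ] L2R) where
  carrier := {T | ∃ A : 𝔄, (A : L2R →L[ℂ] L2R) = T ∧ σ A = 0}
  add_mem' := by
    rintro _ _ ⟨A, rfl, hA⟩ ⟨B, rfl, hB⟩
    exact ⟨A + B, rfl, by rw [map_add, hA, hB, add_zero]⟩
  zero_mem' := ⟨0, rfl, map_zero σ⟩
  smul_mem' := by
    rintro t _ ⟨A, rfl, hA⟩
    refine ⟨t • A, rfl, ?_⟩
    have hA' : σ A = 0 := hA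
    change σ (t • A) = 0
    rw [map_smul, hA']
    exact smul_zero (A := C(X × Bool, ℂ)) t

theorem mem_kerSub {σ : 𝔄 →⋆ₐ[ℂ] C(X × Bool, ℂ)} {A : 𝔄} :
    (A : L2R →L[ℂ] L2R) ∈ kerSub σ ↔ σ A = 0 :=
  ⟨fun ⟨_, h, hA⟩ => Subtype.ext h ▸ hA, fun h => ⟨A, rfl, h⟩⟩

theorem prodSpan_le_kerSub {σ : 𝔄 →⋆ₐ[ℂ] C(X × Bool, ℂ)}
    (h2 : ∀ (b : C(EReal, ℂ)) (A : 𝔄), (A : L2R →L[ℂ] L2R) = erealD b → σ A = symD b) :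
    prodSpan VanishInf ≤ kerSub σ := Submodule.span_le.2 (by
  rintro _ ⟨a, k, b, hb, rfl⟩
  refine ⟨⟨erealM a, erealM_mem a⟩ * ⟨expM k, expM_mem k⟩ * ⟨erealD b, erealD_mem b⟩, rfl, ?_⟩
  have e : symD b = 0 := by
    ext ⟨m, s⟩
    cases s
    · exact hb.1
    · exact hb.2
  rw [map_mul, h2 b ⟨erealD b, erealD_mem b⟩ rfl, e, mul_zero])

/-- Elements of the kernel of the principal symbol are limits of sums of operators
`a(M) e^{ikM} φ(D)`, `φ` vanishing at infinity, and compact operators. -/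
theorem exists_approx_of_symbol_eq_zero {σ : 𝔄 →⋆ₐ[ℂ] C(X × Bool, ℂ)}
    (h1 : ∀ (H : C(EReal × Circle, ℂ)) (A : 𝔄), (A : L2R →L[ℂ] L2R) = pairM H → σ A = symM H)
    (h2 : ∀ (b : C(EReal, ℂ)) (A : 𝔄), (A : L2R →L[ℂ] L2R) = erealD b → σ A = symD b)
    (h3 : ∀ A : 𝔄, IsCompactOperator (A : L2R →L[ℂ] L2R) → σ A = 0)
    (h4 : ∀ A : 𝔄, ‖σ A‖ ≤ ‖(A : L2R →L[ℂ] L2R)‖) {A : 𝔄} (hA : σ A = 0) {ε : ℝ} (hε : 0 < ε)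
    {b c : C(EReal, ℂ)} (b1 : b ⊤ = 1) (b0 : b ⊥ = 0) (c0 : c ⊤ = 0) (c1 : c ⊥ = 1)
    (hb : ∀ x, ‖b x‖ ≤ 1) (hc : ∀ x, ‖c x‖ ≤ 1) :
    ∃ B ∈ expSpan, ∃ C ∈ expSpan, ∃ K ∈ cptA,
      ‖(A : L2R →L[ℂ] L2R) - (erealM b * B + erealM c * C + K)‖ ≤ ε := by
  obtain ⟨w, hw, hd⟩ := Metric.mem_closure_iff.1 (mem_closure_prodSpan A.2) (ε / 3) (by positivity)
  obtain ⟨T, hT, K, hK, rfl⟩ := Submodule.mem_sup.1 hw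
  obtain ⟨H, G, T₀, hT₀, rfl⟩ := exists_decomposition b1 b0 c0 c1 hT
  obtain ⟨B, hB, C, hC, K', hK', hs⟩ := exists_splitting b1 b0 c0 c1 hT₀
  rw [dist_eq_norm] at hd
  obtain ⟨T₁, hT₁, hσ₁⟩ := prodSpan_le_kerSub h2 hT₀
  set w : 𝔄 := ⟨pairM H, pairM_mem H⟩ * ⟨erealD b, erealD_mem b⟩ +
      ⟨pairM G, pairM_mem G⟩ * ⟨erealD c, erealD_mem c⟩ with hw
  have hσw : σ w = symM H * symD b + symM G * symD c := by
    rw [hw, map_add, map_mul, map_mul, h1 H ⟨_, pairM_mem H⟩ rfl, h1 G ⟨_, pairM_mem G⟩ rfl,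
      h2 b ⟨_, erealD_mem b⟩ rfl, h2 c ⟨_, erealD_mem c⟩ rfl]
  have hσ : ‖σ (A - (w + T₁ + ⟨K, hK.2⟩))‖ ≤ ε / 3 := by
    refine (h4 _).trans (le_trans (le_of_eq ?_) hd.le)
    rw [← hT₁]
    rfl
  rw [map_sub, map_add, map_add, hA, hσ₁, h3 ⟨K, hK.2⟩ hK.1, add_zero, add_zero, zero_sub, norm_neg,
    hσw] at hσ
  have hH : ‖pairM H‖ ≤ ε / 3 := norm_pairM_le_of (by positivity) fun m => by
    refine le_trans (le_of_eq ?_) ((ContinuousMap.norm_coe_le_norm _ (m, true)).trans hσ)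
    change _ = ‖H m.1 * b ⊤ + G m.1 * c ⊤‖
    rw [b1, c0, mul_one, mul_zero, add_zero]
  have hG : ‖pairM G‖ ≤ ε / 3 := norm_pairM_le_of (by positivity) fun m => by
    refine le_trans (le_of_eq ?_) ((ContinuousMap.norm_coe_le_norm _ (m, false)).trans hσ)
    change _ = ‖H m.1 * b ⊥ + G m.1 * c ⊥‖
    rw [b0, c1, mul_one, mul_zero, zero_add]
  have nb : ‖erealD b‖ ≤ 1 := (opD_ereal_norm_le b).trans ((ContinuousMap.norm_le _ zero_le_one).2 hb)
  have nc : ‖erealD c‖ ≤ 1 := (opD_ereal_norm_le c).trans ((ContinuousMap.norm_le _ zero_le_one).2 hc)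
  refine ⟨B, hB, C, hC, K' + K, add_mem hK' hK, ?_⟩
  have e : (A : L2R →L[ℂ] L2R) - (erealM b * B + erealM c * C + (K' + K)) =
      ((A : L2R →L[ℂ] L2R) - (pairM H * erealD b + pairM G * erealD c + T₀ + K)) +
      pairM H * erealD b + pairM G * erealD c := by
    rw [hs]
    abel
  rw [e]
  have m1 : ‖pairM H * erealD b‖ ≤ ε / 3 * 1 :=
    (norm_mul_le _ _).trans (mul_le_mul hH nb (norm_nonneg _) (by positivity))
  have m2 : ‖pairM G * erealD c‖ ≤ ε / 3 * 1 :=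
    (norm_mul_le _ _).trans (mul_le_mul hG nc (norm_nonneg _) (by positivity))
  refine (norm_add₃_le).trans ?_
  linarith

end Structure

end SemiPeriodic

namespace SemiPeriodic

/-! ## Fibre decomposition of the operators commuting with `2π`-periodic functions -/

section Fibres

open Filter Topology

/-- Evaluation at a point of a homomorphism into an algebra of operator valued functions. -/
noncomputable def evalAt {R K H : Type*} [Semiring R] [Algebra ℂ R] [Star R] [TopologicalSpace K]
    [NormedAddCommGroup H] [InnerProductSpace ℂ H] [CompleteSpace H]
    (γ : R →⋆ₐ[ℂ] C(K, H →L[ℂ] H)) (v : K) : R →⋆ₐ[ℂ] (H →L[ℂ] H) where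
  toFun A := γ A v
  map_one' := by rw [map_one]; rfl
  map_mul' A B := by rw [map_mul]; rfl
  map_zero' := by rw [map_zero]; rfl
  map_add' A B := by rw [map_add]; rfl
  commutes' c := by rw [AlgHomClass.commutes]; rfl
  map_star' A := by rw [map_star]; rfl

theorem evalAt_apply {R K H : Type*} [Semiring R] [Algebra ℂ R] [Star R] [TopologicalSpace K]
    [NormedAddCommGroup H] [InnerProductSpace ℂ H] [CompleteSpace H]
    (γ : R →⋆ₐ[ℂ] C(K, H →L[ℂ] H)) (v : K) (A : R) : evalAt γ v A = γ A v := rfl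

theorem lintegral_eq_tsum_Ioc {T : ℝ} (hT : 0 < T) {F : ℝ → ℝ≥0∞} (hF : Measurable F) :
    ∫⁻ x, F x = ∫⁻ ξ in Set.Ioc 0 T, ∑' j : ℤ, F (ξ + j * T) := by
  rw [lintegral_tsum (fun j => by fun_prop), ← setLIntegral_univ, ← iUnion_Ioc_zsmul hT,
    lintegral_iUnion (fun _ => measurableSet_Ioc) (by
      simpa using Set.pairwise_disjoint_Ioc_add_zsmul (0 : ℝ) T)]
  refine tsum_congr fun j => ?_
  have h := (measurePreserving_add_right volume ((j : ℝ) * T)).setLIntegral_comp_preimage_emb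
    (measurableEmbedding_addRight _) F (Set.Ioc (j • T) ((j + 1) • T))
  rw [← h]
  congr 2
  ext x
  simp only [Set.mem_preimage, Set.mem_Ioc, zsmul_eq_mul, Int.cast_add, Int.cast_one]
  constructor <;> rintro ⟨h1, h2⟩ <;> constructor <;> linarith

theorem lintegral_enorm_sq (f : L2R) : ∫⁻ x, ‖f x‖ₑ ^ 2 = ENNReal.ofReal (‖f‖ ^ 2) := by
  rw [L2R.norm_sq_eq, ofReal_integral_eq_lintegral_ofReal]
  · refine lintegral_congr fun x => ?_
    rw [ENNReal.ofReal_pow (norm_nonneg _), ofReal_norm]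
  · exact (memLp_two_iff_integrable_sq_norm (Lp.aestronglyMeasurable f)).1 (Lp.memLp f)
  · exact .of_forall fun x => sq_nonneg _

theorem l2Z.norm_sq_eq_tsum (u : l2Z) : ENNReal.ofReal (‖u‖ ^ 2) = ∑' j, ‖u j‖ₑ ^ 2 := by
  have h := lp.hasSum_norm (p := 2) (by norm_num) u
  simp only [ENNReal.toReal_ofNat, Real.rpow_ofNat] at h
  rw [← h.tsum_eq, ENNReal.ofReal_tsum_of_nonneg (fun _ => sq_nonneg _) h.summable]
  refine tsum_congr fun j => ?_
  rw [ENNReal.ofReal_pow (norm_nonneg _), ofReal_norm]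

theorem exists_l2Z {a : ℤ → ℂ} (h : ∑' j, ‖a j‖ₑ ^ 2 ≠ ⊤) : ∃ u : l2Z, ∀ j, u j = a j := by
  refine ⟨⟨a, memℓp_gen ?_⟩, fun _ => rfl⟩
  simp only [ENNReal.toReal_ofNat, Real.rpow_ofNat]
  have h2 : ∑' j, ((‖a j‖₊ ^ 2 : NNReal) : ℝ≥0∞) ≠ ⊤ := by
    simp only [ENNReal.coe_pow]
    exact h
  have h3 := NNReal.summable_coe.2 (ENNReal.tsum_coe_ne_top_iff_summable.1 h2)
  simpa only [NNReal.coe_pow, coe_nnnorm] using h3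

theorem norm_le_of_fibres {g h : L2R} {C T : ℝ} (hC : 0 ≤ C) (hT : 0 < T)
    (H : ∀ᵐ ξ : ℝ, ∀ u : l2Z, (∀ j : ℤ, u j = g (ξ + j * T)) →
      ∃ v : l2Z, (∀ j : ℤ, v j = h (ξ + j * T)) ∧ ‖v‖ ≤ C * ‖u‖) : ‖h‖ ≤ C * ‖g‖ := by
  have mg : Measurable fun x => ‖g x‖ₑ ^ 2 := (Lp.stronglyMeasurable g).measurable.enorm.pow_const 2
  have mh : Measurable fun x => ‖h x‖ₑ ^ 2 := (Lp.stronglyMeasurable h).measurable.enorm.pow_const 2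
  have eg := lintegral_enorm_sq g
  have eh := lintegral_enorm_sq h
  rw [lintegral_eq_tsum_Ioc hT mg] at eg
  rw [lintegral_eq_tsum_Ioc hT mh] at eh
  have mg' : Measurable fun ξ => ∑' j : ℤ, ‖g (ξ + j * T)‖ₑ ^ 2 :=
    Measurable.tsum fun _ => mg.comp (measurable_add_const _)
  have hfin := ae_lt_top mg' (eg.trans_ne ENNReal.ofReal_ne_top)
  have key : ENNReal.ofReal (‖h‖ ^ 2) ≤ ENNReal.ofReal (C ^ 2) * ENNReal.ofReal (‖g‖ ^ 2) := by
    rw [← eg, ← eh, ← lintegral_const_mul _ mg']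
    refine lintegral_mono_ae ?_
    filter_upwards [hfin, ae_restrict_of_ae H] with ξ h1 h2
    obtain ⟨u, hu⟩ := exists_l2Z h1.ne
    obtain ⟨v, hv, hle⟩ := h2 u hu
    simp only [← hu, ← hv]
    rw [← l2Z.norm_sq_eq_tsum, ← l2Z.norm_sq_eq_tsum, ← ENNReal.ofReal_mul (sq_nonneg _), ← mul_pow]
    exact ENNReal.ofReal_le_ofReal (pow_le_pow_left₀ (norm_nonneg _) hle 2)
  rw [← ENNReal.ofReal_mul (sq_nonneg _), ← mul_pow,
    ENNReal.ofReal_le_ofReal_iff (by positivity)] at key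
  exact le_of_sq_le_sq key (by positivity)

theorem diagE_apply_apply (d : C(EReal, ℂ)) (u : l2Z) (j : ℤ) :
    diagE d u j = d ((j : ℝ) : EReal) * u j :=
  diagOp_apply ⟨‖d‖, fun _ => d.norm_coe_le_norm _⟩ u j

theorem Y_int_apply (k : ℤ) (u : l2Z) (j : ℤ) : Y k u j = u (j + k) := by
  have h2 : inner ℂ (basisVec j) (Y k u) = inner ℂ (Y (-k) (basisVec j)) u := by
    rw [← star_Y]
    exact (ContinuousLinearMap.adjoint_inner_left (Y k) u (basisVec j)).symm
  have h3 := Y_int (-k) j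
  push_cast at h3
  rw [h3, inner_basisVec, inner_basisVec, sub_neg_eq_add] at h2
  exact h2

/-- `S` describes the boundary symbol of `B` and the action of `B` on the fibres of the Fourier
transform modulo `(2π)⁻¹ ℤ`. -/
def HasFibres (γ : 𝔄 →⋆ₐ[ℂ] C(Circle × Bool, 𝔅)) (B : L2R →L[ℂ] L2R) (S : ℝ → 𝔅) : Prop :=
  (∀ A : 𝔄, (A : L2R →L[ℂ] L2R) = B → ∀ (φ : ℝ) (s : Bool),
    evalAt γ (Circle.exp (2 * Real.pi * φ), s) A = Y φ * S φ * Y (-φ)) ∧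
  ∀ f : L2R, ∀ᵐ ξ : ℝ, ∀ u : l2Z, (∀ j : ℤ, u j = FT f (ξ + j * (2 * Real.pi)⁻¹)) →
    ∀ j : ℤ, S (-(2 * Real.pi * ξ)) u j = FT (B f) (ξ + j * (2 * Real.pi)⁻¹)

theorem ae_shift {p : ℝ → Prop} (h : ∀ᵐ x, p x) (T : ℝ) : ∀ᵐ ξ : ℝ, ∀ j : ℤ, p (ξ + j * T) :=
  ae_all_iff.2 fun j => (measurePreserving_add_right volume ((j : ℝ) * T)).quasiMeasurePreserving.ae h

theorem hasFibres_generator {γ : 𝔄 →⋆ₐ[ℂ] C(Circle × Bool, 𝔅)} (hγ : IsBoundarySymbol γ)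
    (k : ℤ) (b : C(EReal, ℂ)) :
    HasFibres γ (expM k * erealD b) fun φ => Y (-k) * diagE (shiftE b φ) := by
  constructor
  · intro A hA φ s
    have e : A = ⟨expM k, expM_mem k⟩ * ⟨erealD b, erealD_mem b⟩ := Subtype.ext hA
    have e1 := hγ.2.1 k ⟨expM k, expM_mem k⟩ rfl (Circle.exp (2 * Real.pi * φ)) s
    have e2 := hγ.2.2 b ⟨erealD b, erealD_mem b⟩ rfl φ s
    rw [← bsymR_eq, bsymR] at e2
    rw [e, map_mul, evalAt_apply, evalAt_apply, e1, e2]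
    simp only [← mul_assoc, ← Y_add]
    rw [add_comm]
  · intro f
    have h1 := FT_opD (fun x : ℝ => b x) f
    have h2 : FT ((expM k * erealD b) f) =
        translate (k / (2 * Real.pi)) (FT (erealD b f)) := FT_exp k (erealD b f)
    have h3 := ae_shift (translate_coeFn (k / (2 * Real.pi)) (FT (erealD b f))) (2 * Real.pi)⁻¹
    have h4 := ae_shift (opM_coeFn (BddMeas.ereal b).scale (FT f)) (2 * Real.pi)⁻¹
    filter_upwards [h3, h4] with ξ h3 h4 u hu j
    rw [h2, h3, mul_apply_eq_comp]
    have e := Y_int_apply (-k) (diagE (shiftE b (-(2 * Real.pi * ξ))) u) j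
    push_cast at e
    rw [e, diagE_apply_apply, shiftE_apply, hu]
    have e5 : ξ + j * (2 * Real.pi)⁻¹ - k / (2 * Real.pi) = ξ + ((j + -k : ℤ) : ℝ) * (2 * Real.pi)⁻¹ := by
      push_cast; ring
    rw [e5, erealD_apply, h1]
    refine Eq.trans ?_ (h4 _).symm
    congr 3
    push_cast
    field_simp
    ring_nf

theorem exists_hasFibres {γ : 𝔄 →⋆ₐ[ℂ] C(Circle × Bool, 𝔅)} (hγ : IsBoundarySymbol γ)
    {B : L2R →L[ℂ] L2R} (hB : B ∈ expSpan) : ∃ S, HasFibres γ B S := by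
  have key : B ∈ expSpan ∧ ∃ S, HasFibres γ B S := by
    refine Submodule.span_induction (p := fun B _ => B ∈ expSpan ∧ ∃ S, HasFibres γ B S)
      ?_ ?_ ?_ ?_ hB
    · rintro _ ⟨k, b, hb, rfl⟩
      exact ⟨Submodule.subset_span ⟨k, b, hb, rfl⟩, _, hasFibres_generator hγ k b⟩
    · refine ⟨zero_mem _, fun _ => 0, fun A hA φ s => ?_, fun f => ?_⟩
      · have e : A = 0 := Subtype.ext hA
        rw [e, map_zero]
        simp
      · have h := ae_shift (Lp.coeFn_zero ℂ 2 (volume : Measure ℝ)) (2 * Real.pi)⁻¹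
        filter_upwards [h] with ξ h u hu j
        rw [zero_apply, zero_apply, map_zero]
        exact (h j).symm
    · rintro B C - - ⟨hB, S, h1, h2⟩ ⟨hC, S', h1', h2'⟩
      refine ⟨add_mem hB hC, fun φ => S φ + S' φ, fun A hA φ s => ?_, fun f => ?_⟩
      · have e : A = ⟨B, expSpan_le B hB⟩ + ⟨C, expSpan_le C hC⟩ := Subtype.ext hA
        rw [e, map_add, h1 ⟨B, expSpan_le B hB⟩ rfl φ s,
          h1' ⟨C, expSpan_le C hC⟩ rfl φ s, mul_add, add_mul]
      · have h := ae_shift (Lp.coeFn_add (FT (B f)) (FT (C f))) (2 * Real.pi)⁻¹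
        filter_upwards [h, h2 f, h2' f] with ξ h h2 h2' u hu j
        rw [add_apply, add_apply, map_add, h, lp.coeFn_add, Pi.add_apply, h2 u hu, h2' u hu]
        rfl
    · rintro t B - ⟨hB, S, h1, h2⟩
      refine ⟨Submodule.smul_mem _ t hB, fun φ => t • S φ, fun A hA φ s => ?_, fun f => ?_⟩
      · have e : A = t • ⟨B, expSpan_le B hB⟩ := Subtype.ext hA
        rw [e, map_smul, h1 ⟨B, expSpan_le B hB⟩ rfl φ s,
          mul_smul_comm, smul_mul_assoc]
      · have h := ae_shift (Lp.coeFn_smul t (FT (B f))) (2 * Real.pi)⁻¹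
        filter_upwards [h, h2 f] with ξ h h2 u hu j
        rw [smul_apply, smul_apply, map_smul, h, lp.coeFn_smul, Pi.smul_apply, h2 u hu]
        rfl
  exact key.2

/-- On the closure of the span of the operators `e^{ikM} φ(D)`, the boundary symbol is
isometric. -/
theorem norm_le_boundarySymbol {γ : 𝔄 →⋆ₐ[ℂ] C(Circle × Bool, 𝔅)} (hγ : IsBoundarySymbol γ)
    {B : 𝔄} (hB : (B : L2R →L[ℂ] L2R) ∈ expSpan) {C : ℝ} (s : Bool) (hC : 0 ≤ C)
    (h : ∀ z, ‖evalAt γ (z, s) B‖ ≤ C) : ‖(B : L2R →L[ℂ] L2R)‖ ≤ C := by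
  obtain ⟨S, h1, h2⟩ := exists_hasFibres hγ hB
  have hS : ∀ φ, ‖S φ‖ ≤ C := fun φ => by
    have e : S φ = Y (-φ) * evalAt γ (Circle.exp (2 * Real.pi * φ), s) B * Y φ := by
      rw [h1 B rfl φ s, ← mul_assoc, ← mul_assoc, Y_neg_mul, one_mul, mul_assoc, Y_neg_mul, mul_one]
    rw [e]
    refine (norm_mul_le _ _).trans ?_
    refine (mul_le_of_le_one_right (norm_nonneg _) (norm_Y_le _)).trans ?_
    refine (norm_mul_le _ _).trans ?_
    exact (mul_le_of_le_one_left (norm_nonneg _) (norm_Y_le _)).trans (h _)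
  refine ContinuousLinearMap.opNorm_le_bound _ hC fun f => ?_
  rw [← FT.norm_map, ← FT.norm_map f]
  refine norm_le_of_fibres hC (inv_pos.2 Real.two_pi_pos) ?_
  filter_upwards [h2 f] with ξ h2 u hu
  exact ⟨S (-(2 * Real.pi * ξ)) u, h2 u hu, ContinuousLinearMap.le_of_opNorm_le _ (hS _) u⟩

end Fibres

end SemiPeriodic

namespace SemiPeriodic

/-! ## The ideal `𝔈/𝔎_ℝ` and the boundary symbol -/

section Ideal

open Filter Topology

/-- A principal symbol and a boundary principal symbol, with the properties used below. -/
structure SymbolPair (σ : 𝔄 →⋆ₐ[ℂ] C(X × Bool, ℂ)) (γ : 𝔄 →⋆ₐ[ℂ] C(Circle × Bool, 𝔅)) : Prop where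
  isPrincipal : IsPrincipalSymbol σ
  pairM : ∀ (H : C(EReal × Circle, ℂ)) (A : 𝔄), (A : L2R →L[ℂ] L2R) = pairM H → σ A = symM H
  erealD : ∀ (b : C(EReal, ℂ)) (A : 𝔄), (A : L2R →L[ℂ] L2R) = erealD b → σ A = symD b
  compact : ∀ A : 𝔄, IsCompactOperator (A : L2R →L[ℂ] L2R) → σ A = 0
  norm_le : ∀ A : 𝔄, ‖σ A‖ ≤ ‖(A : L2R →L[ℂ] L2R)‖
  isBoundary : IsBoundarySymbol γ
  bdry_compact : ∀ A : 𝔄, IsCompactOperator (A : L2R →L[ℂ] L2R) → ∀ v, evalAt γ v A = 0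
  bdry_norm_le : ∀ (A : 𝔄) (v), ‖evalAt γ v A‖ ≤ ‖(A : L2R →L[ℂ] L2R)‖

theorem exists_symbolPair : ∃ σ γ, SymbolPair σ γ := by
  obtain ⟨σ, h1, h2, h3, h4, h5⟩ := exists_isPrincipalSymbol
  obtain ⟨γ, g1, g2, g3⟩ := exists_isBoundarySymbol
  refine ⟨σ, γ, h1, h2, h3, h4, h5, g1, fun A hA v => ?_, fun A v => ?_⟩
  · rw [evalAt_apply, g2 A hA]
    rfl
  · exact (ContinuousMap.norm_coe_le_norm (γ A) v).trans (g3 A)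

/-- A space of operator valued functions that is a module over the scalar functions and is dense in
every fibre is dense. -/
theorem exists_near_of_fibres {K E : Type*} [TopologicalSpace K] [CompactSpace K] [T2Space K]
    [NormedAddCommGroup E] [NormedSpace ℂ E] (D : Submodule ℂ (K → E))
    (hc : ∀ d ∈ D, Continuous d) (hD : ∀ (g : C(K, ℂ)), ∀ d ∈ D, (fun z => g z • d z) ∈ D)
    {f : K → E} (hf : Continuous f) {ε : ℝ} (h : ∀ z, ∃ d ∈ D, ‖d z - f z‖ < ε) :
    ∃ d ∈ D, ∀ z, ‖d z - f z‖ ≤ ε := by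
  choose d hd hdz using h
  set U : K → Set K := fun y => {z | ‖d y z - f z‖ < ε}
  have hU : ∀ y, IsOpen (U y) := fun y =>
    isOpen_lt ((hc _ (hd y)).sub hf).norm continuous_const
  obtain ⟨t, ht⟩ := isCompact_univ.elim_finite_subcover U hU fun z _ =>
    Set.mem_iUnion.2 ⟨z, hdz z⟩
  obtain ⟨p, hp⟩ := PartitionOfUnity.exists_isSubordinate isClosed_univ (fun y : t => U y)
    (fun y => hU y) (by
      intro z hz
      obtain ⟨y, hy, hzy⟩ := Set.mem_iUnion₂.1 (ht hz)
      exact Set.mem_iUnion.2 ⟨⟨y, hy⟩, hzy⟩)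
  have hsum : ∀ z, ∑ y, p y z = 1 := fun z => by
    rw [← finsum_eq_sum_of_fintype]
    exact p.sum_eq_one (Set.mem_univ z)
  refine ⟨fun z => ∑ y, ((p y z : ℝ) : ℂ) • d y z, ?_, fun z => ?_⟩
  · have : (fun z => ∑ y, ((p y z : ℝ) : ℂ) • d y z) = ∑ y, fun z => ((p y z : ℝ) : ℂ) • d y z := by
      ext z
      rw [Finset.sum_apply]
    rw [this]
    exact Submodule.sum_mem _ fun y _ => hD ⟨fun z => ((p y z : ℝ) : ℂ),
      Complex.continuous_ofReal.comp (p y).continuous⟩ _ (hd _)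
  · have e : ∑ y, ((p y z : ℝ) : ℂ) • d y z - f z = ∑ y, ((p y z : ℝ) : ℂ) • (d y z - f z) := by
      simp only [smul_sub, Finset.sum_sub_distrib, ← Finset.sum_smul]
      rw [← Complex.ofReal_sum, hsum, Complex.ofReal_one, one_smul]
    rw [e]
    calc ‖∑ y, ((p y z : ℝ) : ℂ) • (d y z - f z)‖ ≤ ∑ y, p y z * ε := by
          refine (norm_sum_le _ _).trans (Finset.sum_le_sum fun y _ => ?_)
          rw [norm_smul, Complex.norm_real, Real.norm_of_nonneg (p.nonneg y z)]
          by_cases hz : z ∈ tsupport (p y)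
          · exact mul_le_mul_of_nonneg_left (le_of_lt (hp y hz)) (p.nonneg y z)
          · rw [image_eq_zero_of_notMem_tsupport hz, zero_mul, zero_mul]
      _ = ε := by rw [← Finset.sum_mul, hsum, one_mul]

variable {σ : 𝔄 →⋆ₐ[ℂ] C(X × Bool, ℂ)} {γ : 𝔄 →⋆ₐ[ℂ] C(Circle × Bool, 𝔅)}

theorem evalAt_expSpan_generator (hγ : IsBoundarySymbol γ) (k : ℤ) (b : C(EReal, ℂ)) {A : 𝔄}
    (hA : (A : L2R →L[ℂ] L2R) = expM k * erealD b) (φ : ℝ) (s : Bool) :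
    evalAt γ (Circle.exp (2 * Real.pi * φ), s) A = Y (-k) * bsymR b φ := by
  have e : A = ⟨expM k, expM_mem k⟩ * ⟨erealD b, erealD_mem b⟩ := Subtype.ext hA
  have e1 := hγ.2.1 k ⟨expM k, expM_mem k⟩ rfl (Circle.exp (2 * Real.pi * φ)) s
  have e2 := hγ.2.2 b ⟨erealD b, erealD_mem b⟩ rfl φ s
  rw [← bsymR_eq] at e2
  rw [e, map_mul, evalAt_apply, evalAt_apply, e1, e2]

theorem isCompactOperator_evalAt_expSpan (hγ : IsBoundarySymbol γ) {B : 𝔄}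
    (hB : (B : L2R →L[ℂ] L2R) ∈ expSpan) (v : Circle × Bool) : IsCompactOperator (evalAt γ v B) := by
  have key : ∀ T ∈ expSpan, ∀ A : 𝔄, (A : L2R →L[ℂ] L2R) = T → IsCompactOperator (evalAt γ v A) := by
    intro T hT
    have : T ∈ expSpan ∧ ∀ A : 𝔄, (A : L2R →L[ℂ] L2R) = T → IsCompactOperator (evalAt γ v A) := by
      refine Submodule.span_induction (p := fun T _ => T ∈ expSpan ∧
        ∀ A : 𝔄, (A : L2R →L[ℂ] L2R) = T → IsCompactOperator (evalAt γ v A)) ?_ ?_ ?_ ?_ hT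
      · rintro _ ⟨k, b, hb, rfl⟩
        refine ⟨Submodule.subset_span ⟨k, b, hb, rfl⟩, fun A hA => ?_⟩
        obtain ⟨z, s⟩ := v
        obtain ⟨φ, rfl⟩ := exists_exp_two_pi z
        rw [evalAt_expSpan_generator hγ k b hA]
        exact (isCompactOperator_bsymR hb φ).clm_comp (Y (-k))
      · refine ⟨zero_mem _, fun A hA => ?_⟩
        have e : A = 0 := Subtype.ext hA
        rw [e, map_zero]
        exact isCompactOperator_zero
      · rintro B C - - ⟨hB, h1⟩ ⟨hC, h2⟩
        refine ⟨add_mem hB hC, fun A hA => ?_⟩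
        have e : A = ⟨B, expSpan_le B hB⟩ + ⟨C, expSpan_le C hC⟩ := Subtype.ext hA
        rw [e, map_add]
        exact (h1 _ rfl).add (h2 _ rfl)
      · rintro t B - ⟨hB, h1⟩
        refine ⟨Submodule.smul_mem _ t hB, fun A hA => ?_⟩
        have e : A = t • ⟨B, expSpan_le B hB⟩ := Subtype.ext hA
        rw [e, map_smul]
        exact IsCompactOperator.smul (S := ℂ) (h1 _ rfl) t
    exact this.2
  exact key _ hB B rfl

/-- Multiplication of the symbol by a scalar function on the circle. -/
theorem exists_smul_expSpan (hγ : IsBoundarySymbol γ) (g : C(Circle, ℂ)) {B : 𝔄}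
    (hB : (B : L2R →L[ℂ] L2R) ∈ expSpan) :
    ∃ B' : 𝔄, (B' : L2R →L[ℂ] L2R) ∈ expSpan ∧
      ∀ z s, evalAt γ (z, s) B' = g z • evalAt γ (z, s) B := by
  have key : ∀ T ∈ expSpan, T ∈ expSpan ∧ ∃ B' : 𝔄, (B' : L2R →L[ℂ] L2R) ∈ expSpan ∧
      ∀ A : 𝔄, (A : L2R →L[ℂ] L2R) = T → ∀ z s, evalAt γ (z, s) B' = g z • evalAt γ (z, s) A := by
    intro T hT
    refine Submodule.span_induction (p := fun T _ => T ∈ expSpan ∧ ∃ B' : 𝔄,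
      (B' : L2R →L[ℂ] L2R) ∈ expSpan ∧ ∀ A : 𝔄, (A : L2R →L[ℂ] L2R) = T →
        ∀ z s, evalAt γ (z, s) B' = g z • evalAt γ (z, s) A) ?_ ?_ ?_ ?_ hT
    · rintro _ ⟨k, b, hb, rfl⟩
      obtain ⟨C, hC⟩ := (isCompact_range g.continuous).isBounded.exists_norm_le
      have hg : ∀ x : ℝ, ‖g (Circle.exp (-(2 * Real.pi * x)))‖ ≤ C := fun x => hC _ ⟨_, rfl⟩
      have hvan : ∀ l : Filter ℝ, Tendsto (fun x : ℝ => b x) l (𝓝 0) →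
          Tendsto (fun x : ℝ => g (Circle.exp (-(2 * Real.pi * x))) * b x) l (𝓝 0) := fun l hl => by
        rw [tendsto_zero_iff_norm_tendsto_zero] at hl ⊢
        refine squeeze_zero (fun _ => norm_nonneg _) (fun x => ?_)
          (by simpa using hl.const_mul C)
        rw [norm_mul]
        exact mul_le_mul_of_nonneg_right (hg x) (norm_nonneg _)
      obtain ⟨b', hb', b0, b1⟩ := exists_ereal_extension
        (fun x : ℝ => g (Circle.exp (-(2 * Real.pi * x))) * b x)
        ((g.continuous.comp (Circle.exp.continuous.comp (by fun_prop))).mul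
          (b.continuous.comp continuous_coe_real_ereal))
        (hvan _ (by have := tendsto_ereal_atBot b; rwa [hb.1] at this))
        (hvan _ (by have := tendsto_ereal_atTop b; rwa [hb.2] at this))
      have hm : expM k * erealD b' ∈ expSpan := Submodule.subset_span ⟨k, b', ⟨b0, b1⟩, rfl⟩
      refine ⟨Submodule.subset_span ⟨k, b, hb, rfl⟩, ⟨_, expSpan_le _ hm⟩, hm, fun A hA z s => ?_⟩
      obtain ⟨φ, rfl⟩ := exists_exp_two_pi z
      rw [evalAt_expSpan_generator hγ k b hA, evalAt_expSpan_generator hγ k b' rfl,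
        ← mul_smul_comm, bsymR, bsymR, ← smul_mul_assoc, ← mul_smul_comm]
      congr 3
      refine ext_basisVec fun j => ?_
      rw [diagE_basisVec, smul_apply, diagE_basisVec, shiftE_apply, shiftE_apply, hb', smul_smul]
      congr 3
      rw [← Circle.periodic_exp.int_mul (-j) (2 * Real.pi * φ)]
      congr 1
      push_cast
      ring
    · refine ⟨zero_mem _, 0, zero_mem _, fun A hA z s => ?_⟩
      have e : A = 0 := Subtype.ext hA
      rw [e, map_zero, smul_zero]
    · rintro B C - - ⟨hB, B', hB', h1⟩ ⟨hC, C', hC', h2⟩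
      refine ⟨add_mem hB hC, B' + C', add_mem hB' hC', fun A hA z s => ?_⟩
      have e : A = ⟨B, expSpan_le B hB⟩ + ⟨C, expSpan_le C hC⟩ := Subtype.ext hA
      rw [e, map_add, map_add, h1 ⟨B, expSpan_le B hB⟩ rfl, h2 ⟨C, expSpan_le C hC⟩ rfl, smul_add]
    · rintro t B - ⟨hB, B', hB', h1⟩
      refine ⟨Submodule.smul_mem _ t hB, t • B', Submodule.smul_mem _ t hB', fun A hA z s => ?_⟩
      have e : A = t • ⟨B, expSpan_le B hB⟩ := Subtype.ext hA
      rw [e, map_smul, map_smul, h1 ⟨B, expSpan_le B hB⟩ rfl, smul_comm]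
  obtain ⟨-, B', hB', h⟩ := key _ hB
  exact ⟨B', hB', h B rfl⟩

/-- A continuous function with `b 0 = 1` and vanishing at the other integers. -/
theorem exists_bump (φ : ℝ) (j : ℤ) : ∃ b : C(EReal, ℂ), VanishInf b ∧
    diagE (shiftE b φ) = matUnit j j := by
  obtain ⟨b, hb, b0, b1⟩ := exists_ereal_extension
    (fun x : ℝ => ((max 0 (1 - |x - (j - φ)|) : ℝ) : ℂ)) (l₁ := 0) (l₂ := 0) (by fun_prop)
    (tendsto_const_nhds.congr' (by
      filter_upwards [eventually_le_atBot (j - φ - 1)] with x hx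
      have h : 1 - |x - (j - φ)| ≤ 0 := by linarith [neg_le_abs (x - (j - φ))]
      rw [max_eq_left h, Complex.ofReal_zero]))
    (tendsto_const_nhds.congr' (by
      filter_upwards [eventually_ge_atTop (j - φ + 1)] with x hx
      have h : 1 - |x - (j - φ)| ≤ 0 := by linarith [le_abs_self (x - (j - φ))]
      rw [max_eq_left h, Complex.ofReal_zero]))
  refine ⟨b, ⟨b0, b1⟩, ext_basisVec fun i => ?_⟩
  rw [diagE_basisVec, matUnit_basisVec, shiftE_apply, hb, sub_sub_sub_cancel_right]
  split_ifs with h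
  · subst h
    simp
  · have h1 : (1 : ℝ) ≤ |(i : ℝ) - j| := by
      have : (1 : ℤ) ≤ |i - j| := Int.one_le_abs (sub_ne_zero.2 (Ne.symm h))
      exact_mod_cast this
    rw [max_eq_left (by linarith), Complex.ofReal_zero, zero_smul]

theorem exists_matUnit_expSpan (hγ : IsBoundarySymbol γ) (φ : ℝ) (i j : ℤ) :
    ∃ B : 𝔄, (B : L2R →L[ℂ] L2R) ∈ expSpan ∧ ∀ s,
      evalAt γ (Circle.exp (2 * Real.pi * φ), s) B = Y φ * matUnit i j * Y (-φ) := by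
  obtain ⟨b, hb, h⟩ := exists_bump φ j
  have hm : expM (i - j) * erealD b ∈ expSpan := Submodule.subset_span ⟨i - j, b, hb, rfl⟩
  refine ⟨⟨_, expSpan_le _ hm⟩, hm, fun s => ?_⟩
  rw [evalAt_expSpan_generator hγ (i - j) b rfl, bsymR, h, ← mul_assoc, ← mul_assoc, ← Y_add,
    add_comm, Y_add, mul_assoc (Y φ)]
  congr 2
  refine ext_basisVec fun k => ?_
  have e := Y_int (-(i - j)) j
  rw [mul_apply_eq_comp, matUnit_basisVec, matUnit_basisVec]
  push_cast at e ⊢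
  split_ifs
  · rw [e]
    congr 1
    ring
  · rw [map_zero]

theorem exists_near_expSpan (hγ : IsBoundarySymbol γ) {f : Circle → 𝔅} (hf : Continuous f)
    (hc : ∀ z, IsCompactOperator (f z)) (s : Bool) {ε : ℝ} (hε : 0 < ε) :
    ∃ B : 𝔄, (B : L2R →L[ℂ] L2R) ∈ expSpan ∧ ∀ z, ‖evalAt γ (z, s) B - f z‖ ≤ ε := by
  set D : Submodule ℂ (Circle → 𝔅) :=
    { carrier := {d | ∃ B : 𝔄, (B : L2R →L[ℂ] L2R) ∈ expSpan ∧ ∀ z, d z = evalAt γ (z, s) B}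
      add_mem' := by
        rintro d d' ⟨B, hB, h⟩ ⟨B', hB', h'⟩
        exact ⟨B + B', add_mem hB hB', fun z => by rw [Pi.add_apply, h, h', map_add]⟩
      zero_mem' := ⟨0, zero_mem _, fun z => by rw [map_zero]; rfl⟩
      smul_mem' := by
        rintro t d ⟨B, hB, h⟩
        exact ⟨t • B, Submodule.smul_mem _ t hB, fun z => by rw [Pi.smul_apply, h, map_smul]⟩ }
    with hD
  obtain ⟨d, ⟨B, hB, h⟩, hd⟩ := exists_near_of_fibres D (f := f) (ε := ε) (by
      rintro d ⟨B, hB, h⟩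
      rw [show d = fun z => γ B (z, s) from funext h]
      exact (γ B).continuous.comp (by fun_prop)) (by
      rintro g d ⟨B, hB, h⟩
      obtain ⟨B', hB', h'⟩ := exists_smul_expSpan hγ g hB
      exact ⟨B', hB', fun z => by rw [h', ← h]⟩) hf (by
      intro z
      obtain ⟨φ, rfl⟩ := exists_exp_two_pi z
      set K := Y (-φ) * f (Circle.exp (2 * Real.pi * φ)) * Y φ with hK
      have hKc : IsCompactOperator K := ((hc _).clm_comp (Y (-φ))).comp_clm (Y φ)
      obtain ⟨N, hN⟩ := ((tendsto_iff_norm_sub_tendsto_zero.1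
        (tendsto_trunc_mul_trunc hKc)).eventually (gt_mem_nhds hε)).exists
      choose B hB hBγ using fun i j => exists_matUnit_expSpan hγ φ i j
      refine ⟨fun z => evalAt γ (z, s) (∑ i ∈ Finset.Icc (-(N : ℤ)) N, ∑ j ∈ Finset.Icc (-(N : ℤ)) N,
        K (basisVec j) i • B i j), ⟨_, ?_, fun _ => rfl⟩, ?_⟩
      · have : ∀ (t : Finset ℤ) (F : ℤ → 𝔄), (∀ i, (F i : L2R →L[ℂ] L2R) ∈ expSpan) →
            ((∑ i ∈ t, F i : 𝔄) : L2R →L[ℂ] L2R) ∈ expSpan := fun t F hF => by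
          rw [AddSubmonoidClass.coe_finsetSum]
          exact sum_mem fun i _ => hF i
        exact this _ _ fun i => this _ _ fun j => Submodule.smul_mem _ _ (hB i j)
      · have e : evalAt γ (Circle.exp (2 * Real.pi * φ), s) (∑ i ∈ Finset.Icc (-(N : ℤ)) N,
            ∑ j ∈ Finset.Icc (-(N : ℤ)) N, K (basisVec j) i • B i j) =
            Y φ * (trunc N * K * trunc N) * Y (-φ) := by
          rw [trunc_mul_mul_trunc]
          simp only [map_sum, map_smul, hBγ, Finset.mul_sum, Finset.sum_mul, mul_smul_comm,
            smul_mul_assoc]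
        have e2 : f (Circle.exp (2 * Real.pi * φ)) = Y φ * K * Y (-φ) := by
          rw [hK, ← mul_assoc, ← mul_assoc, Y_mul_neg, one_mul, mul_assoc _ (Y φ),
            Y_mul_neg, mul_one]
        change ‖evalAt γ (Circle.exp (2 * Real.pi * φ), s) _ - _‖ < ε
        rw [e, e2, ← sub_mul, ← mul_sub]
        refine lt_of_le_of_lt ?_ hN
        refine (norm_mul_le _ _).trans ?_
        refine (mul_le_of_le_one_right (norm_nonneg _) (norm_Y_le _)).trans ?_
        refine (norm_mul_le _ _).trans ?_
        exact mul_le_of_le_one_left (norm_nonneg _) (norm_Y_le _))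
  exact ⟨B, hB, fun z => by rw [← h]; exact hd z⟩

end Ideal

end SemiPeriodic

namespace SemiPeriodic

section IdealIso

open Filter Topology

variable {σ : 𝔄 →⋆ₐ[ℂ] C(X × Bool, ℂ)} {γ : 𝔄 →⋆ₐ[ℂ] C(Circle × Bool, 𝔅)}

/-- Cut-off functions near `±∞`, as elements of `𝔄`. -/
structure EndCutoffs (γ : 𝔄 →⋆ₐ[ℂ] C(Circle × Bool, 𝔅)) (M : Bool → 𝔄) : Prop where
  norm_le : ∀ s, ‖(M s : L2R →L[ℂ] L2R)‖ ≤ 1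
  bdry : ∀ s t z, evalAt γ (z, t) (M s) = if s = t then 1 else 0

theorem SymbolPair.exists_endCutoffs (P : SymbolPair σ γ) : ∃ M, EndCutoffs γ M ∧
    ∀ A : 𝔄, σ A = 0 → ∀ ε > 0, ∃ (B : Bool → 𝔄) (K : 𝔄),
      (∀ s, (B s : L2R →L[ℂ] L2R) ∈ expSpan) ∧ IsCompactOperator (K : L2R →L[ℂ] L2R) ∧
      ‖((A - (M true * B true + M false * B false + K) : 𝔄) : L2R →L[ℂ] L2R)‖ ≤ ε := by
  obtain ⟨b, c, -, b1, b0, c0, c1, hb, hc⟩ := exists_cutoffs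
  refine ⟨fun s => bif s then ⟨erealM b, erealM_mem b⟩ else ⟨erealM c, erealM_mem c⟩,
    ⟨fun s => ?_, fun s t z => ?_⟩, fun A hA ε hε => ?_⟩
  · cases s
    · exact (opM_ereal_norm_le c).trans ((ContinuousMap.norm_le _ zero_le_one).2 hc)
    · exact (opM_ereal_norm_le b).trans ((ContinuousMap.norm_le _ zero_le_one).2 hb)
  · have e1 := P.isBoundary.1 b ⟨erealM b, erealM_mem b⟩ rfl z t
    have e2 := P.isBoundary.1 c ⟨erealM c, erealM_mem c⟩ rfl z t
    cases s
    · refine e2.trans ?_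
      cases t <;> simp [endpt, c0, c1]
    · refine e1.trans ?_
      cases t <;> simp [endpt, b0, b1]
  · obtain ⟨B, hB, C, hC, K, hK, h⟩ := exists_approx_of_symbol_eq_zero P.pairM P.erealD P.compact
      P.norm_le hA hε b1 b0 c0 c1 hb hc
    refine ⟨fun s => bif s then ⟨B, expSpan_le B hB⟩ else ⟨C, expSpan_le C hC⟩, ⟨K, hK.2⟩,
      fun s => ?_, hK.1, h⟩
    cases s
    · exact hC
    · exact hB

theorem EndCutoffs.evalAt_add {M : Bool → 𝔄} (h : EndCutoffs γ M) (B : Bool → 𝔄) (z : Circle)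
    (s : Bool) : evalAt γ (z, s) (M true * B true + M false * B false) = evalAt γ (z, s) (B s) := by
  rw [map_add, map_mul, map_mul, h.bdry, h.bdry]
  cases s <;> simp

theorem isCompactOperator_of_forall_near {E : Type*} [NormedAddCommGroup E] [NormedSpace ℂ E]
    [CompleteSpace E] {T : E →L[ℂ] E}
    (h : ∀ ε > 0, ∃ K : E →L[ℂ] E, IsCompactOperator K ∧ ‖T - K‖ ≤ ε) : IsCompactOperator T := by
  have hT : T ∈ closure {f : E →L[ℂ] E | IsCompactOperator f} := by
    refine Metric.mem_closure_iff.2 fun ε hε => ?_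
    obtain ⟨K, hK, hd⟩ := h (ε / 2) (half_pos hε)
    exact ⟨K, hK, by rw [dist_eq_norm]; linarith⟩
  rwa [isClosed_setOfPred_isCompactOperator.closure_eq] at hT

theorem SymbolPair.isCompactOperator_evalAt (P : SymbolPair σ γ) {A : 𝔄} (hA : σ A = 0)
    (v : Circle × Bool) : IsCompactOperator (evalAt γ v A) := by
  obtain ⟨M, hM, h⟩ := P.exists_endCutoffs
  refine isCompactOperator_of_forall_near fun ε hε => ?_
  obtain ⟨B, K, hB, hK, hd⟩ := h A hA ε hε
  refine ⟨evalAt γ v (B v.2), isCompactOperator_evalAt_expSpan P.isBoundary (hB _) v, ?_⟩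
  refine le_trans (le_of_eq ?_) ((P.bdry_norm_le _ v).trans hd)
  have e := hM.evalAt_add B v.1 v.2
  rw [map_sub, map_add _ _ K, P.bdry_compact K hK, add_zero, e]

theorem SymbolPair.isCompactOperator (P : SymbolPair σ γ) {A : 𝔄} (hA : σ A = 0)
    (hγ : ∀ v, evalAt γ v A = 0) : IsCompactOperator (A : L2R →L[ℂ] L2R) := by
  obtain ⟨M, hM, h⟩ := P.exists_endCutoffs
  refine isCompactOperator_of_forall_near fun ε hε => ?_
  obtain ⟨B, K, hB, hK, hd⟩ := h A hA (ε / 3) (by positivity)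
  refine ⟨K, hK, ?_⟩
  have hn : ∀ s, ‖((M s * B s : 𝔄) : L2R →L[ℂ] L2R)‖ ≤ ε / 3 := fun s => by
    have h1 : ‖(B s : L2R →L[ℂ] L2R)‖ ≤ ε / 3 := by
      refine norm_le_boundarySymbol P.isBoundary (hB s) s (by positivity) fun z => ?_
      refine le_trans (le_of_eq ?_) ((P.bdry_norm_le _ (z, s)).trans hd)
      rw [map_sub, map_add _ _ K, P.bdry_compact K hK, add_zero, hM.evalAt_add, hγ, zero_sub,
        norm_neg]
    exact (norm_mul_le (M s : L2R →L[ℂ] L2R) (B s)).trans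
      ((mul_le_of_le_one_left (norm_nonneg _) (hM.norm_le s)).trans h1)
  have e : (A : L2R →L[ℂ] L2R) - K =
      ((A - (M true * B true + M false * B false + K) : 𝔄) : L2R →L[ℂ] L2R) +
      ((M true * B true : 𝔄) : L2R →L[ℂ] L2R) + ((M false * B false : 𝔄) : L2R →L[ℂ] L2R) := by
    change _ = (A : L2R →L[ℂ] L2R) - (((M true * B true : 𝔄) : L2R →L[ℂ] L2R) +
      ((M false * B false : 𝔄) : L2R →L[ℂ] L2R) + K) + _ + _
    abel
  rw [e]
  refine norm_add₃_le.trans ?_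
  linarith [hn true, hn false]

theorem SymbolPair.exists_of_compact (P : SymbolPair σ γ) {f : Circle → 𝔅} (hf : Continuous f)
    (hc : ∀ z, IsCompactOperator (f z)) (s : Bool) :
    ∃ B : 𝔄, σ B = 0 ∧ ∀ z, evalAt γ (z, s) B = f z := by
  choose B hB hBf using fun n : ℕ =>
    exists_near_expSpan P.isBoundary hf hc s (ε := 1 / ((n : ℝ) + 1)) (by positivity)
  have hcau : CauchySeq fun n => (B n : L2R →L[ℂ] L2R) := by
    refine cauchySeq_of_le_tendsto_0' (fun n : ℕ => 2 * (1 / ((n : ℝ) + 1))) (fun n m hnm => ?_)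
      (by simpa using tendsto_one_div_add_atTop_nhds_zero_nat.const_mul (2 : ℝ))
    rw [dist_eq_norm]
    have := norm_le_boundarySymbol P.isBoundary (B := B n - B m) (sub_mem (hB n) (hB m)) s
      (C := 2 * (1 / ((n : ℝ) + 1))) (by positivity) fun z => ?_
    · exact this
    · rw [map_sub]
      have e : evalAt γ (z, s) (B n) - evalAt γ (z, s) (B m) =
        (evalAt γ (z, s) (B n) - f z) - (evalAt γ (z, s) (B m) - f z) := by abel
      have h3 : 1 / ((m : ℝ) + 1) ≤ 1 / ((n : ℝ) + 1) := by gcongr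
      rw [e]
      refine (norm_sub_le _ _).trans ?_
      linarith [hBf n z, hBf m z]
  obtain ⟨T, hT⟩ := cauchySeq_tendsto_of_complete hcau
  have hTA : T ∈ 𝔄 := isClosed_𝔄.mem_of_tendsto hT (.of_forall fun n => (B n).2)
  have hd : Tendsto (fun n => ‖((⟨T, hTA⟩ - B n : 𝔄) : L2R →L[ℂ] L2R)‖) atTop (𝓝 0) := by
    have := tendsto_iff_norm_sub_tendsto_zero.1 hT
    simp only [norm_sub_rev] at this
    exact this
  refine ⟨⟨T, hTA⟩, ?_, fun z => ?_⟩
  · refine norm_le_zero_iff.1 (ge_of_tendsto' hd fun n => ?_)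
    refine le_trans (le_of_eq ?_) (P.norm_le _)
    have h0 : σ (B n) = 0 := by
      have h1 : ∀ T ∈ expSpan, T ∈ kerSub σ := fun T hT => by
        refine prodSpan_le_kerSub P.erealD (Submodule.span_mono ?_ hT)
        rintro _ ⟨k, φ, hφ, rfl⟩
        exact ⟨1, k, φ, hφ, by rw [map_one, one_mul]⟩
      exact mem_kerSub.1 (h1 _ (hB n))
    rw [map_sub, h0, sub_zero]
  · refine sub_eq_zero.1 (norm_le_zero_iff.1 (ge_of_tendsto'
      (by simpa only [add_zero] using hd.add (tendsto_one_div_add_atTop_nhds_zero_nat (𝕜 := ℝ)))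
      fun n => ?_))
    have e : evalAt γ (z, s) ⟨T, hTA⟩ - f z = evalAt γ (z, s) (⟨T, hTA⟩ - B n) +
      (evalAt γ (z, s) (B n) - f z) := by rw [map_sub]; abel
    rw [e]
    exact (norm_add_le _ _).trans (add_le_add (P.bdry_norm_le _ _) (hBf n z))

theorem SymbolPair.exists_lift (P : SymbolPair σ γ) (F : C(Circle × Bool, compactsZ)) :
    ∃ A : 𝔄, σ A = 0 ∧ ∀ v, evalAt γ v A = F v := by
  obtain ⟨M, hM, -⟩ := P.exists_endCutoffs
  choose B hB hBF using fun s : Bool => P.exists_of_compact (f := fun z => (F (z, s) : 𝔅))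
    (by fun_prop) (fun z => (F (z, s)).2) s
  refine ⟨M true * B true + M false * B false, ?_, ?_⟩
  · rw [map_add, map_mul, map_mul, hB, hB, mul_zero, mul_zero, add_zero]
  · rintro ⟨z, s⟩
    rw [hM.evalAt_add, hBF]

theorem SymbolPair.compactIdeal_le (P : SymbolPair σ γ) : compactIdeal ≤ RingHom.ker σ :=
  fun A hA => P.compact A hA

/-- The boundary symbol on `𝔄/𝔎_ℝ`. -/
noncomputable def SymbolPair.quotEval (P : SymbolPair σ γ) (v : Circle × Bool) :
    𝔄 ⧸ compactIdeal →+* 𝔅 :=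
  Ideal.Quotient.lift compactIdeal (evalAt γ v).toAlgHom.toRingHom fun A hA => P.bdry_compact A hA v

theorem SymbolPair.quotEval_mk (P : SymbolPair σ γ) (v : Circle × Bool) (A : 𝔄) :
    P.quotEval v (Ideal.Quotient.mk compactIdeal A) = γ A v :=
  Ideal.Quotient.lift_mk ..

theorem SymbolPair.quotEval_smul (P : SymbolPair σ γ) (v : Circle × Bool) (c : ℂ)
    (x : 𝔄 ⧸ compactIdeal) : P.quotEval v (c • x) = c • P.quotEval v x := by
  obtain ⟨A, rfl⟩ := Ideal.Quotient.mk_surjective x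
  exact map_smul (evalAt γ v) c A

theorem SymbolPair.quotEval_compact (P : SymbolPair σ γ) (v : Circle × Bool) {x : 𝔄 ⧸ compactIdeal}
    (hx : x ∈ EK σ) : IsCompactOperator (P.quotEval v x) := by
  obtain ⟨A, hA, rfl⟩ := hx
  rw [P.quotEval_mk]
  exact P.isCompactOperator_evalAt hA v

theorem SymbolPair.quotEval_continuous (P : SymbolPair σ γ) (x : 𝔄 ⧸ compactIdeal) :
    Continuous fun v => P.quotEval v x := by
  obtain ⟨A, rfl⟩ := Ideal.Quotient.mk_surjective x
  simp only [P.quotEval_mk]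
  exact (γ A).continuous

/-- The isomorphism `𝔈/𝔎_ℝ → C(S*S¹, 𝔎_ℤ)` induced by the boundary symbol. -/
noncomputable def SymbolPair.bdryMap (P : SymbolPair σ γ) :
    EK σ →ₙₐ[ℂ] C(Circle × Bool, compactsZ) where
  toFun x := ⟨fun v => ⟨P.quotEval v x.1, P.quotEval_compact v x.2⟩,
    (P.quotEval_continuous x.1).subtype_mk _⟩
  map_smul' c x := ContinuousMap.ext fun v => Subtype.ext (P.quotEval_smul v c x.1)
  map_zero' := ContinuousMap.ext fun v => Subtype.ext (map_zero (P.quotEval v))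
  map_add' x y := ContinuousMap.ext fun v => Subtype.ext (map_add (P.quotEval v) x.1 y.1)
  map_mul' x y := ContinuousMap.ext fun v => Subtype.ext (map_mul (P.quotEval v) x.1 y.1)

theorem SymbolPair.bdryMap_mk (P : SymbolPair σ γ) (A : 𝔄) (hA : σ A = 0) (v : Circle × Bool) :
    (P.bdryMap ⟨Ideal.Quotient.mk compactIdeal A, A, hA, rfl⟩ v : 𝔅) = γ A v :=
  P.quotEval_mk v A

theorem SymbolPair.exists_bdryMap_eq (P : SymbolPair σ γ) (F : C(Circle × Bool, compactsZ)) :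
    ∃ x, P.bdryMap x = F := by
  obtain ⟨A, hA, h⟩ := P.exists_lift F
  have e : P.bdryMap ⟨Ideal.Quotient.mk compactIdeal A, A, hA, rfl⟩ = F := by
    refine DFunLike.ext _ _ fun v => Subtype.ext ?_
    exact (P.bdryMap_mk A hA v).trans (h v)
  exact ⟨_, e⟩

theorem SymbolPair.bijective_bdryMap (P : SymbolPair σ γ) : Function.Bijective P.bdryMap := by
  constructor
  · rintro ⟨_, A, hA, rfl⟩ ⟨_, B, hB, rfl⟩ h
    refine Subtype.ext (Ideal.Quotient.eq.2 (P.isCompactOperator (by rw [map_sub, hA, hB, sub_zero])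
      fun v => ?_))
    rw [map_sub, evalAt_apply, evalAt_apply, ← P.bdryMap_mk A hA, ← P.bdryMap_mk B hB, h, sub_self]
  · exact P.exists_bdryMap_eq

end IdealIso

end SemiPeriodic

namespace SemiPeriodic

/-! ## Matrices over a unitization -/

section UnitizationMatrices

variable {J A : Type*} [NonUnitalRing J] [Module ℂ J] [IsScalarTower ℂ J J] [SMulCommClass ℂ J J]
  [Ring A] [Algebra ℂ A]

/-- `a` is congruent modulo the image of `J` to the scalar matrix `c`. -/
def ScalarMod (U : Unitization ℂ J →ₐ[ℂ] A) {ι κ : Type} (a : Matrix ι κ A) (c : Matrix ι κ ℂ) : Prop :=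
  ∀ i j, ∃ k : J, U k = a i j - algebraMap ℂ A (c i j)

variable {U : Unitization ℂ J →ₐ[ℂ] A} {ι κ μ : Type}

theorem unitization_apply (U : Unitization ℂ J →ₐ[ℂ] A) (x : Unitization ℂ J) :
    U x = algebraMap ℂ A x.fst + U x.snd := by
  conv_lhs => rw [← Unitization.inl_fst_add_inr_snd_eq x, map_add]
  congr 1
  exact AlgHom.commutes U x.fst

theorem ScalarMod.exists_matrix {a : Matrix ι κ A} {c : Matrix ι κ ℂ} (h : ScalarMod U a c) :
    ∃ p : Matrix ι κ (Unitization ℂ J), p.map U = a ∧ p.map (Unitization.fstHom ℂ J) = c := by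
  choose k hk using h
  refine ⟨Matrix.of fun i j => Unitization.inl (c i j) + (k i j : Unitization ℂ J), ?_, ?_⟩
  · ext i j
    rw [Matrix.map_apply, Matrix.of_apply, map_add, hk]
    have : U (Unitization.inl (c i j)) = algebraMap ℂ A (c i j) := AlgHom.commutes U _
    rw [this, add_sub_cancel]
  · ext i j
    simp

theorem unitizationMatrix_ext (hU : ∀ k : J, U k = 0 → k = 0) {p q : Matrix ι κ (Unitization ℂ J)}
    (h1 : p.map U = q.map U)
    (h2 : p.map (Unitization.fstHom ℂ J) = q.map (Unitization.fstHom ℂ J)) : p = q := by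
  ext i j
  · exact congrFun (congrFun h2 i) j
  · have e1 : U (p i j) = U (q i j) := congrFun (congrFun h1 i) j
    have e2 : (p i j).fst = (q i j).fst := congrFun (congrFun h2 i) j
    rw [unitization_apply U (p i j), unitization_apply U (q i j), e2, add_right_inj] at e1
    refine sub_eq_zero.1 (hU _ ?_)
    rw [Unitization.inr_sub, map_sub, e1, sub_self]

theorem MvN.of_map [Fintype ι] [Fintype κ] (hU : ∀ k : J, U k = 0 → k = 0)
    {p : Matrix ι ι (Unitization ℂ J)} {q : Matrix κ κ (Unitization ℂ J)}
    {x : Matrix ι κ A} {y : Matrix κ ι A} {c : Matrix ι κ ℂ} {d : Matrix κ ι ℂ}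
    (hx : ScalarMod U x c) (hy : ScalarMod U y d) (hxy : x * y = p.map U) (hyx : y * x = q.map U)
    (hcd : c * d = p.map (Unitization.fstHom ℂ J)) (hdc : d * c = q.map (Unitization.fstHom ℂ J)) :
    MvN p q := by
  obtain ⟨x', rfl, rfl⟩ := hx.exists_matrix
  obtain ⟨y', rfl, rfl⟩ := hy.exists_matrix
  exact ⟨x', y', unitizationMatrix_ext hU (by rw [Matrix.map_mul, hxy]) (by rw [Matrix.map_mul, hcd]),
    unitizationMatrix_ext hU (by rw [Matrix.map_mul, hyx]) (by rw [Matrix.map_mul, hdc])⟩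

theorem isIdempotentElem_of_map [Fintype ι] (hU : ∀ k : J, U k = 0 → k = 0)
    {p : Matrix ι ι (Unitization ℂ J)} (h1 : IsIdempotentElem (p.map U))
    (h2 : IsIdempotentElem (p.map (Unitization.fstHom ℂ J))) : IsIdempotentElem p :=
  unitizationMatrix_ext hU (by rw [Matrix.map_mul, h1.eq]) (by rw [Matrix.map_mul, h2.eq])

end UnitizationMatrices

/-! ## Functoriality of `K₀` -/

section Functoriality

variable {R S : Type*} [Ring R] [Ring S]

theorem K0.mk_eq {ι κ : Type} [Fintype ι] [Fintype κ] {e : Matrix ι ι R} {f : Matrix κ κ R}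
    (he : IsIdempotentElem e) (hf : IsIdempotentElem f) (h : MvN e f) : K0.mk e he = K0.mk f hf :=
  congrArg _ (V.of_eq he hf h)

theorem K0.mk_add {ι κ : Type} [Fintype ι] [Fintype κ] {e : Matrix ι ι R} {f : Matrix κ κ R}
    (he : IsIdempotentElem e) (hf : IsIdempotentElem f) :
    K0.mk e he + K0.mk f hf = K0.mk (Matrix.fromBlocks e 0 0 f) (idem_blocks he hf) := by
  rw [K0.mk, K0.mk, K0.mk, ← map_add]
  exact congrArg _ (V.add_of he hf)

theorem K0.map_mk (φ : R →+* S) {ι : Type} [Fintype ι] (e : Matrix ι ι R) (he : IsIdempotentElem e) :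
    K0.map φ (K0.mk e he) = K0.mk (e.map φ) (idem_map φ he) := by
  rw [K0.mk, K0.map_of, V.map_of]
  rfl

/-- Homomorphisms on `K₀` agree if they agree on the classes of idempotents. -/
theorem K0.hom_ext {G : Type*} [AddCommGroup G] {f g : K0 R →+ G}
    (h : ∀ (n : ℕ) (e : Matrix (Fin n) (Fin n) R) (he : IsIdempotentElem e),
      f (K0.mk e he) = g (K0.mk e he)) : f = g := by
  refine Algebra.GrothendieckAddGroup.lift.symm.injective ?_
  ext x
  induction x using V.ind with
  | _ n e he => exact h n e he

theorem K0.map_id : K0.map (RingHom.id R) = AddMonoidHom.id _ :=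
  K0.hom_ext fun n e he => by
    rw [K0.map_mk]
    rfl

variable {J J' J'' : Type*} [NonUnitalRing J] [Module ℂ J] [IsScalarTower ℂ J J]
  [SMulCommClass ℂ J J] [NonUnitalRing J'] [Module ℂ J'] [IsScalarTower ℂ J' J']
  [SMulCommClass ℂ J' J'] [NonUnitalRing J''] [Module ℂ J''] [IsScalarTower ℂ J'' J'']
  [SMulCommClass ℂ J'' J'']

theorem unitizationMap_inr (φ : J →ₙₐ[ℂ] J') (k : J) : unitizationMap φ k = (φ k : J') := by
  simp [unitizationMap]

theorem unitizationMap_fst (φ : J →ₙₐ[ℂ] J') (x : Unitization ℂ J) :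
    (unitizationMap φ x).fst = x.fst := by
  rw [unitization_apply (unitizationMap φ) x, unitizationMap_inr]
  simp [Unitization.algebraMap_eq_inl]

theorem unitizationMap_snd (φ : J →ₙₐ[ℂ] J') (x : Unitization ℂ J) :
    (unitizationMap φ x).snd = φ x.snd := by
  rw [unitization_apply (unitizationMap φ) x, unitizationMap_inr]
  simp [Unitization.algebraMap_eq_inl]

theorem unitizationMap_comp (φ : J →ₙₐ[ℂ] J') (ψ : J' →ₙₐ[ℂ] J'') :
    (unitizationMap ψ).toRingHom.comp (unitizationMap φ).toRingHom =
      (unitizationMap (ψ.comp φ)).toRingHom := by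
  refine RingHom.ext fun x => ?_
  change unitizationMap ψ (unitizationMap φ x) = unitizationMap (ψ.comp φ) x
  ext <;> simp only [unitizationMap_fst, unitizationMap_snd, NonUnitalAlgHom.comp_apply]

theorem K0nu.coe_map (φ : J →ₙₐ[ℂ] J') (x : K0nu J) :
    (K0nu.map φ x : K0 (Unitization ℂ J')) = K0.map (unitizationMap φ).toRingHom x := rfl

theorem K0nu.map_map (φ : J →ₙₐ[ℂ] J') (ψ : J' →ₙₐ[ℂ] J'') (x : K0nu J) :
    K0nu.map ψ (K0nu.map φ x) = K0nu.map (ψ.comp φ) x := by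
  refine Subtype.ext ?_
  rw [K0nu.coe_map, K0nu.coe_map, K0nu.coe_map, ← unitizationMap_comp, ← K0.map_comp]
  rfl

theorem K0nu.map_id (x : K0nu J) : K0nu.map (NonUnitalAlgHom.id ℂ J) x = x := by
  refine Subtype.ext ?_
  have h : (unitizationMap (NonUnitalAlgHom.id ℂ J)).toRingHom = RingHom.id _ := by
    refine RingHom.ext fun x => ?_
    change unitizationMap (NonUnitalAlgHom.id ℂ J) x = x
    ext <;> simp only [unitizationMap_fst, unitizationMap_snd, NonUnitalAlgHom.coe_id, id_eq]
  rw [K0nu.coe_map, h, K0.map_id]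
  rfl

theorem K0nu.map_zero_hom (x : K0nu J) : K0nu.map (0 : J →ₙₐ[ℂ] J') x = 0 := by
  refine Subtype.ext ?_
  have h : (unitizationMap (0 : J →ₙₐ[ℂ] J')).toRingHom =
      (algebraMap ℂ (Unitization ℂ J')).comp (Unitization.fstHom ℂ J).toRingHom := by
    refine RingHom.ext fun x => ?_
    change unitizationMap (0 : J →ₙₐ[ℂ] J') x = algebraMap ℂ (Unitization ℂ J') x.fst
    ext <;> simp [unitizationMap_fst, unitizationMap_snd, Unitization.algebraMap_eq_inl]
  have hx : K0.map (Unitization.fstHom ℂ J).toRingHom x = 0 := x.2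
  rw [K0nu.coe_map, h, ← K0.map_comp, AddMonoidHom.comp_apply, hx, map_zero]
  rfl

theorem K0nu.bijective_map {φ : J →ₙₐ[ℂ] J'} (h : Function.Bijective φ) :
    Function.Bijective (K0nu.map φ) := by
  obtain ⟨g, h1, h2⟩ := Function.bijective_iff_has_inverse.1 h
  let ψ : J' →ₙₐ[ℂ] J := φ.inverse g h1 h2
  have e1 : ψ.comp φ = NonUnitalAlgHom.id ℂ J := NonUnitalAlgHom.ext h1
  have e2 : φ.comp ψ = NonUnitalAlgHom.id ℂ J' := NonUnitalAlgHom.ext h2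
  refine Function.bijective_iff_has_inverse.2 ⟨K0nu.map ψ, fun x => ?_, fun x => ?_⟩
  · rw [K0nu.map_map, e1, K0nu.map_id]
  · rw [K0nu.map_map, e2, K0nu.map_id]

end Functoriality

end SemiPeriodic

namespace SemiPeriodic

/-! ## Paths and loops of idempotents relative to an ideal -/

section Paths

open Filter Topology unitInterval

variable {M : Type*} [NormedRing M] [CompleteSpace M]

/-- `a` and `b` are conjugate by an invertible element congruent to `1` modulo `K`. -/
def ConjMod {M : Type*} [Ring M] (K : Ideal M) (a b : M) : Prop :=
  ∃ W : Mˣ, (W : M) - 1 ∈ K ∧ W * a = b * W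

theorem inv_sub_one_mem {M : Type*} [Ring M] {K : Ideal M} {W : Mˣ} (h : (W : M) - 1 ∈ K) :
    ((W⁻¹ : Mˣ) : M) - 1 ∈ K := by
  have e : ((W⁻¹ : Mˣ) : M) - 1 = -(((W⁻¹ : Mˣ) : M) * ((W : M) - 1)) := by
    rw [mul_sub, Units.inv_mul, mul_one, neg_sub]
  rw [e]
  exact K.neg_mem (K.mul_mem_left _ h)

theorem mul_sub_one_mem {M : Type*} [Ring M] {K : Ideal M} {a b : M}
    (ha : a - 1 ∈ K) (hb : b - 1 ∈ K) : a * b - 1 ∈ K := by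
  have e : a * b - 1 = a * (b - 1) + (a - 1) := by rw [mul_sub, mul_one]; abel
  rw [e]
  exact K.add_mem (K.mul_mem_left _ hb) ha

theorem ConjMod.symm {M : Type*} [Ring M] {K : Ideal M} {a b : M} (h : ConjMod K a b) :
    ConjMod K b a := by
  obtain ⟨W, hW, h⟩ := h
  exact ⟨W⁻¹, inv_sub_one_mem hW, by rw [Units.inv_mul_eq_iff_eq_mul, ← mul_assoc, h, mul_assoc,
    Units.mul_inv, mul_one]⟩

theorem ConjMod.trans {M : Type*} [Ring M] {K : Ideal M} {a b c : M} (h : ConjMod K a b)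
    (h' : ConjMod K b c) : ConjMod K a c := by
  obtain ⟨W, hW, h⟩ := h
  obtain ⟨V, hV, h'⟩ := h'
  refine ⟨V * W, mul_sub_one_mem hV hW, ?_⟩
  rw [Units.val_mul, mul_assoc, h, ← mul_assoc, h', mul_assoc]

theorem ConjMod.of_path (K : Ideal M) [K.IsTwoSided] {q : I → M} (hq : Continuous q)
    (hi : ∀ t, IsIdempotentElem (q t)) (hK : ∀ s t, q s - q t ∈ K) : ConjMod K (q 0) (q 1) := by
  have : Std.Symm fun s t => ConjMod K (q s) (q t) := ⟨fun _ _ h => h.symm⟩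
  refine PreconnectedSpace.induction₂ (fun s t => ConjMod K (q s) (q t)) (fun s => ?_)
    ⟨fun _ _ _ h h' => h.trans h'⟩ 0 1
  have hc : Continuous fun t => q t * q s + (1 - q t) * (1 - q s) := by fun_prop
  have h1 : q s * q s + (1 - q s) * (1 - q s) = 1 := by
    rw [(hi s).eq, (hi s).one_sub.eq, add_sub_cancel]
  have hU : {x : M | IsUnit x} ∈ 𝓝 (q s * q s + (1 - q s) * (1 - q s)) := by
    rw [h1]
    exact Units.isOpen.mem_nhds isUnit_one
  filter_upwards [hc.continuousAt.preimage_mem_nhds hU] with t ht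
  obtain ⟨W, hW⟩ := ht
  refine ⟨W, ?_, ?_⟩
  · have e : (W : M) - 1 = q t * (q s - q t) + (q t - q s) * q s := by
      rw [hW, mul_sub, sub_mul, (hi t).eq, (hi s).eq]
      noncomm_ring
    rw [e]
    exact K.add_mem (K.mul_mem_left _ (hK _ _)) (K.mul_mem_right _ (hK _ _))
  · rw [hW]
    have e1 : (q t * q s + (1 - q t) * (1 - q s)) * q s = q t * q s := by
      rw [add_mul, mul_assoc, (hi s).eq, mul_assoc, (hi s).one_sub_mul_self, mul_zero, add_zero]
    have e2 : q t * (q t * q s + (1 - q t) * (1 - q s)) = q t * q s := by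
      rw [mul_add, ← mul_assoc, (hi t).eq, ← mul_assoc, (hi t).mul_one_sub_self, zero_mul, add_zero]
    rw [e1, e2]

/-- Functions with values in an ideal. -/
def funIdeal {M : Type*} [NormedRing M] (K : Ideal M) : Ideal C(I, M) where
  carrier := {f | ∀ t, f t ∈ K}
  add_mem' ha hb t := K.add_mem (ha t) (hb t)
  zero_mem' _ := K.zero_mem
  smul_mem' c _ h t := K.mul_mem_left (c t) (h t)

instance {K : Ideal M} [K.IsTwoSided] : (funIdeal K).IsTwoSided where
  mul_mem_of_left b h t := K.mul_mem_right (b t) (h t)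

/-- A path of idempotents is given by a path of conjugations. -/
theorem exists_conj_path (K : Ideal M) [K.IsTwoSided] {q : I → M} (hq : Continuous q)
    (hi : ∀ t, IsIdempotentElem (q t)) (hK : ∀ s t, q s - q t ∈ K) :
    ∃ w : C(I, M), w 0 = 1 ∧ ∀ t, IsUnit (w t) ∧ w t - 1 ∈ K ∧ w t * q 0 = q t * w t := by
  let Q : C(I, C(I, M)) := ContinuousMap.curry ⟨fun p : I × I => q (p.1 * p.2), by fun_prop⟩
  have hQ : ∀ s t, Q s t = q (s * t) := fun _ _ => rfl
  obtain ⟨W, hW, h⟩ := ConjMod.of_path (funIdeal K) Q.continuous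
    (fun s => ContinuousMap.ext fun t => hi (s * t)) (fun s s' t => hK (s * t) (s' * t))
  have hc : ∀ t, (W : C(I, M)) t * q 0 = q t * (W : C(I, M)) t := fun t => by
    have := congrArg (fun f : C(I, M) => f t) h
    simpa only [ContinuousMap.mul_apply, hQ, zero_mul, one_mul] using this
  set v : M := ((W⁻¹ : C(I, M)ˣ) : C(I, M)) 0 with hv
  have ev : ∀ t, (W : C(I, M)) t * ((W⁻¹ : C(I, M)ˣ) : C(I, M)) t = 1 := fun t =>
    congrArg (fun f : C(I, M) => f t) W.mul_inv
  have ev' : ∀ t, ((W⁻¹ : C(I, M)ˣ) : C(I, M)) t * (W : C(I, M)) t = 1 := fun t =>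
    congrArg (fun f : C(I, M) => f t) W.inv_mul
  have hvK : v - 1 ∈ K := inv_sub_one_mem hW 0
  have hvq : v * q 0 = q 0 * v := by
    calc v * q 0 = v * (q 0 * ((W : C(I, M)) 0 * v)) := by rw [ev, mul_one]
      _ = (v * (W : C(I, M)) 0) * q 0 * v := by
          rw [← mul_assoc (q 0), ← hc 0]; simp only [mul_assoc]
      _ = q 0 * v := by rw [ev', one_mul]
  refine ⟨W * ContinuousMap.const I v, ev 0, fun t => ⟨?_, ?_, ?_⟩⟩
  · exact IsUnit.mul ⟨⟨_, _, ev t, ev' t⟩, rfl⟩ ⟨⟨_, _, ev' 0, ev 0⟩, rfl⟩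
  · exact mul_sub_one_mem (hW t) hvK
  · change (W : C(I, M)) t * v * q 0 = q t * ((W : C(I, M)) t * v)
    rw [mul_assoc, hvq, ← mul_assoc, hc, mul_assoc]

/-- The elements congruent to `1` modulo `K` that commute with `e`. -/
def commMod (K : Ideal M) (e : M) : Set M := {g | IsUnit g ∧ g - 1 ∈ K ∧ g * e = e * g}

/-- A loop of idempotents is given by a loop of conjugations, if all monodromies can be deformed
to `1`. -/
theorem exists_conj_loop (K : Ideal M) [K.IsTwoSided] {q : Circle → M} (hq : Continuous q)
    (hi : ∀ z, IsIdempotentElem (q z)) (hK : ∀ z z', q z - q z' ∈ K)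
    (hJ : ∀ h ∈ commMod K (q 1), JoinedIn (commMod K (q 1)) 1 h) :
    ∃ w : C(Circle, M), ∀ z, IsUnit (w z) ∧ w z - 1 ∈ K ∧ w z * q 1 = q z * w z := by
  let r : I → Circle := fun t => Circle.exp (2 * Real.pi * t)
  have hr : Continuous r := Circle.exp.continuous.comp (by fun_prop)
  have r0 : r 0 = 1 := by simp [r]
  have r1 : r 1 = 1 := by simp [r]
  obtain ⟨w, w0, hw⟩ := exists_conj_path K (hq.comp hr) (fun t => hi _) (fun s t => hK _ _)
  simp only [Function.comp_apply, r0] at hw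
  obtain ⟨g, hg⟩ := hJ (w 1) ⟨(hw 1).1, (hw 1).2.1, by have := (hw 1).2.2; rwa [r1] at this⟩
  set V : I → M := fun t => w t * Ring.inverse (g t) with hV
  have hVc : Continuous V := by
    refine w.continuous.mul (continuous_iff_continuousAt.2 fun t => ?_)
    obtain ⟨u, hu⟩ := (hg t).1
    have h1 := NormedRing.inverse_continuousAt u
    rw [hu] at h1
    exact h1.comp g.continuous.continuousAt
  have hVp : ∀ t, IsUnit (V t) ∧ V t - 1 ∈ K ∧ V t * q 1 = q (r t) * V t := fun t => by
    obtain ⟨⟨u, hu⟩, h2, h3⟩ := hg t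
    have e : V t = w t * ((u⁻¹ : Mˣ) : M) := by
      change w t * Ring.inverse (g t) = _
      rw [← hu, Ring.inverse_unit]
    rw [← hu] at h2 h3
    rw [e]
    refine ⟨(hw t).1.mul (u⁻¹).isUnit, mul_sub_one_mem (hw t).2.1 (inv_sub_one_mem h2), ?_⟩
    have h4 : ((u⁻¹ : Mˣ) : M) * q 1 = q 1 * ((u⁻¹ : Mˣ) : M) := by
      rw [Units.inv_mul_eq_iff_eq_mul, ← mul_assoc, h3, mul_assoc, Units.mul_inv, mul_one]
    rw [mul_assoc, h4, ← mul_assoc, (hw t).2.2, mul_assoc]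
  have V0 : V 0 = 1 := by rw [hV]; simp [w0]
  have V1 : V 1 = 1 := by
    rw [hV]
    simp only [Path.target]
    exact Ring.mul_inverse_cancel _ (hw 1).1
  obtain ⟨F, hF⟩ := exists_circle_map
    (f := (fun x : ℝ => V (Set.projIcc 0 1 zero_le_one x)) ∘ Int.fract ∘ fun θ => θ / (2 * Real.pi))
    ((ContinuousOn.comp_fract'' (f := fun x : ℝ => V (Set.projIcc 0 1 zero_le_one x))
      (hVc.comp continuous_projIcc).continuousOn (by
        rw [Set.projIcc_left, Set.projIcc_right]
        exact V0.trans V1.symm)).comp (by fun_prop)) (fun θ => by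
      have : (θ + 2 * Real.pi) / (2 * Real.pi) = θ / (2 * Real.pi) + 1 := by
        field_simp
      simp only [Function.comp_apply, this, Int.fract_add_one])
  refine ⟨F, fun z => ?_⟩
  obtain ⟨φ, rfl⟩ := exists_exp_two_pi z
  have h1 : F (Circle.exp (2 * Real.pi * φ)) = V ⟨Int.fract φ, Int.fract_nonneg φ,
      (Int.fract_lt_one φ).le⟩ := by
    rw [hF]
    simp only [Function.comp_apply, mul_div_cancel_left₀ φ Real.two_pi_pos.ne']
    rw [Set.projIcc_of_mem zero_le_one ⟨Int.fract_nonneg φ, (Int.fract_lt_one φ).le⟩]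
  have h2 : Circle.exp (2 * Real.pi * φ) = r ⟨Int.fract φ, Int.fract_nonneg φ,
      (Int.fract_lt_one φ).le⟩ := by
    change _ = Circle.exp (2 * Real.pi * Int.fract φ)
    rw [← Circle.periodic_exp.sub_int_mul_eq ⌊φ⌋]
    congr 1
    rw [Int.fract]
    ring
  rw [h1]
  conv => enter [2, 2, 2, 1]; rw [h2]
  exact hVp _

variable [NormedAlgebra ℂ M]

theorem finite_spectrum_of_isIntegral [Nontrivial M] {F : M} (h : IsIntegral ℂ F) :
    (spectrum ℂ F).Finite := by
  obtain ⟨p, hp, h0⟩ := h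
  refine (p.roots.toFinset.finite_toSet).subset fun t ht => ?_
  have h1 := spectrum.subset_polynomial_aeval F p ⟨t, ht, rfl⟩
  have h2 : Polynomial.aeval F p = 0 := h0
  rw [h2, spectrum.zero_eq, Set.mem_singleton_iff] at h1
  simpa [hp.ne_zero] using h1

theorem joinedIn_commMod [Nontrivial M] {K : Ideal M} {e F : M} (hK : F ∈ K) (he : F * e = e * F)
    (hF : IsIntegral ℂ F) (hu : IsUnit (1 + F)) : JoinedIn (commMod K e) 1 (1 + F) := by
  set S : Set ℂ := {t | IsUnit (1 + t • F)} with hS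
  have hfin : Sᶜ.Finite := by
    refine ((finite_spectrum_of_isIntegral hF).image fun t => -t⁻¹).subset fun t ht => ?_
    have ht0 : t ≠ 0 := by
      rintro rfl
      exact ht (by simp [hS])
    refine ⟨-t⁻¹, fun h => ht ?_, by simp⟩
    have e1 : 1 + t • F = (Units.mk0 (-t) (neg_ne_zero.2 ht0)) • (algebraMap ℂ M (-t⁻¹) - F) := by
      rw [Units.smul_mk0, smul_sub, Algebra.algebraMap_eq_smul_one, smul_smul, neg_mul_neg,
        mul_inv_cancel₀ ht0, one_smul, neg_smul, sub_neg_eq_add]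
    change IsUnit (1 + t • F)
    rw [e1]
    exact h.smul _
  have hpath := hfin.countable.isPathConnected_compl_of_one_lt_rank (E := ℂ) (by
    rw [Complex.rank_real_complex]; exact Cardinal.one_lt_two)
  rw [compl_compl] at hpath
  have h01 := (hpath.joinedIn 0 (by simp [hS]) 1 (by simpa [hS] using hu)).map
    (f := fun t : ℂ => 1 + t • F) (by fun_prop)
  simp only [zero_smul, add_zero, one_smul] at h01
  refine h01.mono ?_
  rintro _ ⟨t, ht, rfl⟩
  refine ⟨ht, ?_, ?_⟩
  · rw [add_sub_cancel_left, ← smul_one_mul]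
    exact K.mul_mem_left _ hK
  · rw [add_mul, mul_add, one_mul, mul_one, smul_mul_assoc, mul_smul_comm, he]

/-- If the elements of `K` commuting with `e` are limits of integral ones, every invertible element
congruent to `1` and commuting with `e` can be deformed to `1`. -/
theorem joinedIn_one_commMod {K : Ideal M} {e : M}
    (hA : ∀ k ∈ K, k * e = e * k → ∀ ε > 0, ∃ F ∈ K, F * e = e * F ∧ IsIntegral ℂ F ∧ ‖F - k‖ < ε) :
    ∀ h ∈ commMod K e, JoinedIn (commMod K e) 1 h := by
  rintro h ⟨hu, hK, he⟩
  rcases subsingleton_or_nontrivial M with hM | hM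
  · rw [Subsingleton.elim h 1]
    exact JoinedIn.refl ⟨isUnit_one, by simp, by simp⟩
  obtain ⟨ε, hε, hball⟩ := Metric.isOpen_iff.1 (Units.isOpen (R := M)) h hu
  obtain ⟨F, hFK, hFe, hFi, hF⟩ := hA (h - 1) hK (by rw [sub_mul, mul_sub, he, one_mul, mul_one]) ε hε
  have hmem : ∀ t : ℝ, t ∈ Set.Icc (0 : ℝ) 1 → 1 + F + t • (h - (1 + F)) ∈ commMod K e := by
    intro t ht
    refine ⟨hball ?_, ?_, ?_⟩
    · have e1 : 1 + F + t • (h - (1 + F)) - h = (1 - t) • (F - (h - 1)) := by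
        simp only [smul_sub, sub_smul, smul_add, one_smul]
        abel
      rw [mem_ball_iff_norm, e1, norm_smul, Real.norm_of_nonneg (by linarith [ht.2])]
      exact lt_of_le_of_lt (mul_le_of_le_one_left (norm_nonneg _) (by linarith [ht.1])) hF
    · have e2 : 1 + F + t • (h - (1 + F)) - 1 = F + (t • (1 : M)) * ((h - 1) - F) := by
        rw [smul_one_mul, sub_sub]
        abel
      rw [e2]
      exact K.add_mem hFK (K.mul_mem_left _ (K.sub_mem hK hFK))
    · simp only [add_mul, mul_add, sub_mul, mul_sub, smul_mul_assoc, mul_smul_comm, he, hFe, one_mul,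
        mul_one]
  have hu' : IsUnit (1 + F) := by simpa using (hmem 0 (by simp)).1
  refine (joinedIn_commMod hFK hFe hFi hu').trans (JoinedIn.ofLine
    (f := fun t : ℝ => 1 + F + t • (h - (1 + F))) (by fun_prop) (by simp) (by simp) ?_)
  rintro _ ⟨t, ht, rfl⟩
  exact hmem t ht

end Paths

end SemiPeriodic

namespace SemiPeriodic

section CompactMatrices

open Filter Topology

variable {ι : Type} [Fintype ι] [DecidableEq ι]

attribute [local instance] Matrix.linftyOpNormedRing Matrix.linftyOpNormedAlgebra

theorem completeSpace_matrix (ι : Type) [Fintype ι] [DecidableEq ι] :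
    @CompleteSpace (Matrix ι ι 𝔅) (Matrix.linftyOpNormedRing.toMetricSpace.toUniformSpace) :=
  (inferInstance : CompleteSpace (ι → ι → 𝔅))

attribute [local instance] completeSpace_matrix

/-- The matrices of compact operators. -/
def cptMat (ι : Type) [Fintype ι] [DecidableEq ι] : Ideal (Matrix ι ι 𝔅) where
  carrier := {m | ∀ i j, IsCompactOperator (m i j)}
  add_mem' ha hb i j := (ha i j).add (hb i j)
  zero_mem' _ _ := isCompactOperator_zero
  smul_mem' c m hm i j := by
    rw [smul_eq_mul, Matrix.mul_apply]
    exact (compactsZ.toNonUnitalSubsemiring.toAddSubmonoid).sum_mem fun l _ =>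
      (hm l j).clm_comp (c i l)

instance : (cptMat ι).IsTwoSided where
  mul_mem_of_left {m} c hm i j := by
    rw [Matrix.mul_apply]
    exact (compactsZ.toNonUnitalSubsemiring.toAddSubmonoid).sum_mem fun l _ =>
      (hm i l).comp_clm (c l j)

/-- Compression of a matrix of operators to the span of finitely many basis vectors. -/
noncomputable def compress (ι : Type) [Fintype ι] [DecidableEq ι] (N : ℕ) :
    Matrix ι ι 𝔅 →ₗ[ℂ] Matrix ι ι 𝔅 where
  toFun m := Matrix.of fun i j => trunc N * m i j * trunc N
  map_add' m m' := by ext1 i j; simp [mul_add, add_mul]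
  map_smul' c m := by ext1 i j; simp

theorem compress_apply (N : ℕ) (m : Matrix ι ι 𝔅) :
    compress ι N m = Matrix.of fun i j => trunc N * m i j * trunc N := rfl

theorem compress_eq (N : ℕ) (m : Matrix ι ι 𝔅) : compress ι N m =
    Matrix.diagonal (fun _ => trunc N) * m * Matrix.diagonal (fun _ => trunc N) := by
  ext1 i j
  rw [Matrix.mul_diagonal, Matrix.diagonal_mul]
  rfl

theorem compress_mul (N : ℕ) (m m' x : Matrix ι ι 𝔅) :
    compress ι N m * (x * compress ι N m') ∈ LinearMap.range (compress ι N) :=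
  ⟨m * (Matrix.diagonal (fun _ => trunc N) * x * Matrix.diagonal (fun _ => trunc N)) * m', by
    simp only [compress_eq, mul_assoc]⟩

theorem finiteDimensional_range_compress (N : ℕ) :
    FiniteDimensional ℂ (LinearMap.range (compress ι N)) := by
  let f : ι × ι × Finset.Icc (-(N : ℤ)) N × Finset.Icc (-(N : ℤ)) N → Matrix ι ι 𝔅 :=
    fun x => Matrix.single x.1 x.2.1 (matUnit x.2.2.1 x.2.2.2)
  have hfd : FiniteDimensional ℂ (Submodule.span ℂ (Set.range f)) :=
    FiniteDimensional.span_of_finite ℂ (Set.finite_range f)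
  refine Submodule.finiteDimensional_of_le (S₂ := Submodule.span ℂ (Set.range f)) ?_
  rintro _ ⟨m, rfl⟩
  rw [Matrix.matrix_eq_sum_single (compress ι N m)]
  refine sum_mem fun i _ => sum_mem fun j _ => ?_
  rw [compress_apply, Matrix.of_apply, trunc_mul_mul_trunc]
  have e : ∀ x : 𝔅, Matrix.single i j x = Matrix.singleLinearMap ℂ i j x := fun _ => rfl
  rw [e, map_sum]
  refine sum_mem fun a ha => ?_
  rw [map_sum]
  refine sum_mem fun b hb => ?_
  rw [map_smul]
  exact Submodule.smul_mem _ _ (Submodule.subset_span ⟨(i, j, ⟨a, ha⟩, ⟨b, hb⟩), rfl⟩)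

theorem isIntegral_of_mul_mem {B : Type*} [Ring B] [Algebra ℂ B] {V : Submodule ℂ B}
    [FiniteDimensional ℂ V] {F : B} (h1 : 1 ∈ V) (h : ∀ x ∈ V, F * x ∈ V) : IsIntegral ℂ F := by
  have hpow : ∀ n : ℕ, F ^ n ∈ V := fun n => by
    induction n with
    | zero => rwa [pow_zero]
    | succ n ih => rw [pow_succ']; exact h _ ih
  have hle : Subalgebra.toSubmodule (Algebra.adjoin ℂ {F}) ≤ V := by
    intro x hx
    rw [Subalgebra.mem_toSubmodule, Algebra.adjoin_singleton_eq_range_aeval] at hx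
    obtain ⟨p, rfl⟩ := hx
    change Polynomial.aeval F p ∈ V
    rw [Polynomial.aeval_eq_sum_range]
    exact sum_mem fun n _ => Submodule.smul_mem _ _ (hpow n)
  have hfd := Submodule.finiteDimensional_of_le hle
  exact IsIntegral.of_mem_of_fg (Algebra.adjoin ℂ {F}) (Module.Finite.iff_fg.1 hfd) F
    (Algebra.self_mem_adjoin_singleton ℂ F)

theorem isIntegral_compress {e : Matrix ι ι 𝔅} (he : IsIdempotentElem e) (N : ℕ)
    (k : Matrix ι ι 𝔅) :
    IsIntegral ℂ (e * compress ι N k * e + (1 - e) * compress ι N k * (1 - e)) := by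
  set R := LinearMap.range (compress ι N)
  have hR : FiniteDimensional ℂ R := finiteDimensional_range_compress N
  let L : Matrix ι ι 𝔅 → (Matrix ι ι 𝔅 →ₗ[ℂ] Matrix ι ι 𝔅) := fun f =>
    (LinearMap.mulLeft ℂ f).comp (LinearMap.mulRight ℂ f)
  have hL : ∀ f x, L f x = f * (x * f) := fun _ _ => rfl
  have key : ∀ f : Matrix ι ι 𝔅, IsIdempotentElem f → ∀ g, g * f = 0 → ∀ x ∈ R.map (L f),
      (f * compress ι N k * f + g * compress ι N k * g) * x ∈ R.map (L f) := by
    rintro f hf g hg _ ⟨_, ⟨m, rfl⟩, rfl⟩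
    refine ⟨_, compress_mul N k m f, ?_⟩
    rw [hL, hL, add_mul, mul_assoc (g * _) g, ← mul_assoc g f, hg, zero_mul, mul_zero, add_zero]
    rw [mul_assoc (f * _) f, ← mul_assoc f f, hf.eq]
    simp only [mul_assoc]
  refine isIntegral_of_mul_mem (V := R.map (L e) ⊔ R.map (L (1 - e)) ⊔ Submodule.span ℂ {1})
    (Submodule.mem_sup_right (Submodule.mem_span_singleton_self 1)) fun x hx => ?_
  obtain ⟨y, hy, z, hz, rfl⟩ := Submodule.mem_sup.1 hx
  obtain ⟨u, hu, v, hv, rfl⟩ := Submodule.mem_sup.1 hy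
  obtain ⟨c, rfl⟩ := Submodule.mem_span_singleton.1 hz
  have h1 : e * compress ι N k * e ∈ R.map (L e) := ⟨_, ⟨k, rfl⟩, by rw [hL, mul_assoc]⟩
  have h2 : (1 - e) * compress ι N k * (1 - e) ∈ R.map (L (1 - e)) :=
    ⟨_, ⟨k, rfl⟩, by rw [hL, mul_assoc]⟩
  rw [mul_add, mul_add, mul_smul_comm, mul_one]
  refine Submodule.mem_sup_left (add_mem (add_mem (Submodule.mem_sup_left ?_)
    (Submodule.mem_sup_right ?_)) (Submodule.smul_mem _ _ (add_mem (Submodule.mem_sup_left h1)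
      (Submodule.mem_sup_right h2))))
  · exact key e he (1 - e) he.one_sub_mul_self u hu
  · rw [add_comm]
    exact key (1 - e) he.one_sub e he.mul_one_sub_self v hv

theorem compress_mem (N : ℕ) {k : Matrix ι ι 𝔅} (hk : k ∈ cptMat ι) : compress ι N k ∈ cptMat ι :=
  fun i j => ((hk i j).clm_comp (trunc N)).comp_clm (trunc N)

/-- The invertible matrices congruent to `1` that commute with an idempotent are connected. -/
theorem joinedIn_cptMat {e : Matrix ι ι 𝔅} (he : IsIdempotentElem e) :
    ∀ h ∈ commMod (cptMat ι) e, JoinedIn (commMod (cptMat ι) e) 1 h := by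
  refine joinedIn_one_commMod fun k hk hke ε hε => ?_
  have ht : Tendsto (fun N => compress ι N k) atTop (𝓝 k) := by
    refine tendsto_pi_nhds.2 fun i => tendsto_pi_nhds.2 fun j => ?_
    exact tendsto_trunc_mul_trunc (hk i j)
  have ht2 : Tendsto (fun N => e * compress ι N k * e + (1 - e) * compress ι N k * (1 - e)) atTop
      (𝓝 k) := by
    have h := ((ht.const_mul e).mul_const e).add ((ht.const_mul (1 - e)).mul_const (1 - e))
    have e1 : e * k * e + (1 - e) * k * (1 - e) = k := by
      have h2 : (1 - e) * k = k * (1 - e) := by rw [sub_mul, mul_sub, hke, one_mul, mul_one]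
      rw [← hke, h2, mul_assoc, mul_assoc, he.eq, he.one_sub.eq, ← mul_add, add_sub_cancel, mul_one]
    rwa [e1] at h
  obtain ⟨N, hN⟩ := ((tendsto_iff_norm_sub_tendsto_zero.1 ht2).eventually (gt_mem_nhds hε)).exists
  have hc := compress_mem N hk
  refine ⟨_, add_mem ?_ ?_, ?_, isIntegral_compress he N k, hN⟩
  · exact (cptMat ι).mul_mem_right _ ((cptMat ι).mul_mem_left _ hc)
  · exact (cptMat ι).mul_mem_right _ ((cptMat ι).mul_mem_left _ hc)
  · rw [add_mul, mul_add, mul_assoc _ e e, he.eq, mul_assoc _ (1 - e) e, he.one_sub_mul_self,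
      ← mul_assoc e (e * _), ← mul_assoc e e, he.eq, ← mul_assoc e ((1 - e) * _), ← mul_assoc e (1 - e),
      he.mul_one_sub_self]
    simp

theorem continuous_inverse_mat {Z : Type*} [TopologicalSpace Z] {w : Z → Matrix ι ι 𝔅}
    (hw : Continuous w) (hu : ∀ z, IsUnit (w z)) : Continuous fun z => Ring.inverse (w z) :=
  continuous_iff_continuousAt.2 fun z => by
    obtain ⟨u, hz⟩ := hu z
    have h1 := NormedRing.inverse_continuousAt u
    rw [hz] at h1
    exact h1.comp hw.continuousAt

/-- A loop of idempotent matrices of operators, constant modulo compact operators, is given by a loop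
of conjugations. -/
theorem exists_conj_loop_cptMat {q : Circle → Matrix ι ι 𝔅} (hq : Continuous q)
    (hi : ∀ z, IsIdempotentElem (q z)) (hK : ∀ z z', q z - q z' ∈ cptMat ι) :
    ∃ w : Circle → Matrix ι ι 𝔅, Continuous w ∧
      ∀ z, IsUnit (w z) ∧ w z - 1 ∈ cptMat ι ∧ w z * q 1 = q z * w z := by
  obtain ⟨w, hw⟩ := exists_conj_loop (cptMat ι) hq hi hK (joinedIn_cptMat (hi 1))
  exact ⟨w, w.continuous, hw⟩

/-- The exchange of two diagonal blocks which agree modulo compact operators is a conjugation by an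
invertible matrix congruent to `1`. -/
theorem conjMod_swap {a b c : Matrix ι ι 𝔅} (ha : IsIdempotentElem a) (hb : IsIdempotentElem b)
    (hac : a - c ∈ cptMat ι) (hbc : b - c ∈ cptMat ι) :
    ConjMod (cptMat (ι ⊕ ι)) (Matrix.fromBlocks a 0 0 b) (Matrix.fromBlocks b 0 0 a) := by
  let r : ℝ → Matrix (ι ⊕ ι) (ι ⊕ ι) 𝔅 := fun t =>
    Matrix.fromBlocks ((Real.cos t : ℂ) • 1) (-(Real.sin t : ℂ) • 1) ((Real.sin t : ℂ) • 1)
      ((Real.cos t : ℂ) • 1)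
  let q : unitInterval → Matrix (ι ⊕ ι) (ι ⊕ ι) 𝔅 := fun t =>
    r (Real.pi / 2 * t) * Matrix.fromBlocks a 0 0 b * r (-(Real.pi / 2 * t))
  have hr : Continuous r := by
    refine Continuous.matrix_fromBlocks ?_ ?_ ?_ ?_ <;> fun_prop
  have hrr : ∀ t, r (-t) * r t = 1 := fun t => by
    have h : (Real.cos t : ℂ) ^ 2 + (Real.sin t : ℂ) ^ 2 = 1 := by
      exact_mod_cast Real.cos_sq_add_sin_sq t
    simp only [r, Matrix.fromBlocks_multiply, Real.cos_neg, Real.sin_neg, smul_mul_smul_comm, mul_one,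
      ← add_smul, Complex.ofReal_neg, neg_neg]
    rw [← Matrix.fromBlocks_one]
    congr 1
    · rw [← sq, ← sq, h, one_smul]
    · rw [mul_neg, mul_comm, neg_add_cancel, zero_smul]
    · rw [neg_mul, mul_comm, neg_add_cancel, zero_smul]
    · rw [mul_neg, neg_mul, neg_neg, ← sq, ← sq, add_comm, h, one_smul]
  have hq : Continuous q := by
    refine ((hr.comp ?_).mul continuous_const).mul (hr.comp ?_) <;> fun_prop
  have hi : ∀ t, IsIdempotentElem (q t) := fun t => by
    have := (idem_blocks ha hb).eq
    change r _ * _ * r _ * (r _ * _ * r _) = r _ * _ * r _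
    rw [mul_assoc, ← mul_assoc (r (-_)), ← mul_assoc (r (-_)), hrr, one_mul, ← mul_assoc,
      mul_assoc (r _), this]
  have hK : ∀ t, q t - Matrix.fromBlocks c 0 0 c ∈ cptMat (ι ⊕ ι) := fun t => by
    have hd : Matrix.fromBlocks a 0 0 b - Matrix.fromBlocks c 0 0 c ∈ cptMat (ι ⊕ ι) := by
      rintro (i | i) (j | j)
      · exact hac i j
      · simpa using isCompactOperator_zero
      · simpa using isCompactOperator_zero
      · exact hbc i j
    have hrc : ∀ s, r s * Matrix.fromBlocks c 0 0 c = Matrix.fromBlocks c 0 0 c * r s := fun s => by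
      simp only [r, Matrix.fromBlocks_multiply]
      simp
    have e : q t - Matrix.fromBlocks c 0 0 c = r (Real.pi / 2 * t) *
        (Matrix.fromBlocks a 0 0 b - Matrix.fromBlocks c 0 0 c) * r (-(Real.pi / 2 * t)) := by
      have h2 := hrr (-(Real.pi / 2 * t))
      rw [neg_neg] at h2
      rw [mul_sub, sub_mul, hrc, mul_assoc (Matrix.fromBlocks c 0 0 c), h2, mul_one]
    rw [e]
    exact (cptMat _).mul_mem_right _ ((cptMat _).mul_mem_left _ hd)
  have h := ConjMod.of_path (cptMat (ι ⊕ ι)) hq hi (fun s t => by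
    have := sub_mem (hK s) (hK t)
    rwa [sub_sub_sub_cancel_right] at this)
  have e0 : q 0 = Matrix.fromBlocks a 0 0 b := by
    have : r 0 = 1 := by simp [r]
    simp [q, this]
  have e1 : q 1 = Matrix.fromBlocks b 0 0 a := by
    simp [q, r, Matrix.fromBlocks_multiply]
  rwa [e0, e1] at h

end CompactMatrices

end SemiPeriodic

namespace SemiPeriodic

/-! ## Recognizing `K₀` of a direct sum -/

section DirectSum

variable {J K : Type*} [NonUnitalRing J] [Module ℂ J] [IsScalarTower ℂ J J] [SMulCommClass ℂ J J]
  [NonUnitalRing K] [Module ℂ K] [IsScalarTower ℂ K K] [SMulCommClass ℂ K K]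

theorem K0nu.bijective_prod {e₀ e₁ : J →ₙₐ[ℂ] K} (c₀ c₁ : K →ₙₐ[ℂ] J)
    (h₀₀ : e₀.comp c₀ = NonUnitalAlgHom.id ℂ K) (h₁₁ : e₁.comp c₁ = NonUnitalAlgHom.id ℂ K)
    (h₁₀ : e₁.comp c₀ = 0) (h₀₁ : e₀.comp c₁ = 0)
    (h : ∀ x : K0 (Unitization ℂ J),
      x + K0.map ((algebraMap ℂ (Unitization ℂ J)).comp (Unitization.fstHom ℂ J).toRingHom) x =
        K0.map (unitizationMap (c₀.comp e₀)).toRingHom x +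
          K0.map (unitizationMap (c₁.comp e₁)).toRingHom x) :
    Function.Bijective ((K0nu.map e₀).prod (K0nu.map e₁) : K0nu J →+ K0nu K × K0nu K) := by
  constructor
  · refine (injective_iff_map_eq_zero _).2 fun x hx => Subtype.ext ?_
    have key : ∀ (e : J →ₙₐ[ℂ] K) (c : K →ₙₐ[ℂ] J), K0nu.map e x = 0 →
        K0.map (unitizationMap (c.comp e)).toRingHom (x : K0 (Unitization ℂ J)) = 0 :=
      fun e c he => by
        rw [← K0nu.coe_map, ← K0nu.map_map, he, map_zero]
        rfl
    have hx0 : K0.map (Unitization.fstHom ℂ J).toRingHom (x : K0 (Unitization ℂ J)) = 0 := x.2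
    have hx1 := h x
    rw [← K0.map_comp, AddMonoidHom.comp_apply, hx0, map_zero, key e₀ c₀ (congrArg Prod.fst hx),
      key e₁ c₁ (congrArg Prod.snd hx), add_zero, add_zero] at hx1
    exact hx1
  · rintro ⟨x, y⟩
    refine ⟨K0nu.map c₀ x + K0nu.map c₁ y, Prod.ext ?_ ?_⟩
    · change K0nu.map e₀ _ = x
      rw [map_add, K0nu.map_map, K0nu.map_map, h₀₀, h₀₁, K0nu.map_id, K0nu.map_zero_hom, add_zero]
    · change K0nu.map e₁ _ = y
      rw [map_add, K0nu.map_map, K0nu.map_map, h₁₁, h₁₀, K0nu.map_id, K0nu.map_zero_hom, zero_add]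

theorem K0nu.bijective_prod_comp {J' : Type*} [NonUnitalRing J'] [Module ℂ J'] [IsScalarTower ℂ J' J']
    [SMulCommClass ℂ J' J'] {e₀ e₁ : J →ₙₐ[ℂ] K} {Φ : J' →ₙₐ[ℂ] J} (hΦ : Function.Bijective Φ)
    (h : Function.Bijective ((K0nu.map e₀).prod (K0nu.map e₁) : K0nu J →+ K0nu K × K0nu K)) :
    Function.Bijective ((K0nu.map (e₀.comp Φ)).prod (K0nu.map (e₁.comp Φ)) :
      K0nu J' →+ K0nu K × K0nu K) := by
  have e : ⇑((K0nu.map (e₀.comp Φ)).prod (K0nu.map (e₁.comp Φ))) =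
      ((K0nu.map e₀).prod (K0nu.map e₁)) ∘ K0nu.map Φ := by
    ext1 x
    exact Prod.ext (K0nu.map_map Φ e₀ x).symm (K0nu.map_map Φ e₁ x).symm
  rw [e]
  exact h.comp (K0nu.bijective_map hΦ)

end DirectSum

/-! ## `K₀` of the operator valued functions on `S*S¹` -/

section LoopKTheory

attribute [local instance] Matrix.linftyOpNormedRing Matrix.linftyOpNormedAlgebra completeSpace_matrix

/-- The compact operator valued functions on `S*S¹`. -/
abbrev LoopK : Type := C(Circle × Bool, compactsZ)

set_option synthInstance.maxHeartbeats 400000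

noncomputable local instance : NonUnitalRing LoopK := inferInstance
noncomputable local instance : NonUnitalSemiring LoopK := inferInstance
noncomputable local instance : NonUnitalNonAssocSemiring LoopK := inferInstance
noncomputable local instance : AddCommMonoid LoopK := inferInstance
noncomputable local instance : Module ℂ LoopK := inferInstance
noncomputable local instance : DistribMulAction ℂ LoopK := inferInstance
local instance : IsScalarTower ℂ LoopK LoopK := inferInstance
local instance : SMulCommClass ℂ LoopK LoopK := inferInstance
noncomputable local instance : Ring (Unitization ℂ LoopK) := inferInstance
noncomputable local instance : Semiring (Unitization ℂ LoopK) := inferInstance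
noncomputable local instance : NonAssocSemiring (Unitization ℂ LoopK) := inferInstance
noncomputable local instance : Algebra ℂ (Unitization ℂ LoopK) := inferInstance

/-- A function in `LoopK` as a function with values in `𝔅`. -/
noncomputable def loopIncl : LoopK →ₙₐ[ℂ] (Circle × Bool → 𝔅) where
  toFun f v := f v
  map_smul' _ _ := rfl
  map_zero' := rfl
  map_add' _ _ := rfl
  map_mul' _ _ := rfl

/-- The elements of the unitization of `LoopK` as functions with values in `𝔅`. -/
noncomputable def loopU : Unitization ℂ LoopK →ₐ[ℂ] (Circle × Bool → 𝔅) := Unitization.lift loopIncl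

theorem loopU_inr (k : LoopK) (v : Circle × Bool) : loopU (k : Unitization ℂ LoopK) v = k v := by
  simp [loopU, loopIncl]
  rfl

theorem loopU_apply (x : Unitization ℂ LoopK) (v : Circle × Bool) :
    loopU x v = algebraMap ℂ 𝔅 x.fst + x.snd v := by
  rw [unitization_apply loopU x, Pi.add_apply, loopU_inr]
  rfl

theorem loopU_injective (k : LoopK) (h : loopU (k : Unitization ℂ LoopK) = 0) : k = 0 :=
  ContinuousMap.ext fun v => Subtype.ext ((loopU_inr k v).symm.trans (congrFun h v))

theorem continuous_loopU (x : Unitization ℂ LoopK) : Continuous (loopU x) := by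
  have : loopU x = fun v => algebraMap ℂ 𝔅 x.fst + x.snd v := funext (loopU_apply x)
  rw [this]
  exact continuous_const.add (continuous_subtype_val.comp x.snd.continuous)

/-- The constant functions on one of the circles. -/
noncomputable def constOn (s : Bool) : compactsZ →ₙₐ[ℂ] LoopK where
  toFun k := ⟨fun v => if v.2 = s then k else 0,
    (continuous_of_discreteTopology (f := fun t : Bool => if t = s then k else 0)).comp continuous_snd⟩
  map_smul' c k := ContinuousMap.ext fun v => by
    change (if v.2 = s then c • k else 0) = c • (if v.2 = s then k else 0)
    split_ifs <;> simp
  map_zero' := ContinuousMap.ext fun v => ite_self _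
  map_add' k k' := ContinuousMap.ext fun v => by
    change (if v.2 = s then k + k' else 0) = (if v.2 = s then k else 0) + (if v.2 = s then k' else 0)
    split_ifs <;> simp
  map_mul' k k' := ContinuousMap.ext fun v => by
    change (if v.2 = s then k * k' else 0) = (if v.2 = s then k else 0) * (if v.2 = s then k' else 0)
    split_ifs <;> simp

theorem constOn_apply (s : Bool) (k : compactsZ) (v : Circle × Bool) :
    constOn s k v = if v.2 = s then k else 0 := rfl

theorem evalOne_constOn (s t : Bool) (k : compactsZ) :
    evalOne s (constOn t k) = if s = t then k else 0 := rfl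

variable {ι : Type} [Fintype ι] [DecidableEq ι]

/-- Evaluation of a matrix over the unitization of `LoopK`. -/
noncomputable def evalMat (p : Matrix ι ι (Unitization ℂ LoopK)) (v : Circle × Bool) :
    Matrix ι ι 𝔅 := p.map fun x => loopU x v

theorem evalMat_idem {p : Matrix ι ι (Unitization ℂ LoopK)} (hp : IsIdempotentElem p)
    (v : Circle × Bool) : IsIdempotentElem (evalMat p v) :=
  idem_map ((Pi.evalRingHom _ v).comp loopU.toRingHom) hp

theorem continuous_evalMat (p : Matrix ι ι (Unitization ℂ LoopK)) : Continuous (evalMat p) :=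
  continuous_pi fun i => continuous_pi fun j => continuous_loopU (p i j)

theorem evalMat_sub_mem (p : Matrix ι ι (Unitization ℂ LoopK)) (v : Circle × Bool) :
    evalMat p v - (p.map (Unitization.fstHom ℂ LoopK)).map (algebraMap ℂ 𝔅) ∈ cptMat ι := by
  intro i j
  have e : (evalMat p v - (p.map (Unitization.fstHom ℂ LoopK)).map (algebraMap ℂ 𝔅)) i j =
      ((p i j).snd v : 𝔅) := by
    change loopU (p i j) v - algebraMap ℂ 𝔅 (p i j).fst = _
    rw [loopU_apply, add_sub_cancel_left]
  rw [e]
  exact ((p i j).snd v).2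

theorem scalarMod_loopU {x : Circle × Bool → Matrix ι ι 𝔅} (hx : Continuous x) {c : Matrix ι ι ℂ}
    (h : ∀ v, x v - c.map (algebraMap ℂ 𝔅) ∈ cptMat ι) :
    ScalarMod loopU (Matrix.of fun i j v => x v i j) c := fun i j =>
  ⟨⟨fun v => ⟨(x v - c.map (algebraMap ℂ 𝔅)) i j, h v i j⟩, by
    refine Continuous.subtype_mk ?_ _
    exact ((continuous_apply j).comp ((continuous_apply i).comp hx)).sub continuous_const⟩, by
    ext1 v
    rw [loopU_inr]
    rfl⟩

theorem MvN.of_evalMat {p q : Matrix ι ι (Unitization ℂ LoopK)} (hp : IsIdempotentElem p)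
    (hpq : p.map (Unitization.fstHom ℂ LoopK) = q.map (Unitization.fstHom ℂ LoopK))
    {W : Circle × Bool → Matrix ι ι 𝔅} (hW : Continuous W)
    (h : ∀ v, IsUnit (W v) ∧ W v - 1 ∈ cptMat ι ∧ W v * evalMat q v = evalMat p v * W v) :
    MvN p q := by
  set c := p.map (Unitization.fstHom ℂ LoopK) with hc
  have hci : c * c = c := idem_map (Unitization.fstHom ℂ LoopK).toRingHom hp
  set V := fun v => Ring.inverse (W v) with hV
  have hVc : Continuous V := continuous_inverse_mat hW fun v => (h v).1
  have hWV : ∀ v, W v * V v = 1 := fun v => Ring.mul_inverse_cancel _ (h v).1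
  have hVW : ∀ v, V v * W v = 1 := fun v => Ring.inverse_mul_cancel _ (h v).1
  have hVK : ∀ v, V v - 1 ∈ cptMat ι := fun v =>
    inv_sub_one_mem (W := ⟨W v, V v, hWV v, hVW v⟩) (h v).2.1
  have hmul : ∀ x y : Circle × Bool → Matrix ι ι 𝔅, (Matrix.of fun i j v => x v i j) *
      (Matrix.of fun i j v => y v i j) = Matrix.of fun i j v => (x v * y v) i j := fun x y => by
    ext1 i j
    ext1 v
    simp [Matrix.mul_apply]
  have hK : ∀ v, evalMat p v - c.map (algebraMap ℂ 𝔅) ∈ cptMat ι := evalMat_sub_mem p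
  refine MvN.of_map loopU_injective
    (scalarMod_loopU (x := fun v => evalMat p v * W v) (c := c) ((continuous_evalMat p).mul hW) fun v => ?_)
    (scalarMod_loopU (x := fun v => V v * evalMat p v) (c := c) (hVc.mul (continuous_evalMat p)) fun v => ?_)
    ?_ ?_ hci (hci.trans hpq)
  · have e : evalMat p v * W v - c.map (algebraMap ℂ 𝔅) =
        evalMat p v * (W v - 1) + (evalMat p v - c.map (algebraMap ℂ 𝔅)) := by
      rw [mul_sub, mul_one]; abel
    rw [e]
    exact add_mem ((cptMat ι).mul_mem_left _ (h v).2.1) (hK v)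
  · have e : V v * evalMat p v - c.map (algebraMap ℂ 𝔅) =
        (V v - 1) * evalMat p v + (evalMat p v - c.map (algebraMap ℂ 𝔅)) := by
      rw [sub_mul, one_mul]; abel
    rw [e]
    exact add_mem ((cptMat ι).mul_mem_right _ (hVK v)) (hK v)
  · rw [hmul]
    have e : ∀ v, evalMat p v * W v * (V v * evalMat p v) = evalMat p v := fun v => by
      rw [mul_assoc, ← mul_assoc (W v), hWV, one_mul, (evalMat_idem hp v).eq]
    simp only [e]
    rfl
  · rw [hmul]
    have e : ∀ v, V v * evalMat p v * (evalMat p v * W v) = evalMat q v := fun v => by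
      rw [mul_assoc, ← mul_assoc (evalMat p v), (evalMat_idem hp v).eq, ← (h v).2.2, ← mul_assoc, hVW,
        one_mul]
    simp only [e]
    rfl

theorem evalMat_fromBlocks (p q : Matrix ι ι (Unitization ℂ LoopK)) (v : Circle × Bool) :
    evalMat (Matrix.fromBlocks p 0 0 q) v = Matrix.fromBlocks (evalMat p v) 0 0 (evalMat q v) := by
  rw [evalMat, Matrix.fromBlocks_map]
  congr 1 <;> ext1 i j <;> simp

/-- Replacing functions by their scalar parts. -/
noncomputable def scalarHom : Unitization ℂ LoopK →+* Unitization ℂ LoopK :=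
  (algebraMap ℂ (Unitization ℂ LoopK)).comp (Unitization.fstHom ℂ LoopK).toRingHom

/-- Replacing functions by their value at `1` on one circle, and by their scalar part on the other. -/
noncomputable def freeze (s : Bool) : Unitization ℂ LoopK →+* Unitization ℂ LoopK :=
  (unitizationMap ((constOn s).comp (evalOne s))).toRingHom

theorem fst_scalarHom (x : Unitization ℂ LoopK) : (scalarHom x).fst = x.fst := by
  simp [scalarHom, Unitization.algebraMap_eq_inl]

theorem fst_freeze (s : Bool) (x : Unitization ℂ LoopK) : (freeze s x).fst = x.fst :=
  unitizationMap_fst _ x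

theorem loopU_scalarHom (x : Unitization ℂ LoopK) (v : Circle × Bool) :
    loopU (scalarHom x) v = algebraMap ℂ 𝔅 x.fst := by
  change loopU (algebraMap ℂ (Unitization ℂ LoopK) x.fst) v = _
  rw [AlgHom.commutes]
  rfl

theorem loopU_freeze (s : Bool) (x : Unitization ℂ LoopK) (v : Circle × Bool) :
    loopU (freeze s x) v = if v.2 = s then loopU x (1, s) else algebraMap ℂ 𝔅 x.fst := by
  have e : (freeze s x).snd = constOn s (evalOne s x.snd) := unitizationMap_snd _ x
  rw [loopU_apply, fst_freeze, e, constOn_apply]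
  split_ifs
  · rw [loopU_apply]
    rfl
  · exact add_zero _

theorem MvN.freeze {p : Matrix ι ι (Unitization ℂ LoopK)} (hp : IsIdempotentElem p) :
    MvN (Matrix.fromBlocks p 0 0 (p.map scalarHom))
      (Matrix.fromBlocks (p.map (freeze true)) 0 0 (p.map (SemiPeriodic.freeze false))) := by
  set c : Matrix ι ι 𝔅 := (p.map (Unitization.fstHom ℂ LoopK)).map (algebraMap ℂ 𝔅) with hc
  have hci : IsIdempotentElem c := idem_map (algebraMap ℂ 𝔅)
    (idem_map (Unitization.fstHom ℂ LoopK).toRingHom hp)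
  set P := fun v => Matrix.fromBlocks (evalMat p v) 0 0 c with hP
  have e1 : ∀ v, evalMat (Matrix.fromBlocks p 0 0 (p.map scalarHom)) v = P v := fun v => by
    rw [evalMat_fromBlocks]
    congr 1
    ext1 i j
    exact loopU_scalarHom _ v
  have ef : ∀ s v, evalMat (p.map (SemiPeriodic.freeze s)) v = if v.2 = s then evalMat p (1, s) else c := by
    intro s v
    ext1 i j
    refine (loopU_freeze s (p i j) v).trans ?_
    split_ifs <;> rfl
  have hpi := fun v => evalMat_idem hp v
  have loop : ∀ s, ∃ w : Circle → Matrix (ι ⊕ ι) (ι ⊕ ι) 𝔅, Continuous w ∧ ∀ z, IsUnit (w z) ∧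
      w z - 1 ∈ cptMat (ι ⊕ ι) ∧ w z * P (1, s) = P (z, s) * w z := fun s => by
    refine exists_conj_loop_cptMat (q := fun z => P (z, s)) ?_ (fun z => idem_blocks (hpi _) hci) ?_
    · exact ((continuous_evalMat p).comp (by fun_prop)).matrix_fromBlocks continuous_const
        continuous_const continuous_const
    · intro z z'
      have h := sub_mem (evalMat_sub_mem p (z, s)) (evalMat_sub_mem p (z', s))
      rw [sub_sub_sub_cancel_right] at h
      rintro (i | i) (j | j)
      · exact h i j
      all_goals
        simp only [P, Matrix.sub_apply, Matrix.fromBlocks_apply₁₂, Matrix.fromBlocks_apply₂₁,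
          Matrix.fromBlocks_apply₂₂, sub_self]
        exact isCompactOperator_zero
  choose w hwc hw using loop
  obtain ⟨W, hWK, hW⟩ := conjMod_swap (ι := ι) (a := c) (b := evalMat p (1, false)) (c := c) hci (hpi _)
    (by rw [sub_self]; exact zero_mem _) (evalMat_sub_mem p _)
  refine MvN.of_evalMat (idem_blocks hp (idem_map scalarHom hp)) ?_
    (W := fun v => if v.2 = true then w true v.1 else w false v.1 * W) ?_ ?_
  · ext1 i j
    rcases i with i | i <;> rcases j with j | j
    · exact (fst_freeze true (p i j)).symm
    · rfl
    · rfl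
    · exact (fst_scalarHom (p i j)).trans (fst_freeze false (p i j)).symm
  · have h : ∀ s : Bool, Continuous fun z : Circle => if s = true then w true z else w false z * W := by
      intro s
      cases s
      · simp only [Bool.false_eq_true, if_false]
        exact (hwc false).mul continuous_const
      · simpa using hwc true
    exact (continuous_prod_of_discrete_right (α := Circle) (f := fun v : Circle × Bool =>
      if v.2 = true then w true v.1 else w false v.1 * W)).2 h
  · rintro ⟨z, s⟩
    rw [e1, evalMat_fromBlocks, ef, ef]
    cases s
    · simp only [Bool.false_eq_true, if_false, if_true]
      refine ⟨(hw false z).1.mul W.isUnit, mul_sub_one_mem (hw false z).2.1 hWK, ?_⟩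
      rw [mul_assoc, hW, ← mul_assoc, (hw false z).2.2, mul_assoc]
    · simp only [Bool.true_eq_false, if_false, if_true]
      exact hw true z

theorem K0.map_freeze (x : K0 (Unitization ℂ LoopK)) :
    x + K0.map scalarHom x = K0.map (freeze true) x + K0.map (freeze false) x := by
  have h : AddMonoidHom.id _ + K0.map scalarHom = K0.map (freeze true) + K0.map (freeze false) :=
    K0.hom_ext fun n e he => by
      simp only [AddMonoidHom.add_apply, AddMonoidHom.id_apply, K0.map_mk, K0.mk_add]
      exact K0.mk_eq _ _ (MvN.freeze he)
  exact DFunLike.congr_fun h x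

/-- Evaluation at `(1, ±1)` induces an isomorphism on `K₀`. -/
theorem bijective_evalOne : Function.Bijective
    ((K0nu.map (evalOne false)).prod (K0nu.map (evalOne true)) :
      K0nu LoopK →+ K0nu compactsZ × K0nu compactsZ) :=
  K0nu.bijective_prod (constOn false) (constOn true)
    (NonUnitalAlgHom.ext fun k => (evalOne_constOn false false k).trans (if_pos rfl))
    (NonUnitalAlgHom.ext fun k => (evalOne_constOn true true k).trans (if_pos rfl))
    (NonUnitalAlgHom.ext fun k => (evalOne_constOn _ _ k).trans (if_neg Bool.false_ne_true.symm))
    (NonUnitalAlgHom.ext fun k => (evalOne_constOn _ _ k).trans (if_neg Bool.false_ne_true))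
    fun x => (K0.map_freeze x).trans (add_comm _ _)

theorem bijective_nuMap {σ : 𝔄 →⋆ₐ[ℂ] C(X × Bool, ℂ)} {Φ : EK σ →ₙₐ[ℂ] LoopK}
    (h : Function.Bijective Φ) : Function.Bijective (nuMap Φ) :=
  K0nu.bijective_prod_comp h bijective_evalOne

end LoopKTheory

end SemiPeriodic

namespace SemiPeriodic

/-! ## The index of an invertible matrix over a quotient -/

section IndexTheory

theorem idem_one {R : Type*} [Ring R] {ι : Type} [Fintype ι] [DecidableEq ι] :
    IsIdempotentElem (1 : Matrix ι ι R) := one_mul 1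

theorem K0.mk_orthogonal {R : Type*} [Ring R] {ι : Type} [Fintype ι] {e f : Matrix ι ι R}
    (he : IsIdempotentElem e) (hf : IsIdempotentElem f) (hef : e * f = 0) (hfe : f * e = 0)
    (h : IsIdempotentElem (e + f)) : K0.mk (e + f) h = K0.mk e he + K0.mk f hf := by
  rw [K0.mk_add]
  refine K0.mk_eq _ _ ⟨Matrix.fromCols e f, Matrix.fromRows e f, ?_, ?_⟩
  · rw [Matrix.fromCols_mul_fromRows, he.eq, hf.eq]
  · rw [Matrix.fromRows_mul_fromCols, he.eq, hf.eq, hef, hfe]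

theorem K0.mk_sub {R : Type*} [Ring R] {ι : Type} [Fintype ι] [DecidableEq ι] {e : Matrix ι ι R}
    (he : IsIdempotentElem e) : 
    K0.mk (1 - e) he.one_sub = K0.mk (1 : Matrix ι ι R) idem_one - K0.mk e he := by
  have h := K0.mk_orthogonal he he.one_sub he.mul_one_sub_self he.one_sub_mul_self
    (by rw [add_sub_cancel]; exact idem_one (R := R) (ι := ι))
  simp only [add_sub_cancel] at h
  rw [h, add_sub_cancel_left]

variable {A Q J : Type*} [Ring A] [Algebra ℂ A] [Ring Q]
  [NonUnitalRing J] [Module ℂ J] [IsScalarTower ℂ J J] [SMulCommClass ℂ J J]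

/-- `π` is surjective and `U` identifies `J` with its kernel. -/
structure IsExt (π : A →+* Q) (U : Unitization ℂ J →ₐ[ℂ] A) : Prop where
  surj : Function.Surjective π
  inj : ∀ k : J, U k = 0 → k = 0
  ker : ∀ a, π a = 0 ↔ ∃ k : J, U k = a

/-- `c` is the index of `u`: for a left invertible matrix `X` over `A` that lifts `C u`, with a left
inverse `Y` that lifts `u⁻¹ C'`, the idempotent `X Y` has class `c` relative to `1`. -/
def IsIdx (π : A →+* Q) (U : Unitization ℂ J →ₐ[ℂ] A) {ι : Type} [Fintype ι] [DecidableEq ι]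
    (u : (Matrix ι ι Q)ˣ) (c : K0 (Unitization ℂ J)) : Prop :=
  ∃ (μ : Type) (_ : Fintype μ) (C : Matrix μ ι ℂ) (C' : Matrix ι μ ℂ)
    (X : Matrix μ ι A) (Y : Matrix ι μ A) (p : Matrix μ μ (Unitization ℂ J))
    (hp : IsIdempotentElem p), C' * C = 1 ∧ Y * X = 1 ∧
    X.map π = C.map (π.comp (algebraMap ℂ A)) * (u : Matrix ι ι Q) ∧
    Y.map π = ((u⁻¹ : (Matrix ι ι Q)ˣ) : Matrix ι ι Q) * C'.map (π.comp (algebraMap ℂ A)) ∧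
    p.map U = X * Y ∧ p.map (Unitization.fstHom ℂ J) = C * C' ∧
    c = K0.mk p hp - K0.mk (1 : Matrix ι ι (Unitization ℂ J)) idem_one

variable {π : A →+* Q} {U : Unitization ℂ J →ₐ[ℂ] A} {ι κ μ ν : Type} [Fintype ι] [DecidableEq ι]
  [Fintype μ] [Fintype ν]

theorem IsExt.scalarMod (h : IsExt π U) {M : Matrix μ ν A} {C : Matrix μ ν ℂ}
    (hM : M.map π = C.map (π.comp (algebraMap ℂ A))) : ScalarMod U M C := fun i j =>
  (h.ker _).1 (by
    rw [map_sub, sub_eq_zero]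
    exact congrFun (congrFun hM i) j)

theorem IsExt.exists_idem (h : IsExt π U) {M : Matrix μ μ A} {C : Matrix μ μ ℂ}
    (hM : M.map π = C.map (π.comp (algebraMap ℂ A))) (hM1 : IsIdempotentElem M)
    (hC : IsIdempotentElem C) :
    ∃ p : Matrix μ μ (Unitization ℂ J), IsIdempotentElem p ∧ p.map U = M ∧ p.map (Unitization.fstHom ℂ J) = C := by
  obtain ⟨p, h1, h2⟩ := (h.scalarMod hM).exists_matrix
  exact ⟨p, isIdempotentElem_of_map h.inj (by rwa [h1]) (by rwa [h2]), h1, h2⟩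

theorem IsExt.map_map (h : IsExt π U) (p : Matrix μ ν (Unitization ℂ J)) :
    (p.map U).map π = (p.map (Unitization.fstHom ℂ J)).map (π.comp (algebraMap ℂ A)) := by
  ext1 i j
  change π (U (p i j)) = π (algebraMap ℂ A (p i j).fst)
  rw [unitization_apply U (p i j), map_add, (h.ker _).2 ⟨_, rfl⟩, add_zero]

theorem idem_mul_of_eq_one {R : Type*} [Ring R] {X : Matrix μ ι R} {Y : Matrix ι μ R}
    (h : Y * X = 1) : IsIdempotentElem (X * Y) := by
  rw [IsIdempotentElem, Matrix.mul_assoc, ← Matrix.mul_assoc Y, h, Matrix.one_mul]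

theorem IsExt.isIdx_unique (h : IsExt π U) {u : (Matrix ι ι Q)ˣ} {c d : K0 (Unitization ℂ J)}
    (hc : IsIdx π U u c) (hd : IsIdx π U u d) : c = d := by
  obtain ⟨μ, _, C, C', X, Y, p, hp, hC, hYX, hX, hY, hpU, hpC, rfl⟩ := hc
  obtain ⟨ν, _, D, D', Z, W, q, hq, hD, hWZ, hZ, hW, hqU, hqD, rfl⟩ := hd
  congr 1
  refine K0.mk_eq _ _ (MvN.of_map h.inj (x := X * W) (y := Z * Y) (c := C * D') (d := D * C')
    (h.scalarMod ?_) (h.scalarMod ?_) ?_ ?_ ?_ ?_)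
  · rw [Matrix.map_mul, Matrix.map_mul, hX, hW, Matrix.mul_assoc, ← Matrix.mul_assoc _ _ (D'.map _),
      Units.mul_inv, Matrix.one_mul]
  · rw [Matrix.map_mul, Matrix.map_mul, hZ, hY, Matrix.mul_assoc, ← Matrix.mul_assoc _ _ (C'.map _),
      Units.mul_inv, Matrix.one_mul]
  · rw [hpU, Matrix.mul_assoc, ← Matrix.mul_assoc W, hWZ, Matrix.one_mul]
  · rw [hqU, Matrix.mul_assoc, ← Matrix.mul_assoc Y, hYX, Matrix.one_mul]
  · rw [hpC, Matrix.mul_assoc, ← Matrix.mul_assoc D', hD, Matrix.one_mul]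
  · rw [hqD, Matrix.mul_assoc, ← Matrix.mul_assoc C', hC, Matrix.one_mul]

theorem IsExt.isIdx_intro (h : IsExt π U) (u : (Matrix ι ι Q)ˣ) {C : Matrix μ ι ℂ}
    {C' : Matrix ι μ ℂ} {X : Matrix μ ι A} {Y : Matrix ι μ A} (hC : C' * C = 1) (hYX : Y * X = 1)
    (hX : X.map π = C.map (π.comp (algebraMap ℂ A)) * (u : Matrix ι ι Q))
    (hY : Y.map π = ((u⁻¹ : (Matrix ι ι Q)ˣ) : Matrix ι ι Q) * C'.map (π.comp (algebraMap ℂ A))) :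
    ∃ (p : Matrix μ μ (Unitization ℂ J)) (hp : IsIdempotentElem p), p.map U = X * Y ∧
      p.map (Unitization.fstHom ℂ J) = C * C' ∧
      IsIdx π U u (K0.mk p hp - K0.mk (1 : Matrix ι ι (Unitization ℂ J)) idem_one) := by
  obtain ⟨p, hp, h1, h2⟩ := h.exists_idem (M := X * Y) (C := C * C') (by
    rw [Matrix.map_mul, Matrix.map_mul, hX, hY, Matrix.mul_assoc, ← Matrix.mul_assoc _ _ (C'.map _),
      Units.mul_inv, Matrix.one_mul]) (idem_mul_of_eq_one hYX) (idem_mul_of_eq_one hC)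
  exact ⟨p, hp, h1, h2, μ, inferInstance, C, C', X, Y, p, hp, hC, hYX, hX, hY, h1, h2, rfl⟩

theorem IsExt.exists_isIdx (h : IsExt π U) (u : (Matrix ι ι Q)ˣ) : ∃ c, IsIdx π U u c := by
  choose g hg using h.surj
  set a : Matrix ι ι A := (u : Matrix ι ι Q).map g with ha
  set b : Matrix ι ι A := ((u⁻¹ : (Matrix ι ι Q)ˣ) : Matrix ι ι Q).map g with hb
  have ha' : a.map π = u := by ext1 i j; exact hg _
  have hb' : b.map π = ((u⁻¹ : (Matrix ι ι Q)ˣ) : Matrix ι ι Q) := by ext1 i j; exact hg _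
  have hone : (1 : Matrix ι ι A).map π = 1 := Matrix.map_one _ (map_zero π) (map_one π)
  have hba : (1 - b * a).map π = 0 := by
    rw [Matrix.map_sub (hf := map_sub π), Matrix.map_mul, ha', hb', Units.inv_mul, hone, sub_self]
  obtain ⟨p, hp, -, -, hc⟩ := h.isIdx_intro u (C := Matrix.fromRows 1 0) (C' := Matrix.fromCols 1 0)
    (X := Matrix.fromRows a (1 - b * a)) (Y := Matrix.fromCols (b + (1 - b * a) * b) (1 - b * a))
    (by simp [Matrix.fromCols_mul_fromRows]) (by
      rw [Matrix.fromCols_mul_fromRows]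
      noncomm_ring) (by
      rw [Matrix.fromRows_map, Matrix.fromRows_map, Matrix.fromRows_mul, hba, ha',
        Matrix.map_one _ (map_zero _) (map_one _), Matrix.map_zero _ (map_zero _), Matrix.one_mul,
        Matrix.zero_mul]) (by
      rw [Matrix.fromCols_map, Matrix.fromCols_map, Matrix.mul_fromCols, hba,
        Matrix.map_add (hf := map_add π), Matrix.map_mul, hba, hb', Matrix.zero_mul, add_zero,
        Matrix.map_one _ (map_zero _) (map_one _), Matrix.map_zero _ (map_zero _), Matrix.mul_one,
        Matrix.mul_zero])
  exact ⟨_, hc⟩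

theorem IsIdx.map_fst {u : (Matrix ι ι Q)ˣ} {c : K0 (Unitization ℂ J)} (hc : IsIdx π U u c) :
    c ∈ K0nu J := by
  obtain ⟨μ, _, C, C', X, Y, p, hp, hC, -, -, -, -, hpC, rfl⟩ := hc
  change K0.map (Unitization.fstHom ℂ J).toRingHom _ = 0
  rw [map_sub, sub_eq_zero, K0.map_mk, K0.map_mk]
  refine K0.mk_eq _ _ ⟨C, C', hpC.symm, hC.trans ?_⟩
  exact (Matrix.map_one _ (map_zero _) (map_one _)).symm

theorem IsIdx.of_map (W : (Matrix ι ι A)ˣ) {u : (Matrix ι ι Q)ˣ}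
    (hW : (W : Matrix ι ι A).map π = u) : IsIdx π U u 0 := by
  have hone : (1 : Matrix ι ι A).map π = 1 := Matrix.map_one _ (map_zero π) (map_one π)
  have h1 : (1 : Matrix ι ι ℂ).map (π.comp (algebraMap ℂ A)) = 1 :=
    Matrix.map_one _ (map_zero _) (map_one _)
  have hW' : ((W⁻¹ : (Matrix ι ι A)ˣ) : Matrix ι ι A).map π = ((u⁻¹ : (Matrix ι ι Q)ˣ) : Matrix ι ι Q) := by
    refine (Units.inv_eq_of_mul_eq_one_right ?_).symm
    rw [← hW, ← Matrix.map_mul, Units.mul_inv, hone]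
  refine ⟨ι, inferInstance, 1, 1, W, ((W⁻¹ : (Matrix ι ι A)ˣ) : Matrix ι ι A), 1, idem_one, one_mul 1,
    Units.inv_mul W, ?_, ?_, ?_, ?_, (sub_self _).symm⟩
  · rw [hW, h1, Matrix.one_mul]
  · rw [hW', h1, Matrix.mul_one]
  · rw [Units.mul_inv]
    exact Matrix.map_one _ (map_zero _) (map_one _)
  · rw [Matrix.one_mul]
    exact Matrix.map_one _ (map_zero _) (map_one _)

theorem IsExt.isIdx_mul (h : IsExt π U) {u v : (Matrix ι ι Q)ˣ} {c d : K0 (Unitization ℂ J)}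
    (hc : IsIdx π U u c) (hd : IsIdx π U v d) : IsIdx π U (u * v) (c + d) := by
  classical
  obtain ⟨μ, _, C, C', X, Y, p, hp, hC, hYX, hX, hY, hpU, hpC, rfl⟩ := hc
  obtain ⟨ν, _, D, D', Z, W, q, hq, hD, hWZ, hZ, hW, hqU, hqD, rfl⟩ := hd
  set ρ := π.comp (algebraMap ℂ A) with hρ
  set a : ℂ →+* A := algebraMap ℂ A with ha
  have hπa : ∀ {α β : Type} (M : Matrix α β ℂ), (M.map a).map π = M.map ρ := fun M => rfl
  have hDD : IsIdempotentElem (D * D') := idem_mul_of_eq_one hD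
  have hDa : D'.map a * D.map a = 1 := by
    rw [← Matrix.map_mul, hD, Matrix.map_one _ (map_zero a) (map_one a)]
  have hDρ : D'.map ρ * D.map ρ = 1 := by
    rw [← Matrix.map_mul, hD, Matrix.map_one _ (map_zero ρ) (map_one ρ)]
  set e := 1 - D.map a * D'.map a with he
  have hei : e * e = e := (idem_mul_of_eq_one hDa).one_sub
  have heD : e * D.map a = 0 := by
    rw [he, Matrix.sub_mul, Matrix.mul_assoc, hDa, Matrix.mul_one, Matrix.one_mul, sub_self]
  have hDe : D'.map a * e = 0 := by
    rw [he, Matrix.mul_sub, ← Matrix.mul_assoc, hDa, Matrix.mul_one, Matrix.one_mul, sub_self]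
  set F : Matrix (μ ⊕ ν) ν A := Matrix.fromRows (X * D'.map a) e with hF
  set G : Matrix ν (μ ⊕ ν) A := Matrix.fromCols (D.map a * Y) e with hG
  have hGF : G * F = 1 := by
    rw [hF, hG, Matrix.fromCols_mul_fromRows, hei, Matrix.mul_assoc, ← Matrix.mul_assoc Y, hYX,
      Matrix.one_mul, he, add_sub_cancel]
  have hFG : F * G = Matrix.fromBlocks (X * Y) 0 0 e := by
    rw [hF, hG, Matrix.fromRows_mul_fromCols, hei, Matrix.mul_assoc, ← Matrix.mul_assoc (D'.map a), hDa,
      Matrix.one_mul, Matrix.mul_assoc, hDe, Matrix.mul_zero, ← Matrix.mul_assoc, heD, Matrix.zero_mul]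
  have heπ : e.map π = 1 - D.map ρ * D'.map ρ := by
    rw [he, Matrix.map_sub (hf := map_sub π), Matrix.map_one _ (map_zero π) (map_one π), Matrix.map_mul]
    rfl
  have heD' : e.map π * D.map ρ = 0 := by
    rw [heπ, Matrix.sub_mul, Matrix.mul_assoc, hDρ, Matrix.mul_one, Matrix.one_mul, sub_self]
  have hDe' : D'.map ρ * e.map π = 0 := by
    rw [heπ, Matrix.mul_sub, ← Matrix.mul_assoc, hDρ, Matrix.mul_one, Matrix.one_mul, sub_self]
  obtain ⟨r, hr, hrU, hrC, hidx⟩ := h.isIdx_intro (u * v) (C := Matrix.fromRows C 0)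
    (C' := Matrix.fromCols C' 0) (X := F * Z) (Y := W * G)
    (by rw [Matrix.fromCols_mul_fromRows, hC, Matrix.mul_zero, add_zero])
    (by rw [Matrix.mul_assoc, ← Matrix.mul_assoc G, hGF, Matrix.one_mul, hWZ])
    (by
      rw [Matrix.map_mul, hF, Matrix.fromRows_map, Matrix.fromRows_map, Matrix.fromRows_mul,
        Matrix.fromRows_mul, hZ, Matrix.map_mul, hX, ← Matrix.mul_assoc (e.map π), heD',
        Matrix.mul_assoc, hπa, ← Matrix.mul_assoc (D'.map ρ), hDρ, Matrix.map_zero _ (map_zero _)]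
      simp only [Matrix.one_mul, Matrix.zero_mul, Matrix.mul_assoc, Units.val_mul]
      rfl)
    (by
      rw [Matrix.map_mul, hG, Matrix.fromCols_map, Matrix.fromCols_map, Matrix.mul_fromCols,
        Matrix.mul_fromCols, hW, Matrix.map_mul, hY, Matrix.mul_assoc, Matrix.mul_assoc _ _ (e.map π),
        hDe', hπa, ← Matrix.mul_assoc (D'.map ρ), hDρ, Matrix.map_zero _ (map_zero _), mul_inv_rev]
      simp only [Matrix.one_mul, Matrix.mul_zero, Matrix.mul_assoc, Units.val_mul]
      rfl)
  have hgoal : K0.mk r hr - K0.mk (1 : Matrix ι ι (Unitization ℂ J)) idem_one =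
      K0.mk p hp - K0.mk (1 : Matrix ι ι (Unitization ℂ J)) idem_one +
        (K0.mk q hq - K0.mk (1 : Matrix ι ι (Unitization ℂ J)) idem_one) := by
    set b : ℂ →+* Unitization ℂ J := algebraMap ℂ (Unitization ℂ J) with hb
    set s : Matrix ν ν (Unitization ℂ J) := (D * D').map b with hs
    have hsi : IsIdempotentElem s := idem_map b hDD
    have e1 : K0.mk s hsi = K0.mk (1 : Matrix ι ι (Unitization ℂ J)) idem_one :=
      K0.mk_eq _ _ ⟨D.map b, D'.map b, by rw [← Matrix.map_mul], by
        rw [← Matrix.map_mul, hD, Matrix.map_one _ (map_zero b) (map_one b)]⟩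
    have hsU : s.map U = D.map a * D'.map a := by
      rw [← Matrix.map_mul]
      ext1 i j
      exact AlgHom.commutes U _
    have hsf : s.map (Unitization.fstHom ℂ J) = D * D' := by
      ext1 i j
      exact AlgHom.commutes (Unitization.fstHom ℂ J) _
    have e2 : K0.mk p hp + K0.mk (1 - s) hsi.one_sub = K0.mk r hr + K0.mk (1 - q) hq.one_sub := by
      rw [K0.mk_add, K0.mk_add]
      have hZW : IsIdempotentElem (Z * W) := idem_mul_of_eq_one hWZ
      set f := 1 - Z * W with hf
      have hff : f * f = f := hZW.one_sub
      have hFf : F * Z * (W * G) * (F * f) = 0 := by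
        rw [Matrix.mul_assoc, Matrix.mul_assoc, Matrix.mul_assoc W, ← Matrix.mul_assoc G, hGF,
          Matrix.one_mul, ← Matrix.mul_assoc Z, hZW.mul_one_sub_self, Matrix.mul_zero]
      have hfG : f * G * (F * Z * (W * G)) = 0 := by
        rw [Matrix.mul_assoc, ← Matrix.mul_assoc G, ← Matrix.mul_assoc G, hGF, Matrix.one_mul,
          ← Matrix.mul_assoc, ← Matrix.mul_assoc, Matrix.mul_assoc f, hZW.one_sub_mul_self,
          Matrix.zero_mul]
      have hN : F * Z * (W * G) * (F * Z * (W * G)) = F * Z * (W * G) := by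
        rw [← hrU, ← Matrix.map_mul, hr.eq]
      have hfπ : f.map π = (1 - D * D').map ρ := by
        rw [hf, Matrix.map_sub (hf := map_sub π), Matrix.map_mul, hZ, hW, Matrix.mul_assoc,
          ← Matrix.mul_assoc _ _ (D'.map _), Units.mul_inv, Matrix.one_mul,
          Matrix.map_one _ (map_zero π) (map_one π), Matrix.map_sub (hf := map_sub ρ),
          Matrix.map_one _ (map_zero ρ) (map_one ρ), Matrix.map_mul]
      have hE := hDD.one_sub
      have hfe : f.map π = e.map π := by
        rw [hfπ, heπ, Matrix.map_sub (hf := map_sub ρ), Matrix.map_one _ (map_zero ρ) (map_one ρ),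
          Matrix.map_mul]
      have heeπ : e.map π * e.map π = e.map π := by rw [← Matrix.map_mul, hei]
      refine K0.mk_eq _ _ <| MvN.of_map h.inj (x := Matrix.fromCols (F * Z * (W * G)) (F * f))
        (y := Matrix.fromRows (F * Z * (W * G)) (f * G))
        (c := Matrix.fromCols (Matrix.fromRows C 0 * Matrix.fromCols C' 0) (Matrix.fromRows 0 (1 - D * D')))
        (d := Matrix.fromRows (Matrix.fromRows C 0 * Matrix.fromCols C' 0) (Matrix.fromCols 0 (1 - D * D')))
        (h.scalarMod ?_) (h.scalarMod ?_) ?_ ?_ ?_ ?_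
      · rw [Matrix.fromCols_map, Matrix.fromCols_map, ← hrU, ← hrC, h.map_map, Matrix.map_mul, hF,
          Matrix.fromRows_map, Matrix.fromRows_map, Matrix.fromRows_mul, hfe, heeπ, Matrix.map_mul, hπa,
          Matrix.mul_assoc, hDe', Matrix.mul_zero, Matrix.map_zero _ (map_zero _), ← hfe, hfπ]
      · rw [Matrix.fromRows_map, Matrix.fromRows_map, ← hrU, ← hrC, h.map_map, Matrix.map_mul, hG,
          Matrix.fromCols_map, Matrix.fromCols_map, Matrix.mul_fromCols, hfe, heeπ, Matrix.map_mul, hπa,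
          ← Matrix.mul_assoc, heD', Matrix.zero_mul, Matrix.map_zero _ (map_zero _), ← hfe, hfπ]
      · rw [Matrix.fromCols_mul_fromRows, hN, Matrix.fromBlocks_map, hpU, Matrix.mul_assoc F f,
          ← Matrix.mul_assoc f f, hff, Matrix.mul_assoc F Z, ← Matrix.mul_assoc Z W, ← Matrix.mul_add,
          ← Matrix.add_mul, hf, add_sub_cancel, Matrix.one_mul, hFG, Matrix.map_zero _ (map_zero _),
          Matrix.map_zero _ (map_zero _), Matrix.map_sub (hf := map_sub U), hsU,
          Matrix.map_one _ (map_zero U) (map_one U)]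
      · rw [Matrix.fromRows_mul_fromCols, hN, hFf, hfG, Matrix.fromBlocks_map, hrU, Matrix.mul_assoc f G,
          ← Matrix.mul_assoc G F, hGF, Matrix.one_mul, hff, Matrix.map_zero _ (map_zero _),
          Matrix.map_zero _ (map_zero _), Matrix.map_sub (hf := map_sub U), hqU,
          Matrix.map_one _ (map_zero U) (map_one U)]
      · rw [Matrix.fromCols_mul_fromRows, ← hrC, ← Matrix.map_mul, hr.eq, hrC, Matrix.fromBlocks_map,
          hpC, Matrix.map_sub (hf := map_sub (Unitization.fstHom ℂ J)), hsf]
        simp only [Matrix.fromRows_mul_fromCols, hE.eq, Matrix.fromBlocks_add, Matrix.zero_mul,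
          Matrix.mul_zero, add_zero, zero_add]
        simp
      · rw [Matrix.fromRows_mul_fromCols, ← hrC, ← Matrix.map_mul, hr.eq, hrC, Matrix.fromBlocks_map,
          hrC, Matrix.map_sub (hf := map_sub (Unitization.fstHom ℂ J)), hqD]
        simp [Matrix.fromCols_mul_fromRows, hE.eq, Matrix.mul_fromCols]
    rw [K0.mk_sub hsi, K0.mk_sub hq, e1] at e2
    rw [eq_sub_of_add_eq e2.symm]
    abel
  rwa [hgoal] at hidx

end IndexTheory

end SemiPeriodic

namespace SemiPeriodic

section IndexMap

variable {A Q J : Type*} [Ring A] [Algebra ℂ A] [Ring Q]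
  [NonUnitalRing J] [Module ℂ J] [IsScalarTower ℂ J J] [SMulCommClass ℂ J J]
  {π : A →+* Q} {U : Unitization ℂ J →ₐ[ℂ] A} {ι κ ι' : Type} [Fintype ι] [DecidableEq ι]
  [Fintype κ] [DecidableEq κ] [Fintype ι'] [DecidableEq ι']

theorem IsIdx.reindex {u : (Matrix ι ι Q)ˣ} {c : K0 (Unitization ℂ J)} (hc : IsIdx π U u c)
    (e : ι ⊕ κ ≃ ι') {v : (Matrix ι' ι' Q)ˣ}
    (hv : (v : Matrix ι' ι' Q) = Matrix.reindex e e (Matrix.fromBlocks (u : Matrix ι ι Q) 0 0 1))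
    (hv' : ((v⁻¹ : (Matrix ι' ι' Q)ˣ) : Matrix ι' ι' Q) =
      Matrix.reindex e e (Matrix.fromBlocks ((u⁻¹ : (Matrix ι ι Q)ˣ) : Matrix ι ι Q) 0 0 1)) :
    IsIdx π U v c := by
  obtain ⟨μ, _, C, C', X, Y, p, hp, hC, hYX, hX, hY, hpU, hpC, rfl⟩ := hc
  set ρ := π.comp (algebraMap ℂ A) with hρ
  have hone : IsIdempotentElem (1 : Matrix κ κ (Unitization ℂ J)) := idem_one
  refine ⟨μ ⊕ κ, inferInstance, (Matrix.fromBlocks C 0 0 1).submatrix id e.symm,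
    (Matrix.fromBlocks C' 0 0 1).submatrix e.symm id, (Matrix.fromBlocks X 0 0 1).submatrix id e.symm,
    (Matrix.fromBlocks Y 0 0 1).submatrix e.symm id, Matrix.fromBlocks p 0 0 1,
    idem_blocks hp hone, ?_, ?_, ?_, ?_, ?_, ?_, ?_⟩
  · rw [← Matrix.submatrix_mul _ _ _ _ _ Function.bijective_id, Matrix.fromBlocks_multiply]
    simp [hC]
  · rw [← Matrix.submatrix_mul _ _ _ _ _ Function.bijective_id, Matrix.fromBlocks_multiply]
    simp [hYX]
  · rw [hv, Matrix.reindex_apply, ← Matrix.submatrix_map, ← Matrix.submatrix_map,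
      Matrix.submatrix_mul_equiv, Matrix.fromBlocks_map, Matrix.fromBlocks_map, hX,
      Matrix.fromBlocks_multiply]
    simp
    rfl
  · rw [hv', Matrix.reindex_apply, ← Matrix.submatrix_map, ← Matrix.submatrix_map,
      Matrix.submatrix_mul_equiv, Matrix.fromBlocks_map, Matrix.fromBlocks_map, hY,
      Matrix.fromBlocks_multiply]
    simp
    rfl
  · rw [Matrix.submatrix_mul_equiv, Matrix.fromBlocks_multiply, Matrix.fromBlocks_map, hpU]
    simp
  · rw [Matrix.submatrix_mul_equiv, Matrix.fromBlocks_multiply, Matrix.fromBlocks_map, hpC]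
    simp
  · have h1 : K0.mk (1 : Matrix ι' ι' (Unitization ℂ J)) idem_one =
        K0.mk (1 : Matrix ι ι (Unitization ℂ J)) idem_one + K0.mk (1 : Matrix κ κ (Unitization ℂ J)) hone := by
      have h2 := MvN.reindex e (idem_one (R := Unitization ℂ J) (ι := ι ⊕ κ))
      rw [K0.mk_add]
      refine K0.mk_eq _ _ ?_
      rw [Matrix.fromBlocks_one]
      simpa using h2.symm
    rw [h1, ← K0.mk_add hp hone]
    abel

theorem IsIdx.pad {m n : ℕ} (h : m ≤ n) {u : GLn Q m} {c : K0 (Unitization ℂ J)}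
    (hc : IsIdx π U u c) : IsIdx π U (SemiPeriodic.pad h u) c :=
  hc.reindex (finSumFinEquiv.trans (finCongr (Nat.add_sub_cancel' h))) rfl
    (by rw [← map_inv]; rfl)

theorem IsIdx.map {B R J' : Type*} [Ring B] [Algebra ℂ B] [Ring R] [NonUnitalRing J'] [Module ℂ J']
    [IsScalarTower ℂ J' J'] [SMulCommClass ℂ J' J'] {π' : B →+* R} {U' : Unitization ℂ J' →ₐ[ℂ] B}
    (f : A →+* B) (hf : ∀ c : ℂ, f (algebraMap ℂ A c) = algebraMap ℂ B c) (g : J →ₙₐ[ℂ] J')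
    (hfg : ∀ k : J, f (U k) = U' (g k)) (h : Q →+* R) (hh : ∀ a, h (π a) = π' (f a))
    {u : (Matrix ι ι Q)ˣ} {c : K0 (Unitization ℂ J)} (hc : IsIdx π U u c) :
    IsIdx π' U' (Units.map h.mapMatrix.toMonoidHom u) (K0.map (unitizationMap g).toRingHom c) := by
  obtain ⟨μ, _, C, C', X, Y, p, hp, hC, hYX, hX, hY, hpU, hpC, rfl⟩ := hc
  have hρ : ∀ {α β : Type} (M : Matrix α β ℂ), (M.map (π.comp (algebraMap ℂ A))).map h =
      M.map (π'.comp (algebraMap ℂ B)) := fun M => by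
    ext1 i j
    change h (π (algebraMap ℂ A _)) = π' (algebraMap ℂ B _)
    rw [hh, hf]
  have hπ : ∀ {α β : Type} (M : Matrix α β A), (M.map f).map π' = (M.map π).map h := fun M => by
    ext1 i j
    exact (hh _).symm
  have hUU : ∀ x, U' (unitizationMap g x) = f (U x) := fun x => by
    rw [unitization_apply U x, unitization_apply U', map_add, hf, hfg, unitizationMap_fst,
      unitizationMap_snd]
  refine ⟨μ, inferInstance, C, C', X.map f, Y.map f, p.map (unitizationMap g).toRingHom, idem_map _ hp,
    hC, ?_, ?_, ?_, ?_, ?_, ?_⟩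
  · rw [← Matrix.map_mul, hYX, Matrix.map_one _ (map_zero f) (map_one f)]
  · rw [hπ, hX, Matrix.map_mul, hρ]
    rfl
  · rw [hπ, hY, Matrix.map_mul, hρ, ← map_inv]
    rfl
  · rw [← Matrix.map_mul, ← hpU]
    ext1 i j
    exact hUU _
  · rw [← hpC]
    ext1 i j
    exact unitizationMap_fst g _
  · rw [map_sub, K0.map_mk, K0.map_mk]
    congr 1
    refine K0.mk_eq _ _ ?_
    rw [Matrix.map_one _ (map_zero _) (map_one _)]
    exact MvN.refl idem_one

/-- The index map, provided invertible matrices in the connected component of `1` lift. -/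
theorem IsExt.exists_indexMap [TopologicalSpace Q] [IsTopologicalRing Q] (h : IsExt π U)
    (hlift : ∀ (n : ℕ), ∀ u ∈ Subgroup.connectedComponentOfOne (GLn Q n),
      ∃ W : (Matrix (Fin n) (Fin n) A)ˣ, (W : Matrix (Fin n) (Fin n) A).map π = u) :
    ∃ δ : Additive (K1 Q) →+ K0nu J, ∀ (n : ℕ) (u : GLn Q n) (c : K0 (Unitization ℂ J)),
      IsIdx π U u c → (δ (Additive.ofMul (K1.mk u)) : K0 (Unitization ℂ J)) = c := by
  choose idx hidx using fun (n : ℕ) (u : GLn Q n) => h.exists_isIdx u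
  have hmem : ∀ n u, idx n u ∈ K0nu J := fun n u => (hidx n u).map_fst
  have hmul : ∀ n u v, idx n (u * v) = idx n u + idx n v := fun n u v =>
    h.isIdx_unique (hidx n _) (h.isIdx_mul (hidx n u) (hidx n v))
  let F : ∀ n, GLn Q n →* Multiplicative (K0nu J) := fun n =>
    MonoidHom.mk' (fun u => Multiplicative.ofAdd ⟨idx n u, hmem n u⟩) fun u v =>
      congrArg Multiplicative.ofAdd (Subtype.ext (hmul n u v))
  have hF : ∀ n, Subgroup.connectedComponentOfOne (GLn Q n) ≤ (F n).ker := fun n u hu => by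
    obtain ⟨W, hW⟩ := hlift n u hu
    exact congrArg Multiplicative.ofAdd
      (Subtype.ext (h.isIdx_unique (hidx n u) (IsIdx.of_map W hW)) : (⟨idx n u, hmem n u⟩ : K0nu J) = 0)
  let G : ∀ n, GLComp Q n →* Multiplicative (K0nu J) := fun n => QuotientGroup.lift _ (F n) (hF n)
  have hG : ∀ (m n : ℕ) (hmn : m ≤ n) (x : GLComp Q m), G m x = G n (padComp hmn x) := by
    intro m n hmn x
    induction x using QuotientGroup.induction_on with
    | H u =>
      exact congrArg Multiplicative.ofAdd
        (Subtype.ext (h.isIdx_unique ((hidx m u).pad hmn) (hidx n _)))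
  let D : K1 Q →* Multiplicative (K0nu J) := MonoidHom.mk'
    (fun x => DirectLimit.lift (fun _ _ h => padComp (Q := Q) h) (fun n => G n) hG x)
    (DirectLimit.lift_mul (f := fun _ _ h => padComp (Q := Q) h) G hG)
  refine ⟨MonoidHom.toAdditiveLeft D, fun n u c hc => ?_⟩
  exact h.isIdx_unique (hidx n u) hc

end IndexMap

end SemiPeriodic

namespace SemiPeriodic

section Lifting

attribute [local instance] Matrix.linftyOpNormedRing Matrix.linftyOpNormedAlgebra

theorem isOpenMap_mk {R : Type*} [Ring R] [TopologicalSpace R] [IsTopologicalRing R] (I : Ideal R)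
    [I.IsTwoSided] : IsOpenMap (Ideal.Quotient.mk I) := fun U hU => by
  rw [isOpen_coinduced]
  have : (Ideal.Quotient.mk I) ⁻¹' ((Ideal.Quotient.mk I) '' U) = ⋃ x ∈ I, (fun y => x + y) ⁻¹' U := by
    ext y
    simp only [Set.mem_preimage, Set.mem_image, Set.mem_iUnion, exists_prop]
    exact ⟨fun ⟨z, hz, h⟩ => ⟨z - y, Ideal.Quotient.eq.mp h, by simpa using hz⟩,
      fun ⟨x, hx, h⟩ => ⟨x + y, h, by simp [Ideal.Quotient.eq_zero_iff_mem.mpr hx]⟩⟩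
  rw [this]
  exact isOpen_biUnion fun x _ => hU.preimage (by fun_prop)

theorem isOpen_isUnit_matrix (R : Type*) [NormedRing R] [CompleteSpace R] (n : ℕ) :
    IsOpen {m : Matrix (Fin n) (Fin n) R | IsUnit m} := by
  have : @CompleteSpace (Matrix (Fin n) (Fin n) R)
      (Matrix.linftyOpNormedRing.toMetricSpace.toUniformSpace) :=
    (inferInstance : CompleteSpace (Fin n → Fin n → R))
  exact Units.isOpen

theorem exists_lift_of_mem_component {R : Type*} [NormedRing R] [CompleteSpace R] (I : Ideal R)
    [I.IsTwoSided] {n : ℕ} {u : GLn (R ⧸ I) n} (hu : u ∈ Subgroup.connectedComponentOfOne (GLn (R ⧸ I) n)) :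
    ∃ W : (Matrix (Fin n) (Fin n) R)ˣ,
      (W : Matrix (Fin n) (Fin n) R).map (Ideal.Quotient.mk I) = u := by
  set f : (Matrix (Fin n) (Fin n) R)ˣ →* GLn (R ⧸ I) n :=
    Units.map (Ideal.Quotient.mk I).mapMatrix.toMonoidHom with hf
  have hopen : IsOpenMap fun m : Matrix (Fin n) (Fin n) R => m.map (Ideal.Quotient.mk I) := by
    have h1 : ∀ i : Fin n, IsOpenMap (Pi.map (fun _ : Fin n => (Ideal.Quotient.mk I : R → R ⧸ I))) :=
      fun i => IsOpenMap.piMap (fun _ => isOpenMap_mk I) (by simp)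
    exact IsOpenMap.piMap (f := fun _ : Fin n => Pi.map (fun _ : Fin n => (Ideal.Quotient.mk I : R → R ⧸ I)))
      h1 (by simp)
  have hV : IsOpen ((fun m : Matrix (Fin n) (Fin n) R => m.map (Ideal.Quotient.mk I)) ''
      {m | IsUnit m}) := hopen _ (isOpen_isUnit_matrix R n)
  have hH : IsOpen (f.range : Set (GLn (R ⧸ I) n)) := by
    refine Subgroup.isOpen_of_mem_nhds _ (g := 1) (Filter.mem_of_superset
      ((hV.preimage Units.continuous_val).mem_nhds ⟨1, isUnit_one, ?_⟩) ?_)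
    · exact Matrix.map_one _ (map_zero _) (map_one _)
    · rintro v ⟨_, ⟨w, rfl⟩, hw⟩
      exact ⟨w, Units.ext hw⟩
  obtain ⟨W, hW⟩ : u ∈ f.range := (IsClopen.connectedComponent_subset
    ⟨Subgroup.isClosed_of_isOpen _ hH, hH⟩ f.range.one_mem) hu
  exact ⟨W, congrArg Units.val hW⟩

end Lifting

section Extension

theorem unitization_coe {A : Type*} [Ring A] [Algebra ℂ A] {J : NonUnitalSubalgebra ℂ A} (k : J) :
    NonUnitalSubalgebra.unitization J (k : Unitization ℂ J) = k := by
  simp [NonUnitalSubalgebra.unitization_apply]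

theorem isExt_factor {R : Type*} [Ring R] [Algebra ℂ R] {I I' : Ideal R} [I.IsTwoSided] [I'.IsTwoSided]
    (h : I ≤ I') {J : NonUnitalSubalgebra ℂ (R ⧸ I)}
    (hJ : (J : Set (R ⧸ I)) = Ideal.Quotient.mk I '' (I' : Set R)) :
    IsExt (Ideal.Quotient.factor h) (NonUnitalSubalgebra.unitization J) where
  surj := Ideal.Quotient.factor_surjective h
  inj k hk := Subtype.ext ((unitization_coe k).symm.trans hk)
  ker a := by
    obtain ⟨A, rfl⟩ := Ideal.Quotient.mk_surjective a
    rw [Ideal.Quotient.factor_mk, Ideal.Quotient.eq_zero_iff_mem]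
    simp only [unitization_coe]
    constructor
    · exact fun hA => ⟨⟨_, hJ.ge ⟨A, hA, rfl⟩⟩, rfl⟩
    · rintro ⟨⟨_, hk⟩, rfl⟩
      obtain ⟨B, hB, hBA⟩ := hJ.le hk
      have h2 := sub_mem (S := Ideal R) hB (h (Ideal.Quotient.eq.1 hBA))
      rwa [sub_sub_cancel] at h2

variable {σ : 𝔄 →⋆ₐ[ℂ] C(X × Bool, ℂ)}

theorem isExt_EK (hK : compactIdeal ≤ RingHom.ker σ) :
    IsExt (Ideal.Quotient.factor hK) (NonUnitalSubalgebra.unitization (EK σ)) :=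
  isExt_factor hK rfl

theorem exists_indexMap_EK (hK : compactIdeal ≤ RingHom.ker σ) :
    ∃ δ : Additive (K1 (AE σ)) →+ K0nu (EK σ), ∀ (n : ℕ) (u : GLn (AE σ) n) (c : K0 (Unitization ℂ (EK σ))),
      IsIdx (Ideal.Quotient.factor hK) (NonUnitalSubalgebra.unitization (EK σ)) u c →
      (δ (Additive.ofMul (K1.mk u)) : K0 (Unitization ℂ (EK σ))) = c := by
  have : CompleteSpace 𝔄 := (StarSubalgebra.isClosed_topologicalClosure _).completeSpace_coe
  refine (isExt_EK hK).exists_indexMap fun n u hu => ?_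
  obtain ⟨W, hW⟩ := exists_lift_of_mem_component (RingHom.ker σ) hu
  refine ⟨Units.map (Ideal.Quotient.mk compactIdeal).mapMatrix.toMonoidHom W, ?_⟩
  rw [← hW]
  ext1 i j
  exact Ideal.Quotient.factor_mk hK _

theorem isIndexMap_of_isIdx {A Q : Type*} [Ring A] [Algebra ℂ A] [Ring Q] [TopologicalSpace Q]
    [IsTopologicalRing Q] {π : A →+* Q} {J : NonUnitalSubalgebra ℂ A} {δ : Additive (K1 Q) →+ K0nu J}
    (h : ∀ (n : ℕ) (u : GLn Q n) (c : K0 (Unitization ℂ J)),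
      IsIdx π (NonUnitalSubalgebra.unitization J) u c →
      (δ (Additive.ofMul (K1.mk u)) : K0 (Unitization ℂ J)) = c) : IsIndexMap π J δ := by
  intro n u w p hp hw hpU hpf
  set W : Matrix (Fin n ⊕ Fin n) (Fin n ⊕ Fin n) A := (w : Matrix (Fin n ⊕ Fin n) (Fin n ⊕ Fin n) A)
    with hW
  set W' : Matrix (Fin n ⊕ Fin n) (Fin n ⊕ Fin n) A :=
    ((w⁻¹ : (Matrix (Fin n ⊕ Fin n) (Fin n ⊕ Fin n) A)ˣ) : Matrix (Fin n ⊕ Fin n) (Fin n ⊕ Fin n) A)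
    with hW'
  have hWW : W' * W = 1 := Units.inv_mul w
  have hWW' : W * W' = 1 := Units.mul_inv w
  have hw' : W'.map π = Matrix.fromBlocks ((u⁻¹ : GLn Q n) : Matrix (Fin n) (Fin n) Q) 0 0
      (u : Matrix (Fin n) (Fin n) Q) := by
    refine left_inv_eq_right_inv (a := W.map π) ?_ ?_
    · rw [← Matrix.map_mul, hWW, Matrix.map_one _ (map_zero π) (map_one π)]
    · rw [hw, Matrix.fromBlocks_multiply]
      simp
  have hcorner : ∀ (S : Type _) [Ring S], (Matrix.fromRows 1 0 : Matrix (Fin n ⊕ Fin n) (Fin n) S) *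
      (Matrix.fromCols 1 0 : Matrix (Fin n) (Fin n ⊕ Fin n) S) = Matrix.fromBlocks 1 0 0 0 :=
    fun S _ => by
      rw [Matrix.fromRows_mul_fromCols]
      simp only [Matrix.mul_zero, Matrix.zero_mul, Matrix.one_mul]
  have hone : ∀ (S : Type _) [Ring S], (Matrix.fromCols 1 0 : Matrix (Fin n) (Fin n ⊕ Fin n) S) *
      (Matrix.fromRows 1 0 : Matrix (Fin n ⊕ Fin n) (Fin n) S) = 1 :=
    fun S _ => by simp [Matrix.fromCols_mul_fromRows]
  have e1 : K0.mk (Matrix.fromBlocks 1 0 0 0 :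
      Matrix (Fin n ⊕ Fin n) (Fin n ⊕ Fin n) (Unitization ℂ J)) (idem_corner _ n) =
      K0.mk (1 : Matrix (Fin n) (Fin n) (Unitization ℂ J)) idem_one :=
    K0.mk_eq _ _ ⟨_, _, hcorner _, hone _⟩
  obtain ⟨R, hR⟩ : ∃ R : Matrix (Fin n ⊕ Fin n) (Fin n) A, R = Matrix.fromRows 1 0 := ⟨_, rfl⟩
  obtain ⟨R', hR'⟩ : ∃ R' : Matrix (Fin n) (Fin n ⊕ Fin n) A, R' = Matrix.fromCols 1 0 := ⟨_, rfl⟩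
  have hRR : R' * R = 1 := by rw [hR, hR', hone]
  rw [e1]
  refine h n u _ ⟨_, inferInstance, Matrix.fromRows 1 0, Matrix.fromCols 1 0, W * R, R' * W', p, hp,
    ?_, ?_, ?_, ?_, ?_, ?_, rfl⟩
  · simp [Matrix.fromCols_mul_fromRows]
  · rw [Matrix.mul_assoc, ← Matrix.mul_assoc W', hWW, Matrix.one_mul, hRR]
  · rw [Matrix.map_mul, hw, hR, Matrix.fromRows_map, Matrix.fromRows_map, Matrix.fromBlocks_mul_fromRows,
      Matrix.fromRows_mul]
    simp
  · rw [Matrix.map_mul, hw', hR', Matrix.fromCols_map, Matrix.fromCols_map,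
      Matrix.fromCols_mul_fromBlocks, Matrix.mul_fromCols]
    simp
  · rw [hpU, Matrix.mul_assoc W R, ← Matrix.mul_assoc R R', hR, hR', hcorner, Matrix.mul_assoc]
  · rw [hpf]
    ext (i | i) (j | j) <;> simp [Matrix.mul_apply, Matrix.one_apply]

end Extension

end SemiPeriodic

namespace SemiPeriodic

/-! ## Index of one-sided invertible elements -/

section OneSided

variable {A Q J : Type*} [Ring A] [Algebra ℂ A] [Ring Q]
  [NonUnitalRing J] [Module ℂ J] [IsScalarTower ℂ J J] [SMulCommClass ℂ J J]
  {π : A →+* Q} {U : Unitization ℂ J →ₐ[ℂ] A}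

/-- The unit `u` as an invertible `1 × 1` matrix. -/
def unitMat {R : Type*} [Ring R] (u : Rˣ) : (Matrix (Fin 1) (Fin 1) R)ˣ :=
  Units.map (Matrix.scalar (Fin 1)).toMonoidHom u

theorem unitMat_apply {R : Type*} [Ring R] (u : Rˣ) (i j : Fin 1) :
    (unitMat u : Matrix (Fin 1) (Fin 1) R) i j = u := by
  rw [Subsingleton.elim j i]
  exact Matrix.diagonal_apply_eq _ _

theorem unitMat_inv_apply {R : Type*} [Ring R] (u : Rˣ) (i j : Fin 1) :
    (((unitMat u)⁻¹ : (Matrix (Fin 1) (Fin 1) R)ˣ) : Matrix (Fin 1) (Fin 1) R) i j = (u⁻¹ : Rˣ) := by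
  rw [unitMat, ← map_inv]
  exact unitMat_apply u⁻¹ i j

variable {S S' : A} {E : J} {u : Qˣ}

theorem isIdx_isometry (hE : IsIdempotentElem E) (h1 : S' * S = 1) (h2 : S * S' = 1 - U E)
    (hu : (u : Q) = π S) (hu' : ((u⁻¹ : Qˣ) : Q) = π S') :
    IsIdx π U (unitMat u) (-K0.mk _ (idem_inr hE)) := by
  have hone : ∀ i j : Fin 1, (1 : Matrix (Fin 1) (Fin 1) A) i j = 1 := fun i j => by
    rw [Subsingleton.elim j i, Matrix.one_apply_eq]
  refine ⟨Fin 1, inferInstance, 1, 1, Matrix.of fun _ _ => S, Matrix.of fun _ _ => S',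
    1 - Matrix.of fun _ _ => (E : Unitization ℂ J), (idem_inr hE).one_sub, one_mul 1, ?_, ?_, ?_, ?_, ?_, ?_⟩
  · ext1 i j
    simp [Matrix.mul_apply, h1, hone]
  · rw [Matrix.map_one _ (map_zero _) (map_one _), Matrix.one_mul]
    ext1 i j
    rw [unitMat_apply, hu]
    rfl
  · rw [Matrix.map_one _ (map_zero _) (map_one _), Matrix.mul_one]
    ext1 i j
    rw [unitMat_inv_apply, hu']
    rfl
  · rw [Matrix.map_sub (hf := map_sub U), Matrix.map_one _ (map_zero _) (map_one _)]
    ext1 i j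
    rw [Matrix.sub_apply, hone]
    simp [Matrix.mul_apply, h2]
  · rw [Matrix.map_sub (hf := map_sub _), Matrix.map_one _ (map_zero _) (map_one _), Matrix.mul_one]
    ext1 i j
    simp
  · rw [K0.mk_sub (idem_inr hE)]
    abel

theorem isIdx_coisometry (hE : IsIdempotentElem E) (h1 : S' * S = 1) (h2 : S * S' = 1 - U E)
    (hu : (u : Q) = π S') (hu' : ((u⁻¹ : Qˣ) : Q) = π S) (hπ : π (U E) = 0) :
    IsIdx π U (unitMat u) (K0.mk _ (idem_inr hE)) := by
  have hEE : U E * U E = U E := by rw [← map_mul, ← Unitization.inr_mul, hE.eq]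
  have hSE : S' * U E = 0 := by
    have h : U E = 1 - S * S' := by rw [h2, sub_sub_cancel]
    rw [h, mul_sub, ← mul_assoc, h1, mul_one, one_mul, sub_self]
  have hES : U E * S = 0 := by
    have h : U E = 1 - S * S' := by rw [h2, sub_sub_cancel]
    rw [h, sub_mul, mul_assoc, h1, mul_one, one_mul, sub_self]
  have hone : ∀ (R : Type _) [Ring R] (i j : Fin 1), (1 : Matrix (Fin 1) (Fin 1) R) i j = 1 :=
    fun R _ i j => by rw [Subsingleton.elim j i, Matrix.one_apply_eq]
  refine ⟨Fin 1 ⊕ Fin 1, inferInstance, Matrix.fromRows 1 0, Matrix.fromCols 1 0,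
    Matrix.fromRows (Matrix.of fun _ _ => S') (Matrix.of fun _ _ => U E),
    Matrix.fromCols (Matrix.of fun _ _ => S) (Matrix.of fun _ _ => U E),
    Matrix.fromBlocks 1 0 0 (Matrix.of fun _ _ => (E : Unitization ℂ J)), idem_blocks idem_one (idem_inr hE),
    ?_, ?_, ?_, ?_, ?_, ?_, ?_⟩
  · simp [Matrix.fromCols_mul_fromRows]
  · rw [Matrix.fromCols_mul_fromRows]
    ext1 i j
    rw [hone]
    simp [Matrix.mul_apply, h2, hEE]
  · rw [Matrix.fromRows_map, Matrix.fromRows_map, Matrix.fromRows_mul,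
      Matrix.map_one _ (map_zero _) (map_one _), Matrix.one_mul, Matrix.map_zero _ (map_zero _),
      Matrix.zero_mul]
    congr 1
    · ext1 i j
      rw [unitMat_apply, hu]
      rfl
    · ext1 i j
      exact hπ
  · rw [Matrix.fromCols_map, Matrix.fromCols_map, Matrix.mul_fromCols,
      Matrix.map_one _ (map_zero _) (map_one _), Matrix.mul_one, Matrix.map_zero _ (map_zero _),
      Matrix.mul_zero]
    congr 1
    · ext1 i j
      rw [unitMat_inv_apply, hu']
      rfl
    · ext1 i j
      exact hπ
  · rw [Matrix.fromRows_mul_fromCols, Matrix.fromBlocks_map, Matrix.map_one _ (map_zero _) (map_one _),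
      Matrix.map_zero _ (map_zero _)]
    congr 1 <;> ext1 i j <;> simp [Matrix.mul_apply, h1, hSE, hES, hEE, hone]
  · rw [Matrix.fromRows_mul_fromCols, Matrix.fromBlocks_map, Matrix.map_one _ (map_zero _) (map_one _),
      Matrix.map_zero _ (map_zero _), Matrix.mul_zero, Matrix.mul_zero, Matrix.one_mul, Matrix.zero_mul]
    congr 1
  · rw [← K0.mk_add idem_one (idem_inr hE), add_sub_cancel_left]

theorem isIdx_unitMat_one : IsIdx π U (unitMat (1 : Qˣ)) 0 :=
  IsIdx.of_map 1 (by rw [unitMat, map_one]; exact Matrix.map_one _ (map_zero _) (map_one _))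

end OneSided

/-! ## Rank one projections -/

open scoped InnerProductSpace in
theorem exists_rankOne {T : 𝔅} (hT : IsIdempotentElem T) (hs : IsSelfAdjoint T)
    (h1 : Module.finrank ℂ (LinearMap.range T.toLinearMap) = 1) :
    ∃ v : l2Z, ‖v‖ = 1 ∧ T = InnerProductSpace.rankOne ℂ v v := by
  obtain ⟨⟨w, hw⟩, hw0, hspan⟩ := finrank_eq_one_iff'.1 h1
  have hw0' : w ≠ 0 := fun h => hw0 (Subtype.ext h)
  have hTw : T w = w := by
    obtain ⟨y, rfl⟩ := hw
    exact DFunLike.congr_fun hT.eq y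
  have hn : ((‖w‖ : ℝ) : ℂ) ≠ 0 := by simpa using hw0'
  refine ⟨((‖w‖ : ℝ) : ℂ)⁻¹ • w, ?_, ?_⟩
  · rw [norm_smul, norm_inv, Complex.norm_real, norm_norm, inv_mul_cancel₀ (by simpa using hw0')]
  · ext1 u
    obtain ⟨c, hc⟩ := hspan ⟨T u, u, rfl⟩
    have hc' : c • w = T u := congrArg Subtype.val hc
    have e : ⟪w, T u⟫_ℂ = ⟪w, u⟫_ℂ := by
      rw [← ContinuousLinearMap.adjoint_inner_left]
      have : ContinuousLinearMap.adjoint T = T := hs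
      rw [this, hTw]
    rw [← hc', inner_smul_right, inner_self_eq_norm_sq_to_K] at e
    rw [InnerProductSpace.rankOne_apply, inner_smul_left, ← e, ← hc', smul_smul]
    congr 1
    simp only [map_inv₀, Complex.conj_ofReal, Complex.coe_algebraMap]
    field_simp

theorem isIdempotentElem_matUnit (j : ℤ) :
    IsIdempotentElem (⟨matUnit j j, isCompactOperator_matUnit j j⟩ : compactsZ) :=
  Subtype.ext (ext_basisVec fun k => by
    change matUnit j j (matUnit j j (basisVec k)) = matUnit j j (basisVec k)
    rw [matUnit_basisVec]
    split_ifs with h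
    · rw [matUnit_basisVec, if_pos rfl]
    · rw [map_zero])

theorem K0nu.mk_rankOne {E : compactsZ} (hE : IsIdempotentElem E) (hs : IsSelfAdjoint (E : 𝔅))
    (h1 : Module.finrank ℂ (LinearMap.range (E : 𝔅).toLinearMap) = 1) (j : ℤ) :
    K0nu.mk E hE = K0nu.mk _ (isIdempotentElem_matUnit j) := by
  obtain ⟨v, hv, hEv⟩ := exists_rankOne (congrArg Subtype.val hE) hs h1
  have hb : ‖basisVec j‖ = 1 := by
    rw [basisVec, lp.norm_single (by norm_num)]
    simp
  let x : compactsZ := ⟨InnerProductSpace.rankOne ℂ v (basisVec j), isCompactOperator_rankOne _ _⟩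
  let y : compactsZ := ⟨InnerProductSpace.rankOne ℂ (basisVec j) v, isCompactOperator_rankOne _ _⟩
  have comp : ∀ a b c : l2Z, ‖b‖ = 1 → InnerProductSpace.rankOne ℂ a b * InnerProductSpace.rankOne ℂ b c =
      InnerProductSpace.rankOne ℂ a c := fun a b c h => by
    ext1 u
    rw [mul_apply_eq_comp, InnerProductSpace.rankOne_apply, InnerProductSpace.rankOne_apply,
      InnerProductSpace.rankOne_apply, inner_smul_right, inner_self_eq_norm_sq_to_K, h]
    simp
  have hxy : x * y = E := Subtype.ext ((comp _ _ _ hb).trans hEv.symm)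
  have hyx : y * x = ⟨matUnit j j, isCompactOperator_matUnit j j⟩ := Subtype.ext (comp _ _ _ hv)
  refine Subtype.ext (K0.mk_eq _ _ ⟨Matrix.of fun _ _ => (x : Unitization ℂ compactsZ),
    Matrix.of fun _ _ => (y : Unitization ℂ compactsZ), ?_, ?_⟩)
  · ext1 i k
    simp [Matrix.mul_apply, ← Unitization.inr_mul, hxy]
  · ext1 i k
    simp [Matrix.mul_apply, ← Unitization.inr_mul, hyx]

end SemiPeriodic

namespace SemiPeriodic

open Filter Topology

/-! ## The model operators on `ℓ²(ℤ)` -/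

/-- The function `clamp(x - t)` on `[-∞,+∞]` for an integer `t`: on integers it is the indicator
function of `{j | t < j}`. -/
theorem exists_step (t : ℤ) : ∃ f : C(EReal, ℂ), (∀ j : ℤ, f ((j : ℝ) : EReal) = if t < j then 1 else 0) ∧
    (∀ x : ℝ, f x = (max 0 (min (x - t) 1) : ℝ)) ∧ f ⊥ = 0 ∧ f ⊤ = 1 := by
  have h₁ : Tendsto (fun x : ℝ => ((max 0 (min (x - t) 1) : ℝ) : ℂ)) atBot (𝓝 0) := by
    refine tendsto_const_nhds.congr' ?_
    filter_upwards [eventually_le_atBot (t : ℝ)] with x hx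
    rw [max_eq_left ((min_le_left _ _).trans (by linarith))]
    simp
  have h₂ : Tendsto (fun x : ℝ => ((max 0 (min (x - t) 1) : ℝ) : ℂ)) atTop (𝓝 1) := by
    refine tendsto_const_nhds.congr' ?_
    filter_upwards [eventually_ge_atTop ((t : ℝ) + 1)] with x hx
    rw [min_eq_right (by linarith)]
    simp
  obtain ⟨F, hF, hb, ht⟩ := exists_ereal_extension _ (by fun_prop) h₁ h₂
  refine ⟨F, fun j => ?_, hF, hb, ht⟩
  rw [hF]
  split_ifs with h
  · have h' : (t : ℝ) + 1 ≤ j := by exact_mod_cast h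
    rw [min_eq_right (by linarith)]
    simp
  · have h' : (j : ℝ) ≤ t := by exact_mod_cast not_lt.1 h
    rw [max_eq_left ((min_le_left _ _).trans (by linarith))]
    simp

/-- The operator `e_j ↦ a_j e_{j-k} + b_j e_j`. -/
noncomputable def shiftDiag (k : ℤ) (a b : C(EReal, ℂ)) : 𝔅 := Y k * diagE a + diagE b

theorem shiftDiag_basisVec (k : ℤ) (a b : C(EReal, ℂ)) (j : ℤ) : shiftDiag k a b (basisVec j) =
    a ((j : ℝ) : EReal) • basisVec (j - k) + b ((j : ℝ) : EReal) • basisVec j := by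
  rw [shiftDiag, add_apply, mul_apply_eq_comp, diagE_basisVec, diagE_basisVec, map_smul, Y_int]

theorem isCompactOperator_diagE {d : C(EReal, ℂ)} (hd : VanishInf d) : IsCompactOperator (diagE d) := by
  have h := isCompactOperator_diagE_shiftE hd 0
  have e : diagE (shiftE d 0) = diagE d := ext_basisVec fun j => by
    rw [diagE_basisVec, diagE_basisVec, shiftE_apply, sub_zero]
  rwa [e] at h

theorem isCompactOperator_shiftDiag_sub (k : ℤ) {a b a' b' : C(EReal, ℂ)} (ha : VanishInf (a - a'))
    (hb : VanishInf (b - b')) : IsCompactOperator (shiftDiag k a b - shiftDiag k a' b' : 𝔅) := by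
  have e : shiftDiag k a b - shiftDiag k a' b' = Y k * diagE (a - a') + diagE (b - b') := by
    rw [shiftDiag, shiftDiag, map_sub, map_sub, mul_sub]
    abel
  rw [e]
  exact ((isCompactOperator_diagE ha).clm_comp (Y k)).add (isCompactOperator_diagE hb)

theorem one_sub_matUnit_basisVec (j : ℤ) : (1 - matUnit 0 0 : 𝔅) (basisVec j) =
    basisVec j - if 0 = j then basisVec 0 else 0 := by
  rw [sub_apply, matUnit_basisVec]
  rfl

/-- Operators that differ by a compact operator from a partial shift to the right. -/
theorem exists_isometry {a b : C(EReal, ℂ)} (ha : a ⊥ = 0 ∧ a ⊤ = 1) (hb : b ⊥ = 1 ∧ b ⊤ = 0) :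
    ∃ S S' : 𝔅, S' * S = 1 ∧ S * S' = 1 - matUnit 0 0 ∧ IsCompactOperator (shiftDiag (-1) a b - S : 𝔅) := by
  obtain ⟨f, hf, -, hf0, hf1⟩ := exists_step (-1)
  obtain ⟨g, hg, -, hg0, hg1⟩ := exists_step 0
  refine ⟨shiftDiag (-1) f (1 - f), shiftDiag 1 g (1 - f), ext_basisVec fun j => ?_,
    ext_basisVec fun j => ?_, isCompactOperator_shiftDiag_sub _ ⟨?_, ?_⟩ ⟨?_, ?_⟩⟩
  · rw [mul_apply_eq_comp, shiftDiag_basisVec, map_add, map_smul, map_smul, shiftDiag_basisVec,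
      shiftDiag_basisVec]
    simp only [ContinuousMap.sub_apply, ContinuousMap.one_apply, hf, hg]
    rcases lt_or_ge j 0 with h | h
    · simp [show ¬ (-1 < j) by omega, show ¬ (0 < j) by omega]
    · simp [show -1 < j by omega, show -1 ≤ j by omega, show 0 < j + 1 by omega]
  · rw [mul_apply_eq_comp, shiftDiag_basisVec, map_add, map_smul, map_smul, shiftDiag_basisVec,
      shiftDiag_basisVec, one_sub_matUnit_basisVec]
    simp only [ContinuousMap.sub_apply, ContinuousMap.one_apply, hf, hg]
    rcases lt_trichotomy j 0 with h | h | h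
    · simp [show ¬ (-1 < j) by omega, show ¬ (0 < j) by omega, show ¬ (0 = j) by omega]
    · subst h
      simp
    · simp [show -1 < j by omega, show -1 < j - 1 by omega, h, show ¬ (0 = j) by omega]
  all_goals simp [ha, hb, hf0, hf1]

theorem exists_coisometry {a b : C(EReal, ℂ)} (ha : a ⊥ = 1 ∧ a ⊤ = 0) (hb : b ⊥ = 0 ∧ b ⊤ = 1) :
    ∃ S S' : 𝔅, S' * S = 1 ∧ S * S' = 1 - matUnit 0 0 ∧ IsCompactOperator (shiftDiag (-1) a b - S' : 𝔅) := by
  obtain ⟨f, hf, -, hf0, hf1⟩ := exists_step (-1)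
  obtain ⟨g, hg, -, hg0, hg1⟩ := exists_step 0
  refine ⟨shiftDiag 1 (1 - g) g, shiftDiag (-1) (1 - f) g, ext_basisVec fun j => ?_,
    ext_basisVec fun j => ?_, isCompactOperator_shiftDiag_sub _ ⟨?_, ?_⟩ ⟨?_, ?_⟩⟩
  · rw [mul_apply_eq_comp, shiftDiag_basisVec, map_add, map_smul, map_smul, shiftDiag_basisVec,
      shiftDiag_basisVec]
    simp only [ContinuousMap.sub_apply, ContinuousMap.one_apply, hf, hg]
    rcases le_or_gt j 0 with h | h
    · simp [show ¬ (-1 < j - 1) by omega, show ¬ (0 < j) by omega, show ¬ (1 < j) by omega]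
    · simp [show -1 < j by omega, h]
  · rw [mul_apply_eq_comp, shiftDiag_basisVec, map_add, map_smul, map_smul, shiftDiag_basisVec,
      shiftDiag_basisVec, one_sub_matUnit_basisVec]
    simp only [ContinuousMap.sub_apply, ContinuousMap.one_apply, hf, hg]
    rcases lt_trichotomy j 0 with h | h | h
    · simp [show ¬ (-1 < j) by omega, show ¬ (0 < j + 1) by omega, show ¬ (0 < j) by omega,
        show ¬ (0 = j) by omega]
    · subst h
      simp
    · simp [show -1 < j by omega, h, show ¬ (0 = j) by omega]
  all_goals simp [ha, hb, hf0, hf1, hg0, hg1]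

/-! ## The operators `A₁, …, A₄` -/

/-- `λ` is a function of modulus `1` that behaves like `e^{ix}` near the end `s₀` and like `1` near the
other end. -/
def IsTwist (g : ℝ → ℂ) (s₀ : Bool) : Prop :=
  (∀ x, g x * star (g x) = 1) ∧ ∃ a b : C(EReal, ℂ),
    (∀ x : ℝ, g x = a x * Complex.exp (((1 : ℤ) : ℂ) * x * Complex.I) + b x) ∧
    a (endpt s₀) = 1 ∧ b (endpt s₀) = 0 ∧ a (endpt !s₀) = 0 ∧ b (endpt !s₀) = 1

theorem exp_mul_star (x : ℝ) : Complex.exp (x * Complex.I) * star (Complex.exp (x * Complex.I)) = 1 := by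
  rw [← starRingEnd_apply, Complex.mul_conj, Complex.normSq_eq_norm_sq, Complex.norm_exp_ofReal_mul_I]
  simp

theorem isTwist_l : IsTwist l true := by
  obtain ⟨a, -, ha, ha0, ha1⟩ := exists_step 0
  have e : ∀ x, l x = Complex.exp ((max x 0 : ℝ) * Complex.I) := fun x => by
    rw [l]
    split_ifs with h
    · rw [max_eq_left h]
    · rw [max_eq_right (not_le.1 h).le]
      simp
  have h₁ : Tendsto (fun x : ℝ => (1 - a x) * Complex.exp ((max x 0 : ℝ) * Complex.I)) atBot (𝓝 1) := by
    refine tendsto_const_nhds.congr' ?_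
    filter_upwards [eventually_le_atBot 0] with x hx
    rw [ha, max_eq_right hx, max_eq_left ((min_le_left _ _).trans (by simpa using hx))]
    simp
  have h₂ : Tendsto (fun x : ℝ => (1 - a x) * Complex.exp ((max x 0 : ℝ) * Complex.I)) atTop (𝓝 0) := by
    refine tendsto_const_nhds.congr' ?_
    filter_upwards [eventually_ge_atTop 1] with x hx
    rw [ha, min_eq_right (by simpa using hx)]
    simp
  have hc : Continuous fun x : ℝ => (1 - a x) * Complex.exp ((max x 0 : ℝ) * Complex.I) := by
    simp only [ha]
    fun_prop
  obtain ⟨b, hb, hb0, hb1⟩ := exists_ereal_extension _ hc h₁ h₂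
  refine ⟨fun x => by rw [e]; exact exp_mul_star _, a, b, fun x => ?_, ha1, hb1, ha0, hb0⟩
  rw [hb, e]
  rcases le_total x 0 with h | h
  · rw [ha, max_eq_left (a := (0 : ℝ)) ((min_le_left _ _).trans (by simpa using h))]
    simp
  · rw [max_eq_left h]
    simp only [Int.cast_one, one_mul]
    ring

theorem isTwist_lTilde : IsTwist lTilde false := by
  obtain ⟨f, -, hf, hf0, hf1⟩ := exists_step (-1)
  set a : C(EReal, ℂ) := 1 - f with ha'
  have ha : ∀ x : ℝ, a x = 1 - (max 0 (min (x + 1) 1) : ℝ) := fun x => by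
    rw [ha', ContinuousMap.sub_apply, hf]
    simp
  have e : ∀ x, lTilde x = Complex.exp ((min x 0 : ℝ) * Complex.I) := fun x => by
    rw [lTilde]
    split_ifs with h
    · rw [min_eq_right h]
      simp
    · rw [min_eq_left (not_le.1 h).le]
  have h₁ : Tendsto (fun x : ℝ => (1 - a x) * Complex.exp ((min x 0 : ℝ) * Complex.I)) atBot (𝓝 0) := by
    refine tendsto_const_nhds.congr' ?_
    filter_upwards [eventually_le_atBot (-1)] with x hx
    rw [ha, max_eq_left ((min_le_left _ _).trans (by linarith))]
    simp
  have h₂ : Tendsto (fun x : ℝ => (1 - a x) * Complex.exp ((min x 0 : ℝ) * Complex.I)) atTop (𝓝 1) := by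
    refine tendsto_const_nhds.congr' ?_
    filter_upwards [eventually_ge_atTop 0] with x hx
    rw [ha, min_eq_right (a := x + 1) (by linarith), min_eq_right hx]
    simp
  have hc : Continuous fun x : ℝ => (1 - a x) * Complex.exp ((min x 0 : ℝ) * Complex.I) := by
    simp only [ha]
    fun_prop
  obtain ⟨b, hb, hb0, hb1⟩ := exists_ereal_extension _ hc h₁ h₂
  refine ⟨fun x => by rw [e]; exact exp_mul_star _, a, b, fun x => ?_, ?_, hb0, ?_, hb1⟩
  · rw [hb, e]
    rcases le_total x 0 with h | h
    · rw [min_eq_left h]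
      simp only [Int.cast_one, one_mul]
      ring
    · rw [ha, min_eq_right (a := x + 1) (by linarith)]
      simp
  · simp [ha', endpt, hf0]
  · simp [ha', endpt, hf1]

theorem exists_cutoff {c : ℝ → ℝ} (hc : IsCutoff c) :
    ∃ F : C(EReal, ℂ), (∀ x : ℝ, F x = c x) ∧ F ⊥ = 1 ∧ F ⊤ = 0 :=
  exists_ereal_extension (fun x => c x) (Complex.continuous_ofReal.comp hc.1.continuous)
    (tendsto_const_nhds.congr' (by
      filter_upwards [eventually_le_atBot (-1 / 5 : ℝ)] with x hx
      simp [hc.2.2.2.1 x hx]))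
    (tendsto_const_nhds.congr' (by
      filter_upwards [eventually_ge_atTop (1 / 5 : ℝ)] with x hx
      simp [hc.2.2.2.2 x hx]))

end SemiPeriodic

namespace SemiPeriodic

/-! ## The index of the model operators -/

theorem isExt_mk {R : Type*} [Ring R] [Algebra ℂ R] {I : Ideal R} [I.IsTwoSided]
    {J : NonUnitalSubalgebra ℂ R} (hJ : (J : Set R) = I) :
    IsExt (Ideal.Quotient.mk I) (NonUnitalSubalgebra.unitization J) where
  surj := Ideal.Quotient.mk_surjective
  inj k hk := Subtype.ext ((unitization_coe k).symm.trans hk)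
  ker a := by
    rw [Ideal.Quotient.eq_zero_iff_mem]
    simp only [unitization_coe]
    exact ⟨fun h => ⟨⟨a, hJ.ge h⟩, rfl⟩, fun ⟨k, hk⟩ => hk ▸ hJ.le k.2⟩

theorem exists_unit_mk {R : Type*} [Ring R] {I : Ideal R} [I.IsTwoSided] {a b : R} (h : a * b - 1 ∈ I)
    (h' : b * a - 1 ∈ I) : ∃ u : (R ⧸ I)ˣ, (u : R ⧸ I) = Ideal.Quotient.mk I a :=
  ⟨⟨Ideal.Quotient.mk I a, Ideal.Quotient.mk I b, by rw [← map_mul]; exact Ideal.Quotient.eq.2 h,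
    by rw [← map_mul]; exact Ideal.Quotient.eq.2 h'⟩, rfl⟩

theorem IsExt.map_index {A Q J B R J' : Type*} [Ring A] [Algebra ℂ A] [Ring Q] [TopologicalSpace Q]
    [IsTopologicalRing Q] [NonUnitalRing J] [Module ℂ J] [IsScalarTower ℂ J J] [SMulCommClass ℂ J J]
    [Ring B] [Algebra ℂ B] [Ring R] [NonUnitalRing J'] [Module ℂ J'] [IsScalarTower ℂ J' J']
    [SMulCommClass ℂ J' J'] {π : A →+* Q} {U : Unitization ℂ J →ₐ[ℂ] A} (hπ : IsExt π U)
    {π' : B →+* R} {U' : Unitization ℂ J' →ₐ[ℂ] B} (hπ' : IsExt π' U')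
    {δ : Additive (K1 Q) →+ K0nu J}
    (hδ : ∀ (n : ℕ) (u : GLn Q n) (c : K0 (Unitization ℂ J)), IsIdx π U u c →
      (δ (Additive.ofMul (K1.mk u)) : K0 (Unitization ℂ J)) = c)
    (f : A →+* B) (hf : ∀ c : ℂ, f (algebraMap ℂ A c) = algebraMap ℂ B c) (g : J →ₙₐ[ℂ] J')
    (hfg : ∀ k : J, f (U k) = U' (g k)) (h : Q →+* R) (hh : ∀ a, h (π a) = π' (f a)) {u : Qˣ}
    {c : K0nu J'} (hc : IsIdx π' U' (unitMat (Units.map h.toMonoidHom u)) (c : K0 (Unitization ℂ J'))) :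
    K0nu.map g (δ (Additive.ofMul (K1.ofUnit u))) = c := by
  obtain ⟨c₀, hc₀⟩ := hπ.exists_isIdx (unitMat u)
  refine Subtype.ext ?_
  rw [K0nu.coe_map]
  change K0.map _ (δ (Additive.ofMul (K1.mk (n := 1) (unitMat u))) : K0 (Unitization ℂ J)) = _
  rw [hδ 1 (unitMat u) c₀ hc₀]
  have hm := hc₀.map f hf g hfg h hh
  have e : Units.map h.mapMatrix.toMonoidHom (unitMat u) = unitMat (Units.map h.toMonoidHom u) :=
    Units.ext (by
      ext1 i j
      rw [unitMat_apply]
      exact congrArg h (unitMat_apply u i j))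
  rw [e] at hm
  exact hπ'.isIdx_unique hm hc

/-- The ideal of compact operators on `ℓ²(ℤ)`. -/
def cptB : Ideal 𝔅 where
  carrier := {T | IsCompactOperator T}
  add_mem' ha hb := IsCompactOperator.add ha hb
  zero_mem' := isCompactOperator_zero
  smul_mem' A _ hB := IsCompactOperator.clm_comp hB A

instance : cptB.IsTwoSided where
  mul_mem_of_left {_} B hA := IsCompactOperator.comp_clm hA B

theorem isExt_cptB : IsExt (Ideal.Quotient.mk cptB) (NonUnitalSubalgebra.unitization compactsZ) :=
  isExt_mk rfl

theorem mk_matUnit (j : ℤ) : Ideal.Quotient.mk cptB (matUnit j j) = 0 :=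
  Ideal.Quotient.eq_zero_iff_mem.2 (isCompactOperator_matUnit j j)

section ModelIndex

variable {S S' T : 𝔅} {v : (𝔅 ⧸ cptB)ˣ}

theorem isIdx_of_isometry (h1 : S' * S = 1) (h2 : S * S' = 1 - matUnit 0 0)
    (hv : (v : 𝔅 ⧸ cptB) = Ideal.Quotient.mk cptB T) (hT : IsCompactOperator (T - S : 𝔅)) :
    IsIdx (Ideal.Quotient.mk cptB) (NonUnitalSubalgebra.unitization compactsZ) (unitMat v)
      ((-K0nu.mk _ (isIdempotentElem_matUnit 0) : K0nu compactsZ) : K0 (Unitization ℂ compactsZ)) := by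
  have hv' : (v : 𝔅 ⧸ cptB) = Ideal.Quotient.mk cptB S := hv.trans (Ideal.Quotient.eq.2 hT)
  refine isIdx_isometry (isIdempotentElem_matUnit 0) h1 (by rw [h2, unitization_coe]) hv'
    (Units.inv_eq_of_mul_eq_one_right ?_)
  rw [hv', ← map_mul, h2, map_sub, map_one, mk_matUnit, sub_zero]

theorem isIdx_of_coisometry (h1 : S' * S = 1) (h2 : S * S' = 1 - matUnit 0 0)
    (hv : (v : 𝔅 ⧸ cptB) = Ideal.Quotient.mk cptB T) (hT : IsCompactOperator (T - S' : 𝔅)) :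
    IsIdx (Ideal.Quotient.mk cptB) (NonUnitalSubalgebra.unitization compactsZ) (unitMat v)
      ((K0nu.mk _ (isIdempotentElem_matUnit 0) : K0nu compactsZ) : K0 (Unitization ℂ compactsZ)) := by
  have hv' : (v : 𝔅 ⧸ cptB) = Ideal.Quotient.mk cptB S' := hv.trans (Ideal.Quotient.eq.2 hT)
  refine isIdx_coisometry (isIdempotentElem_matUnit 0) h1 (by rw [h2, unitization_coe]) hv'
    (Units.inv_eq_of_mul_eq_one_right ?_) ?_
  · rw [hv', ← map_mul, h1, map_one]
  · rw [unitization_coe]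
    exact mk_matUnit 0

end ModelIndex

variable {σ : 𝔄 →⋆ₐ[ℂ] C(X × Bool, ℂ)} {γ : 𝔄 →⋆ₐ[ℂ] C(Circle × Bool, 𝔅)}

/-- The homomorphism from `𝔄/𝔈` to the Calkin algebra of `ℓ²(ℤ)` induced by the boundary symbol. -/
noncomputable def SymbolPair.calkinEval (P : SymbolPair σ γ) (v : Circle × Bool) : AE σ →+* 𝔅 ⧸ cptB :=
  Ideal.Quotient.lift (RingHom.ker σ) ((Ideal.Quotient.mk cptB).comp (evalAt γ v).toAlgHom.toRingHom)
    fun _ hA => Ideal.Quotient.eq_zero_iff_mem.2 (P.isCompactOperator_evalAt hA v)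

theorem SymbolPair.calkinEval_mk (P : SymbolPair σ γ) (v : Circle × Bool) (A : 𝔄) :
    P.calkinEval v (Ideal.Quotient.mk (RingHom.ker σ) A) = Ideal.Quotient.mk cptB (γ A v) :=
  Ideal.Quotient.lift_mk ..

theorem SymbolPair.calkinEval_factor (P : SymbolPair σ γ) (v : Circle × Bool) (a : 𝔄 ⧸ compactIdeal) :
    P.calkinEval v (Ideal.Quotient.factor P.compactIdeal_le a) =
      Ideal.Quotient.mk cptB (P.quotEval v a) := by
  obtain ⟨A, rfl⟩ := Ideal.Quotient.mk_surjective a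
  rw [Ideal.Quotient.factor_mk, P.calkinEval_mk, P.quotEval_mk]

theorem SymbolPair.quotEval_algebraMap (P : SymbolPair σ γ) (v : Circle × Bool) (c : ℂ) :
    P.quotEval v (algebraMap ℂ (𝔄 ⧸ compactIdeal) c) = algebraMap ℂ 𝔅 c :=
  AlgHomClass.commutes (evalAt γ v) c

theorem SymbolPair.quotEval_coe (P : SymbolPair σ γ) (s : Bool) (k : EK σ) :
    P.quotEval (1, s) (NonUnitalSubalgebra.unitization (EK σ) (k : Unitization ℂ (EK σ))) =
      NonUnitalSubalgebra.unitization compactsZ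
        (((evalOne s).comp P.bdryMap k : compactsZ) : Unitization ℂ compactsZ) :=
  (congrArg _ (unitization_coe k)).trans (unitization_coe ((evalOne s).comp P.bdryMap k)).symm

theorem SymbolPair.map_index (P : SymbolPair σ γ) {δ : Additive (K1 (AE σ)) →+ K0nu (EK σ)}
    (hδ : ∀ (n : ℕ) (u : GLn (AE σ) n) (c : K0 (Unitization ℂ (EK σ))),
      IsIdx (Ideal.Quotient.factor P.compactIdeal_le) (NonUnitalSubalgebra.unitization (EK σ)) u c →
      (δ (Additive.ofMul (K1.mk u)) : K0 (Unitization ℂ (EK σ))) = c)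
    {A : 𝔄} {u : (AE σ)ˣ} (hu : (u : AE σ) = Ideal.Quotient.mk (RingHom.ker σ) A) (s : Bool)
    {c : K0nu compactsZ}
    (hc : ∀ v : (𝔅 ⧸ cptB)ˣ, (v : 𝔅 ⧸ cptB) = Ideal.Quotient.mk cptB (γ A (1, s)) →
      IsIdx (Ideal.Quotient.mk cptB) (NonUnitalSubalgebra.unitization compactsZ) (unitMat v)
        (c : K0 (Unitization ℂ compactsZ))) :
    K0nu.map ((evalOne s).comp P.bdryMap) (δ (Additive.ofMul (K1.ofUnit u))) = c := by
  exact (isExt_EK P.compactIdeal_le).map_index isExt_cptB hδ (P.quotEval (1, s))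
    (P.quotEval_algebraMap (1, s)) ((evalOne s).comp P.bdryMap) (P.quotEval_coe s)
    (P.calkinEval (1, s)) (P.calkinEval_factor (1, s))
    (hc _ ((congrArg _ hu).trans (P.calkinEval_mk _ A)))

end SemiPeriodic

namespace SemiPeriodic

variable {σ : 𝔄 →⋆ₐ[ℂ] C(X × Bool, ℂ)} {γ : 𝔄 →⋆ₐ[ℂ] C(Circle × Bool, 𝔅)}

theorem evalAt_one_erealD (hγ : IsBoundarySymbol γ) (b : C(EReal, ℂ)) {B : 𝔄}
    (hB : (B : L2R →L[ℂ] L2R) = erealD b) (s : Bool) : evalAt γ (1, s) B = diagE b := by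
  have h := hγ.2.2 b B hB 0 s
  rw [mul_zero, Circle.exp_zero, neg_zero, Y_zero, one_mul, mul_one] at h
  refine h.trans ?_
  simp only [sub_zero]
  rfl

theorem sum_mul_sum_eq_one {x y p q : ℂ} (hxy : x * y = 1) (hpq : p = 1 ∧ q = 0 ∨ p = 0 ∧ q = 1) :
    (x * p + q) * (y * p + q) = 1 := by
  rcases hpq with ⟨rfl, rfl⟩ | ⟨rfl, rfl⟩ <;> simp [hxy]

/-- The operators `g(M) β(D) + β'(D)`. -/
theorem SymbolPair.exists_twisted (P : SymbolPair σ γ) {g : ℝ → ℂ} {s₀ : Bool} (hg : IsTwist g s₀)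
    {β β' : C(EReal, ℂ)} (hβ : ∀ s, β (endpt s) = 1 ∧ β' (endpt s) = 0 ∨ β (endpt s) = 0 ∧ β' (endpt s) = 1)
    (hsum : β + β' = 1) : ∃ (A : 𝔄) (u : (AE σ)ˣ),
      (A : L2R →L[ℂ] L2R) = opM g * opD (fun ξ => β ξ) + opD (fun ξ => β' ξ) ∧
      (u : AE σ) = Ideal.Quotient.mk (RingHom.ker σ) A ∧
      γ A (1, s₀) = shiftDiag (-1) β β' ∧ γ A (1, !s₀) = 1 := by
  obtain ⟨hg1, a, b, hab, ha, hb, ha', hb'⟩ := hg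
  let a' : 𝔄 := ⟨erealM a, erealM_mem a⟩
  let b' : 𝔄 := ⟨erealM b, erealM_mem b⟩
  let e : 𝔄 := ⟨expM 1, expM_mem 1⟩
  let B : 𝔄 := ⟨SemiPeriodic.erealD β, erealD_mem β⟩
  let C : 𝔄 := ⟨SemiPeriodic.erealD β', erealD_mem β'⟩
  have hexp : BddMeas fun x : ℝ => Complex.exp (((1 : ℤ) : ℂ) * x * Complex.I) := by
    simpa using BddMeas.exp 1
  have hg : g = fun x : ℝ => a x * Complex.exp (((1 : ℤ) : ℂ) * x * Complex.I) + b x := funext hab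
  have hgb : BddMeas g := by
    rw [hg]
    exact ((BddMeas.ereal a).mul hexp).add (.ereal b)
  have hL : ((a' * e + b' : 𝔄) : L2R →L[ℂ] L2R) = opM g := by
    rw [hg, opM_add ((BddMeas.ereal a).mul hexp) (.ereal b), opM_mul (.ereal a) hexp]
    rfl
  obtain ⟨L, hL'⟩ : ∃ L : 𝔄, L = a' * e + b' := ⟨_, rfl⟩
  rw [← hL'] at hL
  have hLL : L * star L = 1 := Subtype.ext (by
    change (L : L2R →L[ℂ] L2R) * star (L : L2R →L[ℂ] L2R) = 1
    rw [hL, ← opM_star hgb, ← opM_mul hgb hgb.star, ← opM_one]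
    exact congrArg opM (funext hg1))
  have hsym : ∀ T T' : 𝔄, T * T' = 1 → σ ((T * B + C) * (T' * B + C)) = 1 := fun T T' hT => by
    ext ⟨m, s⟩
    have e1 : σ T (m, s) * σ T' (m, s) = 1 := by
      rw [← ContinuousMap.mul_apply, ← map_mul, hT, map_one]
      rfl
    have e2 : σ B (m, s) = β (endpt s) := P.isPrincipal.2.2.2 β B rfl m s
    have e3 : σ C (m, s) = β' (endpt s) := P.isPrincipal.2.2.2 β' C rfl m s
    rw [map_mul, map_add, map_add, map_mul, map_mul]
    simp only [ContinuousMap.mul_apply, ContinuousMap.add_apply, ContinuousMap.one_apply, e2, e3]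
    exact sum_mul_sum_eq_one e1 (hβ s)
  have hLL' : star L * L = 1 := Subtype.ext (by
    change star (L : L2R →L[ℂ] L2R) * (L : L2R →L[ℂ] L2R) = 1
    rw [hL, ← opM_star hgb, ← opM_mul hgb.star hgb, ← opM_one]
    exact congrArg opM (funext fun x => (mul_comm _ _).trans (hg1 x)))
  have hker : ∀ T T' : 𝔄, T * T' = 1 → (T * B + C) * (T' * B + C) - 1 ∈ RingHom.ker σ := fun T T' h => by
    rw [RingHom.mem_ker, map_sub, hsym T T' h, map_one, sub_self]
  obtain ⟨u, hu⟩ := exists_unit_mk (I := RingHom.ker σ) (hker L (star L) hLL) (hker (star L) L hLL')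
  have hγ : ∀ s, γ (L * B + C) (1, s) = (a (endpt s) • Y (-1) + b (endpt s) • 1) * diagE β + diagE β' := by
    intro s
    have e1 : evalAt γ (1, s) a' = a (endpt s) • (1 : 𝔅) := P.isBoundary.1 a a' rfl 1 s
    have e2 : evalAt γ (1, s) b' = b (endpt s) • (1 : 𝔅) := P.isBoundary.1 b b' rfl 1 s
    have e3 : evalAt γ (1, s) e = Y (-1) :=
      (P.isBoundary.2.1 1 e rfl 1 s).trans (by rw [Int.cast_one])
    rw [← evalAt_apply, hL', map_add, map_mul, map_add, map_mul, e1, e2, e3,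
      evalAt_one_erealD P.isBoundary β rfl, evalAt_one_erealD P.isBoundary β' rfl, smul_one_mul]
  refine ⟨L * B + C, u, ?_, hu, ?_, ?_⟩
  · rw [← hL]
    rfl
  · rw [hγ, ha, hb, one_smul, zero_smul, add_zero, shiftDiag]
    simp
  · rw [hγ, ha', hb', one_smul, zero_smul, zero_add, one_mul, ← map_add, hsum, map_one]

end SemiPeriodic

namespace SemiPeriodic

variable {σ : 𝔄 →⋆ₐ[ℂ] C(X × Bool, ℂ)} {γ : 𝔄 →⋆ₐ[ℂ] C(Circle × Bool, 𝔅)}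

theorem isIdx_of_eq_one {T : 𝔅} (hT : T = 1) (v : (𝔅 ⧸ cptB)ˣ)
    (hv : (v : 𝔅 ⧸ cptB) = Ideal.Quotient.mk cptB T) :
    IsIdx (Ideal.Quotient.mk cptB) (NonUnitalSubalgebra.unitization compactsZ) (unitMat v)
      ((0 : K0nu compactsZ) : K0 (Unitization ℂ compactsZ)) := by
  obtain rfl : v = 1 := Units.ext (by rw [hv, hT, map_one, Units.val_one])
  exact isIdx_unitMat_one

theorem IsCutoff.exists_model {c : ℝ → ℝ} (hc : IsCutoff c) {E : compactsZ} (hE : IsIdempotentElem E)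
    (hEs : IsSelfAdjoint (E : 𝔅)) (hE1 : Module.finrank ℂ (LinearMap.range (E : 𝔅).toLinearMap) = 1) :
    ∃ β β' : C(EReal, ℂ), ((fun ξ : ℝ => β ξ) = fun ξ => 1 - (c ξ : ℂ)) ∧
      ((fun ξ : ℝ => β' ξ) = fun ξ => (c ξ : ℂ)) ∧ β + β' = 1 ∧
      (∀ s, β (endpt s) = 1 ∧ β' (endpt s) = 0 ∨ β (endpt s) = 0 ∧ β' (endpt s) = 1) ∧
      (∀ v : (𝔅 ⧸ cptB)ˣ, (v : 𝔅 ⧸ cptB) = Ideal.Quotient.mk cptB (shiftDiag (-1) β β') →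
        IsIdx (Ideal.Quotient.mk cptB) (NonUnitalSubalgebra.unitization compactsZ) (unitMat v)
          ((-K0nu.mk E hE : K0nu compactsZ) : K0 (Unitization ℂ compactsZ))) ∧
      ∀ v : (𝔅 ⧸ cptB)ˣ, (v : 𝔅 ⧸ cptB) = Ideal.Quotient.mk cptB (shiftDiag (-1) β' β) →
        IsIdx (Ideal.Quotient.mk cptB) (NonUnitalSubalgebra.unitization compactsZ) (unitMat v)
          (K0nu.mk E hE : K0 (Unitization ℂ compactsZ)) := by
  obtain ⟨f, hf, hf0, hf1⟩ := exists_cutoff hc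
  have hb0 : (1 - f) ⊥ = 0 ∧ (1 - f) ⊤ = 1 := by simp [hf0, hf1]
  obtain ⟨S, S', hS1, hS2, hS⟩ := exists_isometry hb0 ⟨hf0, hf1⟩
  obtain ⟨R, R', hR1, hR2, hR⟩ := exists_coisometry ⟨hf0, hf1⟩ hb0
  rw [K0nu.mk_rankOne hE hEs hE1 0]
  refine ⟨1 - f, f, funext fun ξ => ?_, funext hf, sub_add_cancel 1 f, fun s => ?_,
    fun v hv => isIdx_of_isometry hS1 hS2 hv hS, fun v hv => isIdx_of_coisometry hR1 hR2 hv hR⟩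
  · rw [ContinuousMap.sub_apply, hf]
    rfl
  · cases s <;> simp [endpt, hf0, hf1]

theorem SymbolPair.exists_index (P : SymbolPair σ γ) {δ : Additive (K1 (AE σ)) →+ K0nu (EK σ)}
    (hδ : ∀ (n : ℕ) (u : GLn (AE σ) n) (c : K0 (Unitization ℂ (EK σ))),
      IsIdx (Ideal.Quotient.factor P.compactIdeal_le) (NonUnitalSubalgebra.unitization (EK σ)) u c →
      (δ (Additive.ofMul (K1.mk u)) : K0 (Unitization ℂ (EK σ))) = c)
    {g : ℝ → ℂ} {s₀ : Bool} (hg : IsTwist g s₀) {β β' : C(EReal, ℂ)}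
    (hβ : ∀ s, β (endpt s) = 1 ∧ β' (endpt s) = 0 ∨ β (endpt s) = 0 ∧ β' (endpt s) = 1)
    (hsum : β + β' = 1) {e : K0nu compactsZ}
    (he : ∀ v : (𝔅 ⧸ cptB)ˣ, (v : 𝔅 ⧸ cptB) = Ideal.Quotient.mk cptB (shiftDiag (-1) β β') →
      IsIdx (Ideal.Quotient.mk cptB) (NonUnitalSubalgebra.unitization compactsZ) (unitMat v)
        (e : K0 (Unitization ℂ compactsZ))) :
    ∃ (A : 𝔄) (u : (AE σ)ˣ),
      (A : L2R →L[ℂ] L2R) = opM g * opD (fun ξ => β ξ) + opD (fun ξ => β' ξ) ∧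
      (u : AE σ) = Ideal.Quotient.mk (RingHom.ker σ) A ∧
      K0nu.map ((evalOne s₀).comp P.bdryMap) (δ (Additive.ofMul (K1.ofUnit u))) = e ∧
      K0nu.map ((evalOne !s₀).comp P.bdryMap) (δ (Additive.ofMul (K1.ofUnit u))) = 0 := by
  refine (P.exists_twisted hg hβ hsum).imp fun A h => h.imp fun u h => ⟨h.1, h.2.1, ?_, ?_⟩
  · exact P.map_index hδ h.2.1 s₀ fun v hv => he v (hv.trans (congrArg _ h.2.2.1))
  · exact P.map_index hδ h.2.1 (!s₀) (isIdx_of_eq_one h.2.2.2)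

theorem SymbolPair.exists_operators (P : SymbolPair σ γ) {δ : Additive (K1 (AE σ)) →+ K0nu (EK σ)}
    (hδ : ∀ (n : ℕ) (u : GLn (AE σ) n) (c : K0 (Unitization ℂ (EK σ))),
      IsIdx (Ideal.Quotient.factor P.compactIdeal_le) (NonUnitalSubalgebra.unitization (EK σ)) u c →
      (δ (Additive.ofMul (K1.mk u)) : K0 (Unitization ℂ (EK σ))) = c)
    {g : ℝ → ℂ} {s : Bool} (hg : IsTwist g s) {c : ℝ → ℝ} (hc : IsCutoff c)
    {E : compactsZ} (hE : IsIdempotentElem E) (hEs : IsSelfAdjoint (E : 𝔅))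
    (hE1 : Module.finrank ℂ (LinearMap.range (E : 𝔅).toLinearMap) = 1) :
    (∃ (A : 𝔄) (u : (AE σ)ˣ),
      (A : L2R →L[ℂ] L2R) = opM g * opD (fun ξ => 1 - c ξ) + opD (fun ξ => c ξ) ∧
      (u : AE σ) = Ideal.Quotient.mk (RingHom.ker σ) A ∧
      K0nu.map ((evalOne s).comp P.bdryMap) (δ (Additive.ofMul (K1.ofUnit u))) = -K0nu.mk E hE ∧
      K0nu.map ((evalOne !s).comp P.bdryMap) (δ (Additive.ofMul (K1.ofUnit u))) = 0) ∧
    ∃ (A : 𝔄) (u : (AE σ)ˣ),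
      (A : L2R →L[ℂ] L2R) = opD (fun ξ => 1 - c ξ) + opM g * opD (fun ξ => c ξ) ∧
      (u : AE σ) = Ideal.Quotient.mk (RingHom.ker σ) A ∧
      K0nu.map ((evalOne s).comp P.bdryMap) (δ (Additive.ofMul (K1.ofUnit u))) = K0nu.mk E hE ∧
      K0nu.map ((evalOne !s).comp P.bdryMap) (δ (Additive.ofMul (K1.ofUnit u))) = 0 := by
  refine (hc.exists_model hE hEs hE1).elim fun β h => h.elim fun β' h => ?_
  have e1 : opM g * opD (fun ξ => β ξ) + opD (fun ξ => β' ξ) =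
      opM g * opD (fun ξ => 1 - c ξ) + opD (fun ξ => c ξ) := by
    rw [h.1, h.2.1]
  have e2 : opM g * opD (fun ξ => β' ξ) + opD (fun ξ => β ξ) =
      opD (fun ξ => 1 - c ξ) + opM g * opD (fun ξ => c ξ) := by
    rw [h.1, h.2.1, add_comm]
  exact ⟨(P.exists_index hδ hg h.2.2.2.1 h.2.2.1 h.2.2.2.2.1).imp fun A h' => h'.imp fun u h' =>
      ⟨h'.1.trans e1, h'.2⟩,
    (P.exists_index hδ hg (fun s => (h.2.2.2.1 s).symm.imp And.symm And.symm)
      ((add_comm _ _).trans h.2.2.1) h.2.2.2.2.2).imp fun A h' => h'.imp fun u h' =>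
        ⟨h'.1.trans e2, h'.2⟩⟩

end SemiPeriodic

open SemiPeriodic
theorem mainTheorem7 :
    ∃ (σ : 𝔄 →⋆ₐ[ℂ] C(X × Bool, ℂ)) (γ : 𝔄 →⋆ₐ[ℂ] C(Circle × Bool, 𝔅)),
      IsPrincipalSymbol σ ∧ IsBoundarySymbol γ ∧
      ∃ (hK : compactIdeal ≤ RingHom.ker σ)
        (Φ : EK σ →ₙₐ[ℂ] C(Circle × Bool, compactsZ))
        (δ₁ : Additive (K1 (AE σ)) →+ K0nu (EK σ)),
        (∀ (A : 𝔄) (hA : σ A = 0) (v : Circle × Bool),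
          (Φ ⟨Ideal.Quotient.mk compactIdeal A, A, hA, rfl⟩ v : 𝔅) = γ A v) ∧
        Function.Bijective Φ ∧
        Function.Bijective (nuMap Φ) ∧
        IsIndexMap (Ideal.Quotient.factor hK) (EK σ) δ₁ ∧
        ∀ c : ℝ → ℝ, IsCutoff c →
        ∀ (E : compactsZ) (hE : IsIdempotentElem E), IsSelfAdjoint (E : 𝔅) →
          Module.finrank ℂ (LinearMap.range (E : 𝔅).toLinearMap) = 1 →
        ∃ (A₁ A₂ A₃ A₄ : 𝔄) (u₁ u₂ u₃ u₄ : (AE σ)ˣ),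
          (A₁ : L2R →L[ℂ] L2R) = opM l * opD (fun ξ => 1 - c ξ) + opD (fun ξ => c ξ) ∧
          (A₂ : L2R →L[ℂ] L2R) = opM lTilde * opD (fun ξ => 1 - c ξ) + opD (fun ξ => c ξ) ∧
          (A₃ : L2R →L[ℂ] L2R) = opD (fun ξ => 1 - c ξ) + opM l * opD (fun ξ => c ξ) ∧
          (A₄ : L2R →L[ℂ] L2R) = opD (fun ξ => 1 - c ξ) + opM lTilde * opD (fun ξ => c ξ) ∧
          (u₁ : AE σ) = Ideal.Quotient.mk (RingHom.ker σ) A₁ ∧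
          (u₂ : AE σ) = Ideal.Quotient.mk (RingHom.ker σ) A₂ ∧
          (u₃ : AE σ) = Ideal.Quotient.mk (RingHom.ker σ) A₃ ∧
          (u₄ : AE σ) = Ideal.Quotient.mk (RingHom.ker σ) A₄ ∧
          nuMap Φ (δ₁ (Additive.ofMul (K1.ofUnit u₁))) = (0, -K0nu.mk E hE) ∧
          nuMap Φ (δ₁ (Additive.ofMul (K1.ofUnit u₂))) = (-K0nu.mk E hE, 0) ∧
          nuMap Φ (δ₁ (Additive.ofMul (K1.ofUnit u₃))) = (0, K0nu.mk E hE) ∧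
          nuMap Φ (δ₁ (Additive.ofMul (K1.ofUnit u₄))) = (K0nu.mk E hE, 0) := by
  refine exists_symbolPair.imp fun σ h => h.imp fun γ P => ⟨P.isPrincipal, P.isBoundary,
    P.compactIdeal_le, P.bdryMap, (exists_indexMap_EK P.compactIdeal_le).imp fun δ hδ => ⟨P.bdryMap_mk,
    P.bijective_bdryMap, bijective_nuMap P.bijective_bdryMap, isIndexMap_of_isIdx hδ,
    fun c hc E hE hEs hE1 => ?_⟩⟩
  have h := P.exists_operators hδ isTwist_l hc hE hEs hE1
  have h' := P.exists_operators hδ isTwist_lTilde hc hE hEs hE1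
  refine h.1.elim fun A₁ h₁ => h₁.elim fun u₁ h₁ => h'.1.elim fun A₂ h₂ => h₂.elim fun u₂ h₂ =>
    h.2.elim fun A₃ h₃ => h₃.elim fun u₃ h₃ => h'.2.elim fun A₄ h₄ => h₄.elim fun u₄ h₄ => ?_
  exact ⟨A₁, A₂, A₃, A₄, u₁, u₂, u₃, u₄, h₁.1, h₂.1, h₃.1, h₄.1, h₁.2.1, h₂.2.1, h₃.2.1, h₄.2.1,
    Prod.ext h₁.2.2.2 h₁.2.2.1, Prod.ext h₂.2.2.1 h₂.2.2.2, Prod.ext h₃.2.2.2 h₃.2.2.1,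
    Prod.ext h₄.2.2.1 h₄.2.2.2⟩
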